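/- **Conventions.** Manifolds are finite-dimensional, smooth, Hausdorff, second countable and without boundary; Lie groups are real Lie groups of this kind. Coalgebras are over $\mathbb{R}$, coassociative, counital and cocommutative; with the tensor product they form a category with finite products. Group objects in it are the cocommutative Hopf algebras. *Point distributions.* For a pointed manifold $(X,x_0)$ let $A_X$ be the algebra of germs at $x_0$ of smooth functions, $\mathfrak m$ its maximal ideal and $\hat A_X=\varprojlim_n A_X/\mathfrak m^n$. Let $\mathrm{Dist}(X)=\hom^{\mathrm{cont}}_{\mathbb{R}}(\hat A_X,\mathbb{R})$ ($\mathbb{R}$ discrete) be the coalgebra dual to $\hat A_X$. It is functorial in $X$. *Formal manifolds.* A coalgebra $C$ is conilpotent if it has a grouplike element $e$ such that every $c\in C$ lies in some $F_n$, where $F_0=\mathbb{R}e$ and $F_{n+1}=\Delta^{-1}(F_n\otimes C+C\otimes F_0)$; it is of finite type if its space of primitive elements is finite-dimensional. A morphism $f:C\to D$ is a formal submersion if the dual map $f^\vee:D^\vee\to C^\vee$ is formally smooth for the topologies defined by the powers of the maximal ideals. A pointed formal manifold is a conilpotent coalgebra $C$ of finite type whose counit $C\to\mathbb{R}$ is a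 formal submersion. *Formal $\infty$-groups.* A formal $\infty$-group is a simplicial object $X_\bullet$ in the category of pointed formal manifolds with $X_0=\mathbb{R}$ such that for all $n\ge 1$ and $0\le k\le n$ the limit $\hom(\Lambda^n_k,X_\bullet)$ exists in pointed formal manifolds and the restriction $X_n\to\hom(\Lambda^n_k,X_\bullet)$ is a formal submersion. Morphisms are morphisms of simplicial coalgebras. *Classifying spaces.* For a simplicial group object $G_\bullet$ in a category with finite products, $\overline{W}G$ is the simplicial object with $\overline W_nG=G_{n-1}\times\cdots\times G_0$ and $d_0(g_{n-1},\dots,g_0)=(g_{n-2},\dots,g_0)$, $d_i(g_{n-1},\dots,g_0)=(d_{i-1}g_{n-1},\dots,d_1g_{n-i+1},\,d_0g_{n-i}\cdot g_{n-i-1},\,g_{n-i-2},\dots,g_0)$ for $0<i<n$, $d_n(g_{n-1},\dots,g_0)=(d_{n-1}g_{n-1},\dots,d_1g_1)$, with the usual degeneracies, which insert a unit: $s_i(g_{n-1},\dots,g_0)=(s_{i-1}g_{n-1},\dots,s_0g_{n-i},1,g_{n-i-1},\dots,g_0)$. **Theorem.** 1. $\mathrm{Dist}$ preserves finite products, so that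 $\mathrm{Dist}(G)$ is a cocommutative Hopf algebra for every Lie group $G$ (pointed by its unit $1$). There is an isomorphism of Hopf algebras $\psi_G:\mathcal U(\mathfrak g)\to\mathrm{Dist}(G)$, natural in the Lie group $G$ with Lie algebra $\mathfrak g=T_1G$, such that $$\psi_G(x)(f)=df_1(x)=\tfrac{d}{dt}f(\exp(tx))\big|_{t=0}$$ for all $x\in\mathfrak g$ and all functions $f$ that are smooth near $1$. 2. Let $G_\bullet$ be a simplicial Lie group, with simplicial Lie algebra $\mathfrak g_\bullet$. Then $\mathrm{Dist}_\bullet(\overline WG)$ (that is, $\mathrm{Dist}$ applied levelwise to $\overline WG$) and $\overline W\,\mathcal U(\mathfrak g)$ are formal $\infty$-groups, and the isomorphisms $\psi$ induce an isomorphism of formal $\infty$-groups, natural in $G_\bullet$, $$\psi_{G_\bullet}:\mathrm{Dist}_\bullet(\overline WG)\xrightarrow{\ \cong\ }\overline W\,\mathcal U(\mathfrak g).$$ Here "induced by $\psi$" means that for all $k<n$ the composite of $\psi_{G_\bullet}$ in degree $n$ with the projection $\overline W_n\,\mathcal U(\mathfrak g)\to\mathcal U(\mathfrak g_k)$ is $$\mathrm{Dist}(\overline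 W_nG)\xrightarrow{\ \mathrm{Dist}(\mathrm{pr}_k)\ }\mathrm{Dist}(G_k)\xrightarrow{\ \psi_{G_k}^{-1}\ }\mathcal U(\mathfrak g_k).$$ -/

import Mathlib

universe u v

noncomputable section

namespace FormalLie

section

open CategoryTheory MonoidalCategory CartesianMonoidalCategory Opposite
open scoped MonObj

section Simplices

/-- The value `α(i)` of a monotone map `α : [m] → [n]` as a natural number, for `i ≤ m`
(and `α(m)` for `i > m`). -/
def simplexVal {x y : SimplexCategory} (α : x ⟶ y) (i : ℕ) : ℕ :=
  (α.toOrderHom ⟨min i x.len, by omega⟩ : ℕ)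

theorem simplexVal_le {x y : SimplexCategory} (α : x ⟶ y) (i : ℕ) : simplexVal α i ≤ y.len := by
  have := (α.toOrderHom ⟨min i x.len, by omega⟩).isLt
  unfold simplexVal; omega

theorem simplexVal_mono {x y : SimplexCategory} (α : x ⟶ y) {i j : ℕ} (h : i ≤ j) :
    simplexVal α i ≤ simplexVal α j :=
  α.toOrderHom.monotone (by simp only [Fin.mk_le_mk]; omega)

theorem simplexVal_comp {x y z : SimplexCategory} (α : x ⟶ y) (β : y ⟶ z) (i : ℕ) :
    simplexVal (α ≫ β) i = simplexVal β (simplexVal α i) := by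
  have h := simplexVal_le α i
  unfold simplexVal at *
  simp only [SimplexCategory.comp_toOrderHom, OrderHom.comp_coe, Function.comp_apply]
  congr 3
  ext
  simp only
  omega

theorem simplexVal_id {x : SimplexCategory} (i : ℕ) (hi : i ≤ x.len) :
    simplexVal (𝟙 x) i = i := by
  simp [simplexVal, hi]

theorem simplex_ext {x y : SimplexCategory} {α β : x ⟶ y}
    (h : ∀ i ≤ x.len, simplexVal α i = simplexVal β i) : α = β := by
  ext i
  have hi : (i : ℕ) ≤ x.len := by omega
  have := h i hi
  simpa [simplexVal, hi] using this

/-- For `α : [m] → [n]`, the monotone map `[k] → [n - 1 - p]`, `t ↦ α(m - k + t) - (p + 1)`.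
It is used for `k < m` and `α(m - 1 - k) ≤ p < α(m - k)`, where the subtractions are exact. -/
def shiftMap {x y : SimplexCategory} (α : x ⟶ y) (k p : ℕ) :
    SimplexCategory.mk k ⟶ .mk (y.len - 1 - p) :=
  SimplexCategory.Hom.mk
    { toFun := fun t => ⟨simplexVal α (x.len - k + t) - (p + 1), by
        have := simplexVal_le α (x.len - k + t)
        simp only [SimplexCategory.len_mk]; omega⟩
      monotone' := fun s t h => by
        have := simplexVal_mono α (i := x.len - k + s) (j := x.len - k + t)
          (by have : (s : ℕ) ≤ t := h; omega)
        simp only [Fin.mk_le_mk]; omega }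

theorem simplexVal_shiftMap {x y : SimplexCategory} (α : x ⟶ y) (k p t : ℕ) (ht : t ≤ k) :
    simplexVal (shiftMap α k p) t = simplexVal α (x.len - k + t) - (p + 1) := by
  simp [simplexVal, shiftMap, ht]

end Simplices

section OrderedProducts

variable {M : Type*} [Monoid M]

/-- The ordered product `f a * f (a + 1) * ⋯ * f (b - 1)`. -/
def orderedProd (f : ℕ → M) (a b : ℕ) : M := ((List.range' a (b - a)).map f).prod

theorem orderedProd_self (f : ℕ → M) (a : ℕ) : orderedProd f a a = 1 := by simp [orderedProd]

theorem orderedProd_single (f : ℕ → M) (a : ℕ) : orderedProd f a (a + 1) = f a := by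
  simp [orderedProd]

theorem orderedProd_mul (f : ℕ → M) {a b c : ℕ} (h₁ : a ≤ b) (h₂ : b ≤ c) :
    orderedProd f a b * orderedProd f b c = orderedProd f a c := by
  obtain ⟨d, rfl⟩ := Nat.exists_eq_add_of_le h₁
  obtain ⟨e, rfl⟩ := Nat.exists_eq_add_of_le h₂
  simp only [orderedProd, ← List.prod_append, ← List.map_append]
  congr 2
  rw [show a + d - a = d by omega, show a + d + e - (a + d) = e by omega,
    show a + d + e - a = d + e by omega]
  simp

theorem orderedProd_congr {f g : ℕ → M} {a b : ℕ} (h : ∀ p, a ≤ p → p < b → f p = g p) :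
    orderedProd f a b = orderedProd g a b := by
  unfold orderedProd
  congr 1
  refine List.map_congr_left fun p hp => ?_
  rw [List.mem_range'_1] at hp
  exact h p hp.1 (by omega)

theorem map_orderedProd {N F : Type*} [Monoid N] [FunLike F M N] [MonoidHomClass F M N]
    (φ : F) (f : ℕ → M) (a b : ℕ) : φ (orderedProd f a b) = orderedProd (fun p => φ (f p)) a b := by
  simp [orderedProd, map_list_prod, Function.comp_def]

theorem orderedProd_orderedProd (f : ℕ → M) (c : ℕ → ℕ) (hc : Monotone c) {a b : ℕ} (h : a ≤ b) :
    orderedProd (fun q => orderedProd f (c q) (c (q + 1))) a b = orderedProd f (c a) (c b) := by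
  induction b, h using Nat.le_induction with
  | base => simp [orderedProd_self]
  | succ b hab ih =>
    rw [← orderedProd_mul _ hab (Nat.le_succ b), ih, orderedProd_single,
      orderedProd_mul f (hc hab) (hc (Nat.le_succ b))]

end OrderedProducts

section Wbar

variable {C : Type u} [Category.{v} C] [CartesianMonoidalCategory C]

/-- The object of `k`-simplices of the simplicial object underlying a simplicial group object. -/
abbrev level (G : SimplicialObject (Grp C)) (k : ℕ) : C := (G.obj (op (.mk k))).X

/-- The morphism `G_l → G_k` underlying the action of `ξ : [k] → [l]`. -/
abbrev act (G : SimplicialObject (Grp C)) {k l : ℕ} (ξ : SimplexCategory.mk k ⟶ .mk l) :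
    level G l ⟶ level G k := (G.map ξ.op).hom.hom

/-- `W̄_n G = G_{n-1} × (G_{n-2} × ⋯ × (G_0 × 1))`. -/
def wbarObj (G : SimplicialObject (Grp C)) : ℕ → C
  | 0 => 𝟙_ C
  | n + 1 => level G n ⊗ wbarObj G n

/-- The projection `(g_{n-1}, …, g_0) ↦ g_k` for `k < n` (and the constant map to the unit
of `G_k` for `k ≥ n`). -/
def wbarProj (G : SimplicialObject (Grp C)) : (n k : ℕ) → (wbarObj G n ⟶ level G k)
  | 0, k => toUnit _ ≫ η[level G k]
  | n + 1, k =>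
    if h : n = k then fst _ _ ≫ eqToHom (by rw [h])
    else snd _ _ ≫ wbarProj G n k

/-- The morphism `(g_{n-1}, …, g_0)` with the prescribed components. -/
def wbarLift (G : SimplicialObject (Grp C)) {T : C} (g : ∀ k, T ⟶ level G k) :
    (n : ℕ) → (T ⟶ wbarObj G n)
  | 0 => toUnit _
  | n + 1 => lift (g n) (wbarLift G g n)

theorem wbarLift_proj (G : SimplicialObject (Grp C)) {T : C} (g : ∀ k, T ⟶ level G k)
    {n k : ℕ} (hk : k < n) : wbarLift G g n ≫ wbarProj G n k = g k := by
  induction n with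
  | zero => omega
  | succ n ih =>
    unfold wbarLift wbarProj
    split_ifs with h
    · subst h
      exact (lift_fst_assoc _ _ _).trans (Category.comp_id _)
    · exact (lift_snd_assoc _ _ _).trans (ih (by omega))

theorem wbar_hom_ext (G : SimplicialObject (Grp C)) {T : C} {n : ℕ} {f g : T ⟶ wbarObj G n}
    (h : ∀ k < n, f ≫ wbarProj G n k = g ≫ wbarProj G n k) : f = g := by
  induction n with
  | zero => exact toUnit_unique _ _
  | succ n ih =>
    refine CartesianMonoidalCategory.hom_ext (X := level G n) (Y := wbarObj G n) f g ?_
      (ih fun k hk => ?_)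
    · have := h n (Nat.lt_succ_self n)
      simp only [wbarProj, dif_pos, eqToHom_refl] at this
      exact ((congrArg (f ≫ ·) (Category.comp_id _)).symm.trans this).trans
        (congrArg (g ≫ ·) (Category.comp_id _))
    · have := h k (by omega)
      simp only [wbarProj, hk.ne', dif_neg, not_false_eq_true] at this
      exact (Category.assoc _ _ _).trans (this.trans (Category.assoc _ _ _).symm)

/-- For `α : [m] → [n]` and `k < m`, the `k`-th component of `α^*(g_{n-1}, …, g_0)`, which is the
product of the elements `(shiftMap α k p)^* g_{n-1-p}` of `G_k` over
`p = α(m-1-k), …, α(m-k) - 1`, in this order. -/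
def wbarComp (G : SimplicialObject (Grp C)) {x y : SimplexCategory} (α : x ⟶ y) (k : ℕ) :
    wbarObj G y.len ⟶ level G k :=
  orderedProd (fun p => wbarProj G y.len (y.len - 1 - p) ≫ act G (shiftMap α k p))
    (simplexVal α (x.len - 1 - k)) (simplexVal α (x.len - k))

/-- The action of `α : [m] → [n]` on `W̄ G`. -/
def wbarMap (G : SimplicialObject (Grp C)) {x y : SimplexCategory} (α : x ⟶ y) :
    wbarObj G y.len ⟶ wbarObj G x.len :=
  wbarLift G (wbarComp G α) x.len

theorem comp_orderedProd {T X Y : C} [GrpObj Y] (h : T ⟶ X) (f : ℕ → (X ⟶ Y)) (a b : ℕ) :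
    h ≫ orderedProd f a b = orderedProd (fun p => h ≫ f p) a b :=
  map_orderedProd (MonoidHom.mk (OneHom.mk (fun f : X ⟶ Y => h ≫ f) (MonObj.comp_one h))
    (MonObj.comp_mul h)) f a b

theorem orderedProd_comp {X Y Z : C} [GrpObj Y] [GrpObj Z] (f : ℕ → (X ⟶ Y)) (a b : ℕ)
    (φ : Y ⟶ Z) [IsMonHom φ] :
    orderedProd f a b ≫ φ = orderedProd (fun p => f p ≫ φ) a b :=
  map_orderedProd (MonoidHom.mk (OneHom.mk (fun f : X ⟶ Y => f ≫ φ) (MonObj.one_comp φ))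
    (fun f g => MonObj.mul_comp f g φ)) f a b

theorem act_act (G : SimplicialObject (Grp C)) {j k l : ℕ} (ξ : SimplexCategory.mk k ⟶ .mk l)
    (ζ : SimplexCategory.mk j ⟶ .mk k) : act G ξ ≫ act G ζ = act G (ζ ≫ ξ) := by
  simp [act]

theorem proj_act_congr (G : SimplicialObject (Grp C)) {n k l l' : ℕ} (hl : l = l')
    (ξ : SimplexCategory.mk k ⟶ .mk l) (ξ' : SimplexCategory.mk k ⟶ .mk l')
    (h : ∀ t ≤ k, simplexVal ξ t = simplexVal ξ' t) :
    wbarProj G n l ≫ act G ξ = wbarProj G n l' ≫ act G ξ' := by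
  subst hl
  rw [simplex_ext (α := ξ) (β := ξ') h]

theorem wbarMap_proj (G : SimplicialObject (Grp C)) {x y : SimplexCategory} (α : x ⟶ y) {k : ℕ}
    (hk : k < x.len) : wbarMap G α ≫ wbarProj G x.len k = wbarComp G α k :=
  wbarLift_proj G _ hk

theorem wbarMap_id (G : SimplicialObject (Grp C)) (x : SimplexCategory) :
    wbarMap G (𝟙 x) = 𝟙 _ := by
  refine wbar_hom_ext G fun k hk => ?_
  rw [wbarMap_proj G _ hk, wbarComp, simplexVal_id _ (by omega), simplexVal_id _ (by omega),
    show x.len - k = x.len - 1 - k + 1 by omega, orderedProd_single,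
    proj_act_congr G (l' := k) (by omega) _ (𝟙 _) fun t ht => ?_]
  · simp [act]
  · rw [simplexVal_shiftMap _ _ _ _ ht, simplexVal_id _ (by omega), simplexVal_id _ ht]
    omega

theorem wbarMap_comp (G : SimplicialObject (Grp C)) {x y z : SimplexCategory} (α : x ⟶ y)
    (β : y ⟶ z) : wbarMap G (α ≫ β) = wbarMap G β ≫ wbarMap G α := by
  refine wbar_hom_ext G fun r hr => ?_
  rw [Category.assoc, wbarMap_proj G _ hr, wbarMap_proj G _ hr, wbarComp, wbarComp,
    comp_orderedProd, simplexVal_comp, simplexVal_comp,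
    ← orderedProd_orderedProd _ (simplexVal β) (fun _ _ h => simplexVal_mono β h)
      (simplexVal_mono α (by omega))]
  refine orderedProd_congr fun q hq₁ hq₂ => ?_
  have hy := simplexVal_le α (x.len - r)
  rw [← Category.assoc, wbarMap_proj G _ (by omega), wbarComp, orderedProd_comp,
    show y.len - 1 - (y.len - 1 - q) = q by omega, show y.len - (y.len - 1 - q) = q + 1 by omega]
  refine orderedProd_congr fun p hp₁ hp₂ => ?_
  rw [Category.assoc, act_act]
  refine proj_act_congr G rfl _ _ fun t ht => ?_
  have hq := simplexVal_mono α (i := x.len - r) (j := x.len - r + t) (by omega)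
  have hq' := simplexVal_le α (x.len - r + t)
  rw [simplexVal_shiftMap _ _ _ _ ht, simplexVal_comp, simplexVal_comp,
    simplexVal_shiftMap _ _ _ _ ht, simplexVal_shiftMap _ _ _ _ (by omega)]
  congr 2
  omega

/-- The functor `W̄` from simplicial group objects to simplicial objects. -/
def Wbar : SimplicialObject (Grp C) ⥤ SimplicialObject C where
  obj G :=
    { obj := fun x => wbarObj G x.unop.len
      map := fun α => wbarMap G α.unop
      map_id := fun x => wbarMap_id G x.unop
      map_comp := fun α β => wbarMap_comp G β.unop α.unop }
  map {G H} f :=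
    { app := fun x => wbarLift H (fun k => wbarProj G x.unop.len k ≫ (f.app (op (.mk k))).hom.hom)
        x.unop.len
      naturality := fun x y α => by
        refine wbar_hom_ext H fun k hk => ?_
        dsimp only
        rw [Category.assoc, Category.assoc, wbarLift_proj H _ hk, wbarMap_proj H _ hk,
          ← Category.assoc, wbarMap_proj G _ hk, wbarComp, wbarComp, orderedProd_comp,
          comp_orderedProd]
        refine orderedProd_congr fun p hp₁ hp₂ => ?_
        have hy := simplexVal_le α.unop (y.unop.len - k)
        rw [← Category.assoc _ _ (act H _), wbarLift_proj H _ (by omega), Category.assoc,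
          Category.assoc]
        congr 1
        exact congrArg (fun f => f.hom.hom) (f.naturality (shiftMap α.unop k p).op) }
  map_id G := by
    ext x : 2
    refine wbar_hom_ext G fun k hk => ?_
    dsimp only
    rw [wbarLift_proj G _ hk]
    simp
  map_comp {G H K} f g := by
    ext x : 2
    refine wbar_hom_ext K fun k hk => ?_
    dsimp only [NatTrans.comp_app]
    rw [wbarLift_proj K _ hk, Category.assoc, wbarLift_proj K _ hk,
      ← Category.assoc _ _ ((g.app _).hom.hom), wbarLift_proj H _ hk]
    simp


theorem simplexVal_face {n : ℕ} (i : Fin (n + 2)) {j : ℕ} (hj : j ≤ n) :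
    simplexVal (SimplexCategory.δ i) j = if j < i then j else j + 1 := by
  simp only [simplexVal, SimplexCategory.δ, SimplexCategory.len_mk, hj, min_eq_left,
    SimplexCategory.mkHom, SimplexCategory.Hom.toOrderHom_mk]
  simp only [OrderEmbedding.toOrderHom_coe, Fin.succAboveOrderEmb_apply, Fin.succAbove, Fin.lt_def]
  split_ifs <;> simp_all

theorem simplexVal_degeneracy {n : ℕ} (i : Fin (n + 1)) {j : ℕ} (hj : j ≤ n + 1) :
    simplexVal (SimplexCategory.σ i) j = if j ≤ i then j else j - 1 := by
  have h : simplexVal (SimplexCategory.σ i) j = (Fin.predAbove i ⟨min j (n + 1), by omega⟩ : ℕ) :=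
    rfl
  rw [h]
  split_ifs with hi
  · rw [Fin.predAbove_of_le_castSucc _ _ (by simp [Fin.le_def]; omega)]
    simp [hj]
  · rw [Fin.predAbove_of_castSucc_lt _ _ (by simp [Fin.lt_def]; omega)]
    simp [hj]

/-- `d_i (g_n, …, g_0)` has components `g_k` for `k < n - i`, … -/
theorem wbar_face_low (G : SimplicialObject (Grp C)) {n : ℕ} (i : Fin (n + 2)) {k : ℕ}
    (hk : k + i < n) :
    wbarMap G (SimplexCategory.δ i) ≫ wbarProj G n k = wbarProj G (n + 1) k := by
  refine (wbarMap_proj G (SimplexCategory.δ i) (by simp; omega)).trans ?_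
  rw [wbarComp]
  simp only [SimplexCategory.len_mk]
  rw [simplexVal_face i (by omega), simplexVal_face i (by omega), if_neg (by omega),
    if_neg (by omega), show n - k + 1 = n - 1 - k + 1 + 1 by omega, orderedProd_single,
    proj_act_congr G (l' := k) (by omega) _ (𝟙 _) fun t ht => ?_]
  · simp [act]
  · rw [simplexVal_shiftMap _ _ _ _ ht, simplexVal_id _ ht]
    simp only [SimplexCategory.len_mk]
    rw [simplexVal_face i (by omega), if_neg (by omega)]
    omega

/-- … `d_0 g_{k+1} * g_k` for `k = n - i` … -/
theorem wbar_face_mid (G : SimplicialObject (Grp C)) {n : ℕ} (i : Fin (n + 2)) {k : ℕ}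
    (hk : k + i = n) (hi : 0 < (i : ℕ)) :
    wbarMap G (SimplexCategory.δ i) ≫ wbarProj G n k =
      (wbarProj G (n + 1) (k + 1) ≫ act G (SimplexCategory.δ 0)) * wbarProj G (n + 1) k := by
  refine (wbarMap_proj G (SimplexCategory.δ i) (by simp; omega)).trans ?_
  rw [wbarComp]
  simp only [SimplexCategory.len_mk]
  rw [simplexVal_face i (by omega), simplexVal_face i (by omega), if_pos (by omega),
    if_neg (by omega), ← orderedProd_mul _ (b := n - k) (by omega) (by omega),
    show n - k + 1 = (n - k) + 1 from rfl, orderedProd_single]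
  conv_lhs => enter [1]; rw [show n - k = n - 1 - k + 1 by omega]
  rw [orderedProd_single]
  congr 1
  · refine proj_act_congr G (by omega) _ _ fun t ht => ?_
    rw [simplexVal_shiftMap _ _ _ _ ht, simplexVal_face _ ht]
    simp only [SimplexCategory.len_mk]
    rw [simplexVal_face i (by omega), if_neg (by omega)]
    simp
    omega
  · rw [proj_act_congr G (l' := k) (by omega) _ (𝟙 _) fun t ht => ?_]
    · simp [act]
    · rw [simplexVal_shiftMap _ _ _ _ ht, simplexVal_id _ ht]
      simp only [SimplexCategory.len_mk]
      rw [simplexVal_face i (by omega), if_neg (by omega)]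
      omega

/-- … and `d_{i-(n-k)} g_{k+1}` for `n - i < k < n`. -/
theorem wbar_face_high (G : SimplicialObject (Grp C)) {n : ℕ} (i : Fin (n + 2)) {k j : ℕ}
    (hkn : k < n) (hj : 0 < j) (hk : n + j = k + i)  :
    wbarMap G (SimplexCategory.δ i) ≫ wbarProj G n k =
      wbarProj G (n + 1) (k + 1) ≫ act G (SimplexCategory.δ ⟨j, by omega⟩) := by
  refine (wbarMap_proj G (SimplexCategory.δ i) (by simp; omega)).trans ?_
  rw [wbarComp]
  simp only [SimplexCategory.len_mk]
  rw [simplexVal_face i (by omega), simplexVal_face i (by omega), if_pos (by omega),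
    if_pos (by omega)]
  conv_lhs => enter [3]; rw [show n - k = n - 1 - k + 1 by omega]
  rw [orderedProd_single]
  refine proj_act_congr G (by omega) _ _ fun t ht => ?_
  rw [simplexVal_shiftMap _ _ _ _ ht, simplexVal_face _ ht]
  simp only [SimplexCategory.len_mk]
  rw [simplexVal_face i (by omega)]
  split_ifs <;> omega

/-- `s_i (g_{n-1}, …, g_0)` has components `g_k` for `k < n - i` … -/
theorem wbar_degeneracy_low (G : SimplicialObject (Grp C)) {n : ℕ} (i : Fin (n + 1)) {k : ℕ}
    (hk : k + i < n) :
    wbarMap G (SimplexCategory.σ i) ≫ wbarProj G (n + 1) k = wbarProj G n k := by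
  refine (wbarMap_proj G (SimplexCategory.σ i) (by simp; omega)).trans ?_
  rw [wbarComp]
  simp only [SimplexCategory.len_mk]
  rw [simplexVal_degeneracy i (by omega), simplexVal_degeneracy i (by omega), if_neg (by omega),
    if_neg (by omega), show n + 1 - k - 1 = n + 1 - 1 - k - 1 + 1 by omega, orderedProd_single,
    proj_act_congr G (l' := k) (by omega) _ (𝟙 _) fun t ht => ?_]
  · simp [act]
  · rw [simplexVal_shiftMap _ _ _ _ ht, simplexVal_id _ ht]
    simp only [SimplexCategory.len_mk]
    rw [simplexVal_degeneracy i (by omega), if_neg (by omega)]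
    omega

/-- … `1` for `k = n - i` … -/
theorem wbar_degeneracy_mid (G : SimplicialObject (Grp C)) {n : ℕ} (i : Fin (n + 1)) {k : ℕ}
    (hk : k + i = n) :
    wbarMap G (SimplexCategory.σ i) ≫ wbarProj G (n + 1) k = 1 := by
  refine (wbarMap_proj G (SimplexCategory.σ i) (by simp; omega)).trans ?_
  rw [wbarComp]
  simp only [SimplexCategory.len_mk]
  rw [simplexVal_degeneracy i (by omega), simplexVal_degeneracy i (by omega), if_pos (by omega),
    if_neg (by omega), show n + 1 - k - 1 = n + 1 - 1 - k by omega, orderedProd_self]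

/-- … and `s_{i-(n+1-k)} g_{k-1}` for `n - i < k < n + 1`. -/
theorem wbar_degeneracy_high (G : SimplicialObject (Grp C)) {n : ℕ} (i : Fin (n + 1)) {k j : ℕ}
    (hkn : k < n) (hk : n + j = k + i)  :
    wbarMap G (SimplexCategory.σ i) ≫ wbarProj G (n + 1) (k + 1) =
      wbarProj G n k ≫ act G (SimplexCategory.σ ⟨j, by omega⟩) := by
  refine (wbarMap_proj G (SimplexCategory.σ i) (by simp; omega)).trans ?_
  rw [wbarComp]
  simp only [SimplexCategory.len_mk]
  rw [simplexVal_degeneracy i (by omega), simplexVal_degeneracy i (by omega), if_pos (by omega),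
    if_pos (by omega), show n + 1 - (k + 1) = n + 1 - 1 - (k + 1) + 1 by omega, orderedProd_single]
  refine proj_act_congr G (by omega) _ _ fun t ht => ?_
  rw [simplexVal_shiftMap _ _ _ _ ht, simplexVal_degeneracy _ ht]
  simp only [SimplexCategory.len_mk]
  rw [simplexVal_degeneracy i (by omega)]
  split_ifs <;> omega

end Wbar

end

section

open CategoryTheory MonoidalCategory CartesianMonoidalCategory Opposite
open scoped MonObj Manifold ContDiff

/-- Pointed finite-dimensional smooth manifolds without boundary (Hausdorff, second countable). -/
structure PtdMfd : Type (u + 1) where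
  {E : Type u}
  [normedAddCommGroup : NormedAddCommGroup E]
  [normedSpace : NormedSpace ℝ E]
  [finiteDimensional : FiniteDimensional ℝ E]
  {H : Type u}
  [topH : TopologicalSpace H]
  (I : ModelWithCorners ℝ E H)
  [boundaryless : I.Boundaryless]
  (carrier : Type u)
  [top : TopologicalSpace carrier]
  [charted : ChartedSpace H carrier]
  [isManifold : IsManifold I ∞ carrier]
  [t2 : T2Space carrier]
  [secondCountable : SecondCountableTopology carrier]
  (pt : carrier)

attribute [instance] PtdMfd.normedAddCommGroup PtdMfd.normedSpace PtdMfd.finiteDimensional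
  PtdMfd.topH PtdMfd.boundaryless PtdMfd.top PtdMfd.charted PtdMfd.isManifold PtdMfd.t2
  PtdMfd.secondCountable

namespace PtdMfd

/-- Smooth maps preserving the base points. -/
@[ext]
structure Hom (X Y : PtdMfd.{u}) where
  toFun : X.carrier → Y.carrier
  contMDiff : ContMDiff X.I Y.I ∞ toFun
  map_pt : toFun X.pt = Y.pt

instance : Category PtdMfd.{u} where
  Hom := Hom
  id X := ⟨id, contMDiff_id, rfl⟩
  comp f g := ⟨g.toFun ∘ f.toFun, g.contMDiff.comp f.contMDiff, by simp [f.map_pt, g.map_pt]⟩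

theorem hom_ext {X Y : PtdMfd.{u}} {f g : X ⟶ Y} (h : ∀ x, f.toFun x = g.toFun x) : f = g :=
  Hom.ext (funext h)

/-- The one-point manifold. -/
def point : PtdMfd.{u} where
  E := PUnit
  I := 𝓘(ℝ, PUnit)
  carrier := PUnit
  pt := PUnit.unit

/-- The product of two pointed manifolds. -/
def prod (X Y : PtdMfd.{u}) : PtdMfd.{u} where
  I := X.I.prod Y.I
  carrier := X.carrier × Y.carrier
  pt := (X.pt, Y.pt)

/-- The first projection. -/
def fst (X Y : PtdMfd.{u}) : prod X Y ⟶ X := ⟨Prod.fst, contMDiff_fst, rfl⟩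

/-- The second projection. -/
def snd (X Y : PtdMfd.{u}) : prod X Y ⟶ Y := ⟨Prod.snd, contMDiff_snd, rfl⟩

/-- The morphism into a product with given components. -/
def pair {T X Y : PtdMfd.{u}} (f : T ⟶ X) (g : T ⟶ Y) : T ⟶ prod X Y :=
  ⟨fun t => (f.toFun t, g.toFun t), f.contMDiff.prodMk g.contMDiff,
    Prod.ext f.map_pt g.map_pt⟩

instance : CartesianMonoidalCategory PtdMfd.{u} :=
  CartesianMonoidalCategory.ofChosenFiniteProducts
    ⟨Limits.asEmptyCone point, Limits.IsTerminal.ofUniqueHom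
      (fun _ => ⟨fun _ => PUnit.unit, contMDiff_const, rfl⟩) fun _ _ => rfl⟩
    fun X Y => ⟨Limits.BinaryFan.mk (fst X Y) (snd X Y), Limits.BinaryFan.IsLimit.mk _ pair
      (fun _ _ => rfl) (fun _ _ => rfl) fun f g m hf hg => by
        subst hf hg; rfl⟩

end PtdMfd

/-- Finite-dimensional real Lie groups (Hausdorff, second countable). -/
structure LieGrp : Type (u + 1) where
  {E : Type u}
  [normedAddCommGroup : NormedAddCommGroup E]
  [normedSpace : NormedSpace ℝ E]
  [finiteDimensional : FiniteDimensional ℝ E]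
  {H : Type u}
  [topH : TopologicalSpace H]
  (I : ModelWithCorners ℝ E H)
  [boundaryless : I.Boundaryless]
  (carrier : Type u)
  [top : TopologicalSpace carrier]
  [charted : ChartedSpace H carrier]
  [group : Group carrier]
  [lieGroup : LieGroup I ∞ carrier]
  [t2 : T2Space carrier]
  [secondCountable : SecondCountableTopology carrier]

attribute [instance] LieGrp.normedAddCommGroup LieGrp.normedSpace LieGrp.finiteDimensional
  LieGrp.topH LieGrp.boundaryless LieGrp.top LieGrp.charted LieGrp.group LieGrp.lieGroup LieGrp.t2
  LieGrp.secondCountable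

namespace LieGrp

/-- Smooth group homomorphisms. -/
@[ext]
structure Hom (G K : LieGrp.{u}) where
  toMonoidHom : G.carrier →* K.carrier
  contMDiff : ContMDiff G.I K.I ∞ toMonoidHom

instance : Category LieGrp.{u} where
  Hom := Hom
  id G := ⟨MonoidHom.id _, contMDiff_id⟩
  comp f g := ⟨g.toMonoidHom.comp f.toMonoidHom, g.contMDiff.comp f.contMDiff⟩

/-- The underlying manifold of a Lie group, pointed by the unit. -/
def toPtdMfd (G : LieGrp.{u}) : PtdMfd.{u} where
  I := G.I
  carrier := G.carrier
  isManifold := inferInstance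
  pt := 1

/-- The group multiplication, as a morphism of pointed manifolds. -/
def mulHom (G : LieGrp.{u}) : G.toPtdMfd.prod G.toPtdMfd ⟶ G.toPtdMfd :=
  PtdMfd.Hom.mk (X := G.toPtdMfd.prod G.toPtdMfd) (Y := G.toPtdMfd)
    (fun p : G.carrier × G.carrier => p.1 * p.2)
    (contMDiff_mul (G := G.carrier) G.I ∞) (one_mul (1 : G.carrier))

/-- The inversion, as a morphism of pointed manifolds. -/
def invHom (G : LieGrp.{u}) : G.toPtdMfd ⟶ G.toPtdMfd :=
  PtdMfd.Hom.mk (X := G.toPtdMfd) (Y := G.toPtdMfd) (Inv.inv (α := G.carrier))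
    (contMDiff_inv (G := G.carrier) G.I ∞) (inv_one (G := G.carrier))

instance (G : LieGrp.{u}) : GrpObj G.toPtdMfd where
  one := ⟨fun _ => (1 : G.carrier), contMDiff_const, rfl⟩
  mul := G.mulHom
  inv := G.invHom
  one_mul := PtdMfd.hom_ext fun p => one_mul (M := G.carrier) _
  mul_one := PtdMfd.hom_ext fun p => mul_one (M := G.carrier) _
  mul_assoc := PtdMfd.hom_ext fun p => mul_assoc (G := G.carrier) _ _ _
  left_inv := PtdMfd.hom_ext fun p => inv_mul_cancel (G := G.carrier) p
  right_inv := PtdMfd.hom_ext fun p => mul_inv_cancel (G := G.carrier) p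

/-- The smooth map underlying a homomorphism of Lie groups. -/
def Hom.toPtdMfdHom {G K : LieGrp.{u}} (f : G ⟶ K) : G.toPtdMfd ⟶ K.toPtdMfd :=
  PtdMfd.Hom.mk (X := G.toPtdMfd) (Y := K.toPtdMfd) f.toMonoidHom f.contMDiff
    f.toMonoidHom.map_one

instance {G K : LieGrp.{u}} (f : G ⟶ K) : IsMonHom (Hom.toPtdMfdHom f) where
  one_hom := PtdMfd.hom_ext fun _ => by
    change f.toMonoidHom (1 : G.carrier) = 1
    exact map_one _
  mul_hom := PtdMfd.hom_ext fun p => f.toMonoidHom.map_mul (p : G.carrier × G.carrier).1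
    (p : G.carrier × G.carrier).2

/-- Lie groups as group objects in pointed manifolds. -/
def toGrp : LieGrp.{u} ⥤ Grp PtdMfd.{u} where
  obj G := .mk G.toPtdMfd
  map f := Grp.ofHom (Hom.toPtdMfdHom f)
  map_id _ := rfl
  map_comp _ _ := rfl

end LieGrp

end

section

open scoped Manifold ContDiff Topology
open VectorField

section Related

variable {E : Type*} [NormedAddCommGroup E] [NormedSpace ℝ E]
  {E' : Type*} [NormedAddCommGroup E'] [NormedSpace ℝ E']

/-- A smooth map sends the Lie bracket of two vector fields to the Lie bracket of two vector fields
to which they are related. -/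
theorem fderiv_lieBracket_related {F : E → E'} {V W : E → E} {V' W' : E' → E'} {x : E}
    (hF : ContDiffAt ℝ ∞ F x) (hV : DifferentiableAt ℝ V x) (hW : DifferentiableAt ℝ W x)
    (hV' : DifferentiableAt ℝ V' (F x)) (hW' : DifferentiableAt ℝ W' (F x))
    (h₁ : ∀ᶠ y in 𝓝 x, fderiv ℝ F y (V y) = V' (F y))
    (h₂ : ∀ᶠ y in 𝓝 x, fderiv ℝ F y (W y) = W' (F y)) :
    fderiv ℝ F x (lieBracket ℝ V W x) = lieBracket ℝ V' W' (F x) := by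
  have hF1 : DifferentiableAt ℝ F x := hF.differentiableAt (by simp)
  rw [fderiv_apply_lieBracket (hF.of_le (m := 2) (WithTop.coe_le_coe.2 le_top)) (by simp) hW hV, Filter.EventuallyEq.fderiv_eq h₁,
    Filter.EventuallyEq.fderiv_eq h₂]
  have e₁ := fderiv_comp x hV' hF1
  have e₂ := fderiv_comp x hW' hF1
  simp only [Function.comp_def] at e₁ e₂
  rw [e₁, e₂, ContinuousLinearMap.comp_apply, ContinuousLinearMap.comp_apply, h₁.self_of_nhds,
    h₂.self_of_nhds]
  rfl

end Related

section Manifold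

variable {E : Type*} [NormedAddCommGroup E] [NormedSpace ℝ E] [CompleteSpace E]
  {H : Type*} [TopologicalSpace H] {I : ModelWithCorners ℝ E H} [I.Boundaryless]
  {M : Type*} [TopologicalSpace M] [ChartedSpace H M] [IsManifold I ∞ M]
  {E' : Type*} [NormedAddCommGroup E'] [NormedSpace ℝ E'] [CompleteSpace E']
  {H' : Type*} [TopologicalSpace H'] {I' : ModelWithCorners ℝ E' H'} [I'.Boundaryless]
  {M' : Type*} [TopologicalSpace M'] [ChartedSpace H' M'] [IsManifold I' ∞ M']

/-- A vector field read in the chart at `x`. -/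
def chartField (x : M) (V : ∀ y : M, TangentSpace I y) : E → E :=
  mpullbackWithin 𝓘(ℝ, E) I (extChartAt I x).symm V (Set.range I)

theorem chartField_apply (x : M) (V : ∀ y : M, TangentSpace I y) {q : M}
    (hq : q ∈ (extChartAt I x).source) :
    chartField x V (extChartAt I x q) = mfderiv I 𝓘(ℝ, E) (extChartAt I x) q (V q) := by
  have hinv := isInvertible_mfderivWithin_extChartAt_symm (I := I)
    ((extChartAt I x).map_source hq)
  refine (ContinuousLinearMap.IsInvertible.inverse_apply_eq hinv).2 ?_
  have h := DFunLike.congr_fun (mfderivWithin_extChartAt_symm_comp_mfderiv_extChartAt' hq) (V q)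
  refine Eq.trans ?_ h.symm
  exact congrArg (fun z => (V z : E)) ((extChartAt I x).left_inv hq)

theorem differentiableAt_chartField (x : M) (V : ∀ y : M, TangentSpace I y)
    (hV : MDifferentiableAt I I.tangent (fun y => (V y : TangentBundle I M)) x) :
    DifferentiableAt ℝ (chartField x V) (extChartAt I x x) := by
  have : DifferentiableWithinAt ℝ (chartField x V)
      ((extChartAt I x).symm ⁻¹' Set.univ ∩ Set.range I) (extChartAt I x x) :=
    MDifferentiableWithinAt.differentiableWithinAt_mpullbackWithin_vectorField
      (mdifferentiableWithinAt_univ.2 hV)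
  rwa [Set.preimage_univ, Set.univ_inter, I.range_eq_univ, differentiableWithinAt_univ] at this

theorem mfderiv_chart_mlieBracket (x : M) (V W : ∀ y : M, TangentSpace I y) :
    mfderiv I 𝓘(ℝ, E) (extChartAt I x) x (mlieBracket I V W x) =
      lieBracket ℝ (chartField x V) (chartField x W) (extChartAt I x x) := by
  have hinv := isInvertible_mfderiv_extChartAt (I := I) (mem_extChartAt_source x)
  have := mlieBracketWithin_apply (I := I) (V := V) (W := W) (s := Set.univ) (x₀ := x)
  rw [mlieBracketWithin_univ] at this
  rw [this]
  refine ((ContinuousLinearMap.IsInvertible.inverse_apply_eq hinv).1 rfl).symm.trans ?_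
  change lieBracketWithin ℝ (chartField x V) (chartField x W)
    ((extChartAt I x).symm ⁻¹' Set.univ ∩ Set.range I) (extChartAt I x x) = _
  rw [Set.preimage_univ, Set.univ_inter, I.range_eq_univ, lieBracketWithin_univ]

theorem mfderiv_mlieBracket_related {f : M → M'} (hf : ContMDiff I I' ∞ f) (x : M)
    {V W : ∀ y : M, TangentSpace I y} {V' W' : ∀ y : M', TangentSpace I' y}
    (hV : MDifferentiableAt I I.tangent (fun y => (V y : TangentBundle I M)) x)
    (hW : MDifferentiableAt I I.tangent (fun y => (W y : TangentBundle I M)) x)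
    (hV' : MDifferentiableAt I' I'.tangent (fun y => (V' y : TangentBundle I' M')) (f x))
    (hW' : MDifferentiableAt I' I'.tangent (fun y => (W' y : TangentBundle I' M')) (f x))
    (h₁ : ∀ y, mfderiv I I' f y (V y) = V' (f y)) (h₂ : ∀ y, mfderiv I I' f y (W y) = W' (f y)) :
    mfderiv I I' f x (mlieBracket I V W x) = mlieBracket I' V' W' (f x) := by
  set e := extChartAt I x with he
  set e' := extChartAt I' (f x) with he'
  set F : E → E' := e' ∘ f ∘ e.symm with hFdef
  have hFx : F (e x) = e' (f x) := by simp [F, e]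
  have hFsm : ∀ p ∈ e.source, f p ∈ e'.source → ContDiffAt ℝ ∞ F (e p) := by
    intro p hp hp'
    have s1 : ContMDiffAt 𝓘(ℝ, E) I ∞ e.symm (e p) :=
      (contMDiffOn_extChartAt_symm (I := I) x).contMDiffAt
        ((isOpen_extChartAt_target (I := I) x).mem_nhds (e.map_source hp))
    have s2 : ContMDiffAt I' 𝓘(ℝ, E') ∞ e' (f p) :=
      contMDiffAt_extChartAt' (by rwa [← extChartAt_source I'])
    have hi : e.symm (e p) = p := e.left_inv hp
    have s3 : ContMDiffAt I 𝓘(ℝ, E') ∞ (e' ∘ f) p := s2.comp p hf.contMDiffAt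
    exact (ContMDiffAt.comp_of_eq s3 s1 hi).contDiffAt
  have hder : ∀ p ∈ e.source, f p ∈ e'.source → ∀ v : TangentSpace I p,
      fderiv ℝ F (e p) (mfderiv I 𝓘(ℝ, E) e p v) =
        mfderiv I' 𝓘(ℝ, E') e' (f p) (mfderiv I I' f p v) := by
    intro p hp hp' v
    have hFe : ∀ᶠ q in 𝓝 p, (F ∘ e) q = (e' ∘ f) q := by
      filter_upwards [(isOpen_extChartAt_source (I := I) x).mem_nhds hp] with q hq
      simp [F, e.left_inv hq]
    have d1 : MDifferentiableAt I 𝓘(ℝ, E) e p := mdifferentiableAt_extChartAt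
      (by rwa [extChartAt_source] at hp)
    have d2 : MDifferentiableAt I' 𝓘(ℝ, E') e' (f p) := mdifferentiableAt_extChartAt
      (by rwa [extChartAt_source] at hp')
    have d3 : MDifferentiableAt I I' f p := hf.mdifferentiableAt (by simp)
    have d4 : DifferentiableAt ℝ F (e p) := (hFsm p hp hp').differentiableAt (by simp)
    have c1 : mfderiv I 𝓘(ℝ, E') (F ∘ e) p = _ := mfderiv_comp p d4.mdifferentiableAt d1
    have c2 : mfderiv I 𝓘(ℝ, E') (e' ∘ f) p = _ := mfderiv_comp p d2 d3
    rw [Filter.EventuallyEq.mfderiv_eq hFe, c2, mfderiv_eq_fderiv] at c1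
    exact (DFunLike.congr_fun c1 v).symm
  have hrel : ∀ (X : ∀ y : M, TangentSpace I y) (X' : ∀ y : M', TangentSpace I' y),
      (∀ y, mfderiv I I' f y (X y) = X' (f y)) →
      ∀ᶠ y in 𝓝 (e x), fderiv ℝ F y (chartField x X y) = chartField (f x) X' (F y) := by
    intro X X' hX
    have hn : e.source ∩ f ⁻¹' e'.source ∈ 𝓝 x := Filter.inter_mem
      (extChartAt_source_mem_nhds (I := I) x)
      (hf.continuous.continuousAt (extChartAt_source_mem_nhds (I := I') (f x)))
    have hn' : e.symm ⁻¹' (e.source ∩ f ⁻¹' e'.source) ∈ 𝓝 (e x) :=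
      (continuousAt_extChartAt_symm (I := I) x) (by rwa [extChartAt_to_inv])
    filter_upwards [hn', extChartAt_target_mem_nhds (I := I) x] with y hy hyt
    obtain ⟨p, hp, rfl⟩ : ∃ p, p ∈ e.source ∧ e p = y :=
      ⟨e.symm y, e.map_target hyt, e.right_inv hyt⟩
    have hp' : f p ∈ e'.source := by
      have := hy.2
      rwa [Set.mem_preimage, e.left_inv hp] at this
    have hFp : F (e p) = e' (f p) := by simp [F, e.left_inv hp]
    rw [hFp, chartField_apply x X hp, chartField_apply (f x) X' hp', ← hX p]
    exact hder p hp hp' _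
  have hinv := isInvertible_mfderiv_extChartAt (I := I') (mem_extChartAt_source (f x))
  have hinj : Function.Injective (mfderiv I' 𝓘(ℝ, E') e' (f x)) := by
    obtain ⟨L, hL⟩ := hinv
    rw [← hL]
    exact L.injective
  apply hinj
  have h := hder x (mem_extChartAt_source x) (mem_extChartAt_source (f x)) (mlieBracket I V W x)
  refine h.symm.trans ?_
  rw [mfderiv_chart_mlieBracket, mfderiv_chart_mlieBracket]
  have hd := fderiv_lieBracket_related (F := F) (x := e x)
    (hFsm x (mem_extChartAt_source x) (mem_extChartAt_source (f x)))
    (differentiableAt_chartField x V hV) (differentiableAt_chartField x W hW)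
    (hFx ▸ differentiableAt_chartField (f x) V' hV')
    (hFx ▸ differentiableAt_chartField (f x) W' hW') (hrel V V' h₁) (hrel W W' h₂)
  rw [hFx] at hd
  exact hd

end Manifold

end

section

open scoped TensorProduct

/-- The universal enveloping algebra of a real Lie algebra. -/
abbrev Env (L : Type*) [LieRing L] [LieAlgebra ℝ L] := UniversalEnvelopingAlgebra ℝ L

section Enveloping

variable {L : Type*} [LieRing L] [LieAlgebra ℝ L]


/-- The algebra map `U(L) → A` extending a linear map which sends brackets to commutators. -/
def envLift {A : Type*} [Ring A] [Algebra ℝ A] (f : L →ₗ[ℝ] A)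
    (hf : ∀ x y, f ⁅x, y⁆ = f x * f y - f y * f x) : Env L →ₐ[ℝ] A :=
  letI : LieRing A := LieRing.ofAssociativeRing
  UniversalEnvelopingAlgebra.lift ℝ (LieHom.mk f (fun {x y} => hf x y))

/-- The canonical map `L → U(L)`. -/
def envι : L →ₗ[ℝ] Env L :=
  letI : LieRing (Env L) := LieRing.ofAssociativeRing
  (UniversalEnvelopingAlgebra.ι ℝ : L →ₗ⁅ℝ⁆ Env L).toLinearMap

theorem envι_lie (x y : L) : envι ⁅x, y⁆ = envι x * envι y - envι y * envι x :=
  letI : LieRing (Env L) := LieRing.ofAssociativeRing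
  (UniversalEnvelopingAlgebra.ι ℝ : L →ₗ⁅ℝ⁆ Env L).map_lie x y

@[simp]
theorem envLift_envι {A : Type*} [Ring A] [Algebra ℝ A] (f : L →ₗ[ℝ] A)
    (hf : ∀ x y, f ⁅x, y⁆ = f x * f y - f y * f x) (x : L) : envLift f hf (envι x) = f x :=
  letI : LieRing A := LieRing.ofAssociativeRing
  UniversalEnvelopingAlgebra.lift_ι_apply ℝ (LieHom.mk f (fun {x y} => hf x y)) x

theorem env_hom_ext {A : Type*} [Ring A] [Algebra ℝ A] {f g : Env L →ₐ[ℝ] A}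
    (h : ∀ x : L, f (envι x) = g (envι x)) : f = g :=
  letI : LieRing A := LieRing.ofAssociativeRing
  letI : LieRing (Env L) := LieRing.ofAssociativeRing
  UniversalEnvelopingAlgebra.hom_ext ℝ (LieHom.ext h)

theorem env_induction (S : Subalgebra ℝ (Env L)) (h : ∀ x : L, envι x ∈ S) (u : Env L) : u ∈ S := by
  let f : Env L →ₐ[ℝ] S := envLift (envι.codRestrict (Subalgebra.toSubmodule S) h) fun x y =>
    Subtype.ext (envι_lie x y)
  have : S.val.comp f = AlgHom.id ℝ _ := env_hom_ext fun x => by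
    simp only [AlgHom.comp_apply, f, envLift_envι]
    rfl
  rw [← AlgHom.id_apply (R := ℝ) u, ← this]
  exact (f u).2

/-- The comultiplication of `U(L)`, for which the elements of `L` are primitive. -/
def envComul : Env L →ₐ[ℝ] Env L ⊗[ℝ] Env L :=
  envLift ((TensorProduct.mk ℝ _ _).flip 1 ∘ₗ envι + TensorProduct.mk ℝ _ _ 1 ∘ₗ envι) fun x y => by
    simp only [LinearMap.add_apply, LinearMap.comp_apply, LinearMap.flip_apply,
      TensorProduct.mk_apply, envι_lie, TensorProduct.sub_tmul, TensorProduct.tmul_sub, mul_add,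
      add_mul, Algebra.TensorProduct.tmul_mul_tmul, one_mul, mul_one]
    abel

theorem envComul_envι (x : L) : envComul (envι x) = envι x ⊗ₜ[ℝ] 1 + 1 ⊗ₜ[ℝ] envι x :=
  envLift_envι _ _ x

/-- The counit of `U(L)`, which vanishes on `L`. -/
def envCounit : Env L →ₐ[ℝ] ℝ := envLift 0 (by simp)

theorem envCounit_envι (x : L) : envCounit (envι x) = 0 := envLift_envι _ _ x

instance envBialgebra : Bialgebra ℝ (Env L) :=
  .ofAlgHom envComul envCounit
    (env_hom_ext fun x => by
      simp [envComul_envι, Algebra.TensorProduct.one_def, TensorProduct.add_tmul,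
        TensorProduct.tmul_add]
      abel)
    (env_hom_ext fun x => by simp [envComul_envι, envCounit_envι])
    (env_hom_ext fun x => by simp [envComul_envι, envCounit_envι])

instance envIsCocomm : Coalgebra.IsCocomm ℝ (Env L) where
  comm_comp_comul := by
    have h : (Algebra.TensorProduct.comm ℝ (Env L) (Env L)).toAlgHom.comp envComul = envComul :=
      env_hom_ext fun x => by simp [envComul_envι, add_comm]
    exact congrArg (fun f => f.toLinearMap) h

/-- The antipode `x ↦ -x` (`x ∈ L`) of `U(L)`, as a map to the opposite algebra. -/
def envAntipodeOp : Env L →ₐ[ℝ] (Env L)ᵐᵒᵖ :=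
  envLift ((MulOpposite.opLinearEquiv ℝ).toLinearMap ∘ₗ (-envι)) fun x y => by
    apply MulOpposite.unop_injective
    simp [envι_lie]

/-- The antipode of `U(L)`. -/
def envAntipode : Env L →ₗ[ℝ] Env L :=
  (MulOpposite.opLinearEquiv ℝ).symm.toLinearMap ∘ₗ envAntipodeOp.toLinearMap

theorem envAntipode_envι (x : L) : envAntipode (envι x) = -envι x := by
  simp [envAntipode, envAntipodeOp]

theorem envAntipode_one : envAntipode (1 : Env L) = 1 := by simp [envAntipode]

theorem envAntipode_mul (u v : Env L) : envAntipode (u * v) = envAntipode v * envAntipode u := by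
  simp [envAntipode]

theorem envAntipode_left (u : Env L) (z : Env L ⊗[ℝ] Env L) :
    LinearMap.mul' ℝ (Env L) (envAntipode.rTensor (Env L) (envComul u * z)) =
      envCounit u • LinearMap.mul' ℝ (Env L) (envAntipode.rTensor (Env L) z) := by
  let S : Subalgebra ℝ (Env L) :=
    { carrier := {u | ∀ z, LinearMap.mul' ℝ (Env L) (envAntipode.rTensor (Env L) (envComul u * z)) =
        envCounit u • LinearMap.mul' ℝ (Env L) (envAntipode.rTensor (Env L) z)}
      mul_mem' := fun {a b} ha hb z => by
        rw [map_mul envComul, mul_assoc, ha, hb, map_mul envCounit, mul_smul]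
      add_mem' := fun {a b} ha hb z => by
        rw [map_add, add_mul, map_add, map_add, ha, hb, map_add, add_smul]
      algebraMap_mem' := fun r z => by
        rw [AlgHom.commutes, AlgHom.commutes, ← Algebra.smul_def, map_smul, map_smul]
        rfl }
  refine env_induction S (fun x z => ?_) u z
  rw [envCounit_envι, zero_smul]
  induction z with
  | zero => simp
  | add a b ha hb => rw [mul_add, map_add, map_add, ha, hb, add_zero]
  | tmul a b =>
    simp [envComul_envι, add_mul, envAntipode_mul, envAntipode_envι, mul_assoc]

theorem envAntipode_right (u : Env L) (z : Env L ⊗[ℝ] Env L) :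
    LinearMap.mul' ℝ (Env L) (envAntipode.lTensor (Env L) (z * envComul u)) =
      envCounit u • LinearMap.mul' ℝ (Env L) (envAntipode.lTensor (Env L) z) := by
  let S : Subalgebra ℝ (Env L) :=
    { carrier := {u | ∀ z, LinearMap.mul' ℝ (Env L) (envAntipode.lTensor (Env L) (z * envComul u)) =
        envCounit u • LinearMap.mul' ℝ (Env L) (envAntipode.lTensor (Env L) z)}
      mul_mem' := fun {a b} ha hb z => by
        rw [map_mul envComul, ← mul_assoc, hb, ha, map_mul envCounit, mul_comm, mul_smul]
      add_mem' := fun {a b} ha hb z => by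
        rw [map_add, mul_add, map_add, map_add, ha, hb, map_add, add_smul]
      algebraMap_mem' := fun r z => by
        rw [AlgHom.commutes, AlgHom.commutes, ← Algebra.commutes, ← Algebra.smul_def, map_smul,
          map_smul]
        rfl }
  refine env_induction S (fun x z => ?_) u z
  rw [envCounit_envι, zero_smul]
  induction z with
  | zero => simp
  | add a b ha hb => rw [add_mul, map_add, map_add, ha, hb, add_zero]
  | tmul a b =>
    simp [envComul_envι, mul_add, envAntipode_mul, envAntipode_envι, mul_assoc]

/-- The universal enveloping algebra as a Hopf algebra. -/
instance envHopfAlgebra : HopfAlgebra ℝ (Env L) where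
  antipode := envAntipode
  mul_antipode_rTensor_comul := LinearMap.ext fun u => by
    have := envAntipode_left u 1
    rw [mul_one] at this
    refine this.trans ?_
    rw [Algebra.TensorProduct.one_def, LinearMap.rTensor_tmul, LinearMap.mul'_apply,
      envAntipode_one, mul_one, ← Algebra.algebraMap_eq_smul_one]
    rfl
  mul_antipode_lTensor_comul := LinearMap.ext fun u => by
    have := envAntipode_right u 1
    rw [one_mul] at this
    refine this.trans ?_
    rw [Algebra.TensorProduct.one_def, LinearMap.lTensor_tmul, LinearMap.mul'_apply,
      envAntipode_one, mul_one, ← Algebra.algebraMap_eq_smul_one]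
    rfl

theorem envComul_antipode (u : Env L) :
    TensorProduct.map envAntipode envAntipode (envComul u) = envComul (envAntipode u) := by
  let f : Env L →ₐ[ℝ] (Env L ⊗[ℝ] Env L)ᵐᵒᵖ := (AlgHom.op envComul).comp envAntipodeOp
  let g : Env L →ₐ[ℝ] (Env L ⊗[ℝ] Env L)ᵐᵒᵖ :=
    (Algebra.TensorProduct.opAlgEquiv ℝ ℝ (Env L) (Env L)).toAlgHom.comp
      ((Algebra.TensorProduct.map (S := ℝ) (envAntipodeOp (L := L)) envAntipodeOp).comp envComul)
  have h : f = g := env_hom_ext fun x => by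
    apply MulOpposite.unop_injective
    simp [f, g, envComul_envι, envAntipodeOp, TensorProduct.neg_tmul, TensorProduct.tmul_neg,
      add_comm]
  have key : ∀ z : Env L ⊗[ℝ] Env L, TensorProduct.map envAntipode envAntipode z =
      MulOpposite.unop (Algebra.TensorProduct.opAlgEquiv ℝ ℝ (Env L) (Env L)
        (Algebra.TensorProduct.map (S := ℝ) envAntipodeOp envAntipodeOp z)) := by
    intro z
    induction z with
    | zero => simp
    | add a b ha hb => simp only [map_add, ha, hb, MulOpposite.unop_add]
    | tmul a b => simp [envAntipode]
  rw [key]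
  exact congrArg MulOpposite.unop (DFunLike.congr_fun h u).symm

/-- The antipode of `U(L)` is a morphism of coalgebras. -/
def envAntipodeCoalgHom : Env L →ₗc[ℝ] Env L where
  toLinearMap := envAntipode
  counit_comp := HopfAlgebra.counit_comp_antipode (R := ℝ) (A := Env L)
  map_comp_comul := LinearMap.ext envComul_antipode

variable {L' : Type*} [LieRing L'] [LieAlgebra ℝ L']

/-- The algebra map `U(L) → U(L')` induced by a homomorphism of Lie algebras. -/
def envMap (f : L →ₗ⁅ℝ⁆ L') : Env L →ₐ[ℝ] Env L' :=
  envLift (envι ∘ₗ f.toLinearMap) fun x y => by simp [envι_lie]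

theorem envMap_envι (f : L →ₗ⁅ℝ⁆ L') (x : L) : envMap f (envι x) = envι (f x) :=
  envLift_envι _ _ x

theorem envMap_id : envMap (LieHom.id : L →ₗ⁅ℝ⁆ L) = AlgHom.id ℝ _ :=
  env_hom_ext fun x => by simp [envMap_envι]

theorem envMap_comp {L'' : Type*} [LieRing L''] [LieAlgebra ℝ L''] (g : L' →ₗ⁅ℝ⁆ L'')
    (f : L →ₗ⁅ℝ⁆ L') : envMap (g.comp f) = (envMap g).comp (envMap f) :=
  env_hom_ext fun x => by simp [envMap_envι]

/-- The map `U(L) → U(L')` is a morphism of coalgebras. -/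
def envMapCoalgHom (f : L →ₗ⁅ℝ⁆ L') : Env L →ₗc[ℝ] Env L' where
  toLinearMap := (envMap f).toLinearMap
  counit_comp := by
    have : (envCounit (L := L')).comp (envMap f) = envCounit := env_hom_ext fun x => by
      simp [envMap_envι, envCounit_envι]
    exact congrArg (fun f => f.toLinearMap) this
  map_comp_comul := by
    have : (Algebra.TensorProduct.map (envMap f) (envMap f)).comp envComul =
        envComul.comp (envMap f) := env_hom_ext fun x => by
      simp [envMap_envι, envComul_envι]
    exact congrArg (fun f => f.toLinearMap) this

end Enveloping

end

section

open CategoryTheory MonoidalCategory CartesianMonoidalCategory Opposite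
open scoped MonObj TensorProduct

/-- Cocommutative (counital, coassociative) coalgebras over `ℝ`. -/
structure CocommCoalg : Type (u + 1) where
  (carrier : Type u)
  [addCommGroup : AddCommGroup carrier]
  [module : Module ℝ carrier]
  [coalgebra : Coalgebra ℝ carrier]
  [isCocomm : Coalgebra.IsCocomm ℝ carrier]

attribute [instance] CocommCoalg.addCommGroup CocommCoalg.module CocommCoalg.coalgebra
  CocommCoalg.isCocomm

namespace CocommCoalg

/-- Morphisms of coalgebras. -/
@[ext]
structure Hom (C D : CocommCoalg.{u}) where
  toCoalgHom : C.carrier →ₗc[ℝ] D.carrier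

instance : Category CocommCoalg.{u} where
  Hom := Hom
  id C := ⟨CoalgHom.id ℝ C.carrier⟩
  comp f g := ⟨g.toCoalgHom.comp f.toCoalgHom⟩

theorem hom_ext {C D : CocommCoalg.{u}} {f g : C ⟶ D}
    (h : ∀ c, f.toCoalgHom c = g.toCoalgHom c) : f = g :=
  Hom.ext (CoalgHom.ext h)

/-- The ground field `ℝ` as a coalgebra, with `1` grouplike (lifted to the universe in use). -/
instance unitCoalgebra : Coalgebra ℝ (ULift.{u} ℝ) where
  comul := (LinearMap.toSpanSingleton ℝ (ULift.{u} ℝ ⊗[ℝ] ULift.{u} ℝ)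
    (ULift.up 1 ⊗ₜ ULift.up 1)) ∘ₗ (ULift.moduleEquiv (R := ℝ) (M := ℝ)).toLinearMap
  counit := (ULift.moduleEquiv (R := ℝ) (M := ℝ)).toLinearMap
  coassoc := by ext; simp
  rTensor_counit_comp_comul := by
    ext x
    simp only [LinearMap.comp_apply, LinearEquiv.coe_coe, LinearMap.toSpanSingleton_apply, map_smul,
      LinearMap.rTensor_tmul, TensorProduct.mk_apply, ← TensorProduct.tmul_smul]
    congr 1
    ext
    simp
  lTensor_counit_comp_comul := by
    ext x
    simp only [LinearMap.comp_apply, LinearEquiv.coe_coe, LinearMap.toSpanSingleton_apply, map_smul,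
      LinearMap.lTensor_tmul, LinearMap.flip_apply, TensorProduct.mk_apply, TensorProduct.smul_tmul']
    congr 1
    ext
    simp

instance : Coalgebra.IsCocomm ℝ (ULift.{u} ℝ) where
  comm_comp_comul := by
    ext x
    simp [Coalgebra.comul]

/-- The unit coalgebra `ℝ`. -/
def unit : CocommCoalg.{u} where
  carrier := ULift.{u} ℝ

/-- The counit, as a morphism to the unit coalgebra. -/
def toUnit (C : CocommCoalg.{u}) : C ⟶ unit :=
  ⟨{ toLinearMap := (ULift.moduleEquiv (R := ℝ) (M := ℝ)).symm.toLinearMap ∘ₗ Coalgebra.counit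
     counit_comp := by
      ext c
      exact (ULift.moduleEquiv.{0, 0, u} (R := ℝ) (M := ℝ)).apply_symm_apply _
     map_comp_comul := by
      ext c
      have key : ∀ z : C.carrier ⊗[ℝ] C.carrier,
          TensorProduct.map ((ULift.moduleEquiv.{0, 0, u} (R := ℝ) (M := ℝ)).symm.toLinearMap ∘ₗ
            Coalgebra.counit) ((ULift.moduleEquiv.{0, 0, u} (R := ℝ) (M := ℝ)).symm.toLinearMap ∘ₗ
            Coalgebra.counit) z =
          (Coalgebra.counit (R := ℝ) (TensorProduct.rid ℝ C.carrier
            (Coalgebra.counit.lTensor C.carrier z))) • (ULift.up 1 ⊗ₜ[ℝ] ULift.up 1) := by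
        intro z
        induction z with
        | zero => simp
        | add x y hx hy => simp only [map_add, hx, hy, add_smul]
        | tmul x y =>
          have h : ∀ r : ℝ, (ULift.moduleEquiv.{0, 0, u} (R := ℝ) (M := ℝ)).symm r =
              r • ULift.up 1 := fun r => by ext; simp
          simp only [TensorProduct.map_tmul, LinearMap.comp_apply, LinearEquiv.coe_coe, h,
            LinearMap.lTensor_tmul, TensorProduct.rid_tmul, map_smul, TensorProduct.smul_tmul',
            TensorProduct.tmul_smul, smul_smul, smul_eq_mul]
      refine (key (Coalgebra.comul c)).trans ?_
      rw [Coalgebra.lTensor_counit_comul]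
      simp only [TensorProduct.rid_tmul, one_smul]
      rfl }⟩

/-- The tensor product of two cocommutative coalgebras. -/
def prod (C D : CocommCoalg.{u}) : CocommCoalg.{u} where
  carrier := C.carrier ⊗[ℝ] D.carrier

/-- The first projection `c ⊗ d ↦ ε(d) c`. -/
def fst (C D : CocommCoalg.{u}) : prod C D ⟶ C :=
  ⟨(Coalgebra.TensorProduct.rid ℝ ℝ C.carrier).toCoalgHom.comp
    (Coalgebra.TensorProduct.map (CoalgHom.id ℝ C.carrier) (Coalgebra.counitCoalgHom ℝ D.carrier))⟩

/-- The second projection `c ⊗ d ↦ ε(c) d`. -/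
def snd (C D : CocommCoalg.{u}) : prod C D ⟶ D :=
  ⟨(Coalgebra.TensorProduct.lid ℝ D.carrier).toCoalgHom.comp
    (Coalgebra.TensorProduct.map (Coalgebra.counitCoalgHom ℝ C.carrier) (CoalgHom.id ℝ D.carrier))⟩

/-- The morphism `t ↦ ∑ f(t₁) ⊗ g(t₂)`. -/
def pair {T C D : CocommCoalg.{u}} (f : T ⟶ C) (g : T ⟶ D) : T ⟶ prod C D :=
  ⟨(Coalgebra.TensorProduct.map f.toCoalgHom g.toCoalgHom).comp
    (Coalgebra.comulCoalgHom ℝ T.carrier)⟩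

section Raw

variable {A B T : Type u} [AddCommGroup A] [Module ℝ A] [Coalgebra ℝ A] [AddCommGroup B]
  [Module ℝ B] [Coalgebra ℝ B] [AddCommGroup T] [Module ℝ T] [Coalgebra ℝ T]

theorem raw_pair_fst (f : T →ₗ[ℝ] A) (g : T →ₗc[ℝ] B) (t : T) :
    TensorProduct.rid ℝ A (TensorProduct.map LinearMap.id Coalgebra.counit
      (TensorProduct.map f g.toLinearMap (Coalgebra.comul (R := ℝ) t))) = f t := by
  have key : ∀ z : T ⊗[ℝ] T,
      TensorProduct.rid ℝ A (TensorProduct.map LinearMap.id Coalgebra.counit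
        (TensorProduct.map f g.toLinearMap z)) =
        f (TensorProduct.rid ℝ _ (Coalgebra.counit.lTensor T z)) := by
    intro z
    induction z with
    | zero => simp
    | add x y hx hy => simp only [map_add, hx, hy]
    | tmul x y => simp
  rw [key, Coalgebra.lTensor_counit_comul]
  simp

theorem raw_pair_snd (f : T →ₗc[ℝ] A) (g : T →ₗ[ℝ] B) (t : T) :
    TensorProduct.lid ℝ B (TensorProduct.map Coalgebra.counit LinearMap.id
      (TensorProduct.map f.toLinearMap g (Coalgebra.comul (R := ℝ) t))) = g t := by
  have key : ∀ z : T ⊗[ℝ] T,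
      TensorProduct.lid ℝ B (TensorProduct.map Coalgebra.counit LinearMap.id
        (TensorProduct.map f.toLinearMap g z)) =
        g (TensorProduct.lid ℝ _ (Coalgebra.counit.rTensor T z)) := by
    intro z
    induction z with
    | zero => simp
    | add x y hx hy => simp only [map_add, hx, hy]
    | tmul x y => simp
  rw [key, Coalgebra.rTensor_counit_comul]
  simp

theorem raw_pair_fst_snd (p : A ⊗[ℝ] B) :
    TensorProduct.map
      ((TensorProduct.rid ℝ A).toLinearMap ∘ₗ TensorProduct.map LinearMap.id Coalgebra.counit)
      ((TensorProduct.lid ℝ B).toLinearMap ∘ₗ TensorProduct.map Coalgebra.counit LinearMap.id)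
      (Coalgebra.comul (R := ℝ) p) = p := by
  have key : ∀ (z : A ⊗[ℝ] A) (w : B ⊗[ℝ] B),
      TensorProduct.map
        ((TensorProduct.rid ℝ A).toLinearMap ∘ₗ TensorProduct.map LinearMap.id Coalgebra.counit)
        ((TensorProduct.lid ℝ B).toLinearMap ∘ₗ TensorProduct.map Coalgebra.counit LinearMap.id)
        (TensorProduct.AlgebraTensorModule.tensorTensorTensorComm ℝ ℝ ℝ ℝ _ _ _ _ (z ⊗ₜ[ℝ] w)) =
      (TensorProduct.rid ℝ _ (Coalgebra.counit.lTensor A z)) ⊗ₜ[ℝ]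
        (TensorProduct.lid ℝ _ (Coalgebra.counit.rTensor B w)) := by
    intro z w
    induction z with
    | zero => simp
    | add x y hx hy => simp only [map_add, TensorProduct.add_tmul, hx, hy]
    | tmul x y =>
      induction w with
      | zero => simp
      | add x y hx hy => simp only [map_add, TensorProduct.tmul_add, hx, hy]
      | tmul a b =>
        simp [TensorProduct.smul_tmul', TensorProduct.tmul_smul, smul_smul, mul_comm]
  induction p with
  | zero => simp
  | add x y hx hy => simp only [map_add, hx, hy]
  | tmul c d =>
    refine (key (Coalgebra.comul c) (Coalgebra.comul d)).trans ?_
    rw [Coalgebra.lTensor_counit_comul, Coalgebra.rTensor_counit_comul]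
    simp

end Raw

theorem pair_fst {T C D : CocommCoalg.{u}} (f : T ⟶ C) (g : T ⟶ D) : pair f g ≫ fst C D = f :=
  hom_ext fun t => raw_pair_fst f.toCoalgHom.toLinearMap g.toCoalgHom t

theorem pair_snd {T C D : CocommCoalg.{u}} (f : T ⟶ C) (g : T ⟶ D) : pair f g ≫ snd C D = g :=
  hom_ext fun t => raw_pair_snd f.toCoalgHom g.toCoalgHom.toLinearMap t

theorem comp_pair {S T C D : CocommCoalg.{u}} (m : S ⟶ T) (f : T ⟶ C) (g : T ⟶ D) :
    m ≫ pair f g = pair (m ≫ f) (m ≫ g) := by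
  refine hom_ext fun s => ?_
  change TensorProduct.map f.toCoalgHom.toLinearMap g.toCoalgHom.toLinearMap
    (Coalgebra.comul (R := ℝ) (m.toCoalgHom s)) =
    TensorProduct.map (f.toCoalgHom.toLinearMap ∘ₗ m.toCoalgHom.toLinearMap)
      (g.toCoalgHom.toLinearMap ∘ₗ m.toCoalgHom.toLinearMap) (Coalgebra.comul (R := ℝ) s)
  rw [← CoalgHomClass.map_comp_comul_apply, TensorProduct.map_comp]
  rfl

theorem pair_fst_snd (C D : CocommCoalg.{u}) : pair (fst C D) (snd C D) = 𝟙 _ :=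
  hom_ext fun p => raw_pair_fst_snd (A := C.carrier) (B := D.carrier) p

instance : CartesianMonoidalCategory CocommCoalg.{u} :=
  CartesianMonoidalCategory.ofChosenFiniteProducts
    ⟨Limits.asEmptyCone unit, Limits.IsTerminal.ofUniqueHom toUnit fun C f => hom_ext fun c => by
      have := CoalgHomClass.counit_comp_apply f.toCoalgHom c
      exact (ULift.moduleEquiv.{0, 0, u} (R := ℝ) (M := ℝ)).injective (this.trans
        ((ULift.moduleEquiv.{0, 0, u} (R := ℝ) (M := ℝ)).apply_symm_apply _).symm)⟩
    fun C D => ⟨Limits.BinaryFan.mk (fst C D) (snd C D), Limits.BinaryFan.IsLimit.mk _ pair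
      pair_fst pair_snd fun {T} f g m hf hg => by
        change m ≫ fst C D = f at hf
        change m ≫ snd C D = g at hg
        subst hf hg
        rw [← comp_pair, pair_fst_snd]
        exact (Category.comp_id m).symm⟩

end CocommCoalg

end

section

open CategoryTheory MonoidalCategory CartesianMonoidalCategory Opposite VectorField
open scoped MonObj TensorProduct Manifold ContDiff

namespace LieGrp

instance (G : LieGrp.{u}) : LieGroup G.I (minSmoothness ℝ 3) G.carrier :=
  LieGroup.of_le (n := ∞) (by
    rw [minSmoothness_of_isRCLikeNormedField]; exact WithTop.coe_le_coe.2 le_top)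

instance (G : LieGrp.{u}) : IsManifold G.I ∞ G.carrier := inferInstance

/-- The Lie algebra of a Lie group: the tangent space at the unit, with the bracket of
left-invariant vector fields. -/
abbrev lieAlg (G : LieGrp.{u}) : Type u := GroupLieAlgebra G.I G.carrier

/-- The differential at the unit of a homomorphism of Lie groups. -/
def Hom.differential {G K : LieGrp.{u}} (f : G ⟶ K) : G.lieAlg →ₗ[ℝ] K.lieAlg where
  toFun v := (mfderiv G.I K.I f.toMonoidHom 1 v : K.E)
  map_add' := (mfderiv G.I K.I f.toMonoidHom 1).map_add
  map_smul' := (mfderiv G.I K.I f.toMonoidHom 1).map_smul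

theorem mfderiv_mulInvariantVectorField {G K : LieGrp.{u}} (f : G ⟶ K) (v : G.lieAlg)
    (g : G.carrier) :
    mfderiv G.I K.I f.toMonoidHom g (mulInvariantVectorField v g) =
      mulInvariantVectorField (Hom.differential f v) (f.toMonoidHom g) := by
  have hf : ∀ x, MDifferentiableAt G.I K.I f.toMonoidHom x :=
    fun x => f.contMDiff.mdifferentiableAt (by simp)
  have hG : ∀ x, MDifferentiableAt G.I G.I (g * ·) x :=
    fun x => (contMDiff_mul_left (n := ∞)).mdifferentiableAt (by simp)
  have hK : ∀ x, MDifferentiableAt K.I K.I (f.toMonoidHom g * ·) x :=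
    fun x => (contMDiff_mul_left (n := ∞)).mdifferentiableAt (by simp)
  have h : f.toMonoidHom ∘ (g * ·) = (f.toMonoidHom g * ·) ∘ f.toMonoidHom := by
    ext x; simp
  have c₁ := mfderiv_comp_of_eq (x := (1 : G.carrier)) (hf g) (hG 1) (mul_one g)
  have c₂ := mfderiv_comp_of_eq (x := (1 : G.carrier)) (hK 1) (hf 1) (map_one f.toMonoidHom)
  rw [h, c₂] at c₁
  have e₁ : (mfderiv G.I K.I f.toMonoidHom (g * 1) : G.E →L[ℝ] K.E) =
      mfderiv G.I K.I f.toMonoidHom g :=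
    congrArg (β := G.E →L[ℝ] K.E) (fun x => mfderiv G.I K.I f.toMonoidHom x) (mul_one g)
  have e₂ : (mfderiv K.I K.I (f.toMonoidHom g * ·) (f.toMonoidHom 1) : K.E →L[ℝ] K.E) =
      mfderiv K.I K.I (f.toMonoidHom g * ·) 1 :=
    congrArg (β := K.E →L[ℝ] K.E) (fun x => mfderiv K.I K.I (f.toMonoidHom g * ·) x)
      (map_one f.toMonoidHom)
  have h₁ := DFunLike.congr_fun e₁ (mulInvariantVectorField v g : G.E)
  have h₂ := DFunLike.congr_fun e₂ (Hom.differential f v : K.E)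
  exact h₁.symm.trans ((DFunLike.congr_fun c₁ v).symm.trans h₂)

/-- The homomorphism of Lie algebras induced by a homomorphism of Lie groups. -/
def lieMap {G K : LieGrp.{u}} (f : G ⟶ K) : G.lieAlg →ₗ⁅ℝ⁆ K.lieAlg where
  toLinearMap := Hom.differential f
  map_lie' {v w} := by
    have h := mfderiv_mlieBracket_related f.contMDiff 1
      (mdifferentiableAt_mulInvariantVectorField v) (mdifferentiableAt_mulInvariantVectorField w)
      (mdifferentiableAt_mulInvariantVectorField (Hom.differential f v))
      (mdifferentiableAt_mulInvariantVectorField (Hom.differential f w))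
      (mfderiv_mulInvariantVectorField f v) (mfderiv_mulInvariantVectorField f w)
    rw [map_one f.toMonoidHom] at h
    exact h

theorem lieMap_id (G : LieGrp.{u}) : lieMap (𝟙 G) = LieHom.id := by
  refine LieHom.ext fun v => ?_
  exact DFunLike.congr_fun (mfderiv_id (I := G.I) (x := (1 : G.carrier))) v

theorem lieMap_comp {G K N : LieGrp.{u}} (f : G ⟶ K) (g : K ⟶ N) :
    lieMap (f ≫ g) = (lieMap g).comp (lieMap f) := by
  refine LieHom.ext fun v => ?_
  have c := mfderiv_comp_of_eq (x := (1 : G.carrier)) (I := G.I) (I' := K.I) (I'' := N.I)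
    (g := g.toMonoidHom) (f := f.toMonoidHom) (y := 1)
    (g.contMDiff.mdifferentiableAt (by simp)) (f.contMDiff.mdifferentiableAt (by simp))
    (map_one f.toMonoidHom)
  have e : (mfderiv K.I N.I g.toMonoidHom (f.toMonoidHom 1) : K.E →L[ℝ] N.E) =
      mfderiv K.I N.I g.toMonoidHom 1 :=
    congrArg (β := K.E →L[ℝ] N.E) (fun x => mfderiv K.I N.I g.toMonoidHom x)
      (map_one f.toMonoidHom)
  exact (DFunLike.congr_fun c v).trans
    (DFunLike.congr_fun e (Hom.differential f v : K.E))

end LieGrp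

namespace CocommCoalg

theorem prod_hom_ext {C D T : CocommCoalg.{u}} {f g : C ⊗ D ⟶ T}
    (h : ∀ c d, f.toCoalgHom (c ⊗ₜ[ℝ] d : C.carrier ⊗[ℝ] D.carrier) =
      g.toCoalgHom (c ⊗ₜ[ℝ] d : C.carrier ⊗[ℝ] D.carrier)) : f = g := by
  refine hom_ext fun z => ?_
  have : (f.toCoalgHom.toLinearMap : C.carrier ⊗[ℝ] D.carrier →ₗ[ℝ] T.carrier) =
      g.toCoalgHom.toLinearMap := TensorProduct.ext' h
  exact DFunLike.congr_fun this z

theorem tensorHom_apply {C D C' D' : CocommCoalg.{u}} (f : C ⟶ C') (g : D ⟶ D')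
    (c : C.carrier) (d : D.carrier) :
    (f ⊗ₘ g).toCoalgHom (c ⊗ₜ[ℝ] d : C.carrier ⊗[ℝ] D.carrier) =
      (f.toCoalgHom c ⊗ₜ[ℝ] g.toCoalgHom d : C'.carrier ⊗[ℝ] D'.carrier) := by
  let F : C ⊗ D ⟶ C' ⊗ D' := Hom.mk (C := prod C D) (D := prod C' D')
    (Coalgebra.TensorProduct.map f.toCoalgHom g.toCoalgHom)
  have : f ⊗ₘ g = F := by
    refine CartesianMonoidalCategory.hom_ext _ _ ?_ ?_
    · rw [tensorHom_fst]
      refine prod_hom_ext fun c d => ?_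
      change f.toCoalgHom (Coalgebra.counit (R := ℝ) d • c) =
        Coalgebra.counit (R := ℝ) (g.toCoalgHom d) • f.toCoalgHom c
      rw [CoalgHomClass.counit_comp_apply, map_smul]
    · rw [tensorHom_snd]
      refine prod_hom_ext fun c d => ?_
      change g.toCoalgHom (Coalgebra.counit (R := ℝ) c • d) =
        Coalgebra.counit (R := ℝ) (f.toCoalgHom c) • g.toCoalgHom d
      rw [CoalgHomClass.counit_comp_apply, map_smul]
  rw [this]
  rfl

theorem triple_hom_ext {C D K T : CocommCoalg.{u}} {f g : (C ⊗ D) ⊗ K ⟶ T}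
    (h : ∀ c d k,
      f.toCoalgHom ((c ⊗ₜ[ℝ] d) ⊗ₜ[ℝ] k : (C.carrier ⊗[ℝ] D.carrier) ⊗[ℝ] K.carrier) =
        g.toCoalgHom ((c ⊗ₜ[ℝ] d) ⊗ₜ[ℝ] k : (C.carrier ⊗[ℝ] D.carrier) ⊗[ℝ] K.carrier)) :
    f = g := by
  refine hom_ext fun z => ?_
  have : (f.toCoalgHom.toLinearMap :
      (C.carrier ⊗[ℝ] D.carrier) ⊗[ℝ] K.carrier →ₗ[ℝ] T.carrier) =
      g.toCoalgHom.toLinearMap := TensorProduct.ext_threefold h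
  exact DFunLike.congr_fun this z

theorem associator_apply (C D K : CocommCoalg.{u}) (c : C.carrier) (d : D.carrier)
    (k : K.carrier) :
    (α_ C D K).hom.toCoalgHom ((c ⊗ₜ[ℝ] d) ⊗ₜ[ℝ] k : (C.carrier ⊗[ℝ] D.carrier) ⊗[ℝ] K.carrier) =
      (c ⊗ₜ[ℝ] (d ⊗ₜ[ℝ] k) : C.carrier ⊗[ℝ] (D.carrier ⊗[ℝ] K.carrier)) := by
  let F : (C ⊗ D) ⊗ K ⟶ C ⊗ (D ⊗ K) := Hom.mk (C := prod (prod C D) K) (D := prod C (prod D K))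
    (Coalgebra.TensorProduct.assoc ℝ ℝ C.carrier D.carrier K.carrier).toCoalgHom
  have : (α_ C D K).hom = F := by
    refine CartesianMonoidalCategory.hom_ext _ _ ?_
      (CartesianMonoidalCategory.hom_ext _ _ ?_ ?_)
    · rw [associator_hom_fst]
      refine triple_hom_ext fun c d k => ?_
      change Coalgebra.counit (R := ℝ) d • (Coalgebra.counit (R := ℝ) k • c) =
        (Coalgebra.counit (R := ℝ) k * Coalgebra.counit (R := ℝ) d) • c
      rw [smul_smul, mul_comm]
    · rw [Category.assoc, associator_hom_snd_fst]
      refine triple_hom_ext fun c d k => ?_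
      change Coalgebra.counit (R := ℝ) (Coalgebra.counit (R := ℝ) k • c) • d =
        Coalgebra.counit (R := ℝ) k • (Coalgebra.counit (R := ℝ) c • d)
      rw [map_smul, smul_assoc]
    · rw [Category.assoc, associator_hom_snd_snd]
      refine triple_hom_ext fun c d k => ?_
      change (Coalgebra.counit (R := ℝ) d * Coalgebra.counit (R := ℝ) c) • k =
        Coalgebra.counit (R := ℝ) (Coalgebra.counit (R := ℝ) c • d) • k
      rw [map_smul, smul_eq_mul, mul_comm]
  rw [this]
  rfl

end CocommCoalg

/-- The unit of a bialgebra, as a morphism of coalgebras. -/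
def unitCoalgHom (A : Type*) [Ring A] [Bialgebra ℝ A] : ULift.{u} ℝ →ₗc[ℝ] A where
  toLinearMap := LinearMap.toSpanSingleton ℝ A 1 ∘ₗ
    (ULift.moduleEquiv.{0, 0, u} (R := ℝ) (M := ℝ)).toLinearMap
  counit_comp := LinearMap.ext fun r => by
    change Coalgebra.counit (R := ℝ) (r.down • (1 : A)) = r.down
    rw [map_smul, Bialgebra.counit_one, smul_eq_mul, mul_one]
  map_comp_comul := LinearMap.ext fun r => by
    let w : ULift.{u} ℝ := ULift.up 1
    change TensorProduct.map (LinearMap.toSpanSingleton ℝ A 1 ∘ₗ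
      (ULift.moduleEquiv.{0, 0, u} (R := ℝ) (M := ℝ)).toLinearMap)
      (LinearMap.toSpanSingleton ℝ A 1 ∘ₗ
      (ULift.moduleEquiv.{0, 0, u} (R := ℝ) (M := ℝ)).toLinearMap)
      (r.down • (w ⊗ₜ[ℝ] w)) = Coalgebra.comul (R := ℝ) (r.down • (1 : A))
    rw [map_smul, map_smul, Bialgebra.comul_one, TensorProduct.map_tmul]
    simp [w, Algebra.TensorProduct.one_def]

namespace LieGrp

/-- The universal enveloping algebra of the Lie algebra of `G`, as a coalgebra. -/
def env (G : LieGrp.{u}) : CocommCoalg.{u} where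
  carrier := Env G.lieAlg

/-- The unit of `U(𝔤)`. -/
def envOne (G : LieGrp.{u}) : CocommCoalg.unit ⟶ G.env :=
  CocommCoalg.Hom.mk (C := CocommCoalg.unit) (D := G.env) (unitCoalgHom (Env G.lieAlg))

theorem envOne_apply (G : LieGrp.{u}) (r : ULift.{u} ℝ) :
    (envOne G).toCoalgHom r = (show Env G.lieAlg from r.down • 1) := rfl

/-- The multiplication of `U(𝔤)`. -/
def envMul (G : LieGrp.{u}) : CocommCoalg.prod G.env G.env ⟶ G.env :=
  CocommCoalg.Hom.mk (C := CocommCoalg.prod G.env G.env) (D := G.env)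
    (Bialgebra.mulCoalgHom ℝ (Env G.lieAlg))

/-- The antipode of `U(𝔤)`. -/
def envInv (G : LieGrp.{u}) : G.env ⟶ G.env :=
  CocommCoalg.Hom.mk (C := G.env) (D := G.env) envAntipodeCoalgHom

theorem envMul_apply (G : LieGrp.{u}) (a b : Env G.lieAlg) :
    (envMul G).toCoalgHom (a ⊗ₜ[ℝ] b : Env G.lieAlg ⊗[ℝ] Env G.lieAlg) =
      (show Env G.lieAlg from a * b) := by
  change LinearMap.mul' ℝ (Env G.lieAlg) (a ⊗ₜ[ℝ] b) = a * b
  exact LinearMap.mul'_apply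

/-- `U(𝔤)` is a cocommutative Hopf algebra, i.e. a group object in cocommutative coalgebras. -/
instance (G : LieGrp.{u}) : GrpObj G.env where
  one := envOne G
  mul := envMul G
  inv := envInv G
  one_mul := by
    refine CocommCoalg.prod_hom_ext fun r (x : Env G.lieAlg) => ?_
    rw [← tensorHom_id]
    refine (congrArg (envMul G).toCoalgHom
      (CocommCoalg.tensorHom_apply (envOne G) (𝟙 G.env) r x)).trans ?_
    refine (envMul_apply G (r.down • 1 : Env G.lieAlg) x).trans ?_
    refine (smul_mul_assoc r.down (1 : Env G.lieAlg) x).trans ?_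
    rw [one_mul]
    rw [leftUnitor_hom]
    rfl
  mul_one := by
    refine CocommCoalg.prod_hom_ext fun (x : Env G.lieAlg) r => ?_
    rw [← id_tensorHom]
    refine (congrArg (envMul G).toCoalgHom
      (CocommCoalg.tensorHom_apply (𝟙 G.env) (envOne G) x r)).trans ?_
    refine (envMul_apply G x (r.down • 1 : Env G.lieAlg)).trans ?_
    refine (mul_smul_comm r.down x (1 : Env G.lieAlg)).trans ?_
    rw [mul_one]
    rw [rightUnitor_hom]
    rfl
  mul_assoc := by
    refine CocommCoalg.triple_hom_ext fun (a b c : Env G.lieAlg) => ?_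
    rw [← tensorHom_id, ← id_tensorHom]
    have l₁ := CocommCoalg.tensorHom_apply (envMul G) (𝟙 G.env)
      (a ⊗ₜ[ℝ] b : Env G.lieAlg ⊗[ℝ] Env G.lieAlg) c
    have r₁ := CocommCoalg.tensorHom_apply (𝟙 G.env) (envMul G) a
      (b ⊗ₜ[ℝ] c : Env G.lieAlg ⊗[ℝ] Env G.lieAlg)
    have r₂ := CocommCoalg.associator_apply G.env G.env G.env a b c
    have l := (congrArg (envMul G).toCoalgHom l₁).trans
      (envMul_apply G (LinearMap.mul' ℝ (Env G.lieAlg) (a ⊗ₜ[ℝ] b)) c)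
    have r := (congrArg (envMul G).toCoalgHom ((congrArg
      ((𝟙 G.env) ⊗ₘ envMul G : G.env ⊗ (G.env ⊗ G.env) ⟶ _).toCoalgHom r₂).trans r₁)).trans
      (envMul_apply G a (LinearMap.mul' ℝ (Env G.lieAlg) (b ⊗ₜ[ℝ] c)))
    refine l.trans (Eq.trans ?_ r.symm)
    change LinearMap.mul' ℝ (Env G.lieAlg) (a ⊗ₜ[ℝ] b) * c =
      a * LinearMap.mul' ℝ (Env G.lieAlg) (b ⊗ₜ[ℝ] c)
    rw [LinearMap.mul'_apply, LinearMap.mul'_apply, mul_assoc]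
  left_inv := CocommCoalg.hom_ext fun x =>
    (HopfAlgebra.mul_antipode_rTensor_comul_apply (R := ℝ) (A := Env G.lieAlg) x).trans
      (Algebra.algebraMap_eq_smul_one _)
  right_inv := CocommCoalg.hom_ext fun x =>
    (HopfAlgebra.mul_antipode_lTensor_comul_apply (R := ℝ) (A := Env G.lieAlg) x).trans
      (Algebra.algebraMap_eq_smul_one _)

/-- The map `U(𝔤) → U(𝔨)` induced by a homomorphism of Lie groups. -/
def envHom {G K : LieGrp.{u}} (f : G ⟶ K) : G.env ⟶ K.env :=
  CocommCoalg.Hom.mk (C := G.env) (D := K.env) (envMapCoalgHom (lieMap f))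

instance {G K : LieGrp.{u}} (f : G ⟶ K) : IsMonHom (envHom f) where
  one_hom := CocommCoalg.hom_ext fun r => by
    change envMap (lieMap f) (r.down • (1 : Env G.lieAlg)) = r.down • (1 : Env K.lieAlg)
    rw [map_smul, map_one]
  mul_hom := by
    refine CocommCoalg.prod_hom_ext fun (a b : Env G.lieAlg) => ?_
    have l := congrArg (envHom f).toCoalgHom (envMul_apply G a b)
    have r := (congrArg (envMul K).toCoalgHom
      (CocommCoalg.tensorHom_apply (envHom f) (envHom f) a b)).trans
      (envMul_apply K (envMap (lieMap f) a) (envMap (lieMap f) b))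
    refine l.trans (Eq.trans ?_ r.symm)
    exact map_mul (envMap (lieMap f)) a b

/-- The functor `G ↦ U(𝔤)` from Lie groups to cocommutative Hopf algebras. -/
def envGrp : LieGrp.{u} ⥤ Grp CocommCoalg.{u} where
  obj G := .mk G.env
  map f := Grp.ofHom (envHom f)
  map_id G := by
    ext : 2
    refine CocommCoalg.hom_ext fun x => ?_
    change envMap (lieMap (𝟙 G)) x = x
    rw [lieMap_id, envMap_id]
    rfl
  map_comp f g := by
    ext : 2
    refine CocommCoalg.hom_ext fun x => ?_
    change envMap (lieMap (f ≫ g)) x = envMap (lieMap g) (envMap (lieMap f) x)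
    rw [lieMap_comp, envMap_comp]
    rfl

end LieGrp

end

section

open scoped Manifold ContDiff Topology Convolution
open MeasureTheory

section Hadamard

variable {E : Type*} [NormedAddCommGroup E] [NormedSpace ℝ E]

/-- A parametric integral over `[0, 1]` of a smooth function is smooth. -/
theorem contDiff_integral_unit {k : E → ℝ → ℝ} (hk : ContDiff ℝ ∞ (Function.uncurry k)) :
    ContDiff ℝ ∞ (fun v => ∫ t in (0 : ℝ)..1, k v t) := by
  let χ : ContDiffBump (0 : ℝ) := ⟨1, 2, one_pos, by norm_num⟩
  let g : E → ℝ → ℝ := fun v t => χ (-t) * k v (-t)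
  have hχ : ContDiff ℝ ∞ χ := χ.contDiff
  have hg : ContDiff ℝ ∞ (Function.uncurry g) := by
    have h₁ : ContDiff ℝ ∞ (fun p : E × ℝ => χ (-p.2)) := hχ.comp contDiff_snd.neg
    have h₂ : ContDiff ℝ ∞ (fun p : E × ℝ => k p.1 (-p.2)) :=
      hk.comp (contDiff_fst.prodMk contDiff_snd.neg)
    exact h₁.mul h₂
  have hint : LocallyIntegrable (Set.indicator (Set.Ioc (0 : ℝ) 1) (fun _ => (1 : ℝ))) volume := by
    refine Integrable.locallyIntegrable ?_
    rw [integrable_indicator_iff measurableSet_Ioc]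
    simp
  have key := contDiffOn_convolution_right_with_param_comp (𝕜 := ℝ) (n := ⊤)
    (μ := (volume : Measure ℝ)) (ContinuousLinearMap.mul ℝ ℝ) (s := (Set.univ : Set E))
    (v := fun _ => (0 : ℝ)) contDiffOn_const
    (f := Set.indicator (Set.Ioc (0 : ℝ) 1) (fun _ => (1 : ℝ))) (g := g)
    (k := Metric.closedBall 0 2) isOpen_univ (isCompact_closedBall _ _) (fun p x _ hx => by
      have : χ (-x) = 0 := χ.zero_of_le_dist (by
        simp only [Metric.mem_closedBall, dist_zero_right, Real.norm_eq_abs, not_le] at hx ⊢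
        rw [abs_neg]
        exact hx.le)
      simp [g, this]) hint hg.contDiffOn
  rw [contDiffOn_univ] at key
  convert key using 2 with v
  rw [convolution_def, intervalIntegral.integral_of_le zero_le_one,
    ← integral_indicator measurableSet_Ioc]
  congr 1
  ext t
  by_cases ht : t ∈ Set.Ioc (0 : ℝ) 1
  · have : χ t = 1 := χ.one_of_mem_closedBall (by
      simp only [Metric.mem_closedBall, dist_zero_right, Real.norm_eq_abs]
      rw [abs_of_pos ht.1]
      exact ht.2)
    simp [ht, g, this]
  · simp [ht]

/-- **Hadamard's lemma**. -/
theorem hadamard {d : ℕ} (b : Module.Basis (Fin d) ℝ E) {h : E → ℝ} (hh : ContDiff ℝ ∞ h)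
    (h0 : h 0 = 0) :
    ∃ g : Fin d → E → ℝ, (∀ i, ContDiff ℝ ∞ (g i)) ∧ ∀ v, h v = ∑ i, b.coord i v * g i v := by
  have hd : ∀ i, ContDiff ℝ ∞ (Function.uncurry fun (v : E) (t : ℝ) =>
      fderiv ℝ h (t • v) (b i)) := by
    intro i
    have h₁ : ContDiff ℝ ∞ (fderiv ℝ h) := hh.fderiv_right (by simp)
    have h₂ : ContDiff ℝ ∞ (fun p : E × ℝ => p.2 • p.1) := contDiff_snd.smul contDiff_fst
    exact (h₁.comp h₂).clm_apply contDiff_const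
  refine ⟨fun i v => ∫ t in (0 : ℝ)..1, fderiv ℝ h (t • v) (b i),
    fun i => contDiff_integral_unit (hd i), fun v => ?_⟩
  have hcont : ∀ i, Continuous fun t : ℝ => fderiv ℝ h (t • v) (b i) := fun i =>
    (hd i).continuous.comp (by fun_prop : Continuous fun t : ℝ => (v, t))
  have hderiv : ∀ t : ℝ, HasDerivAt (fun t : ℝ => h (t • v)) (fderiv ℝ h (t • v) v) t := by
    intro t
    have h₁ : HasFDerivAt h (fderiv ℝ h (t • v)) (t • v) :=
      (hh.differentiable (by simp) _).hasFDerivAt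
    have h₂ : HasDerivAt (fun t : ℝ => t • v) v t := by
      simpa using (hasDerivAt_id t).smul_const v
    exact h₁.comp_hasDerivAt t h₂
  have hv : ∀ t : ℝ, fderiv ℝ h (t • v) v = ∑ i, b.coord i v * fderiv ℝ h (t • v) (b i) := by
    intro t
    refine (congrArg (fderiv ℝ h (t • v)) (b.sum_repr v)).symm.trans ?_
    rw [map_sum]
    simp only [map_smul, smul_eq_mul, Module.Basis.coord_apply]
  have hft : ∫ t in (0 : ℝ)..1, fderiv ℝ h (t • v) v = h ((1 : ℝ) • v) - h ((0 : ℝ) • v) := by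
    refine intervalIntegral.integral_eq_sub_of_hasDerivAt (fun t _ => hderiv t) ?_
    simp_rw [hv]
    exact (continuous_finsetSum _ fun i _ => (hcont i).const_mul _).intervalIntegrable _ _
  rw [one_smul, zero_smul, h0, sub_zero] at hft
  rw [← hft]
  simp_rw [hv]
  rw [intervalIntegral.integral_finsetSum]
  · simp
  · exact fun i _ => ((hcont i).const_mul _).intervalIntegrable _ _

end Hadamard

section Germs

open Filter

variable {E : Type*} [NormedAddCommGroup E] [NormedSpace ℝ E]
  {H : Type*} [TopologicalSpace H] (I : ModelWithCorners ℝ E H)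
  {M : Type*} [TopologicalSpace M] [ChartedSpace H M]

instance germAlgebra {α : Type*} (l : Filter α) : Algebra ℝ (Germ l ℝ) :=
  Algebra.ofModule
    (fun r x y => by
      induction x, y using Germ.inductionOn₂ with
      | _ f g => exact congrArg (fun h : α → ℝ => (h : Germ l ℝ)) (smul_mul_assoc r f g))
    (fun r x y => by
      induction x, y using Germ.inductionOn₂ with
      | _ f g => exact congrArg (fun h : α → ℝ => (h : Germ l ℝ)) (mul_smul_comm r f g))

theorem algebraMap_germ {α : Type*} (l : Filter α) (r : ℝ) :
    algebraMap ℝ (Germ l ℝ) r = ((fun _ => r : α → ℝ) : Germ l ℝ) := by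
  rw [Algebra.algebraMap_eq_smul_one]
  exact congrArg (fun h : α → ℝ => (h : Germ l ℝ)) (funext fun _ => mul_one r)

/-- The algebra of germs at `x` of smooth functions. -/
def smoothGerm (x : M) : Subalgebra ℝ (Germ (𝓝 x) ℝ) where
  carrier := {a | ∃ f : M → ℝ, (∀ᶠ y in 𝓝 x, ContMDiffAt I 𝓘(ℝ) ∞ f y) ∧ (f : Germ (𝓝 x) ℝ) = a}
  mul_mem' := by
    rintro _ _ ⟨f, hf, rfl⟩ ⟨g, hg, rfl⟩
    exact ⟨f * g, (hf.and hg).mono fun y h => h.1.mul h.2, rfl⟩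
  add_mem' := by
    rintro _ _ ⟨f, hf, rfl⟩ ⟨g, hg, rfl⟩
    exact ⟨f + g, (hf.and hg).mono fun y h => h.1.add h.2, rfl⟩
  algebraMap_mem' r := ⟨fun _ => r, Eventually.of_forall fun _ => contMDiffAt_const,
    (algebraMap_germ _ r).symm⟩

/-- The germ of a function which is smooth near `x`. -/
def mkGerm (x : M) (f : M → ℝ) (hf : ∀ᶠ y in 𝓝 x, ContMDiffAt I 𝓘(ℝ) ∞ f y) : smoothGerm I x :=
  ⟨(f : Germ (𝓝 x) ℝ), f, hf, rfl⟩

theorem mkGerm_surj {x : M} (a : smoothGerm I x) : ∃ f hf, mkGerm I x f hf = a := by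
  obtain ⟨a, f, hf, rfl⟩ := a
  exact ⟨f, hf, rfl⟩

theorem mkGerm_eq_iff {x : M} {f g : M → ℝ} (hf hg) :
    mkGerm I x f hf = mkGerm I x g hg ↔ f =ᶠ[𝓝 x] g :=
  Subtype.ext_iff.trans Germ.coe_eq

/-- The value at `x` of a germ at `x`. -/
def germEval (x : M) : smoothGerm I x →ₐ[ℝ] ℝ where
  toFun a := a.1.value
  map_one' := rfl
  map_zero' := rfl
  map_mul' := fun ⟨a, f, hf, ha⟩ ⟨b, g, hg, hb⟩ => by
    subst ha hb
    rfl
  map_add' := fun ⟨a, f, hf, ha⟩ ⟨b, g, hg, hb⟩ => by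
    subst ha hb
    rfl
  commutes' r := by
    change Germ.value (algebraMap ℝ (Germ (𝓝 x) ℝ) r) = r
    rw [algebraMap_germ]
    rfl

/-- The ideal of germs vanishing at `x`. -/
def germIdeal (x : M) : Ideal (smoothGerm I x) := RingHom.ker (germEval I x)

theorem germIdeal_fg [FiniteDimensional ℝ E] [I.Boundaryless] [IsManifold I ∞ M] (x : M) :
    ∃ (d : ℕ) (ξ : Fin d → smoothGerm I x), (∀ i, ξ i ∈ germIdeal I x) ∧
      ∀ a ∈ germIdeal I x, ∃ g : Fin d → smoothGerm I x, a = ∑ i, ξ i * g i := by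
  let b := Module.finBasis ℝ E
  set e := extChartAt I x with he
  have hesm : ∀ᶠ y in 𝓝 x, ContMDiffAt I 𝓘(ℝ, E) ∞ e y := by
    filter_upwards [extChartAt_source_mem_nhds (I := I) x] with y hy
    exact contMDiffAt_extChartAt' (by rwa [← extChartAt_source I])
  have hpull : ∀ g : E → ℝ, ContDiff ℝ ∞ g →
      ∀ᶠ y in 𝓝 x, ContMDiffAt I 𝓘(ℝ) ∞ (fun y => g (e y - e x)) y := by
    intro g hg
    filter_upwards [hesm] with y hy
    have : ContDiff ℝ ∞ (fun v => g (v - e x)) := hg.comp (contDiff_id.sub contDiff_const)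
    exact (this.contMDiff.contMDiffAt).comp y hy
  have hcoord : ∀ i, ContDiff ℝ ∞ (b.coord i) := fun i =>
    (LinearMap.toContinuousLinearMap (b.coord i)).contDiff
  refine ⟨_, fun i => mkGerm I x _ (hpull (b.coord i) (hcoord i)), fun i => ?_, fun a ha => ?_⟩
  · change b.coord i (e x - e x) = 0
    simp
  obtain ⟨f, hf, rfl⟩ := mkGerm_surj I a
  have hfx : f x = 0 := ha
  -- the function in the chart
  have h₀ : ∀ᶠ v in 𝓝 (e x), ContDiffAt ℝ ∞ (f ∘ e.symm) v := by
    have h₁ := (continuousAt_extChartAt_symm (I := I) x).eventually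
      (by rw [extChartAt_to_inv]; exact hf)
    filter_upwards [h₁, extChartAt_target_mem_nhds (I := I) x] with v hv hvt
    have s₁ : ContMDiffAt 𝓘(ℝ, E) I ∞ e.symm v :=
      (contMDiffOn_extChartAt_symm (I := I) x).contMDiffAt
        ((isOpen_extChartAt_target (I := I) x).mem_nhds hvt)
    exact (ContMDiffAt.comp v hv s₁).contDiffAt
  obtain ⟨r, hr, hball⟩ := Metric.eventually_nhds_iff_ball.1 h₀
  let ρ : ContDiffBump (0 : E) := ⟨r / 4, r / 2, by positivity, by linarith⟩
  let h : E → ℝ := fun v => ρ v * f (e.symm (e x + v))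
  have hh : ContDiff ℝ ∞ h := by
    rw [contDiff_iff_contDiffAt]
    intro v
    by_cases hv : v ∈ Metric.ball (0 : E) r
    · refine ρ.contDiff.contDiffAt.mul ?_
      have h₂ := hball (e x + v) (by simpa using hv)
      exact ContDiffAt.comp (f := fun w => e x + w) (g := f ∘ e.symm) v h₂ (contDiff_const.add contDiff_id).contDiffAt
    · have hv' : v ∉ Metric.closedBall (0 : E) (r / 2) := by
        simp only [Metric.mem_ball, Metric.mem_closedBall, dist_zero_right] at hv ⊢
        linarith
      have : h =ᶠ[𝓝 v] fun _ => 0 := by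
        filter_upwards [Metric.isClosed_closedBall.isOpen_compl.mem_nhds hv'] with w hw
        have : ρ w = 0 := ρ.zero_of_le_dist (by
          simp only [Set.mem_compl_iff, Metric.mem_closedBall, not_le] at hw
          exact hw.le)
        simp [h, this]
      exact contDiffAt_const.congr_of_eventuallyEq this
  obtain ⟨g, hg, hsum⟩ := hadamard b hh (by simp [h, e, hfx])
  refine ⟨fun i => mkGerm I x _ (hpull (g i) (hg i)), ?_⟩
  have hclose : ∀ᶠ y in 𝓝 x, ρ (e y - e x) = 1 := by
    have : ContinuousAt (fun y => e y - e x) x :=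
      (continuousAt_extChartAt x).sub continuousAt_const
    have h₃ := this.eventually (p := fun v => v ∈ Metric.closedBall (0 : E) (r / 4))
      (by dsimp only; rw [sub_self]; exact Metric.closedBall_mem_nhds _ (by positivity))
    exact h₃.mono fun y hy => ρ.one_of_mem_closedBall hy
  refine Subtype.ext ?_
  have hr : ((∑ i, mkGerm I x _ (hpull (b.coord i) (hcoord i)) * mkGerm I x _ (hpull (g i) (hg i)) :
      smoothGerm I x) : Germ (𝓝 x) ℝ) =
      ((∑ i, fun y => b.coord i (e y - e x) * g i (e y - e x) : M → ℝ) : Germ (𝓝 x) ℝ) := by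
    rw [AddSubmonoidClass.coe_finsetSum]
    exact (map_sum (Germ.coeRingHom (𝓝 x) (R := ℝ)) _ _).symm
  rw [hr]
  refine Germ.coe_eq.2 ?_
  filter_upwards [hclose, extChartAt_source_mem_nhds (I := I) x] with y hy hys
  rw [Finset.sum_apply, ← hsum]
  simp only [h, hy, one_mul, add_sub_cancel]
  rw [e.left_inv hys]

end Germs

end

section

open CategoryTheory
open scoped TensorProduct Manifold ContDiff Topology

section Separation

variable {V W S T : Type*} [AddCommGroup V] [Module ℝ V] [AddCommGroup W] [Module ℝ W]

/-- The functional `v ⊗ w ↦ p(v) q(w)`. -/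
def tensorFunctional (p : Module.Dual ℝ V) (q : Module.Dual ℝ W) : Module.Dual ℝ (V ⊗[ℝ] W) :=
  LinearMap.mul' ℝ ℝ ∘ₗ TensorProduct.map p q

@[simp]
theorem tensorFunctional_tmul (p : Module.Dual ℝ V) (q : Module.Dual ℝ W) (v : V) (w : W) :
    tensorFunctional p q (v ⊗ₜ w) = p v * q w := by
  simp [tensorFunctional]

/-- Separating families of functionals on `V` and `W` give one on `V ⊗ W`. -/
theorem tensor_separating (p : S → Module.Dual ℝ V) (hp : ∀ v, (∀ s, p s v = 0) → v = 0)
    (q : T → Module.Dual ℝ W) (hq : ∀ w, (∀ t, q t w = 0) → w = 0) (z : V ⊗[ℝ] W)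
    (hz : ∀ s t, tensorFunctional (p s) (q t) z = 0) : z = 0 := by
  classical
  let b := Module.Basis.ofVectorSpace ℝ W
  let e := TensorProduct.equivFinsuppOfBasisRight (M := V) b
  suffices h : e z = 0 by simpa using h
  have hsum : z = (e z).sum fun i v => v ⊗ₜ[ℝ] b i := by
    conv_lhs => rw [← e.symm_apply_apply z]
    exact TensorProduct.equivFinsuppOfBasisRight_symm_apply b (e z)
  have key : ∀ s, ((e z).sum fun i v => p s v • b i) = 0 := by
    intro s
    refine hq _ fun t => ?_
    have := hz s t
    rw [hsum] at this
    simpa [Finsupp.sum, map_sum] using this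
  ext i
  refine hp _ fun s => ?_
  have h₁ := congrArg (fun w => b.repr w i) (key s)
  simp only [Finsupp.sum, map_sum, map_smul, Module.Basis.repr_self, Finsupp.coe_finsetSum,
    Finset.sum_apply, Finsupp.smul_apply, smul_eq_mul, map_zero, Finsupp.zero_apply] at h₁
  by_cases hi : i ∈ (e z).support
  · rw [Finset.sum_eq_single i (fun j _ hj => by simp [Finsupp.single_eq_of_ne hj.symm])
      (fun h => absurd hi h)] at h₁
    simpa using h₁
  · simp [Finsupp.notMem_support_iff.1 hi]

end Separation

/-- A commutative `ℝ`-algebra with the linear topology defined by a decreasing sequence of ideals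
of finite codimension. -/
structure LinTopAlg : Type (u + 1) where
  (carrier : Type u)
  [commRing : CommRing carrier]
  [algebra : Algebra ℝ carrier]
  (ideal : ℕ → Ideal carrier)
  (antitone : Antitone ideal)
  (finite : ∀ n, Module.Finite ℝ (carrier ⧸ ideal n))

attribute [instance] LinTopAlg.commRing LinTopAlg.algebra LinTopAlg.finite

namespace LinTopAlg

/-- The subspace of continuous linear functionals (where `ℝ` is discrete). -/
def contDualSubmodule (A : LinTopAlg.{u}) : Submodule ℝ (Module.Dual ℝ A.carrier) where
  carrier := {φ | ∃ n, ∀ a ∈ A.ideal n, φ a = 0}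
  add_mem' := by
    rintro φ ψ ⟨m, hm⟩ ⟨n, hn⟩
    exact ⟨max m n, fun a ha => by
      simp [hm a (A.antitone (le_max_left m n) ha), hn a (A.antitone (le_max_right m n) ha)]⟩
  zero_mem' := ⟨0, fun _ _ => rfl⟩
  smul_mem' := by
    rintro r φ ⟨n, hn⟩
    exact ⟨n, fun a ha => by simp [hn a ha]⟩

/-- The space of continuous linear functionals (where `ℝ` is discrete). -/
def contDual (A : LinTopAlg.{u}) : Type u := A.contDualSubmodule

instance (A : LinTopAlg.{u}) : AddCommGroup A.contDual :=
  inferInstanceAs (AddCommGroup A.contDualSubmodule)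

instance (A : LinTopAlg.{u}) : Module ℝ A.contDual :=
  inferInstanceAs (Module ℝ A.contDualSubmodule)

variable {A : LinTopAlg.{u}}

/-- Evaluation of functionals at `a`. -/
def ev (a : A.carrier) : Module.Dual ℝ A.contDual :=
  Module.Dual.eval ℝ A.carrier a ∘ₗ A.contDualSubmodule.subtype

theorem ev_apply (a : A.carrier) (φ : A.contDual) : ev a φ = φ.1 a := rfl

theorem ev_separating (φ : A.contDual) (h : ∀ a : A.carrier, ev a φ = 0) : φ = 0 :=
  Subtype.ext (LinearMap.ext h)

/-- The functional `φ ⊗ ψ ↦ φ(a) ψ(b)`. -/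
def ev₂ (a b : A.carrier) : Module.Dual ℝ (A.contDual ⊗[ℝ] A.contDual) :=
  tensorFunctional (ev a) (ev b)

theorem ev₂_tmul (a b : A.carrier) (φ ψ : A.contDual) : ev₂ a b (φ ⊗ₜ ψ) = φ.1 a * ψ.1 b :=
  tensorFunctional_tmul _ _ _ _

theorem ev₂_ext {z w : A.contDual ⊗[ℝ] A.contDual} (h : ∀ a b, ev₂ a b z = ev₂ a b w) : z = w := by
  rw [← sub_eq_zero]
  refine tensor_separating ev ev_separating ev ev_separating _ fun a b => ?_
  have := h a b
  rw [← sub_eq_zero, ← map_sub] at this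
  exact this

theorem exists_comul (φ : A.contDual) :
    ∃ z : A.contDual ⊗[ℝ] A.contDual, ∀ a b, ev₂ a b z = φ.1 (a * b) := by
  obtain ⟨φ, n, hn⟩ := φ
  let Q := A.carrier ⧸ A.ideal n
  let b := Module.finBasis ℝ Q
  choose r hr using fun i => Ideal.Quotient.mk_surjective (b i)
  let c : Fin (Module.finrank ℝ Q) → A.contDual := fun i =>
    ⟨b.coord i ∘ₗ (Ideal.Quotient.mkₐ ℝ (A.ideal n)).toLinearMap, n, fun a ha => by
      have : Ideal.Quotient.mk (A.ideal n) a = 0 := Ideal.Quotient.eq_zero_iff_mem.2 ha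
      simp [this]⟩
  let d : Fin (Module.finrank ℝ Q) → A.contDual := fun i =>
    ⟨φ ∘ₗ LinearMap.mulLeft ℝ (r i), n, fun a ha => hn _ ((A.ideal n).mul_mem_left _ ha)⟩
  refine ⟨∑ i, c i ⊗ₜ d i, fun x y => ?_⟩
  have hx : x - ∑ i, b.coord i (Ideal.Quotient.mk (A.ideal n) x) • r i ∈ A.ideal n := by
    rw [← Ideal.Quotient.eq_zero_iff_mem]
    have : ∀ (t : ℝ) (w : A.carrier), Ideal.Quotient.mk (A.ideal n) (t • w) =
      t • Ideal.Quotient.mk (A.ideal n) w := fun t w => rfl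
    rw [map_sub, map_sum]
    simp_rw [this, hr]
    rw [sub_eq_zero]
    exact (b.sum_repr _).symm
  have h₁ := hn _ ((A.ideal n).mul_mem_right y hx)
  rw [sub_mul, map_sub, sub_eq_zero] at h₁
  rw [h₁, Finset.sum_mul, map_sum, map_sum]
  refine Finset.sum_congr rfl fun i _ => ?_
  rw [ev₂_tmul, smul_mul_assoc, map_smul]
  rfl

/-- The comultiplication of the continuous dual, dual to the multiplication:
`Δφ = ∑ φ' ⊗ φ''` with `∑ φ'(a) φ''(b) = φ(ab)`. -/
def comul : A.contDual →ₗ[ℝ] A.contDual ⊗[ℝ] A.contDual where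
  toFun φ := (exists_comul φ).choose
  map_add' φ ψ := ev₂_ext fun a b => by
    rw [map_add, (exists_comul _).choose_spec, (exists_comul _).choose_spec,
      (exists_comul _).choose_spec]
    rfl
  map_smul' r φ := ev₂_ext fun a b => by
    rw [map_smul, (exists_comul _).choose_spec, (exists_comul _).choose_spec]
    rfl

theorem ev₂_comul (φ : A.contDual) (a b : A.carrier) : ev₂ a b (comul φ) = φ.1 (a * b) :=
  (exists_comul φ).choose_spec a b

/-- The counit of the continuous dual is the evaluation at `1`. -/
instance : Coalgebra ℝ A.contDual where
  comul := comul
  counit := ev 1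
  coassoc := by
    ext φ : 1
    rw [← sub_eq_zero]
    refine tensor_separating ev ev_separating (fun p : A.carrier × A.carrier => ev₂ p.1 p.2)
      (fun w hw => ev₂_ext fun a b => by rw [hw (a, b), map_zero]) _ fun a ⟨b, c⟩ => ?_
    have l : ∀ z : A.contDual ⊗[ℝ] A.contDual, tensorFunctional (ev a) (ev₂ b c)
        (TensorProduct.assoc ℝ _ _ _ (comul.rTensor A.contDual z)) = ev₂ (a * b) c z := by
      intro z
      induction z with
      | zero => simp
      | add x y hx hy => simp only [map_add, hx, hy]
      | tmul φ ψ =>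
        have l' : ∀ w : A.contDual ⊗[ℝ] A.contDual, tensorFunctional (ev a) (ev₂ b c)
            (TensorProduct.assoc ℝ _ _ _ (w ⊗ₜ[ℝ] ψ)) = ev₂ a b w * ψ.1 c := by
          intro w
          induction w with
          | zero => simp
          | add x y hx hy => simp only [TensorProduct.add_tmul, map_add, hx, hy, add_mul]
          | tmul φ₁ φ₂ => simp [ev₂_tmul, ev_apply, mul_assoc]
        rw [LinearMap.rTensor_tmul, l', ev₂_comul, ev₂_tmul]
    have r : ∀ z : A.contDual ⊗[ℝ] A.contDual, tensorFunctional (ev a) (ev₂ b c)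
        (comul.lTensor A.contDual z) = ev₂ a (b * c) z := by
      intro z
      induction z with
      | zero => simp
      | add x y hx hy => simp only [map_add, hx, hy]
      | tmul φ ψ => simp [ev₂_tmul, ev₂_comul, ev_apply]
    simp only [LinearMap.comp_apply, LinearEquiv.coe_coe, map_sub, l, r, ev₂_comul, mul_assoc,
      sub_self]
  rTensor_counit_comp_comul := by
    ext φ : 1
    rw [← sub_eq_zero]
    refine tensor_separating (fun _ : Unit => LinearMap.id) (fun v hv => hv ()) ev ev_separating _
      fun _ b => ?_
    have l : ∀ z : A.contDual ⊗[ℝ] A.contDual, tensorFunctional LinearMap.id (ev b)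
        ((ev (1 : A.carrier)).rTensor A.contDual z) = ev₂ 1 b z := by
      intro z
      induction z with
      | zero => simp
      | add x y hx hy => simp only [map_add, hx, hy]
      | tmul φ ψ => simp [ev₂_tmul, ev_apply]
    simp [l, ev₂_comul, ev_apply]
  lTensor_counit_comp_comul := by
    ext φ : 1
    rw [← sub_eq_zero]
    refine tensor_separating ev ev_separating (fun _ : Unit => LinearMap.id) (fun v hv => hv ()) _
      fun a _ => ?_
    have l : ∀ z : A.contDual ⊗[ℝ] A.contDual, tensorFunctional (ev a) LinearMap.id
        ((ev (1 : A.carrier)).lTensor A.contDual z) = ev₂ a 1 z := by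
      intro z
      induction z with
      | zero => simp
      | add x y hx hy => simp only [map_add, hx, hy]
      | tmul φ ψ => simp [ev₂_tmul, ev_apply]
    simp [l, ev₂_comul, ev_apply]

instance : Coalgebra.IsCocomm ℝ A.contDual where
  comm_comp_comul := by
    ext φ : 1
    refine ev₂_ext fun a b => ?_
    have l : ∀ z : A.contDual ⊗[ℝ] A.contDual,
        ev₂ a b (TensorProduct.comm ℝ _ _ z) = ev₂ b a z := by
      intro z
      induction z with
      | zero => simp
      | add x y hx hy => simp only [map_add, hx, hy]
      | tmul φ ψ => simp [ev₂_tmul, mul_comm]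
    refine (l _).trans ?_
    exact (ev₂_comul φ b a).trans ((congrArg φ.1 (mul_comm b a)).trans (ev₂_comul φ a b).symm)

/-- The coalgebra `Spf A` of continuous functionals. -/
def spf (A : LinTopAlg.{u}) : CocommCoalg.{u} where
  carrier := A.contDual

theorem dual_mem {A B : LinTopAlg.{u}} (f : B.carrier →ₐ[ℝ] A.carrier)
    (hf : ∀ n, ∃ m, ∀ b ∈ B.ideal m, f b ∈ A.ideal n) (φ : A.contDual) :
    φ.1 ∘ₗ f.toLinearMap ∈ B.contDualSubmodule := by
  obtain ⟨φ, n, hn⟩ := φ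
  obtain ⟨m, hm⟩ := hf n
  exact ⟨m, fun b hb => hn _ (hm b hb)⟩

/-- The morphism of coalgebras which is dual to a continuous algebra map. -/
def dualMap {A B : LinTopAlg.{u}} (f : B.carrier →ₐ[ℝ] A.carrier)
    (hf : ∀ n, ∃ m, ∀ b ∈ B.ideal m, f b ∈ A.ideal n) : A.contDual →ₗc[ℝ] B.contDual where
  toFun φ := ⟨φ.1 ∘ₗ f.toLinearMap, dual_mem f hf φ⟩
  map_add' _ _ := rfl
  map_smul' _ _ := rfl
  counit_comp := by
    ext φ
    exact congrArg φ.1 (map_one f)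
  map_comp_comul := by
    ext φ : 1
    refine ev₂_ext fun a b => ?_
    let F : A.contDual →ₗ[ℝ] B.contDual :=
      { toFun := fun φ => ⟨φ.1 ∘ₗ f.toLinearMap, dual_mem f hf φ⟩
        map_add' := fun _ _ => rfl
        map_smul' := fun _ _ => rfl }
    have l : ∀ z : A.contDual ⊗[ℝ] A.contDual,
        ev₂ a b (TensorProduct.map F F z) = ev₂ (f a) (f b) z := by
      intro z
      induction z with
      | zero => simp
      | add x y hx hy => simp only [map_add, hx, hy]
      | tmul φ ψ => exact (ev₂_tmul _ _ _ _).trans (ev₂_tmul _ _ _ _).symm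
    refine (l (comul φ)).trans ((ev₂_comul φ _ _).trans ?_)
    refine Eq.trans ?_ (ev₂_comul (F φ) a b).symm
    exact congrArg φ.1 (map_mul f a b).symm

section Completion

variable {A : Type u} [CommRing A] [Algebra ℝ A]

theorem finite_quotient_pow {m : Ideal A} (hm : ∀ a, ∃ r : ℝ, a - algebraMap ℝ A r ∈ m) {d : ℕ}
    (ξ : Fin d → A) (hξ : ∀ i, ξ i ∈ m) (h : ∀ a ∈ m, ∃ g : Fin d → A, a = ∑ i, ξ i * g i)
    (n : ℕ) : Module.Finite ℝ (A ⧸ m ^ n) := by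
  have key : ∀ n, ∃ W : Submodule ℝ A, W.FG ∧ ∀ a, ∃ w ∈ W, a - w ∈ m ^ n := by
    intro n
    induction n with
    | zero => exact ⟨⊥, Submodule.fg_bot, fun a => ⟨0, Submodule.zero_mem _, by simp⟩⟩
    | succ n ih =>
      obtain ⟨W, hW, hWa⟩ := ih
      refine ⟨ℝ ∙ (1 : A) ⊔ ⨆ i, W.map (LinearMap.mulLeft ℝ (ξ i)),
        (Submodule.fg_span_singleton _).sup (Submodule.fg_iSup _ fun i => hW.map _), fun a => ?_⟩
      obtain ⟨r, hr⟩ := hm a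
      obtain ⟨g, hg⟩ := h _ hr
      choose w hw hw' using fun i => hWa (g i)
      refine ⟨algebraMap ℝ A r + ∑ i, ξ i * w i, Submodule.add_mem_sup ?_ ?_, ?_⟩
      · rw [Algebra.algebraMap_eq_smul_one]
        exact Submodule.smul_mem _ _ (Submodule.mem_span_singleton_self _)
      · exact Submodule.sum_mem _ fun i _ => Submodule.mem_iSup_of_mem i ⟨w i, hw i, rfl⟩
      · rw [← sub_sub, hg, ← Finset.sum_sub_distrib]
        refine Ideal.sum_mem _ fun i _ => ?_
        rw [← mul_sub, pow_succ']
        exact Ideal.mul_mem_mul (hξ i) (hw' i)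
  obtain ⟨W, hW, hWa⟩ := key n
  have : Module.Finite ℝ W := Module.Finite.iff_fg.2 hW
  refine Module.Finite.of_surjective ((Ideal.Quotient.mkₐ ℝ (m ^ n)).toLinearMap ∘ₗ W.subtype)
    fun q => ?_
  obtain ⟨a, rfl⟩ := Ideal.Quotient.mk_surjective q
  obtain ⟨w, hw, hw'⟩ := hWa a
  exact ⟨⟨w, hw⟩, ((Ideal.Quotient.mk_eq_mk_iff_sub_mem _ _).2 hw').symm⟩

theorem factor_eval {m : Ideal A} {k n : ℕ} (hkn : k ≤ n) (a : AdicCompletion m A) :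
    Ideal.Quotient.factor (Ideal.pow_le_pow_right hkn) (AdicCompletion.evalₐ m n a) =
      AdicCompletion.evalₐ m k a := by
  induction a using AdicCompletion.induction_on with
  | _ x =>
    rw [AdicCompletion.evalₐ_mk, AdicCompletion.evalₐ_mk, Ideal.Quotient.factor_mk]
    exact AdicCompletion.Ideal.mk_eq_mk m hkn x

/-- The projection `Â → A / m ^ n`, as a map of `ℝ`-algebras. -/
def evalR (m : Ideal A) (n : ℕ) : AdicCompletion m A →ₐ[ℝ] A ⧸ m ^ n :=
  (AdicCompletion.evalₐ m n).restrictScalars ℝ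

/-- The `m`-adic completion `Â` of `A` with the topology of the inverse limit of the `A / m ^ n`. -/
def completion (m : Ideal A) (hfin : ∀ n, Module.Finite ℝ (A ⧸ m ^ n)) : LinTopAlg.{u} where
  carrier := AdicCompletion m A
  ideal n := RingHom.ker (evalR m n)
  antitone := fun k n hkn a ha => by
    rw [RingHom.mem_ker] at ha ⊢
    have := factor_eval hkn a
    exact this.symm.trans ((congrArg _ ha).trans (map_zero _))
  finite n :=
    have := hfin n
    Module.Finite.of_injective (Ideal.kerLiftAlg (evalR m n)).toLinearMap
      (Ideal.kerLiftAlg_injective (evalR m n))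

variable {B : Type u} [CommRing B] [Algebra ℝ B]

theorem pow_le_comap {m : Ideal A} {m' : Ideal B} (f : A →ₐ[ℝ] B) (hf : m ≤ m'.comap f) (n : ℕ) :
    m ^ n ≤ (m' ^ n).comap f :=
  (Ideal.pow_right_mono hf n).trans (Ideal.le_comap_pow f n)

theorem completionMap_compat {m : Ideal A} {m' : Ideal B} (f : A →ₐ[ℝ] B) (hf : m ≤ m'.comap f)
    {k n : ℕ} (hkn : k ≤ n) :
    (Ideal.Quotient.factorₐ ℝ (Ideal.pow_le_pow_right (I := m') hkn)).comp
      ((Ideal.quotientMapₐ (m' ^ n) f (pow_le_comap f hf n)).comp (evalR m n)) =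
      (Ideal.quotientMapₐ (m' ^ k) f (pow_le_comap f hf k)).comp (evalR m k) := by
  ext a
  induction a using AdicCompletion.induction_on with
  | _ x =>
    change Ideal.Quotient.factor (Ideal.pow_le_pow_right hkn)
      (Ideal.quotientMapₐ (m' ^ n) f (pow_le_comap f hf n)
      (AdicCompletion.evalₐ m n (AdicCompletion.mk m A x))) =
      Ideal.quotientMapₐ (m' ^ k) f (pow_le_comap f hf k)
        (AdicCompletion.evalₐ m k (AdicCompletion.mk m A x))
    rw [← factor_eval hkn, AdicCompletion.evalₐ_mk, Ideal.Quotient.factor_mk]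
    rfl

/-- The map `Â → B̂` of completions induced by an algebra map `A → B`. -/
def completionMap {m : Ideal A} {m' : Ideal B} (f : A →ₐ[ℝ] B) (hf : m ≤ m'.comap f) :
    AdicCompletion m A →ₐ[ℝ] AdicCompletion m' B :=
  AdicCompletion.liftAlgHom m'
    (fun n => (Ideal.quotientMapₐ (m' ^ n) f (pow_le_comap f hf n)).comp (evalR m n))
    (fun h => completionMap_compat f hf h)

theorem eval_completionMap {m : Ideal A} {m' : Ideal B} (f : A →ₐ[ℝ] B) (hf : m ≤ m'.comap f)
    (n : ℕ) (a : AdicCompletion m A) :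
    AdicCompletion.evalₐ m' n (completionMap f hf a) =
      Ideal.quotientMapₐ (m' ^ n) f (pow_le_comap f hf n) (evalR m n a) :=
  AdicCompletion.evalₐ_liftAlgHom m'
    (fun n => (Ideal.quotientMapₐ (m' ^ n) f (pow_le_comap f hf n)).comp (evalR m n))
    (fun h => completionMap_compat f hf h) n a

end Completion

end LinTopAlg

namespace PtdMfd

/-- The algebra of germs at the base point. -/
abbrev germs (X : PtdMfd.{u}) : Type u := smoothGerm X.I X.pt

/-- The maximal ideal of the algebra of germs at the base point. -/
abbrev maxIdeal (X : PtdMfd.{u}) : Ideal X.germs := germIdeal X.I X.pt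

theorem finite_germs (X : PtdMfd.{u}) (n : ℕ) : Module.Finite ℝ (X.germs ⧸ X.maxIdeal ^ n) := by
  obtain ⟨d, ξ, hξ, h⟩ := germIdeal_fg X.I X.pt
  refine LinTopAlg.finite_quotient_pow (fun a => ⟨germEval X.I X.pt a, ?_⟩) ξ hξ h n
  change germEval X.I X.pt _ = 0
  simp

/-- The coalgebra `Dist(X) = hom^cont(Â_X, ℝ)` of point distributions of a pointed manifold, where
`Â_X` is the completion of the algebra of germs at the base point. -/
def dist (X : PtdMfd.{u}) : CocommCoalg.{u} :=
  (LinTopAlg.completion X.maxIdeal X.finite_germs).spf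

theorem tendsto_pt {X Y : PtdMfd.{u}} (f : X ⟶ Y) :
    Filter.Tendsto f.toFun (𝓝 X.pt) (𝓝 Y.pt) := by
  have := f.contMDiff.continuous.tendsto X.pt
  rwa [f.map_pt] at this

/-- The pull-back of germs along a map of pointed manifolds. -/
def germMap {X Y : PtdMfd.{u}} (f : X ⟶ Y) : Y.germs →ₐ[ℝ] X.germs where
  toFun a := ⟨a.1.compTendsto f.toFun (tendsto_pt f), by
      obtain ⟨a, g, hg, rfl⟩ := a
      exact ⟨g ∘ f.toFun, ((tendsto_pt f).eventually hg).mono fun y hy =>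
        ContMDiffAt.comp y hy f.contMDiff.contMDiffAt, rfl⟩⟩
  map_one' := rfl
  map_zero' := rfl
  map_mul' := fun ⟨a, g, hg, ha⟩ ⟨b, h, hh, hb⟩ => by subst ha hb; rfl
  map_add' := fun ⟨a, g, hg, ha⟩ ⟨b, h, hh, hb⟩ => by subst ha hb; rfl
  commutes' r := by
    refine Subtype.ext ?_
    change Filter.Germ.compTendsto (algebraMap ℝ (Filter.Germ (𝓝 Y.pt) ℝ) r) f.toFun
      (tendsto_pt f) =
      algebraMap ℝ (Filter.Germ (𝓝 X.pt) ℝ) r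
    simp only [algebraMap_germ]
    rfl

theorem germMap_mkGerm {X Y : PtdMfd.{u}} (f : X ⟶ Y) (g : Y.carrier → ℝ) (hg hgf) :
    germMap f (mkGerm Y.I Y.pt g hg) = mkGerm X.I X.pt (g ∘ f.toFun) hgf := rfl

theorem germMap_maxIdeal {X Y : PtdMfd.{u}} (f : X ⟶ Y) :
    Y.maxIdeal ≤ X.maxIdeal.comap (germMap f) := by
  rintro ⟨a, g, hg, rfl⟩ ha
  change g (f.toFun X.pt) = 0
  rw [f.map_pt]
  exact ha

/-- The map `Dist(X) → Dist(Y)` of point distributions induced by a map of pointed manifolds. -/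
def distMap {X Y : PtdMfd.{u}} (f : X ⟶ Y) : X.dist ⟶ Y.dist :=
  CocommCoalg.Hom.mk (C := X.dist) (D := Y.dist)
    (LinTopAlg.dualMap (A := LinTopAlg.completion X.maxIdeal X.finite_germs)
      (B := LinTopAlg.completion Y.maxIdeal Y.finite_germs)
      (LinTopAlg.completionMap (germMap f) (germMap_maxIdeal f)) fun n => ⟨n, fun b hb => by
        refine (LinTopAlg.eval_completionMap (germMap f) (germMap_maxIdeal f) n b).trans ?_
        rw [show LinTopAlg.evalR Y.maxIdeal n b = 0 from hb, map_zero]⟩)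

theorem completionMap_id (X : PtdMfd.{u}) (a : AdicCompletion X.maxIdeal X.germs) :
    LinTopAlg.completionMap (germMap (𝟙 X)) (germMap_maxIdeal (𝟙 X)) a = a := by
  refine AdicCompletion.ext_evalₐ fun n => ?_
  rw [LinTopAlg.eval_completionMap]
  change _ = LinTopAlg.evalR X.maxIdeal n a
  obtain ⟨q, hq⟩ := Ideal.Quotient.mk_surjective (LinTopAlg.evalR X.maxIdeal n a)
  rw [← hq]
  obtain ⟨q, g, hg, rfl⟩ := q
  rfl

theorem completionMap_comp {X Y Z : PtdMfd.{u}} (f : X ⟶ Y) (g : Y ⟶ Z)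
    (a : AdicCompletion Z.maxIdeal Z.germs) :
    LinTopAlg.completionMap (germMap (f ≫ g)) (germMap_maxIdeal (f ≫ g)) a =
      LinTopAlg.completionMap (germMap f) (germMap_maxIdeal f)
        (LinTopAlg.completionMap (germMap g) (germMap_maxIdeal g) a) := by
  refine AdicCompletion.ext_evalₐ fun n => ?_
  rw [LinTopAlg.eval_completionMap, LinTopAlg.eval_completionMap]
  have : LinTopAlg.evalR Y.maxIdeal n
      (LinTopAlg.completionMap (germMap g) (germMap_maxIdeal g) a) = _ :=
    LinTopAlg.eval_completionMap (germMap g) (germMap_maxIdeal g) n a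
  rw [this]
  obtain ⟨q, hq⟩ := Ideal.Quotient.mk_surjective (LinTopAlg.evalR Z.maxIdeal n a)
  rw [← hq]
  obtain ⟨q, h, hh, rfl⟩ := q
  rfl

/-- The functor `Dist` from pointed manifolds to cocommutative coalgebras. -/
def Dist : PtdMfd.{u} ⥤ CocommCoalg.{u} where
  obj X := X.dist
  map f := distMap f
  map_id X := CocommCoalg.hom_ext fun φ => Subtype.ext <| LinearMap.ext fun a =>
    congrArg φ.1 (completionMap_id X a)
  map_comp f g := CocommCoalg.hom_ext fun φ => Subtype.ext <| LinearMap.ext fun a =>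
    congrArg φ.1 (completionMap_comp f g a)

/-- The value `φ(f)` of a point distribution `φ` on a function `f` which is smooth near the
base point. -/
def distValue {X : PtdMfd.{u}} (φ : X.dist.carrier) (f : X.carrier → ℝ)
    (hf : ∀ᶠ y in 𝓝 X.pt, ContMDiffAt X.I 𝓘(ℝ) ∞ f y) : ℝ :=
  (show LinTopAlg.contDual (LinTopAlg.completion X.maxIdeal X.finite_germs) from φ).1
    (AdicCompletion.of X.maxIdeal X.germs (mkGerm X.I X.pt f hf))

end PtdMfd

end

section

open CategoryTheory MonoidalCategory CartesianMonoidalCategory Opposite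
open scoped TensorProduct

section Kan

variable {C : Type u} [Category.{v} C]

/-- The diagram `el(Λ) → C`, `(x ∈ Λ_p) ↦ X_p` of a simplicial object `X`, whose limit is
the object `hom(Λ, X)`, for the horn `Λ = Λ^n_k`. -/
abbrev hornDiagram (X : SimplicialObject C) (n : ℕ) (k : Fin (n + 1)) :
    (SSet.horn.{0} n k : SSet.{0}).Elements ⥤ C :=
  CategoryOfElements.π (SSet.horn.{0} n k : SSet.{0}) ⋙ X

/-- The simplex `[p] → [n]` underlying an element of the horn. -/
def hornElement {n : ℕ} {k : Fin (n + 1)} (e : (SSet.horn.{0} n k : SSet.{0}).Elements) :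
    op (SimplexCategory.mk n) ⟶ e.1 :=
  (SSet.stdSimplex.objEquiv e.2.1).op

/-- The cone `(X_n → X_p)_{x ∈ Λ_p}` of restriction maps. -/
def hornCone (X : SimplicialObject C) (n : ℕ) (k : Fin (n + 1)) :
    Limits.Cone (hornDiagram X n k) where
  pt := X.obj (op (.mk n))
  π :=
    { app := fun e => X.map (hornElement e)
      naturality := fun e e' f => by
        have h : hornElement e' = hornElement e ≫ f.1 :=
          (congrArg (fun x : (SSet.horn.{0} n k : SSet.{0}).obj e'.1 => (SSet.stdSimplex.objEquiv x.1).op) f.2).symm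
        rw [h]
        change 𝟙 _ ≫ X.map (hornElement e ≫ f.1) = X.map (hornElement e) ≫ X.map f.1
        rw [Category.id_comp, X.map_comp] }

/-- The Kan condition with respect to a class `W` of covers: for all `n ≥ 1` and `0 ≤ k ≤ n`, the
limit `hom(Λ^n_k, X)` exists and the restriction map `X_n → hom(Λ^n_k, X)` is a cover. -/
def IsKan (W : MorphismProperty C) (X : SimplicialObject C) : Prop :=
  ∀ n : ℕ, 1 ≤ n → ∀ k : Fin (n + 1), ∃ (L : Limits.Cone (hornDiagram X n k))
    (hL : Limits.IsLimit L), W (hL.lift (hornCone X n k))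

end Kan

/-- Formal smoothness of a homomorphism `φ : R → S`, where `R` has the `I`-adic and `S` has the
`J`-adic topology: for every ring `A` (with the discrete topology), every ideal `K` of `A` with
`K² = 0` and all continuous homomorphisms `a : R → A`, `b : S → A / K` with `b ∘ φ = a mod K` there
is a (continuous) homomorphism `l : S → A` with `l mod K = b` and `l ∘ φ = a`. -/
def IsAdicFormallySmooth {R S : Type u} [CommRing R] [CommRing S] (I : Ideal R) (J : Ideal S)
    (φ : R →+* S) : Prop :=
  ∀ (A : Type u) [CommRing A] (K : Ideal A), K ^ 2 = ⊥ →
    ∀ (a : R →+* A) (b : S →+* A ⧸ K), (∃ n, I ^ n ≤ RingHom.ker a) → (∃ n, J ^ n ≤ RingHom.ker b) →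
      b.comp φ = (Ideal.Quotient.mk K).comp a →
      ∃ l : S →+* A, (∃ n, J ^ n ≤ RingHom.ker l) ∧ (Ideal.Quotient.mk K).comp l = b ∧
        l.comp φ = a

namespace CocommCoalg

/-- The algebra `ℝ[C]` dual to the coalgebra `C`, with the convolution product. -/
abbrev dualAlg (C : CocommCoalg.{u}) : Type u := WithConv (C.carrier →ₗ[ℝ] ℝ)

/-- The homomorphism `f^∨ : ℝ[D] → ℝ[C]` dual to a morphism `f : C → D`. -/
def dualHom {C D : CocommCoalg.{u}} (f : C ⟶ D) : D.dualAlg →+* C.dualAlg where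
  toFun p := WithConv.toConv (p.ofConv ∘ₗ f.toCoalgHom.toLinearMap)
  map_one' := by
    ext c
    exact CoalgHomClass.counit_comp_apply f.toCoalgHom c
  map_mul' p q := by
    rw [LinearMap.convMul_comp_coalgHom_distrib]
  map_zero' := rfl
  map_add' _ _ := rfl

/-- The ideal of `ℝ[C]` of functionals vanishing at the grouplike elements. For a conilpotent
coalgebra `C`, which has only one grouplike element, this is the maximal ideal of `ℝ[C]`. -/
def dualIdeal (C : CocommCoalg.{u}) : Ideal C.dualAlg where
  carrier := {p | ∀ e : C.carrier, IsGroupLikeElem ℝ e → p e = 0}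
  add_mem' {p q} hp hq e he := by
    change p e + q e = 0
    rw [hp e he, hq e he, add_zero]
  zero_mem' _ _ := rfl
  smul_mem' p q hq e he := by
    change (p * q) e = 0
    rw [LinearMap.convMul_apply, he.comul_eq_tmul_self]
    simp [hq e he]

/-- A morphism `f : C → D` is a formal submersion if `f^∨ : ℝ[D] → ℝ[C]` is formally smooth for the
adic topologies. -/
def IsFormalSubmersion : MorphismProperty CocommCoalg.{u} := fun C D f =>
  IsAdicFormallySmooth D.dualIdeal C.dualIdeal (dualHom f)

/-- The filtration `F₀ = ℝe`, `F_{n+1} = Δ⁻¹(F_n ⊗ C + C ⊗ F₀)` of `C` defined by `e`. -/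
def conilFiltration (C : CocommCoalg.{u}) (e : C.carrier) : ℕ → Submodule ℝ C.carrier
  | 0 => Submodule.span ℝ {e}
  | n + 1 => LinearMap.ker
      (TensorProduct.map (conilFiltration C e n).mkQ (Submodule.span ℝ {e}).mkQ ∘ₗ
        Coalgebra.comul (R := ℝ))

/-- A coalgebra is conilpotent if it has a grouplike element `e` whose filtration is
exhaustive, that is, every element is annihilated by an iterate of the reduced comultiplication. -/
def IsConilpotent (C : CocommCoalg.{u}) : Prop :=
  ∃ e : C.carrier, IsGroupLikeElem ℝ e ∧ ∀ c, ∃ n, c ∈ C.conilFiltration e n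

/-- The space of primitive elements with respect to a grouplike element `e`. -/
def primitives (C : CocommCoalg.{u}) (e : C.carrier) : Submodule ℝ C.carrier where
  carrier := {c | Coalgebra.comul (R := ℝ) c = c ⊗ₜ e + e ⊗ₜ c}
  add_mem' {a b} ha hb := by
    rw [Set.mem_ofPred_eq] at *
    rw [map_add, ha, hb, TensorProduct.add_tmul, TensorProduct.tmul_add]
    abel
  zero_mem' := by simp
  smul_mem' r a ha := by
    rw [Set.mem_ofPred_eq] at *
    rw [map_smul, ha, smul_add, TensorProduct.smul_tmul', TensorProduct.tmul_smul]

/-- A coalgebra is of finite type if its spaces of primitive elements are finite-dimensional. -/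
def IsFiniteType (C : CocommCoalg.{u}) : Prop :=
  ∀ e : C.carrier, IsGroupLikeElem ℝ e → Module.Finite ℝ (C.primitives e)

/-- Pointed formal manifolds: conilpotent coalgebras of finite type whose counit is a formal
submersion. -/
def IsFormalManifold : ObjectProperty CocommCoalg.{u} := fun C =>
  C.IsConilpotent ∧ C.IsFiniteType ∧ IsFormalSubmersion C.toUnit

/-- Formal submersions between pointed formal manifolds. -/
def formalCovers : MorphismProperty IsFormalManifold.{u}.FullSubcategory :=
  IsFormalSubmersion.inverseImage IsFormalManifold.ι

/-- Formal `∞`-groups: simplicial objects in pointed formal manifolds which satisfy the Kan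
condition with respect to formal submersions, and which are reduced, that is, the coalgebra
of `0`-simplices is `ℝ`. -/
def IsFormalInftyGroup : ObjectProperty (SimplicialObject CocommCoalg.{u}) := fun X =>
  (∃ h : ∀ p, IsFormalManifold (X.obj p), IsKan formalCovers (IsFormalManifold.lift X h)) ∧
    Function.Bijective (Coalgebra.counit (R := ℝ) (A := (X.obj (op (.mk 0))).carrier))

end CocommCoalg

/-- The category of formal `∞`-groups. -/
abbrev FmlInftyGrp : Type (u + 1) := CocommCoalg.IsFormalInftyGroup.{u}.FullSubcategory

section Functors

/-- Point distributions on group objects in pointed manifolds, with the group structure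
obtained from `Dist(X × Y) ≅ Dist(X) ⊗ Dist(Y)`. -/
def distGrp [Limits.PreservesFiniteProducts PtdMfd.Dist.{u}] : Grp PtdMfd.{u} ⥤ Grp CocommCoalg.{u} :=
  letI : PtdMfd.Dist.{u}.Monoidal := Functor.Monoidal.ofChosenFiniteProducts _
  PtdMfd.Dist.mapGrp

/-- The simplicial group object in pointed manifolds underlying a simplicial Lie group. -/
abbrev simplicialGrp : SimplicialObject LieGrp.{u} ⥤ SimplicialObject (Grp PtdMfd.{u}) :=
  (SimplicialObject.whiskering _ _).obj LieGrp.toGrp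

/-- The simplicial group object `U(𝔤)` in cocommutative coalgebras defined by a simplicial Lie
group with simplicial Lie algebra `𝔤`. -/
abbrev simplicialEnv : SimplicialObject LieGrp.{u} ⥤ SimplicialObject (Grp CocommCoalg.{u}) :=
  (SimplicialObject.whiskering _ _).obj LieGrp.envGrp

/-- The functor `G ↦ Dist(W̄ G)`. -/
def distWbar : SimplicialObject LieGrp.{u} ⥤ SimplicialObject CocommCoalg.{u} :=
  simplicialGrp ⋙ Wbar ⋙ (SimplicialObject.whiskering _ _).obj PtdMfd.Dist

/-- The functor `G ↦ W̄ U(𝔤)`. -/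
def wbarEnv : SimplicialObject LieGrp.{u} ⥤ SimplicialObject CocommCoalg.{u} :=
  simplicialEnv ⋙ Wbar

end Functors

end

end FormalLie

end

open CategoryTheory Opposite
open scoped ContDiff Manifold Topology

noncomputable section

namespace FormalLie

open scoped TensorProduct

/-- A basis of a coalgebra indexed by multi-indices, which multiplies like divided powers:
`Δ e_α = ∑_{β + γ = α} e_β ⊗ e_γ`. -/
structure DPBasis (σ : Type*) [DecidableEq σ] (C : CocommCoalg.{u}) where
  e : Module.Basis (σ →₀ ℕ) ℝ C.carrier
  counit_e : ∀ α, Coalgebra.counit (R := ℝ) (e α) = if α = 0 then 1 else 0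
  comul_e : ∀ α, Coalgebra.comul (R := ℝ) (e α) =
    ∑ p ∈ Finset.HasAntidiagonal.antidiagonal α, e p.1 ⊗ₜ[ℝ] e p.2

namespace CocommCoalg

/-- Every power of the ideal of functionals vanishing at the grouplike elements contains the
annihilator of a finite-dimensional subspace. -/
def IsCofinite (C : CocommCoalg.{u}) : Prop :=
  ∀ n : ℕ, ∃ F : Submodule ℝ C.carrier, Module.Finite ℝ F ∧
    ∀ p : C.dualAlg, (∀ c ∈ F, p c = 0) → p ∈ C.dualIdeal ^ n

theorem unit_dualAlg_eq (r : unit.{u}.dualAlg) :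
    r = algebraMap ℝ unit.{u}.dualAlg (r.ofConv (ULift.up 1 : ULift.{u} ℝ)) := by
  have key : ∀ (f : ULift.{u} ℝ →ₗ[ℝ] ℝ) (x : ULift.{u} ℝ), f x = f (ULift.up 1) * x.down := by
    intro f x
    have hx : x = x.down • (ULift.up 1 : ULift.{u} ℝ) := by ext; simp
    conv_lhs => rw [hx]
    rw [map_smul, smul_eq_mul, mul_comm]
  exact WithConv.ext (LinearMap.ext fun x => key r.ofConv x)

end CocommCoalg

namespace DPBasis

open CocommCoalg

variable {σ : Type*} [DecidableEq σ] {C : CocommCoalg.{u}} (B : DPBasis σ C)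

theorem mul_apply_e (p q : C.dualAlg) (α : σ →₀ ℕ) :
    (p * q) (B.e α) = ∑ i ∈ Finset.HasAntidiagonal.antidiagonal α, p (B.e i.1) * q (B.e i.2) := by
  rw [LinearMap.convMul_apply, B.comul_e, map_sum, map_sum]
  simp

theorem one_apply_e (α : σ →₀ ℕ) : (1 : C.dualAlg) (B.e α) = if α = 0 then 1 else 0 := by
  rw [LinearMap.convOne_apply, B.counit_e]
  rfl

include B in
theorem dual_ext {p q : C.dualAlg} (h : ∀ α, p (B.e α) = q (B.e α)) : p = q :=
  WithConv.ext (B.e.ext h)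

/-- The functional with prescribed values on the basis. -/
def ofCoeff (f : (σ →₀ ℕ) → ℝ) : C.dualAlg := WithConv.toConv (B.e.constr ℝ f)

@[simp]
theorem ofCoeff_e (f : (σ →₀ ℕ) → ℝ) (α : σ →₀ ℕ) : B.ofCoeff f (B.e α) = f α :=
  B.e.constr_basis ℝ f α

/-- The dual basis. -/
def mon (β : σ →₀ ℕ) : C.dualAlg := B.ofCoeff fun α => if α = β then 1 else 0

theorem mon_e (β α : σ →₀ ℕ) : B.mon β (B.e α) = if α = β then 1 else 0 := B.ofCoeff_e _ _

theorem mon_mul_e (β : σ →₀ ℕ) (q : C.dualAlg) (α : σ →₀ ℕ) :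
    (B.mon β * q) (B.e α) = if β ≤ α then q (B.e (α - β)) else 0 := by
  rw [mul_apply_e]
  simp only [mon_e, ite_mul, one_mul, zero_mul]
  split_ifs with h
  · rw [Finset.sum_eq_single (β, α - β)]
    · simp
    · rintro ⟨x, y⟩ hxy hne
      rw [Finset.HasAntidiagonal.mem_antidiagonal] at hxy
      refine if_neg fun hx => hne ?_
      simp only at hx hxy
      subst hx hxy
      simp
    · intro hn
      exact absurd (Finset.HasAntidiagonal.mem_antidiagonal.2 (add_tsub_cancel_of_le h)) hn
  · refine Finset.sum_eq_zero fun x hx => if_neg fun hx' => h ?_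
    rw [Finset.HasAntidiagonal.mem_antidiagonal] at hx
    rw [← hx, ← hx']
    exact le_self_add

theorem mon_zero : B.mon 0 = 1 := B.dual_ext fun α => by rw [mon_e, one_apply_e]

theorem mon_add (β γ : σ →₀ ℕ) : B.mon (β + γ) = B.mon β * B.mon γ := B.dual_ext fun α => by
  rw [mon_mul_e, mon_e, mon_e, ← ite_and]
  congr 1
  refine propext ⟨?_, ?_⟩
  · rintro rfl
    simp
  · rintro ⟨h, h'⟩
    rw [← h', add_tsub_cancel_of_le h]

theorem mon_pow (β : σ →₀ ℕ) (n : ℕ) : B.mon β ^ n = B.mon (n • β) := by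
  induction n with
  | zero => simp [mon_zero]
  | succ n ih => rw [pow_succ, ih, succ_nsmul, mon_add]

theorem mon_eq_prod (β : σ →₀ ℕ) :
    B.mon β = β.prod fun i k => B.mon (Finsupp.single i 1) ^ k := by
  induction β using Finsupp.induction with
  | zero => simp [mon_zero]
  | single_add i k f hi hk ih =>
    rw [mon_add, Finsupp.prod_add_index' (by simp) (by simp [pow_add]), ← ih,
      Finsupp.prod_single_index (by simp), mon_pow]
    simp

theorem isGroupLikeElem_e_zero : IsGroupLikeElem ℝ (B.e 0) where
  counit_eq_one := by simp [B.counit_e]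
  comul_eq_tmul_self := by simp [B.comul_e]

theorem groupLike_mul {g : C.carrier} (hg : IsGroupLikeElem ℝ g) (p q : C.dualAlg) :
    (p * q) g = p g * q g := by
  rw [LinearMap.convMul_apply, hg.comul_eq_tmul_self]
  simp

theorem groupLike_pow {g : C.carrier} (hg : IsGroupLikeElem ℝ g) (p : C.dualAlg) (n : ℕ) :
    (p ^ n) g = p g ^ n := by
  induction n with
  | zero =>
    rw [pow_zero, pow_zero, LinearMap.convOne_apply, hg.counit_eq_one]
    rfl
  | succ n ih => rw [pow_succ, pow_succ, groupLike_mul hg, ih]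

theorem mon_eq_repr (β : σ →₀ ℕ) (c : C.carrier) : B.mon β c = B.e.repr c β := by
  have : (B.mon β).ofConv = B.e.coord β := B.e.ext fun α => by
    refine (B.mon_e β α).trans ?_
    simp [Finsupp.single_apply]
  exact DFunLike.congr_fun this c

theorem ext_mon {c d : C.carrier} (h : ∀ β, B.mon β c = B.mon β d) : c = d := by
  refine B.e.repr.injective (Finsupp.ext fun β => ?_)
  rw [← mon_eq_repr, ← mon_eq_repr, h]

theorem eq_e_zero {g : C.carrier} (hg : IsGroupLikeElem ℝ g) : g = B.e 0 := by
  refine B.ext_mon fun β => ?_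
  by_cases hβ : β = 0
  · subst hβ
    rw [mon_e, if_pos rfl, mon_zero, LinearMap.convOne_apply, hg.counit_eq_one]
    rfl
  · rw [mon_e, if_neg (Ne.symm hβ)]
    by_contra hne
    have hinj : Function.Injective fun n : ℕ => n • β := fun m n h => by
      obtain ⟨i, hi⟩ : ∃ i, β i ≠ 0 := by
        by_contra h0
        push Not at h0
        exact hβ (Finsupp.ext h0)
      have := DFunLike.congr_fun h i
      simpa [hi] using this
    refine Set.infinite_range_of_injective hinj
      ((B.e.repr g).support.finite_toSet.subset ?_)
    rintro _ ⟨n, rfl⟩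
    simp only [Finset.mem_coe, Finsupp.mem_support_iff]
    rw [← mon_eq_repr, ← mon_pow, groupLike_pow hg]
    exact pow_ne_zero n hne

theorem mem_dualIdeal {p : C.dualAlg} : p ∈ C.dualIdeal ↔ p (B.e 0) = 0 :=
  ⟨fun h => h _ B.isGroupLikeElem_e_zero, fun h g hg => by rw [B.eq_e_zero hg, h]⟩

theorem mon_single_mem (i : σ) : B.mon (Finsupp.single i 1) ∈ C.dualIdeal := by
  rw [B.mem_dualIdeal, mon_e, if_neg]
  exact fun h => by simpa using DFunLike.congr_fun h i

section Finite

variable [Fintype σ]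

/-- The multi-indices with all components less than `n`. -/
def box (σ : Type*) [Fintype σ] [DecidableEq σ] (n : ℕ) : Finset (σ →₀ ℕ) :=
  (Fintype.piFinset fun _ : σ => Finset.range n).map Finsupp.equivFunOnFinite.symm.toEmbedding


theorem mem_box {n : ℕ} {α : σ →₀ ℕ} : α ∈ box σ n ↔ ∀ i, α i < n := by
  simp only [box, Finset.mem_map_equiv, Equiv.symm_symm, Fintype.mem_piFinset, Finset.mem_range]
  rfl

theorem mem_pow_of_vanish {n : ℕ} (p : C.dualAlg) (hp : ∀ α ∈ box σ n, p (B.e α) = 0) :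
    p ∈ C.dualIdeal ^ n := by
  classical
  have hex : ∀ α : σ →₀ ℕ, α ∉ box σ n → ∃ i, n ≤ α i := fun α h => by
    rw [mem_box] at h
    push Not at h
    exact h
  let idx : (σ →₀ ℕ) → Option σ := fun α => if h : α ∈ box σ n then none else some (hex α h).choose
  have hidx : ∀ α i, idx α = some i → n ≤ α i := fun α i h => by
    simp only [idx] at h
    split_ifs at h with h'
    rw [Option.some.injEq] at h
    exact h ▸ (hex α h').choose_spec
  let q : σ → C.dualAlg := fun i => B.ofCoeff fun γ =>
    if idx (γ + Finsupp.single i n) = some i then p (B.e (γ + Finsupp.single i n)) else 0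
  have hsum : p = ∑ i, B.mon (Finsupp.single i 1) ^ n * q i := by
    refine B.dual_ext fun α => ?_
    have hs : (∑ i, B.mon (Finsupp.single i 1) ^ n * q i : C.dualAlg) (B.e α) =
        ∑ i, (B.mon (Finsupp.single i 1) ^ n * q i) (B.e α) := by
      have : ∀ s : Finset σ, (∑ i ∈ s, B.mon (Finsupp.single i 1) ^ n * q i : C.dualAlg) (B.e α) =
          ∑ i ∈ s, (B.mon (Finsupp.single i 1) ^ n * q i) (B.e α) := fun s => by
        induction s using Finset.induction with
        | empty => rfl
        | insert a s ha ih =>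
          rw [Finset.sum_insert ha, Finset.sum_insert ha, ← ih]
          rfl
      exact this _
    rw [hs]
    have hterm : ∀ i, (B.mon (Finsupp.single i 1) ^ n * q i) (B.e α) =
        if idx α = some i then p (B.e α) else 0 := by
      intro i
      rw [mon_pow, mon_mul_e, Finsupp.smul_single, smul_eq_mul, mul_one]
      by_cases hle : Finsupp.single i n ≤ α
      · rw [if_pos hle, ofCoeff_e, tsub_add_cancel_of_le hle]
      · rw [if_neg hle, if_neg]
        exact fun h => hle (by simpa using hidx α i h)
    simp only [hterm]
    by_cases h : α ∈ box σ n
    · simp [idx, h, hp α h]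
    · simp [idx, h]
  rw [hsum]
  exact Ideal.sum_mem _ fun i _ =>
    Ideal.mul_mem_right _ _ (Ideal.pow_mem_pow (B.mon_single_mem i) n)

include B in
theorem isCofinite : C.IsCofinite := fun n => by
  refine ⟨Submodule.span ℝ (B.e '' (box σ n : Set (σ →₀ ℕ))), ?_, fun p hp => ?_⟩
  · exact Module.Finite.span_of_finite ℝ ((box σ n).finite_toSet.image _)
  · exact B.mem_pow_of_vanish p fun α hα => hp _ (Submodule.subset_span ⟨α, hα, rfl⟩)

theorem mkQ_eq_zero {V : Type*} [AddCommGroup V] [Module ℝ V] {W : Submodule ℝ V} {x : V}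
    (hx : x ∈ W) : W.mkQ x = 0 :=
  (Submodule.Quotient.mk_eq_zero W).2 hx

theorem e_mem_conilFiltration (α : σ →₀ ℕ) :
    ∀ n, α.degree ≤ n → B.e α ∈ C.conilFiltration (B.e 0) n := by
  suffices h : ∀ n, ∀ α : σ →₀ ℕ, α.degree ≤ n → B.e α ∈ C.conilFiltration (B.e 0) n from
    fun n hn => h n α hn
  intro n
  induction n with
  | zero =>
    intro α hα
    have : α = 0 := (Finsupp.degree_eq_zero_iff α).1 (by omega)
    subst this
    exact Submodule.mem_span_singleton_self _
  | succ n ih =>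
    intro α hα
    rw [conilFiltration, LinearMap.mem_ker, LinearMap.comp_apply, B.comul_e, map_sum]
    refine Finset.sum_eq_zero fun x hx => ?_
    rw [Finset.HasAntidiagonal.mem_antidiagonal] at hx
    rw [TensorProduct.map_tmul]
    by_cases h0 : x.2 = 0
    · rw [h0, mkQ_eq_zero (Submodule.mem_span_singleton_self _), TensorProduct.tmul_zero]
    · have : x.1.degree ≤ n := by
        have h₁ : x.1.degree + x.2.degree = α.degree := by rw [← hx, map_add]
        have h₂ : x.2.degree ≠ 0 := by rwa [ne_eq, Finsupp.degree_eq_zero_iff]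
        omega
      rw [mkQ_eq_zero (ih _ this), TensorProduct.zero_tmul]

omit [Fintype σ] in
theorem conilFiltration_mono (e : C.carrier) (he : IsGroupLikeElem ℝ e) :
    Monotone (C.conilFiltration e) := by
  refine monotone_nat_of_le_succ fun n => ?_
  induction n with
  | zero =>
    refine (Submodule.span_singleton_le_iff_mem _ _).2 ?_
    rw [conilFiltration, LinearMap.mem_ker, LinearMap.comp_apply, he.comul_eq_tmul_self,
      TensorProduct.map_tmul,
      mkQ_eq_zero (Submodule.mem_span_singleton_self _), TensorProduct.tmul_zero]
  | succ n ih =>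
    intro c hc
    rw [conilFiltration, LinearMap.mem_ker, LinearMap.comp_apply] at hc ⊢
    have : (C.conilFiltration e (n + 1)).mkQ =
        Submodule.factor ih ∘ₗ (C.conilFiltration e n).mkQ := rfl
    rw [this, ← LinearMap.rTensor_comp_map, LinearMap.comp_apply, hc, map_zero]

include B in
theorem isConilpotent : C.IsConilpotent := by
  refine ⟨B.e 0, B.isGroupLikeElem_e_zero, fun c => ?_⟩
  induction B.e.mem_span c using Submodule.span_induction with
  | zero => exact ⟨0, Submodule.zero_mem _⟩
  | mem x hx =>
    obtain ⟨α, rfl⟩ := hx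
    exact ⟨_, B.e_mem_conilFiltration α _ le_rfl⟩
  | add x y _ _ hx hy =>
    obtain ⟨m, hm⟩ := hx
    obtain ⟨n, hn⟩ := hy
    have h := conilFiltration_mono _ B.isGroupLikeElem_e_zero
    exact ⟨max m n, Submodule.add_mem _ (h (le_max_left m n) hm) (h (le_max_right m n) hn)⟩
  | smul r x _ hx =>
    obtain ⟨m, hm⟩ := hx
    exact ⟨m, Submodule.smul_mem _ _ hm⟩

include B in
theorem isFiniteType : C.IsFiniteType := by
  intro g hg
  rw [B.eq_e_zero hg]
  have hle : C.primitives (B.e 0) ≤ Submodule.span ℝ (B.e '' (box σ 2 : Set (σ →₀ ℕ))) := by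
    intro c hc
    have hc' : Coalgebra.comul (R := ℝ) c = c ⊗ₜ B.e 0 + B.e 0 ⊗ₜ c := hc
    rw [Module.Basis.mem_span_image]
    intro α hα
    simp only [Finset.mem_coe, Finsupp.mem_support_iff, mem_box] at hα ⊢
    intro i
    by_contra hi
    push Not at hi
    apply hα
    have hle : Finsupp.single i 1 ≤ α := by simp; omega
    rw [← mon_eq_repr, ← add_tsub_cancel_of_le hle, mon_add, LinearMap.convMul_apply, hc']
    have h₁ : B.mon (Finsupp.single i 1) (B.e 0) = 0 := B.mem_dualIdeal.1 (B.mon_single_mem i)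
    have h₂ : B.mon (α - Finsupp.single i 1) (B.e 0) = 0 := by
      rw [mon_e, if_neg]
      intro h
      have := DFunLike.congr_fun h i
      simp at this
      omega
    simp [h₁, h₂]
  have : Module.Finite ℝ (Submodule.span ℝ (B.e '' (box σ 2 : Set (σ →₀ ℕ)))) :=
    Module.Finite.span_of_finite ℝ ((box σ 2).finite_toSet.image _)
  exact Submodule.finiteDimensional_of_le hle

theorem sum_ofCoeff (s : Finset (σ →₀ ℕ)) (p : C.dualAlg) :
    ∀ α ∈ s, p (B.e α) = (∑ β ∈ s, p (B.e β) • B.mon β) (B.e α) := by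
  intro α hα
  have : ∀ s : Finset (σ →₀ ℕ), (∑ β ∈ s, p (B.e β) • B.mon β) (B.e α) =
      ∑ β ∈ s, p (B.e β) * B.mon β (B.e α) := fun s => by
    induction s using Finset.induction with
    | empty => rfl
    | insert a s ha ih =>
      rw [Finset.sum_insert ha, Finset.sum_insert ha, ← ih]
      rfl
  rw [this]
  simp [mon_e, hα]

include B in
theorem isFormalSubmersion_toUnit : IsFormalSubmersion C.toUnit := by
  intro A _ K hK a b _ ⟨n, hn⟩ hab
  obtain ⟨t, ht⟩ : ∃ t : σ → A, ∀ i, Ideal.Quotient.mk K (t i) =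
      b (B.mon (Finsupp.single i 1)) :=
    ⟨fun i => (Ideal.Quotient.mk_surjective (b (B.mon (Finsupp.single i 1)))).choose,
      fun i => (Ideal.Quotient.mk_surjective (b (B.mon (Finsupp.single i 1)))).choose_spec⟩
  let ρ : ℝ →+* A := a.comp (algebraMap ℝ unit.{u}.dualAlg)
  have hρ : ∀ r, Ideal.Quotient.mk K (ρ r) = b (algebraMap ℝ C.dualAlg r) := fun r => by
    refine (DFunLike.congr_fun hab (algebraMap ℝ unit.{u}.dualAlg r)).symm.trans ?_
    refine congrArg b (B.dual_ext fun α => ?_)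
    change r * Coalgebra.counit (R := ℝ) (C.toUnit.toCoalgHom (B.e α)) =
      r * Coalgebra.counit (R := ℝ) (B.e α)
    rw [CoalgHomClass.counit_comp_apply]
  let N := 2 * n
  let T : (σ →₀ ℕ) → A := fun α => α.prod fun i k => t i ^ k
  have hT0 : T 0 = 1 := Finsupp.prod_zero_index
  have hTadd : ∀ α β, T (α + β) = T α * T β := fun α β =>
    Finsupp.prod_add_index' (by simp) (by simp [pow_add])
  have htK : ∀ i, t i ^ n ∈ K := fun i => by
    rw [← Ideal.Quotient.eq_zero_iff_mem, map_pow, ht, ← map_pow]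
    exact hn (Ideal.pow_mem_pow (B.mon_single_mem i) n)
  have htN : ∀ i, t i ^ N = 0 := fun i => by
    have := Ideal.pow_mem_pow (htK i) 2
    rwa [hK, Ideal.mem_bot, ← pow_mul, mul_comm] at this
  have hTbox : ∀ α, α ∉ box σ N → T α = 0 := fun α hα => by
    rw [mem_box] at hα
    push Not at hα
    obtain ⟨i, hi⟩ := hα
    have h : T (Finsupp.single i N) = 0 := (Finsupp.prod_single_index (by simp)).trans (htN i)
    rw [← tsub_add_cancel_of_le (show Finsupp.single i N ≤ α by simpa using hi), hTadd, h, mul_zero]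
  have hbox : ∀ {α β : σ →₀ ℕ}, β ≤ α → α ∈ box σ N → β ∈ box σ N := fun h h' =>
    mem_box.2 fun i => (h i).trans_lt (mem_box.1 h' i)
  have hbT : ∀ α, b (B.mon α) = Ideal.Quotient.mk K (T α) := fun α => by
    rw [mon_eq_prod, map_finsuppProd, map_finsuppProd]
    simp only [map_pow, ht]
  let l : C.dualAlg →+* A :=
    { toFun := fun p => ∑ α ∈ box σ N, ρ (p (B.e α)) * T α
      map_one' := by
        by_cases h0 : (0 : σ →₀ ℕ) ∈ box σ N
        · rw [Finset.sum_eq_single_of_mem 0 h0, one_apply_e, if_pos rfl, map_one, hT0, one_mul]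
          intro α _ hα
          rw [one_apply_e, if_neg hα, map_zero, zero_mul]
        · have h1 : (1 : A) = 0 := hT0.symm.trans (hTbox 0 h0)
          exact (subsingleton_of_zero_eq_one h1.symm).elim _ _
      map_zero' := Finset.sum_eq_zero fun α _ => by
        change ρ 0 * _ = 0
        rw [map_zero, zero_mul]
      map_add' := fun p q => by
        rw [← Finset.sum_add_distrib]
        refine Finset.sum_congr rfl fun α _ => ?_
        rw [← add_mul, ← map_add]
        rfl
      map_mul' := fun p q => by
        rw [Finset.sum_mul_sum, ← Finset.sum_product',
          ← Finset.sum_filter_add_sum_filter_not (box σ N ×ˢ box σ N) (fun x => x.1 + x.2 ∈ box σ N),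
          Finset.sum_eq_zero (s := {x ∈ box σ N ×ˢ box σ N | ¬ x.1 + x.2 ∈ box σ N})
            (fun x hx => ?_), add_zero,
          ← Finset.sum_fiberwise_of_maps_to (s := {x ∈ box σ N ×ˢ box σ N | x.1 + x.2 ∈ box σ N})
            (t := box σ N) (g := fun x => x.1 + x.2) (fun x hx => (Finset.mem_filter.1 hx).2)]
        · refine Finset.sum_congr rfl fun α hα => ?_
          rw [mul_apply_e, map_sum, Finset.sum_mul]
          refine Finset.sum_congr ?_ fun x hx => ?_
          · ext x
            simp only [Finset.HasAntidiagonal.mem_antidiagonal, Finset.mem_filter,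
              Finset.mem_product]
            refine ⟨fun h => ?_, fun h => h.2⟩
            subst h
            exact ⟨⟨⟨hbox le_self_add hα, hbox le_add_self hα⟩, hα⟩, rfl⟩
          · rw [← (Finset.mem_filter.1 hx).2, hTadd, map_mul]
            ring
        · have h := hTbox _ (Finset.mem_filter.1 hx).2
          rw [hTadd] at h
          calc _ = ρ (p (B.e x.1)) * ρ (q (B.e x.2)) * (T x.1 * T x.2) := by ring
            _ = 0 := by rw [h, mul_zero] }
  have hl : ∀ p, l p = ∑ α ∈ box σ N, ρ (p (B.e α)) * T α := fun _ => rfl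
  have hlK : ∀ p, Ideal.Quotient.mk K (l p) = b p := fun p => by
    have h₁ : p - ∑ β ∈ box σ N, p (B.e β) • B.mon β ∈ C.dualIdeal ^ N :=
      B.mem_pow_of_vanish _ fun α hα => sub_eq_zero.2 (B.sum_ofCoeff _ p α hα)
    have h₂ := hn (Ideal.pow_le_pow_right (by omega : n ≤ N) h₁)
    rw [RingHom.mem_ker, map_sub, sub_eq_zero] at h₂
    rw [h₂, hl, map_sum, map_sum]
    refine Finset.sum_congr rfl fun α _ => ?_
    rw [map_mul, hρ, ← hbT, ← map_mul, Algebra.smul_def]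
  refine ⟨l, ⟨N, ?_⟩, RingHom.ext hlK, RingHom.ext fun r => ?_⟩
  · have h₂ : (C.dualIdeal ^ n).map l ≤ K := Ideal.map_le_iff_le_comap.2 fun p hp => by
      rw [Ideal.mem_comap, ← Ideal.Quotient.eq_zero_iff_mem, hlK]
      exact hn hp
    have h₃ : (C.dualIdeal ^ N).map l ≤ ⊥ := by
      rw [← hK, show N = n * 2 from mul_comm 2 n, Ideal.map_pow, pow_mul, ← Ideal.map_pow]
      exact Ideal.pow_right_mono h₂ 2
    intro p hp
    exact h₃ (Ideal.mem_map_of_mem l hp)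
  · have hr := unit_dualAlg_eq r
    have hv : ∀ α, (dualHom C.toUnit r) (B.e α) = if α = 0 then
        r.ofConv (ULift.up 1 : ULift.{u} ℝ) else 0 := fun α => by
      conv_lhs => rw [hr]
      change r.ofConv (ULift.up 1 : ULift.{u} ℝ) * Coalgebra.counit (R := ℝ) (C.toUnit.toCoalgHom (B.e α)) = _
      rw [CoalgHomClass.counit_comp_apply, counit_e, mul_ite, mul_one, mul_zero]
    rw [RingHom.comp_apply, hl]
    conv_rhs => rw [hr]
    by_cases h0 : (0 : σ →₀ ℕ) ∈ box σ N
    · rw [Finset.sum_eq_single_of_mem 0 h0, hv, if_pos rfl, hT0, mul_one]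
      · rfl
      · intro α _ hα
        rw [hv, if_neg hα, map_zero, zero_mul]
    · have h1 : (1 : A) = 0 := hT0.symm.trans (hTbox 0 h0)
      exact (subsingleton_of_zero_eq_one h1.symm).elim _ _

include B in
theorem isFormalManifold : IsFormalManifold C :=
  ⟨B.isConilpotent, B.isFiniteType, B.isFormalSubmersion_toUnit⟩

end Finite

end DPBasis

end FormalLie

end

noncomputable section

namespace FormalLie

open scoped TensorProduct

section EvalLeft

variable {V W A : Type*} [AddCommGroup V] [Module ℝ V] [AddCommGroup W] [Module ℝ W]

/-- The map `V ⊗ A → A`, `v ⊗ a ↦ p(v) a`. -/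
def evalLeft (A : Type*) [AddCommGroup A] [Module ℝ A] (p : V →ₗ[ℝ] ℝ) : V ⊗[ℝ] A →ₗ[ℝ] A :=
  (TensorProduct.lid ℝ A).toLinearMap ∘ₗ p.rTensor A

section Module

variable [AddCommGroup A] [Module ℝ A]

@[simp]
theorem evalLeft_tmul (p : V →ₗ[ℝ] ℝ) (v : V) (a : A) : evalLeft A p (v ⊗ₜ a) = p v • a := rfl

theorem evalLeft_comp (p : W →ₗ[ℝ] ℝ) (f : V →ₗ[ℝ] W) (z : V ⊗[ℝ] A) :
    evalLeft A (p ∘ₗ f) z = evalLeft A p (f.rTensor A z) := by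
  induction z with
  | zero => simp
  | add x y hx hy => simp only [map_add, hx, hy]
  | tmul v a => simp

theorem evalLeft_eq_zero {S : Type*} (P : S → Module.Dual ℝ V)
    (hP : ∀ v, (∀ s, P s v = 0) → v = 0) (z : V ⊗[ℝ] A) (hz : ∀ s, evalLeft A (P s) z = 0) :
    z = 0 := by
  refine tensor_separating P hP (fun t : Module.Dual ℝ A => t)
    (fun a ha => (Module.forall_dual_apply_eq_zero_iff ℝ a).1 ha) z fun s t => ?_
  have : ∀ z, tensorFunctional (P s) t z = t (evalLeft A (P s) z) := fun z => by
    induction z with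
    | zero => simp
    | add x y hx hy => simp only [map_add, hx, hy]
    | tmul v a => simp
  rw [this, hz, map_zero]

theorem evalLeft_ext {S : Type*} (P : S → Module.Dual ℝ V)
    (hP : ∀ v, (∀ s, P s v = 0) → v = 0) {z w : V ⊗[ℝ] A}
    (h : ∀ s, evalLeft A (P s) z = evalLeft A (P s) w) : z = w := by
  rw [← sub_eq_zero]
  exact evalLeft_eq_zero P hP _ fun s => by rw [map_sub, h, sub_self]

theorem dual_separating (v : V) (h : ∀ p : Module.Dual ℝ V, p v = 0) : v = 0 :=
  (Module.forall_dual_apply_eq_zero_iff ℝ v).1 h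

theorem tensor_dual_separating (z : V ⊗[ℝ] W)
    (h : ∀ p : Module.Dual ℝ V × Module.Dual ℝ W, tensorFunctional p.1 p.2 z = 0) : z = 0 :=
  tensor_separating (fun p => p) dual_separating (fun q => q) dual_separating z
    fun p q => h (p, q)

end Module

variable [CommRing A] [Algebra ℝ A]

/-- The product `(v ⊗ a, w ⊗ b) ↦ (v ⊗ w) ⊗ ab`. -/
def mulRight (z : V ⊗[ℝ] A) (w : W ⊗[ℝ] A) : (V ⊗[ℝ] W) ⊗[ℝ] A :=
  (LinearMap.mul' ℝ A).lTensor (V ⊗[ℝ] W)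
    (TensorProduct.tensorTensorTensorComm ℝ V A W A (z ⊗ₜ w))

theorem evalLeft_mulRight (p : V →ₗ[ℝ] ℝ) (q : W →ₗ[ℝ] ℝ) (z : V ⊗[ℝ] A) (w : W ⊗[ℝ] A) :
    evalLeft A (tensorFunctional p q) (mulRight z w) = evalLeft A p z * evalLeft A q w := by
  unfold mulRight
  induction z with
  | zero => simp
  | add x y hx hy => simp only [map_add, TensorProduct.add_tmul, add_mul, hx, hy]
  | tmul v a =>
    induction w with
    | zero => simp
    | add x y hx hy => simp only [map_add, TensorProduct.tmul_add, mul_add, hx, hy]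
    | tmul w b => simp [smul_smul, mul_comm]

theorem evalLeft_map {A' : Type*} [CommRing A'] [Algebra ℝ A'] (f : A →ₐ[ℝ] A') (p : V →ₗ[ℝ] ℝ)
    (z : V ⊗[ℝ] A) : evalLeft A' p (f.toLinearMap.lTensor V z) = f (evalLeft A p z) := by
  induction z with
  | zero => simp
  | add x y hx hy => simp only [map_add, hx, hy]
  | tmul v a => simp

end EvalLeft

namespace CocommCoalg

variable {C D : CocommCoalg.{u}} {A : Type*} [CommRing A] [Algebra ℝ A]

/-- Functionals on `C` with values in `A` which are evaluations at an element of `C ⊗ A`. -/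
def IsRep (θ : C.dualAlg → A) : Prop :=
  ∃ γ : C.carrier ⊗[ℝ] A, ∀ p, θ p = evalLeft A p.ofConv γ

theorem IsCofinite.isRep (hC : C.IsCofinite) (a : C.dualAlg →ₐ[ℝ] A)
    (ha : ∃ n, ∀ p ∈ C.dualIdeal ^ n, a p = 0) : IsRep a := by
  obtain ⟨n, hn⟩ := ha
  obtain ⟨F, hF, h⟩ := hC n
  let b := Module.finBasis ℝ F
  choose p hp using fun i => LinearMap.exists_extend (b.coord i)
  refine ⟨∑ i, (b i : C.carrier) ⊗ₜ a (WithConv.toConv (p i)), fun q => ?_⟩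
  rw [map_sum]
  simp only [evalLeft_tmul]
  rw [← sub_eq_zero]
  simp_rw [← map_smul, ← map_sum, ← map_sub]
  refine hn _ (h _ fun c hc => ?_)
  have hs : ∀ s : Finset (Fin (Module.finrank ℝ F)),
      (∑ i ∈ s, q.ofConv (b i) • WithConv.toConv (p i) : C.dualAlg) c =
        ∑ i ∈ s, q.ofConv (b i) * p i c := fun s => by
    induction s using Finset.induction with
    | empty => rfl
    | insert a s ha ih =>
      rw [Finset.sum_insert ha, Finset.sum_insert ha, ← ih]
      rfl
  refine sub_eq_zero.2 (Eq.trans ?_ (hs _).symm)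
  have hpc : ∀ i, p i c = b.repr ⟨c, hc⟩ i := fun i => DFunLike.congr_fun (hp i) ⟨c, hc⟩
  simp only [hpc]
  have hb := congrArg (fun x : F => q.ofConv (x : C.carrier)) (b.sum_repr ⟨c, hc⟩)
  simp only [Submodule.coe_sum, map_sum, Submodule.coe_smul, map_smul, smul_eq_mul] at hb
  exact hb.symm.trans (Finset.sum_congr rfl fun i _ => mul_comm _ _)

theorem IsRep.comp_dualHom {θ : C.dualAlg → A} (hθ : IsRep θ) (f : C ⟶ D) :
    IsRep fun p => θ (dualHom f p) := by
  obtain ⟨γ, hγ⟩ := hθ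
  exact ⟨f.toCoalgHom.toLinearMap.rTensor A γ, fun p =>
    (hγ _).trans (evalLeft_comp p.ofConv f.toCoalgHom.toLinearMap γ)⟩

theorem IsRep.map {A' : Type*} [CommRing A'] [Algebra ℝ A'] {θ : C.dualAlg → A} (hθ : IsRep θ)
    (f : A →ₐ[ℝ] A') : IsRep fun p => f (θ p) := by
  obtain ⟨γ, hγ⟩ := hθ
  exact ⟨f.toLinearMap.lTensor _ γ, fun p =>
    (congrArg f (hγ p)).trans (evalLeft_map f _ γ).symm⟩

/-- The functional `p ⊗ q` on a tensor product of coalgebras. -/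
def tensorDual (p : C.dualAlg) (q : D.dualAlg) : (prod C D).dualAlg :=
  WithConv.toConv (tensorFunctional p.ofConv q.ofConv)

theorem isRep_ext {θ θ' : (prod C D).dualAlg → A} (hθ : IsRep θ) (hθ' : IsRep θ')
    (h : ∀ p q, θ (tensorDual p q) = θ' (tensorDual p q)) (p : (prod C D).dualAlg) :
    θ p = θ' p := by
  obtain ⟨γ, hγ⟩ := hθ
  obtain ⟨γ', hγ'⟩ := hθ'
  rw [hγ, hγ']
  congr 1
  refine evalLeft_ext _ tensor_dual_separating fun s => ?_
  have := h (WithConv.toConv s.1) (WithConv.toConv s.2)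
  rwa [hγ, hγ'] at this

theorem tensorDual_mul (p p' : C.dualAlg) (q q' : D.dualAlg) :
    tensorDual p q * tensorDual p' q' = tensorDual (p * p') (q * q') := by
  have h := TensorProduct.map_convMul_map (R := ℝ) (f := p) (h := p') (g := q) (k := q')
  have h' := LinearMap.algHom_comp_convMul_distrib (Algebra.TensorProduct.lmul' ℝ (S := ℝ))
    (WithConv.toConv (TensorProduct.map p.ofConv q.ofConv))
    (WithConv.toConv (TensorProduct.map p'.ofConv q'.ofConv))
  rw [h] at h'
  exact WithConv.ext h'.symm

theorem tensorDual_one : tensorDual (1 : C.dualAlg) (1 : D.dualAlg) = 1 := by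
  refine WithConv.ext (TensorProduct.ext' fun c d => ?_)
  change Coalgebra.counit (R := ℝ) c * Coalgebra.counit (R := ℝ) d =
    Coalgebra.counit (R := ℝ) d * Coalgebra.counit (R := ℝ) c
  exact mul_comm _ _

/-- Two algebra maps `C^∨ → A`, `D^∨ → A` define a map `(C ⊗ D)^∨ → A`. -/
theorem exists_pairing {a : C.dualAlg →ₐ[ℝ] A} {b : D.dualAlg →ₐ[ℝ] A} (ha : IsRep a)
    (hb : IsRep b) : ∃ c : (prod C D).dualAlg →ₐ[ℝ] A, IsRep c ∧
      ∀ p q, c (tensorDual p q) = a p * b q := by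
  obtain ⟨γ, hγ⟩ := ha
  obtain ⟨δ, hδ⟩ := hb
  let z : (C.carrier ⊗[ℝ] D.carrier) ⊗[ℝ] A := mulRight γ δ
  let θ : (prod C D).dualAlg → A := fun p => evalLeft A p.ofConv z
  have hθ : ∀ p q, θ (tensorDual p q) = a p * b q := fun p q =>
    (evalLeft_mulRight p.ofConv q.ofConv γ δ).trans (by rw [hγ, hδ])
  have hmul : (Coalgebra.comul (R := ℝ) (A := (prod C D).carrier)).rTensor A z = mulRight z z := by
    refine evalLeft_ext (fun s : ((Module.Dual ℝ C.carrier × Module.Dual ℝ D.carrier) ×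
      (Module.Dual ℝ C.carrier × Module.Dual ℝ D.carrier)) =>
      tensorFunctional (tensorFunctional s.1.1 s.1.2) (tensorFunctional s.2.1 s.2.2))
      (fun v hv => tensor_separating _ tensor_dual_separating _ tensor_dual_separating v
        fun s t => hv (s, t)) fun s => ?_
    rw [evalLeft_mulRight]
    let p := WithConv.toConv s.1.1
    let q := WithConv.toConv s.1.2
    let p' := WithConv.toConv s.2.1
    let q' := WithConv.toConv s.2.2
    refine (evalLeft_comp _ _ z).symm.trans ?_
    change θ (tensorDual p q * tensorDual p' q') = θ (tensorDual p q) * θ (tensorDual p' q')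
    rw [tensorDual_mul, hθ, hθ, hθ, map_mul, map_mul]
    ring
  let c : (prod C D).dualAlg →ₐ[ℝ] A := AlgHom.ofLinearMap
    { toFun := θ
      map_add' := fun p q => by
        change evalLeft A (p.ofConv + q.ofConv) z = _
        simp only [evalLeft, LinearMap.rTensor_add, LinearMap.comp_add]
        rfl
      map_smul' := fun r p => by
        change evalLeft A (r • p.ofConv) z = _
        simp only [evalLeft, LinearMap.rTensor_smul, LinearMap.comp_smul]
        rfl }
    (by
      change θ 1 = 1
      rw [← tensorDual_one, hθ, map_one, map_one, one_mul])
    (fun p q => by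
      change evalLeft A (tensorFunctional p.ofConv q.ofConv ∘ₗ
        Coalgebra.comul (R := ℝ) (A := (prod C D).carrier)) z = _
      refine (evalLeft_comp _ _ z).trans ((congrArg _ hmul).trans ?_)
      exact evalLeft_mulRight _ _ _ _)
  exact ⟨c, ⟨z, fun _ => rfl⟩, hθ⟩

/-- The pointed formal manifolds among the coalgebras with a single grouplike element for which
the continuous functionals are determined on finite-dimensional subspaces. -/
structure IsNice (C : CocommCoalg.{u}) : Prop where
  isFormalManifold : IsFormalManifold C
  isCofinite : C.IsCofinite
  groupLike_unique : ∀ g h : C.carrier, IsGroupLikeElem ℝ g → IsGroupLikeElem ℝ h → g = h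

theorem IsNice.sub_mem (hC : C.IsNice) {e : C.carrier} (he : IsGroupLikeElem ℝ e) (p : C.dualAlg) :
    p - algebraMap ℝ _ (p e) ∈ C.dualIdeal := by
  intro g hg
  rw [hC.groupLike_unique g e hg he]
  change p.ofConv e - p.ofConv e * Coalgebra.counit (R := ℝ) e = 0
  rw [he.counit_eq_one, mul_one, sub_self]

theorem pairing_continuous (hC : C.IsNice) (hD : D.IsNice) {a : C.dualAlg →ₐ[ℝ] A}
    {b : D.dualAlg →ₐ[ℝ] A} {m n : ℕ} (ha : ∀ p ∈ C.dualIdeal ^ m, a p = 0)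
    (hb : ∀ p ∈ D.dualIdeal ^ n, b p = 0) {c : (prod C D).dualAlg →ₐ[ℝ] A} (hc : IsRep c)
    (h : ∀ p q, c (tensorDual p q) = a p * b q) :
    ∀ p ∈ (prod C D).dualIdeal ^ (m + n), c p = 0 := by
  obtain ⟨e, he, -⟩ := hC.isFormalManifold.1
  obtain ⟨e', he', -⟩ := hD.isFormalManifold.1
  let I : Ideal A := C.dualIdeal.map a ⊔ D.dualIdeal.map b
  have hI : I ^ (m + n) ≤ ⊥ := by
    refine Ideal.sup_pow_add_le_pow_sup_pow.trans (sup_le ?_ ?_)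
    · rw [← Ideal.map_pow]
      exact Ideal.map_le_iff_le_comap.2 ha
    · rw [← Ideal.map_pow]
      exact Ideal.map_le_iff_le_comap.2 hb
  let g : (prod C D).carrier := (e ⊗ₜ[ℝ] e' : C.carrier ⊗[ℝ] D.carrier)
  have hg : IsGroupLikeElem ℝ g :=
    { counit_eq_one := by
        change Coalgebra.counit (R := ℝ) e' * Coalgebra.counit (R := ℝ) e = 1
        rw [he.counit_eq_one, he'.counit_eq_one, one_mul]
      comul_eq_tmul_self := by
        change TensorProduct.AlgebraTensorModule.tensorTensorTensorComm ℝ ℝ ℝ ℝ _ _ _ _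
          (Coalgebra.comul (R := ℝ) e ⊗ₜ[ℝ] Coalgebra.comul (R := ℝ) e') = _
        rw [he.comul_eq_tmul_self, he'.comul_eq_tmul_self]
        rfl }
  have key : ∀ p : (prod C D).dualAlg, Ideal.Quotient.mkₐ ℝ I (c p) = algebraMap ℝ _ (p.ofConv g) := by
    refine isRep_ext (hc.map (Ideal.Quotient.mkₐ ℝ I)) ⟨g ⊗ₜ[ℝ] 1, fun p => ?_⟩ fun p q => ?_
    · exact (Algebra.algebraMap_eq_smul_one _).trans (evalLeft_tmul _ _ _).symm
    · have h₁ : Ideal.Quotient.mkₐ ℝ I (a p) = algebraMap ℝ _ (p e) := by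
        rw [← sub_eq_zero, ← AlgHom.commutes (Ideal.Quotient.mkₐ ℝ I), ← AlgHom.commutes a,
          ← map_sub, ← map_sub]
        exact Ideal.Quotient.eq_zero_iff_mem.2
          (Ideal.mem_sup_left (Ideal.mem_map_of_mem a (hC.sub_mem he p)))
      have h₂ : Ideal.Quotient.mkₐ ℝ I (b q) = algebraMap ℝ _ (q e') := by
        rw [← sub_eq_zero, ← AlgHom.commutes (Ideal.Quotient.mkₐ ℝ I), ← AlgHom.commutes b,
          ← map_sub, ← map_sub]
        exact Ideal.Quotient.eq_zero_iff_mem.2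
          (Ideal.mem_sup_right (Ideal.mem_map_of_mem b (hD.sub_mem he' q)))
      rw [h, map_mul, h₁, h₂, ← map_mul]
      exact congrArg _ (tensorFunctional_tmul p.ofConv q.ofConv e e').symm
  have hle : (prod C D).dualIdeal.map c ≤ I := Ideal.map_le_iff_le_comap.2 fun p hp => by
    have := key p
    rw [show p.ofConv g = 0 from hp g hg, map_zero] at this
    exact Ideal.Quotient.eq_zero_iff_mem (I := I).1 this
  intro p hp
  have := Ideal.mem_map_of_mem c hp
  rw [Ideal.map_pow] at this
  exact hI (Ideal.pow_right_mono hle _ this)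

theorem dualHom_comp {C D K : CocommCoalg.{u}} (f : C ⟶ D) (g : D ⟶ K) (p : K.dualAlg) :
    dualHom (f ≫ g) p = dualHom f (dualHom g p) := rfl

theorem dualHom_mem_pow (f : C ⟶ D) {n : ℕ} {p : D.dualAlg} (hp : p ∈ D.dualIdeal ^ n) :
    dualHom f p ∈ C.dualIdeal ^ n := by
  have h : D.dualIdeal ≤ C.dualIdeal.comap (dualHom f) := fun p hp g hg =>
    hp _ (hg.map f.toCoalgHom)
  exact Ideal.le_comap_pow _ _ (Ideal.pow_right_mono h n hp)

theorem isFormalSubmersion_of_transport {X L : CocommCoalg.{u}} (hX : X.IsNice) (hL : L.IsNice)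
    (r : X ⟶ L) (t : prod L X ⟶ X) (h₁ : t ≫ r = fst L X) (h₂ : pair r (𝟙 X) ≫ t = 𝟙 X) :
    IsFormalSubmersion r := by
  intro A _ K hK a b ⟨m, hm⟩ ⟨n, hn⟩ hab
  obtain ⟨u, ⟨k, hk⟩, hub, hua⟩ := hX.isFormalManifold.2.2 A K hK
    (a.comp (dualHom L.toUnit)) b
    ⟨m, fun p hp => hm (dualHom_mem_pow L.toUnit hp)⟩ ⟨n, hn⟩ (by
      rw [← RingHom.comp_assoc, ← hab]
      refine RingHom.ext fun p => congrArg b ?_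
      change dualHom X.toUnit p = dualHom (r ≫ L.toUnit) p
      refine congrArg (fun f => dualHom f p) ?_
      exact hom_ext (f := X.toUnit) (g := r ≫ L.toUnit) fun x =>
        ULift.ext _ _ (CoalgHomClass.counit_comp_apply r.toCoalgHom x).symm)
  let _ : Algebra ℝ A := (a.comp (algebraMap ℝ L.dualAlg)).toAlgebra
  let a' : L.dualAlg →ₐ[ℝ] A := { a with commutes' := fun _ => rfl }
  have hr : ∀ s : ℝ, dualHom r (algebraMap ℝ _ s) = algebraMap ℝ _ s := fun s => by
    refine WithConv.ext (LinearMap.ext fun x => ?_)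
    change s * Coalgebra.counit (R := ℝ) (r.toCoalgHom x) = s * Coalgebra.counit (R := ℝ) x
    rw [CoalgHomClass.counit_comp_apply]
  let b' : X.dualAlg →ₐ[ℝ] A ⧸ K := { b with
    commutes' := fun s => by
      change b _ = Ideal.Quotient.mk K (a _)
      rw [← hr]
      exact DFunLike.congr_fun hab (algebraMap ℝ _ s) }
  let u' : X.dualAlg →ₐ[ℝ] A := { u with
    commutes' := fun s => by
      have hs : algebraMap ℝ X.dualAlg s = dualHom X.toUnit (algebraMap ℝ _ s) := by
        refine WithConv.ext (LinearMap.ext fun x => ?_)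
        change s * Coalgebra.counit (R := ℝ) x =
          s * Coalgebra.counit (R := ℝ) (X.toUnit.toCoalgHom x)
        rw [CoalgHomClass.counit_comp_apply]
      have hs' : dualHom L.toUnit (algebraMap ℝ _ s) = algebraMap ℝ L.dualAlg s := by
        refine WithConv.ext (LinearMap.ext fun x => ?_)
        change s * Coalgebra.counit (R := ℝ) (L.toUnit.toCoalgHom x) =
          s * Coalgebra.counit (R := ℝ) x
        rw [CoalgHomClass.counit_comp_apply]
      change u _ = a _
      rw [hs, ← hs']
      exact DFunLike.congr_fun hua (algebraMap ℝ _ s) }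
  have ra : IsRep a' := hL.isCofinite.isRep a' ⟨m, fun p hp => hm hp⟩
  have ru : IsRep u' := hX.isCofinite.isRep u' ⟨k, fun p hp => hk hp⟩
  have rb : IsRep b' := hX.isCofinite.isRep b' ⟨n, fun p hp => hn hp⟩
  obtain ⟨c, hc, hc'⟩ := exists_pairing ra ru
  have hcont := pairing_continuous hL hX (a := a') (b := u') (m := m) (n := k)
    (fun p hp => hm hp) (fun p hp => hk hp) hc hc'
  have hmk : ∀ p, Ideal.Quotient.mkₐ ℝ K (c p) = b' (dualHom (pair r (𝟙 X)) p) := by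
    refine isRep_ext (hc.map _) (rb.comp_dualHom _) fun p q => ?_
    rw [hc', map_mul]
    have e₁ : Ideal.Quotient.mkₐ ℝ K (a' p) = b' (dualHom r p) := (DFunLike.congr_fun hab p).symm
    have e₂ : Ideal.Quotient.mkₐ ℝ K (u' q) = b' q := DFunLike.congr_fun hub q
    rw [e₁, e₂, ← map_mul]
    refine congrArg b' (WithConv.ext (LinearMap.ext fun x => ?_))
    change LinearMap.mul' ℝ ℝ (TensorProduct.map (p.ofConv ∘ₗ r.toCoalgHom.toLinearMap) q.ofConv
      (Coalgebra.comul (R := ℝ) x)) = LinearMap.mul' ℝ ℝ (TensorProduct.map p.ofConv q.ofConv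
        (TensorProduct.map r.toCoalgHom.toLinearMap LinearMap.id (Coalgebra.comul (R := ℝ) x)))
    rw [← LinearMap.comp_apply (TensorProduct.map p.ofConv q.ofConv), ← TensorProduct.map_comp]
    rfl
  refine ⟨c.toRingHom.comp (dualHom t), ⟨m + k, fun p hp => hcont _ (dualHom_mem_pow t hp)⟩,
    RingHom.ext fun p => ?_, RingHom.ext fun p => ?_⟩
  · refine (hmk (dualHom t p)).trans ?_
    rw [← dualHom_comp, h₂]
    rfl
  · change c (dualHom t (dualHom r p)) = a p
    rw [← dualHom_comp, h₁]
    have : dualHom (fst L X) p = tensorDual p 1 := by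
      refine WithConv.ext (TensorProduct.ext' fun x y => ?_)
      change p.ofConv (Coalgebra.counit (R := ℝ) y • x) = p.ofConv x * Coalgebra.counit (R := ℝ) y
      rw [map_smul, smul_eq_mul, mul_comm]
    rw [this, hc', map_one, mul_one]
    rfl

end CocommCoalg

end FormalLie

end

noncomputable section

namespace FormalLie

open scoped TensorProduct
open MonoidalCategory CartesianMonoidalCategory

section Splitting

variable {V C : Type*} [AddCommGroup V] [Module ℝ V] [AddCommGroup C] [Module ℝ C]
  [Coalgebra ℝ C] (i : V →ₗ[ℝ] C) (r : C →ₗ[ℝ] V)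

/-- The comultiplication of a retract of a coalgebra. -/
def retractComul : V →ₗ[ℝ] V ⊗[ℝ] V := TensorProduct.map r r ∘ₗ Coalgebra.comul ∘ₗ i

variable {i r} (hri : ∀ v, r (i v) = v)
  (he : ∀ c, TensorProduct.map (i ∘ₗ r) (i ∘ₗ r) (Coalgebra.comul (R := ℝ) c) =
    Coalgebra.comul (R := ℝ) (i (r c)))

include hri he

theorem map_retractComul (v : V) :
    TensorProduct.map i i (retractComul i r v) = Coalgebra.comul (R := ℝ) (i v) := by
  have := he (i v)
  rw [hri, TensorProduct.map_comp] at this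
  exact this

/-- A retract of a coalgebra by an idempotent morphism of coalgebras is a coalgebra. -/
abbrev retractCoalgebra : Coalgebra ℝ V where
  comul := retractComul i r
  counit := Coalgebra.counit ∘ₗ i
  coassoc := by
    ext v
    have hinj : Function.Injective (TensorProduct.map i (TensorProduct.map i i)) := by
      refine Function.LeftInverse.injective (g := TensorProduct.map r (TensorProduct.map r r)) ?_
      intro z
      rw [← LinearMap.comp_apply, ← TensorProduct.map_comp, ← TensorProduct.map_comp,
        show r ∘ₗ i = LinearMap.id from LinearMap.ext hri]
      simp
    apply hinj
    have l : ∀ z : V ⊗[ℝ] V, TensorProduct.map i (TensorProduct.map i i)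
        (TensorProduct.assoc ℝ V V V ((retractComul i r).rTensor V z)) =
        TensorProduct.assoc ℝ C C C ((Coalgebra.comul (R := ℝ)).rTensor C
          (TensorProduct.map i i z)) := by
      intro z
      induction z with
      | zero => simp
      | add x y hx hy => simp only [map_add, hx, hy]
      | tmul x y =>
        rw [LinearMap.rTensor_tmul, TensorProduct.map_tmul, LinearMap.rTensor_tmul,
          ← map_retractComul hri he]
        induction retractComul i r x with
        | zero => simp
        | add x y hx hy => simp only [map_add, TensorProduct.add_tmul, hx, hy]
        | tmul a b => simp
    have l' : ∀ z : V ⊗[ℝ] V, TensorProduct.map i (TensorProduct.map i i)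
        ((retractComul i r).lTensor V z) =
        (Coalgebra.comul (R := ℝ)).lTensor C (TensorProduct.map i i z) := by
      intro z
      induction z with
      | zero => simp
      | add x y hx hy => simp only [map_add, hx, hy]
      | tmul x y =>
        rw [LinearMap.lTensor_tmul, TensorProduct.map_tmul, TensorProduct.map_tmul,
          LinearMap.lTensor_tmul, map_retractComul hri he]
    simp only [LinearMap.comp_apply, LinearEquiv.coe_coe]
    rw [l, l', map_retractComul hri he, Coalgebra.coassoc_apply]
  rTensor_counit_comp_comul := by
    ext v
    have l : ∀ z : V ⊗[ℝ] V, ((Coalgebra.counit (R := ℝ)) ∘ₗ i).rTensor V z =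
        r.lTensor ℝ ((Coalgebra.counit (R := ℝ)).rTensor C (TensorProduct.map i i z)) := by
      intro z
      induction z with
      | zero => simp
      | add x y hx hy => simp only [map_add, hx, hy]
      | tmul x y => simp [hri]
    rw [LinearMap.comp_apply, l, map_retractComul hri he, Coalgebra.rTensor_counit_comul]
    simp [hri]
  lTensor_counit_comp_comul := by
    ext v
    have l : ∀ z : V ⊗[ℝ] V, ((Coalgebra.counit (R := ℝ)) ∘ₗ i).lTensor V z =
        r.rTensor ℝ ((Coalgebra.counit (R := ℝ)).lTensor C (TensorProduct.map i i z)) := by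
      intro z
      induction z with
      | zero => simp
      | add x y hx hy => simp only [map_add, hx, hy]
      | tmul x y => simp [hri]
    rw [LinearMap.comp_apply, l, map_retractComul hri he, Coalgebra.lTensor_counit_comul]
    simp [hri]

theorem retract_isCocomm [Coalgebra.IsCocomm ℝ C] :
    @Coalgebra.IsCocomm ℝ V _ _ _ (retractCoalgebra hri he) :=
  letI := retractCoalgebra hri he
  { comm_comp_comul := by
      ext v
      have hinj : Function.Injective (TensorProduct.map i i) := by
        refine Function.LeftInverse.injective (g := TensorProduct.map r r) ?_
        intro z
        rw [← LinearMap.comp_apply, ← TensorProduct.map_comp,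
          show r ∘ₗ i = LinearMap.id from LinearMap.ext hri]
        simp
      apply hinj
      change TensorProduct.map i i (TensorProduct.comm ℝ V V (retractComul i r v)) =
        TensorProduct.map i i (retractComul i r v)
      rw [TensorProduct.map_comm, map_retractComul hri he, Coalgebra.comm_comul] }

end Splitting

namespace CocommCoalg

/-- Idempotents of coalgebras split. -/
theorem exists_splitting {X : CocommCoalg.{u}} (e : X ⟶ X) (he : e ≫ e = e) :
    ∃ (L : CocommCoalg.{u}) (i : L ⟶ X) (r : X ⟶ L), i ≫ r = 𝟙 L ∧ r ≫ i = e := by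
  let f : X.carrier →ₗ[ℝ] X.carrier := e.toCoalgHom.toLinearMap
  have hf : ∀ x, f (f x) = f x := fun x => congrArg (fun g => g.toCoalgHom x) he
  let V := LinearMap.range f
  let i : V →ₗ[ℝ] X.carrier := V.subtype
  let r : X.carrier →ₗ[ℝ] V := f.rangeRestrict
  have hri : ∀ v, r (i v) = v := by
    rintro ⟨_, x, rfl⟩
    exact Subtype.ext (hf x)
  have hir : i ∘ₗ r = f := rfl
  have hc : ∀ c, TensorProduct.map (i ∘ₗ r) (i ∘ₗ r) (Coalgebra.comul (R := ℝ) c) =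
      Coalgebra.comul (R := ℝ) (i (r c)) := fun c => CoalgHomClass.map_comp_comul_apply e.toCoalgHom c
  let cV : Coalgebra ℝ V := retractCoalgebra hri hc
  have ccV : Coalgebra.IsCocomm ℝ V := retract_isCocomm hri hc
  let L : CocommCoalg.{u} := { carrier := V }
  let i' : L ⟶ X := Hom.mk (C := L) (D := X)
    { toLinearMap := i
      counit_comp := rfl
      map_comp_comul := LinearMap.ext fun v => map_retractComul hri hc v }
  let r' : X ⟶ L := Hom.mk (C := X) (D := L)
    { toLinearMap := r
      counit_comp := LinearMap.ext fun x => CoalgHomClass.counit_comp_apply e.toCoalgHom x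
      map_comp_comul := LinearMap.ext fun x => by
        change TensorProduct.map r r (Coalgebra.comul (R := ℝ) x) =
          TensorProduct.map r r (Coalgebra.comul (R := ℝ) (i (r x)))
        have key : TensorProduct.map r r ∘ₗ TensorProduct.map (i ∘ₗ r) (i ∘ₗ r) =
            TensorProduct.map r r := by
          rw [← TensorProduct.map_comp, ← LinearMap.comp_assoc,
            show r ∘ₗ i = LinearMap.id from LinearMap.ext hri, LinearMap.id_comp]
        rw [← hc]
        exact (DFunLike.congr_fun key _).symm }
  exact ⟨L, i', r', hom_ext fun v => hri v, hom_ext fun x => rfl⟩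

theorem map_mem_conilFiltration {C D : CocommCoalg.{u}} (f : C ⟶ D) (e : C.carrier) (n : ℕ) :
    ∀ c ∈ C.conilFiltration e n, f.toCoalgHom c ∈ D.conilFiltration (f.toCoalgHom e) n := by
  have h0 : Submodule.span ℝ {e} ≤
      (Submodule.span ℝ {f.toCoalgHom e}).comap f.toCoalgHom.toLinearMap :=
    (Submodule.span_singleton_le_iff_mem _ _).2 (Submodule.mem_span_singleton_self _)
  induction n with
  | zero => exact fun c hc => h0 hc
  | succ n ih =>
    intro c hc
    rw [conilFiltration, LinearMap.mem_ker, LinearMap.comp_apply] at hc ⊢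
    rw [← CoalgHomClass.map_comp_comul_apply, ← LinearMap.comp_apply, ← TensorProduct.map_comp]
    have e₁ : (D.conilFiltration (f.toCoalgHom e) n).mkQ ∘ₗ f.toCoalgHom.toLinearMap =
        (C.conilFiltration e n).mapQ _ f.toCoalgHom.toLinearMap ih ∘ₗ
          (C.conilFiltration e n).mkQ := rfl
    have e₂ : (Submodule.span ℝ {f.toCoalgHom e}).mkQ ∘ₗ f.toCoalgHom.toLinearMap =
        (Submodule.span ℝ {e}).mapQ _ f.toCoalgHom.toLinearMap h0 ∘ₗ
          (Submodule.span ℝ {e}).mkQ := rfl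
    refine (DFunLike.congr_fun (congrArg₂ TensorProduct.map e₁ e₂) _).trans ?_
    rw [TensorProduct.map_comp, LinearMap.comp_apply, hc, map_zero]

section Retract

variable {X L : CocommCoalg.{u}} (i : L ⟶ X) (r : X ⟶ L) (h : i ≫ r = 𝟙 L)
include h

theorem retract_apply (x : L.carrier) : r.toCoalgHom (i.toCoalgHom x) = x :=
  congrArg (fun f => f.toCoalgHom x) h

theorem IsFormalManifold.of_retract (hX : IsFormalManifold X) : IsFormalManifold L := by
  refine ⟨?_, ?_, ?_⟩
  · obtain ⟨e, he, hc⟩ := hX.1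
    refine ⟨r.toCoalgHom e, he.map r.toCoalgHom, fun c => ?_⟩
    obtain ⟨n, hn⟩ := hc (i.toCoalgHom c)
    have := map_mem_conilFiltration r e n _ hn
    rw [retract_apply i r h] at this
    exact ⟨n, this⟩
  · intro e he
    have := hX.2.1 _ (he.map i.toCoalgHom)
    let F : L.primitives e →ₗ[ℝ] X.primitives (i.toCoalgHom e) :=
      i.toCoalgHom.toLinearMap.restrict fun c hc => by
        change Coalgebra.comul (R := ℝ) (i.toCoalgHom c) = _
        rw [← CoalgHomClass.map_comp_comul_apply]
        refine (congrArg _ (show Coalgebra.comul (R := ℝ) c = c ⊗ₜ e + e ⊗ₜ c from hc)).trans ?_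
        simp only [map_add, TensorProduct.map_tmul]
        rfl
    refine Module.Finite.of_injective F fun x y hxy => Subtype.ext ?_
    have := congrArg (fun z => r.toCoalgHom z.1) hxy
    exact (retract_apply i r h _).symm.trans (this.trans (retract_apply i r h _))
  · intro A _ K hK a b ha ⟨n, hn⟩ hab
    obtain ⟨l, ⟨m, hm⟩, hl, hl'⟩ := hX.2.2 A K hK a (b.comp (dualHom i)) ha
      ⟨n, fun p hp => hn (dualHom_mem_pow i hp)⟩ (by
        rw [← hab]
        refine RingHom.ext fun p => congrArg b ?_
        exact congrArg (fun f => dualHom f p) (toUnit_unique (i ≫ X.toUnit) L.toUnit))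
    refine ⟨l.comp (dualHom r), ⟨m, fun p hp => hm (dualHom_mem_pow r hp)⟩, ?_, ?_⟩
    · rw [← RingHom.comp_assoc, hl]
      refine RingHom.ext fun p => ?_
      change b (dualHom (i ≫ r) p) = b p
      rw [h]
      rfl
    · rw [← hl']
      refine RingHom.ext fun p => congrArg l ?_
      exact congrArg (fun f => dualHom f p) (toUnit_unique (r ≫ L.toUnit) X.toUnit)

theorem IsNice.of_retract (hX : X.IsNice) : L.IsNice where
  isFormalManifold := IsFormalManifold.of_retract i r h hX.isFormalManifold
  isCofinite n := by
    obtain ⟨F, hF, hF'⟩ := hX.isCofinite n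
    refine ⟨F.map r.toCoalgHom.toLinearMap, inferInstance, fun p hp => ?_⟩
    have h₁ : dualHom r p ∈ X.dualIdeal ^ n := hF' _ fun c hc => hp _ ⟨c, hc, rfl⟩
    have h₂ := dualHom_mem_pow i h₁
    rw [← dualHom_comp, h] at h₂
    exact h₂
  groupLike_unique g g' hg hg' := by
    rw [← retract_apply i r h g, hX.groupLike_unique _ _ (hg.map i.toCoalgHom) (hg'.map i.toCoalgHom),
      retract_apply i r h]

end Retract

theorem IsNice.of_dpBasis {σ : Type*} [DecidableEq σ] [Fintype σ] {C : CocommCoalg.{u}}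
    (B : DPBasis σ C) : C.IsNice where
  isFormalManifold := B.isFormalManifold
  isCofinite := B.isCofinite
  groupLike_unique _ _ hg hh := (B.eq_e_zero hg).trans (B.eq_e_zero hh).symm

end CocommCoalg

/-- A horn filler which is natural in generalized elements, and which does not change a simplex
that is already a filler. -/
structure HornFiller {C : Type*} [Category* C] (X : SimplicialObject C) (n : ℕ) (k : Fin (n + 1)) where
  fill : ∀ {T : C}, ((Functor.const _).obj T ⟶ hornDiagram X n k) → (T ⟶ X.obj (op (.mk n))) →
    (T ⟶ X.obj (op (.mk n)))
  fill_app : ∀ {T : C} (c : (Functor.const _).obj T ⟶ hornDiagram X n k) (x) (j),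
    fill c x ≫ X.map (hornElement j) = c.app j
  fill_res : ∀ {T : C} (x : T ⟶ X.obj (op (.mk n))),
    fill ((Functor.const _).map x ≫ (hornCone X n k).π) x = x
  fill_nat : ∀ {S T : C} (t : S ⟶ T) (c : (Functor.const _).obj T ⟶ hornDiagram X n k) (x),
    t ≫ fill c x = fill ((Functor.const _).map t ≫ c) (t ≫ x)

namespace CocommCoalg

theorem isKan_of_hornFiller (X : SimplicialObject CocommCoalg.{u}) (hX : ∀ p, (X.obj p).IsNice)
    (F : ∀ n : ℕ, 1 ≤ n → ∀ k : Fin (n + 1), HornFiller X n k)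
    (x₀ : ∀ n : ℕ, unit.{u} ⟶ X.obj (op (.mk n))) :
    IsKan formalCovers (IsFormalManifold.lift X fun p => (hX p).isFormalManifold) := by
  intro n hn k
  let Y := X.obj (op (.mk n))
  let φ := F n hn k
  let pt : ∀ T : CocommCoalg.{u}, T ⟶ Y := fun T => T.toUnit ≫ x₀ n
  have hpt : ∀ {S T : CocommCoalg.{u}} (t : S ⟶ T), t ≫ pt T = pt S := fun {S T} t => by
    change t ≫ T.toUnit ≫ x₀ n = S.toUnit ≫ x₀ n
    rw [← Category.assoc]
    exact congrArg (· ≫ x₀ n) (toUnit_unique (t ≫ T.toUnit) S.toUnit)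
  let res : (Functor.const _).obj Y ⟶ hornDiagram X n k := (hornCone X n k).π
  have hres : ∀ j, res.app j = X.map (hornElement j) := fun _ => rfl
  let e : Y ⟶ Y := φ.fill res (pt Y)
  have he_res : ∀ j, e ≫ X.map (hornElement j) = X.map (hornElement j) := fun j =>
    φ.fill_app res (pt Y) j
  have hcomp : ∀ {T : CocommCoalg.{u}} (t : T ⟶ Y) (c : (Functor.const _).obj T ⟶ hornDiagram X n k),
      (∀ j, t ≫ X.map (hornElement j) = c.app j) → t ≫ e = φ.fill c (pt T) := by
    intro T t c hc
    rw [φ.fill_nat, hpt]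
    congr 1
    ext j : 2
    exact hc j
  have hee : e ≫ e = e := hcomp e res he_res
  obtain ⟨L, i, r, hir, hri⟩ := exists_splitting e hee
  have hL : L.IsNice := IsNice.of_retract i r hir (hX _)
  have hi : ∀ {T : CocommCoalg.{u}} (f g : T ⟶ L), f ≫ i = g ≫ i → f = g := fun f g h => by
    have := congrArg (· ≫ r) h
    simpa [hir] using this
  let Lc : Limits.Cone (hornDiagram (IsFormalManifold.lift X fun p => (hX p).isFormalManifold) n k) :=
    { pt := ⟨L, hL.isFormalManifold⟩
      π :=
        { app := fun j => ObjectProperty.homMk (i ≫ X.map (hornElement j))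
          naturality := fun j j' f => by
            have h := (hornCone X n k).w f
            refine ObjectProperty.hom_ext _ ?_
            change 𝟙 _ ≫ i ≫ X.map (hornElement j') = (i ≫ X.map (hornElement j)) ≫ X.map f.1
            rw [Category.id_comp, Category.assoc]
            exact congrArg (i ≫ ·) h.symm } }
  let under : ∀ s : Limits.Cone (hornDiagram (IsFormalManifold.lift X fun p => (hX p).isFormalManifold) n k),
      (Functor.const _).obj s.pt.obj ⟶ hornDiagram X n k := fun s =>
    { app := fun j => (s.π.app j).hom
      naturality := fun j j' f => congrArg (fun g => g.hom) (s.π.naturality f) }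
  have hlift : ∀ s j, (φ.fill (under s) (pt _) ≫ r) ≫ i ≫ X.map (hornElement j) =
      (s.π.app j).hom := fun s j => by
    rw [Category.assoc, ← Category.assoc r, hri, he_res]
    exact φ.fill_app (under s) (pt _) j
  have hLc : Limits.IsLimit Lc :=
    { lift := fun s => ObjectProperty.homMk (φ.fill (under s) (pt _) ≫ r)
      fac := fun s j => ObjectProperty.hom_ext _ (hlift s j)
      uniq := fun s m hm => ObjectProperty.hom_ext _ <| by
        change m.hom = φ.fill (under s) (pt _) ≫ r
        have h₁ := hcomp (m.hom ≫ i) (under s) fun j => by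
          have := congrArg (fun g => g.hom) (hm j)
          exact (Category.assoc _ _ _).trans this
        rw [← h₁, Category.assoc, ← hri, Category.assoc, Category.assoc, hir, Category.comp_id, hir,
          Category.comp_id] }
  refine ⟨Lc, hLc, ?_⟩
  have hm : ∀ m : Y ⟶ L, (m ≫ i) ≫ e = e → m = r := fun m hm => hi _ _ <| by
    rw [hri, ← hm, ← hri, Category.assoc, ← Category.assoc i, hir, Category.id_comp]
  have hr : (hLc.lift (hornCone _ n k)).hom = r := hm _ <| by
    have h₁ := hcomp ((hLc.lift (hornCone _ n k)).hom ≫ i) res fun j => by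
      have := congrArg (fun g => g.hom) (hLc.fac (hornCone _ n k) j)
      exact (Category.assoc _ _ _).trans this
    exact h₁
  change IsFormalSubmersion (hLc.lift (hornCone _ n k)).hom
  rw [hr]
  let c : (Functor.const _).obj (prod L Y) ⟶ hornDiagram X n k :=
    (Functor.const _).map (fst L Y ≫ i) ≫ res
  refine isFormalSubmersion_of_transport (hX _) hL r (φ.fill c (snd L Y)) (hi _ _ ?_) ?_
  · rw [Category.assoc, hri, hcomp _ c (φ.fill_app c _), ← hcomp (fst L Y ≫ i) c (fun j => rfl),
      Category.assoc, ← hri, ← Category.assoc i, hir, Category.id_comp]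
  · rw [φ.fill_nat, pair_snd]
    refine Eq.trans ?_ (φ.fill_res (𝟙 Y))
    congr 1
    ext j : 2
    change pair r (𝟙 Y) ≫ (fst L Y ≫ i) ≫ X.map (hornElement j) = 𝟙 Y ≫ X.map (hornElement j)
    rw [← Category.assoc, ← Category.assoc, pair_fst, hri, he_res, Category.id_comp]

end CocommCoalg

theorem IsKan.of_iso {C : Type*} [Category* C] {W : MorphismProperty C}
    (hW : ∀ {X Y Z : C} (f : X ≅ Y) (g : Y ⟶ Z), W g → W (f.hom ≫ g)) {X Y : SimplicialObject C}
    (α : X ≅ Y) (h : IsKan W X) : IsKan W Y := by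
  intro n hn k
  obtain ⟨L, hL, hL'⟩ := h n hn k
  let β : hornDiagram X n k ≅ hornDiagram Y n k :=
    Functor.isoWhiskerLeft (CategoryOfElements.π (SSet.horn.{0} n k : SSet.{0})) α
  let hM := (Limits.IsLimit.postcomposeHomEquiv β L).symm hL
  refine ⟨(Limits.Cone.postcompose β.hom).obj L, hM, ?_⟩
  have : hM.lift (hornCone Y n k) =
      (α.symm.app (op (.mk n))).hom ≫ hL.lift (hornCone X n k) := by
    refine hM.hom_ext fun j => ?_
    rw [hM.fac]
    change Y.map (hornElement j) =
      (α.inv.app _ ≫ hL.lift (hornCone X n k)) ≫ L.π.app j ≫ α.hom.app _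
    refine Eq.trans ?_ (Category.assoc _ _ _).symm
    have h₂ := (Category.assoc _ _ _).symm.trans
      (congrArg (· ≫ α.hom.app _) (hL.fac (hornCone X n k) j))
    refine Eq.trans ?_ (congrArg (α.inv.app (op (.mk n)) ≫ ·) h₂).symm
    change _ = α.inv.app _ ≫ X.map (hornElement j) ≫ α.hom.app _
    rw [α.hom.naturality, ← Category.assoc, α.inv_hom_id_app, Category.id_comp]
  rw [this]
  exact hW _ _ hL'

namespace CocommCoalg

theorem IsFormalSubmersion.iso_comp {C D K : CocommCoalg.{u}} (f : C ≅ D) (g : D ⟶ K)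
    (hg : IsFormalSubmersion g) : IsFormalSubmersion (f.hom ≫ g) := by
  intro A _ I hI a b ha ⟨n, hn⟩ hab
  obtain ⟨l, ⟨m, hm⟩, hl, hl'⟩ := hg A I hI a (b.comp (dualHom f.hom)) ha
    ⟨n, fun p hp => hn (dualHom_mem_pow f.hom hp)⟩ hab
  refine ⟨l.comp (dualHom f.inv), ⟨m, fun p hp => hm (dualHom_mem_pow f.inv hp)⟩, ?_, ?_⟩
  · rw [← RingHom.comp_assoc, hl]
    refine RingHom.ext fun p => ?_
    change b (dualHom (f.hom ≫ f.inv) p) = b p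
    rw [f.hom_inv_id]
    rfl
  · rw [← hl']
    refine RingHom.ext fun p => congrArg l ?_
    change dualHom (f.inv ≫ f.hom ≫ g) p = dualHom g p
    rw [f.inv_hom_id_assoc]

theorem IsFormalInftyGroup.of_iso {X Y : SimplicialObject CocommCoalg.{u}} (α : X ≅ Y)
    (hX : IsFormalInftyGroup X) : IsFormalInftyGroup Y := by
  obtain ⟨⟨h, hK⟩, h0⟩ := hX
  have h' : ∀ p, IsFormalManifold (Y.obj p) := fun p =>
    IsFormalManifold.of_retract (α.inv.app p) (α.hom.app p) (α.inv_hom_id_app p) (h p)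
  refine ⟨⟨h', ?_⟩, ?_⟩
  · let β : IsFormalManifold.lift X h ≅ IsFormalManifold.lift Y h' :=
      NatIso.ofComponents (fun p => ObjectProperty.isoMk _ (α.app p)) fun f =>
        ObjectProperty.hom_ext _ (α.hom.naturality f)
    exact hK.of_iso (fun f g hg => IsFormalSubmersion.iso_comp
      (IsFormalManifold.ι.mapIso f) g.hom hg) β
  · have hc : (Coalgebra.counit (R := ℝ) (A := (Y.obj (op (.mk 0))).carrier) : _ → ℝ) =
        Coalgebra.counit (R := ℝ) ∘ (α.inv.app (op (.mk 0))).toCoalgHom :=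
      funext fun y => (CoalgHomClass.counit_comp_apply _ y).symm
    rw [hc]
    refine h0.comp (Function.bijective_iff_has_inverse.2
      ⟨(α.hom.app (op (.mk 0))).toCoalgHom, fun y => ?_, fun x => ?_⟩)
    · exact congrArg (fun f => f.toCoalgHom y) (α.inv_hom_id_app (op (.mk 0)))
    · exact congrArg (fun f => f.toCoalgHom x) (α.hom_inv_id_app (op (.mk 0)))

end CocommCoalg

end FormalLie

end

noncomputable section

namespace FormalLie

section

open MonoidalCategory CartesianMonoidalCategory
open scoped MonObj

section Moore

variable {C : Type u} [Category.{v} C] [CartesianMonoidalCategory C]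
  (G : SimplicialObject (Grp C)) {T : C}

/-- The action of `ξ : [k] → [l]` on the simplicial group of `T`-points. -/
def pull {k l : ℕ} (ξ : SimplexCategory.mk k ⟶ .mk l) : (T ⟶ level G l) →* (T ⟶ level G k) where
  toFun g := g ≫ act G ξ
  map_one' := MonObj.one_comp (act G ξ)
  map_mul' g h := MonObj.mul_comp g h (act G ξ)

theorem pull_comp {j k l : ℕ} (ζ : SimplexCategory.mk j ⟶ .mk k) (ξ : SimplexCategory.mk k ⟶ .mk l)
    (g : T ⟶ level G l) : pull G (ζ ≫ ξ) g = pull G ζ (pull G ξ g) := by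
  simp only [pull, MonoidHom.coe_mk, OneHom.coe_mk, Category.assoc, act_act]

theorem pull_id {k : ℕ} (g : T ⟶ level G k) : pull G (𝟙 _) g = g := by
  simp [pull, act]

theorem comp_pull {S : C} (t : S ⟶ T) {k l : ℕ} (ξ : SimplexCategory.mk k ⟶ .mk l)
    (g : T ⟶ level G l) : t ≫ pull G ξ g = pull G ξ (t ≫ g) := by
  simp [pull]

/-- A step of Moore's algorithm: `w` is modified such that its `i`-th face becomes `y i`. -/
def mooreStep {m : ℕ} (s : Fin (m + 1) × Fin (m + 2)) (y : Fin (m + 2) → (T ⟶ level G m))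
    (w : T ⟶ level G (m + 1)) : T ⟶ level G (m + 1) :=
  w * pull G (SimplexCategory.σ s.1) ((pull G (SimplexCategory.δ s.2) w)⁻¹ * y s.2)

/-- Moore's algorithm with a list of steps, the last of which is the head of the list. -/
def mooreFill {m : ℕ} (y : Fin (m + 2) → (T ⟶ level G m)) :
    List (Fin (m + 1) × Fin (m + 2)) → (T ⟶ level G (m + 1)) → (T ⟶ level G (m + 1))
  | [], w => w
  | s :: l, w => mooreStep G s y (mooreFill y l w)

/-- The lists of steps for which Moore's algorithm solves the horn filling problem. -/
def MooreValid {m : ℕ} (k : Fin (m + 2)) : List (Fin (m + 1) × Fin (m + 2)) → Prop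
  | [] => True
  | s :: l => s.2 ≠ k ∧ ((s.1 : ℕ) = s.2 ∨ (s.1 : ℕ) + 1 = s.2) ∧
      (∀ t ∈ l, t.2 ≠ s.2 → (t.2 : ℕ) + s.2 ≠ 2 * s.1 + 1) ∧ MooreValid k l

theorem MooreValid.ne {m : ℕ} {k : Fin (m + 2)} {l : List (Fin (m + 1) × Fin (m + 2))}
    (h : MooreValid k l) : ∀ t ∈ l, t.2 ≠ k := by
  induction l with
  | nil => simp
  | cons s l ih =>
    intro t ht
    rcases List.mem_cons.1 ht with rfl | ht
    · exact h.1
    · exact ih h.2.2.2 t ht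

theorem comp_mooreFill {S : C} (t : S ⟶ T) {m : ℕ} (y : Fin (m + 2) → (T ⟶ level G m))
    (l : List (Fin (m + 1) × Fin (m + 2))) (w : T ⟶ level G (m + 1)) :
    t ≫ mooreFill G y l w = mooreFill G (fun i => t ≫ y i) l (t ≫ w) := by
  induction l with
  | nil => rfl
  | cons s l ih =>
    simp only [mooreFill, mooreStep, MonObj.comp_mul, GrpObj.comp_inv, comp_pull, ih]

theorem mooreFill_self {m : ℕ} (y : Fin (m + 2) → (T ⟶ level G m))
    (l : List (Fin (m + 1) × Fin (m + 2))) (w : T ⟶ level G (m + 1))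
    (h : ∀ t ∈ l, pull G (SimplexCategory.δ t.2) w = y t.2) : mooreFill G y l w = w := by
  induction l with
  | nil => rfl
  | cons s l ih =>
    simp only [List.mem_cons, forall_eq_or_imp] at h
    simp [mooreFill, mooreStep, ih h.2, h.1]

/-- Compatibility of the prescribed faces, in terms of common faces. -/
def FaceCompat {m : ℕ} (k : Fin (m + 2)) (y : Fin (m + 2) → (T ⟶ level G m)) : Prop :=
  ∀ i j, i ≠ k → j ≠ k → ∀ (p : ℕ) (α β : SimplexCategory.mk p ⟶ .mk m),
    α ≫ SimplexCategory.δ i = β ≫ SimplexCategory.δ j → pull G α (y i) = pull G β (y j)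

theorem simplexVal_coe {x y : SimplexCategory} (α : x ⟶ y) (i : Fin (x.len + 1)) :
    simplexVal α i = α.toOrderHom i := by
  simp only [simplexVal, show min (i : ℕ) x.len = i by omega]

theorem exists_face_factor {m : ℕ} {b : Fin (m + 1)} {i j : Fin (m + 2)}
    (hij : j ≠ i) (h : (j : ℕ) + i ≠ 2 * b + 1) (hb : (b : ℕ) = i ∨ (b : ℕ) + 1 = i) :
    ∃ β : SimplexCategory.mk m ⟶ .mk m, (SimplexCategory.δ j ≫ SimplexCategory.σ b) ≫
      SimplexCategory.δ i = β ≫ SimplexCategory.δ j := by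
  refine SimplexCategory.eq_comp_δ_of_not_surjective' _ _ fun x hx => ?_
  have hx' : (x : ℕ) ≤ m := by have := x.isLt; simp only [SimplexCategory.len_mk] at this; omega
  have h1 : simplexVal ((SimplexCategory.δ j ≫ SimplexCategory.σ b) ≫ SimplexCategory.δ i) x
      = j := by
    exact (simplexVal_coe _ x).trans (congrArg Fin.val hx)
  rw [simplexVal_comp, simplexVal_comp, simplexVal_face j hx'] at h1
  have hij' : (j : ℕ) ≠ i := fun h => hij (Fin.ext h)
  rw [simplexVal_degeneracy b (by split_ifs <;> omega), simplexVal_face i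
    (by split_ifs <;> omega)] at h1
  split_ifs at h1 <;> omega

theorem face_degeneracy {m : ℕ} {b : Fin (m + 1)} {i : Fin (m + 2)}
    (hb : (b : ℕ) = i ∨ (b : ℕ) + 1 = i) :
    SimplexCategory.δ i ≫ SimplexCategory.σ b = 𝟙 (SimplexCategory.mk m) := by
  rcases hb with hb | hb
  · rw [show i = b.castSucc from Fin.ext hb.symm, SimplexCategory.δ_comp_σ_self]
  · rw [show i = b.succ from Fin.ext hb.symm, SimplexCategory.δ_comp_σ_succ]

theorem face_mooreFill {m : ℕ} {k : Fin (m + 2)} {y : Fin (m + 2) → (T ⟶ level G m)}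
    (hy : FaceCompat G k y) {l : List (Fin (m + 1) × Fin (m + 2))} (hl : MooreValid k l)
    (w : T ⟶ level G (m + 1)) :
    ∀ t ∈ l, pull G (SimplexCategory.δ t.2) (mooreFill G y l w) = y t.2 := by
  induction l with
  | nil => simp
  | cons s l ih =>
    have hne := hl.ne
    obtain ⟨h1, h2, h3, h4⟩ := hl
    have key : pull G (SimplexCategory.δ s.2) (mooreFill G y (s :: l) w) = y s.2 := by
      simp only [mooreFill, mooreStep]
      rw [map_mul, ← pull_comp, face_degeneracy h2, pull_id]
      simp
    intro t ht
    by_cases hts : t.2 = s.2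
    · rw [hts, key]
    have ht' : t ∈ l := by
      rcases List.mem_cons.1 ht with rfl | ht
      · exact absurd rfl hts
      · exact ht
    obtain ⟨β, hβ⟩ := exists_face_factor hts (h3 t ht' hts) h2
    have e1 := hy _ _ h1 (hne t ht) _ _ _ hβ
    have e2 : pull G (SimplexCategory.δ t.2 ≫ SimplexCategory.σ s.1)
        (pull G (SimplexCategory.δ s.2) (mooreFill G y l w)) = pull G β (y t.2) := by
      rw [← pull_comp, hβ, pull_comp, ih h4 t ht']
    simp only [mooreFill, mooreStep]
    rw [map_mul, ih h4 t ht', ← pull_comp, map_mul, map_inv, e1, e2]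
    simp

theorem exists_mooreValid {m : ℕ} (k : Fin (m + 2)) :
    ∃ l : List (Fin (m + 1) × Fin (m + 2)), MooreValid k l ∧ ∀ i, i ≠ k → ∃ t ∈ l, t.2 = i := by
  have h1 : ∀ u : ℕ, u ≤ k → ∃ l : List (Fin (m + 1) × Fin (m + 2)), MooreValid k l ∧
      ∀ i : Fin (m + 2), (∃ t ∈ l, t.2 = i) ↔ (i : ℕ) < u := by
    intro u
    induction u with
    | zero => exact fun _ => ⟨[], trivial, by simp⟩
    | succ u ih =>
      intro hu
      obtain ⟨l, hl, h⟩ := ih (by omega)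
      have := k.isLt
      refine ⟨(⟨u, by omega⟩, ⟨u, by omega⟩) :: l, ⟨?_, Or.inl rfl, ?_, hl⟩, fun i => ?_⟩
      · exact fun h => by have := congrArg Fin.val h; simp only at this; omega
      · intro t ht hne
        have := (h t.2).1 ⟨t, ht, rfl⟩
        simp only
        omega
      · simp only [List.mem_cons, exists_eq_or_imp, h]
        rw [Fin.ext_iff]
        simp only
        omega
  have h2 : ∀ u : ℕ, u ≤ m + 1 - k → ∃ l : List (Fin (m + 1) × Fin (m + 2)), MooreValid k l ∧
      ∀ i : Fin (m + 2), (∃ t ∈ l, t.2 = i) ↔ (i : ℕ) < k ∨ m + 1 - u < (i : ℕ) := by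
    intro u
    induction u with
    | zero =>
      intro _
      obtain ⟨l, hl, h⟩ := h1 k le_rfl
      exact ⟨l, hl, fun i => (h i).trans (by have := i.isLt; omega)⟩
    | succ u ih =>
      intro hu
      obtain ⟨l, hl, h⟩ := ih (by omega)
      have := k.isLt
      refine ⟨(⟨m - u, by omega⟩, ⟨m + 1 - u, by omega⟩) :: l,
        ⟨?_, Or.inr ?_, ?_, hl⟩, fun i => ?_⟩
      · exact fun h => by have := congrArg Fin.val h; simp only at this; omega
      · simp only; omega
      · intro t ht hne
        have := (h t.2).1 ⟨t, ht, rfl⟩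
        simp only
        omega
      · simp only [List.mem_cons, exists_eq_or_imp, h]
        rw [Fin.ext_iff]
        simp only
        omega
  obtain ⟨l, hl, h⟩ := h2 _ le_rfl
  refine ⟨l, hl, fun i hi => (h i).2 ?_⟩
  have hi' : (i : ℕ) ≠ k := fun h => hi (Fin.ext h)
  omega

/-- A list of steps which fills horns `Λ^{m+1}_k`. -/
def mooreList {m : ℕ} (k : Fin (m + 2)) : List (Fin (m + 1) × Fin (m + 2)) :=
  (exists_mooreValid k).choose

theorem face_mooreFill_mooreList {m : ℕ} {k : Fin (m + 2)} {y : Fin (m + 2) → (T ⟶ level G m)}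
    (hy : FaceCompat G k y) (w : T ⟶ level G (m + 1)) {i : Fin (m + 2)} (hi : i ≠ k) :
    pull G (SimplexCategory.δ i) (mooreFill G y (mooreList k) w) = y i := by
  obtain ⟨t, ht, rfl⟩ := (exists_mooreValid k).choose_spec.2 i hi
  exact face_mooreFill G hy (exists_mooreValid k).choose_spec.1 w t ht

theorem mooreFill_mooreList_self {m : ℕ} {k : Fin (m + 2)} {y : Fin (m + 2) → (T ⟶ level G m)}
    {w : T ⟶ level G (m + 1)} (h : ∀ i, i ≠ k → pull G (SimplexCategory.δ i) w = y i) :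
    mooreFill G y (mooreList k) w = w :=
  mooreFill_self G _ _ _ fun t ht => h _ ((exists_mooreValid k).choose_spec.1.ne t ht)

theorem faceCompat_zero (k : Fin 2) (y : Fin 2 → (T ⟶ level G 0)) : FaceCompat G k y := by
  intro i j hi hj p α β h
  have : i = j := by omega
  subst this
  rw [(cancel_mono _).1 h]

theorem faceCompat_succ {m : ℕ} {k : Fin (m + 3)} {y : Fin (m + 3) → (T ⟶ level G (m + 1))}
    (h : ∀ i j : Fin (m + 2), i ≤ j → i.castSucc ≠ k → j.succ ≠ k →
      pull G (SimplexCategory.δ i) (y j.succ) = pull G (SimplexCategory.δ j) (y i.castSucc)) :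
    FaceCompat G k y := by
  have key : ∀ I J, I < J → I ≠ k → J ≠ k → ∀ (p : ℕ) (α β : SimplexCategory.mk p ⟶ .mk (m + 1)),
      α ≫ SimplexCategory.δ I = β ≫ SimplexCategory.δ J → pull G α (y I) = pull G β (y J) := by
    intro I J hIJ hI hJ p α β e
    obtain ⟨i, rfl⟩ : ∃ i : Fin (m + 2), i.castSucc = I :=
      ⟨⟨I, by omega⟩, rfl⟩
    obtain ⟨j, rfl⟩ : ∃ j : Fin (m + 2), j.succ = J :=
      ⟨⟨J - 1, by omega⟩, Fin.ext (by simp; omega)⟩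
    have hij : i ≤ j := by
      rw [Fin.lt_def] at hIJ; rw [Fin.le_def]; simp at hIJ; omega
    obtain ⟨τ, rfl⟩ := SimplexCategory.eq_comp_δ_of_not_surjective' α j fun x hx => by
      have h1 := congrArg (fun a => simplexVal a x) e
      simp only [simplexVal_comp] at h1
      have h3 := simplexVal_le β x
      simp only [SimplexCategory.len_mk] at h3
      have h2 : simplexVal α x = j := by
        rw [← hx]; exact simplexVal_coe α x
      rw [h2, simplexVal_face _ (by omega), simplexVal_face _ h3] at h1
      rw [Fin.le_def] at hij
      simp only [Fin.val_castSucc, Fin.val_succ] at h1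
      split_ifs at h1 <;> omega
    rw [Category.assoc, ← SimplexCategory.δ_comp_δ hij, ← Category.assoc] at e
    rw [← (cancel_mono _).1 e, pull_comp, pull_comp, h i j hij hI hJ]
  intro I J hI hJ p α β e
  rcases lt_trichotomy I J with hIJ | rfl | hIJ
  · exact key I J hIJ hI hJ p α β e
  · rw [(cancel_mono _).1 e]
  · exact (key J I hIJ hJ hI p β α e.symm).symm

end Moore

end

end FormalLie

end

noncomputable section

namespace FormalLie

section

open MonoidalCategory CartesianMonoidalCategory
open scoped MonObj

section WbarFiller

variable {C : Type u} [Category.{v} C] [CartesianMonoidalCategory C]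
  (G : SimplicialObject (Grp C)) {T : C}

/-- The component `g_n` of a `T`-point `(g_n, …, g_0)` of `W̄ G`. -/
def wtop {n : ℕ} (x : T ⟶ wbarObj G (n + 1)) : T ⟶ level G n :=
  x ≫ fst (level G n) (wbarObj G n)

/-- The `i`-th face of a `T`-point of `W̄ G`. -/
def wface {n : ℕ} (i : Fin (n + 2)) (x : T ⟶ wbarObj G (n + 1)) : T ⟶ wbarObj G n :=
  x ≫ wbarMap G (SimplexCategory.δ i)

/-- The `T`-point of `W̄ G` with the given first component and the given `0`-th face. -/
def wcons {n : ℕ} (g : T ⟶ level G n) (x : T ⟶ wbarObj G n) : T ⟶ wbarObj G (n + 1) :=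
  lift g x

theorem comp_wtop {S : C} (t : S ⟶ T) {n : ℕ} (x : T ⟶ wbarObj G (n + 1)) :
    t ≫ wtop G x = wtop G (t ≫ x) := (Category.assoc _ _ _).symm

theorem comp_wface {S : C} (t : S ⟶ T) {n : ℕ} (i : Fin (n + 2)) (x : T ⟶ wbarObj G (n + 1)) :
    t ≫ wface G i x = wface G i (t ≫ x) := (Category.assoc _ _ _).symm

theorem comp_wcons {S : C} (t : S ⟶ T) {n : ℕ} (g : T ⟶ level G n) (x : T ⟶ wbarObj G n) :
    t ≫ wcons G g x = wcons G (t ≫ g) (t ≫ x) := comp_lift t g x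

theorem wbarProj_top (n : ℕ) : wbarProj G (n + 1) n = fst (level G n) (wbarObj G n) := by
  rw [wbarProj, dif_pos rfl]
  exact Category.comp_id _

theorem wbarProj_succ {n k : ℕ} (h : k < n) :
    wbarProj G (n + 1) k = snd (level G n) (wbarObj G n) ≫ wbarProj G n k := by
  rw [wbarProj, dif_neg (by omega)]
  rfl

theorem wbarMap_face_zero (n : ℕ) :
    wbarMap G (SimplexCategory.δ (0 : Fin (n + 2))) = snd (level G n) (wbarObj G n) := by
  refine wbar_hom_ext G fun k hk => ?_
  exact (wbar_face_low G 0 (by simpa using hk)).trans (wbarProj_succ G hk)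

theorem wtop_wcons {n : ℕ} (g : T ⟶ level G n) (x : T ⟶ wbarObj G n) :
    wtop G (wcons G g x) = g := lift_fst g x

theorem wface_wcons {n : ℕ} (g : T ⟶ level G n) (x : T ⟶ wbarObj G n) :
    wface G 0 (wcons G g x) = x := by
  unfold wface
  refine (congrArg (wcons G g x ≫ ·) (wbarMap_face_zero G n)).trans (lift_snd g x)

theorem wext {n : ℕ} {x y : T ⟶ wbarObj G (n + 1)} (h : wtop G x = wtop G y)
    (h' : wface G 0 x = wface G 0 y) : x = y := by
  refine CartesianMonoidalCategory.hom_ext (X := level G n) (Y := wbarObj G n) x y h ?_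
  rw [← wbarMap_face_zero]
  exact h'

theorem wcons_wface {n : ℕ} (x : T ⟶ wbarObj G (n + 1)) : wcons G (wtop G x) (wface G 0 x) = x :=
  wext G (wtop_wcons G _ _) (wface_wcons G _ _)

theorem wext_zero (x y : T ⟶ wbarObj G 0) : x = y := toUnit_unique _ _

theorem wface_wface {n : ℕ} {i j : Fin (n + 2)} (h : i ≤ j) (x : T ⟶ wbarObj G (n + 2)) :
    wface G i (wface G j.succ x) = wface G j (wface G i.castSucc x) := by
  have h1 := wbarMap_comp G (SimplexCategory.δ i) (SimplexCategory.δ j.succ)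
  have h2 := wbarMap_comp G (SimplexCategory.δ j) (SimplexCategory.δ i.castSucc)
  rw [SimplexCategory.δ_comp_δ h] at h1
  exact (Category.assoc _ _ _).trans ((congrArg (x ≫ ·) (h1.symm.trans h2)).trans
    (Category.assoc _ _ _).symm)

theorem wtop_wface_succ {n : ℕ} {i : Fin (n + 2)} (hi : i ≠ 0) (x : T ⟶ wbarObj G (n + 2)) :
    wtop G (wface G i.succ x) = pull G (SimplexCategory.δ i) (wtop G x) := by
  have h := wbar_face_high G (n := n + 1) i.succ (k := n) (j := i) (by omega)
    (Fin.pos_iff_ne_zero.2 hi) (by simp; omega)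
  rw [wbarProj_top, wbarProj_top] at h
  exact (Category.assoc _ _ _).trans ((congrArg (x ≫ ·) h).trans (Category.assoc _ _ _).symm)

theorem wtop_wface_one {n : ℕ} (x : T ⟶ wbarObj G (n + 2)) :
    wtop G (wface G 1 x) = pull G (SimplexCategory.δ 0) (wtop G x) * wtop G (wface G 0 x) := by
  have h := wbar_face_mid G (n := n + 1) 1 (k := n) (by simp) (by simp)
  rw [wbarProj_top, wbarProj_top, wbarProj_succ G (Nat.lt_succ_self n), wbarProj_top] at h
  refine (Category.assoc _ _ _).trans ((congrArg (x ≫ ·) h).trans ?_)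
  refine (MonObj.comp_mul _ _ _).trans ?_
  congr 1
  · exact (Category.assoc _ _ _).symm
  · unfold wtop wface
    rw [wbarMap_face_zero]
    exact (Category.assoc _ _ _).symm

theorem wext_one {n : ℕ} {x y : T ⟶ wbarObj G (n + 2)} (h : wtop G x = wtop G y)
    (h' : wface G 1 x = wface G 1 y) : x = y := by
  refine wext G h (wext G ?_ ?_)
  · have h1 := congrArg (wtop G) h'
    rw [wtop_wface_one, wtop_wface_one, h] at h1
    exact mul_left_cancel h1
  · have h1 := wface_wface G (i := (0 : Fin (n + 2))) (j := 0) le_rfl x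
    have h2 := wface_wface G (i := (0 : Fin (n + 2))) (j := 0) le_rfl y
    have h3 : wface G (Fin.succ 0) x = wface G (Fin.succ 0) y := h'
    rw [h3] at h1
    exact h1.symm.trans h2

/-- Compatibility of the faces of a horn in `W̄ G`. -/
def WCompat {n : ℕ} (k : Fin (n + 3)) (c : Fin (n + 3) → (T ⟶ wbarObj G (n + 1))) : Prop :=
  ∀ i j : Fin (n + 2), i ≤ j → i.castSucc ≠ k → j.succ ≠ k →
    wface G i (c j.succ) = wface G j (c i.castSucc)

/-- The faces of the first component of a filler of a horn `Λ_{k+1}` in `W̄ G`. -/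
def topFaces {n : ℕ} (c : Fin (n + 3) → (T ⟶ wbarObj G (n + 1))) (i : Fin (n + 2)) :
    T ⟶ level G n :=
  if i = 0 then wtop G (c 1) * (wtop G (c 0))⁻¹ else wtop G (c i.succ)

theorem comp_topFaces {S : C} (t : S ⟶ T) {n : ℕ} (c : Fin (n + 3) → (T ⟶ wbarObj G (n + 1)))
    (i : Fin (n + 2)) : t ≫ topFaces G c i = topFaces G (fun j => t ≫ c j) i := by
  unfold topFaces
  split_ifs
  · simp only [MonObj.comp_mul, GrpObj.comp_inv, comp_wtop]
  · exact comp_wtop G t _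

theorem pull_topFaces_of_ne {n : ℕ} {k : Fin (n + 4)}
    {c : Fin (n + 4) → (T ⟶ wbarObj G (n + 2))} (hc : WCompat G k c) {i j : Fin (n + 2)}
    (hij : i ≤ j) (hi0 : i ≠ 0) (hi : i.castSucc.succ ≠ k) (hj : j.succ.succ ≠ k) :
    pull G (SimplexCategory.δ i) (topFaces G c j.succ) =
      pull G (SimplexCategory.δ j) (topFaces G c i.castSucc) := by
  have hj0 : j ≠ 0 := by rintro rfl; exact hi0 (by simpa using hij)
  have h := congrArg (wtop G) (hc i.succ j.succ (by simpa using hij) (by simpa using hi) hj)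
  rw [wtop_wface_succ G hi0, wtop_wface_succ G hj0] at h
  rw [topFaces, topFaces, if_neg (Fin.succ_ne_zero j), if_neg (by simpa using hi0)]
  exact h

theorem faceCompat_topFaces {n : ℕ} {k : Fin (n + 2)}
    {c : Fin (n + 3) → (T ⟶ wbarObj G (n + 1))} (hc : WCompat G k.succ c) :
    FaceCompat G k (topFaces G c) := by
  cases n with
  | zero => exact faceCompat_zero G k _
  | succ n =>
    refine faceCompat_succ G fun i j hij hi hj => ?_
    by_cases hi0 : i = 0
    · subst hi0
      rw [topFaces, topFaces, if_neg (Fin.succ_ne_zero j), if_pos (by rfl)]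
      have hj' : j.succ.succ ≠ k.succ := by simpa using hj
      have h1k : (1 : Fin (n + 4)) ≠ k.succ := by
        rw [← Fin.succ_zero_eq_one]; exact fun h => hi (Fin.succ_injective _ h)
      have h0k : (0 : Fin (n + 4)) ≠ k.succ := (Fin.succ_ne_zero k).symm
      have a1 := congrArg (wtop G) (hc 1 j.succ (by simp [Fin.le_def]) (by simpa using h1k) hj')
      have a0 := congrArg (wtop G) (hc 0 j.succ (by simp) (by simpa using h0k) hj')
      rw [wtop_wface_one] at a1
      rw [a0] at a1
      change _ = wtop G (wface G j.succ (c 1)) at a1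
      change pull G _ _ * wtop G (wface G j.succ (c 0)) = _ at a1
      rw [map_mul, map_inv, eq_mul_inv_iff_mul_eq]
      by_cases hj0 : j = 0
      · subst hj0
        have b := congrArg (wtop G) (hc 0 0 le_rfl (by simpa using h0k) (by simpa using h1k))
        change wtop G (wface G 0 (c 1)) = wtop G (wface G 0 (c 0)) at b
        change _ * wtop G (wface G 1 (c 0)) = wtop G (wface G 1 (c 1)) at a1
        rw [wtop_wface_one, wtop_wface_one, b, ← mul_assoc] at a1
        exact mul_right_cancel a1
      · rw [wtop_wface_succ G hj0, wtop_wface_succ G hj0] at a1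
        exact a1
    · exact pull_topFaces_of_ne G hc hij hi0 (by simpa using hi) (by simpa using hj)

theorem faceCompat_topFaces_zero {n : ℕ}
    {c : Fin (n + 3) → (T ⟶ wbarObj G (n + 1))} (hc : WCompat G 0 c) :
    FaceCompat G 0 (topFaces G c) := by
  cases n with
  | zero => exact faceCompat_zero G 0 _
  | succ _ =>
    refine faceCompat_succ G fun i j hij hi _ => ?_
    exact pull_topFaces_of_ne G hc hij (by simpa using hi) (Fin.succ_ne_zero _) (Fin.succ_ne_zero _)

/-- A filler of the horn with faces `c`, which is `x` if `x` is a filler. -/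
def wfill : {n : ℕ} → (k : Fin (n + 2)) → (Fin (n + 2) → (T ⟶ wbarObj G n)) →
    (T ⟶ wbarObj G (n + 1)) → (T ⟶ wbarObj G (n + 1))
  | 0, _, _, x => x
  | _ + 1, k, c, x =>
    Fin.cases
      (wcons G (mooreFill G (topFaces G c) (mooreList 0) (wtop G x))
        (wcons G ((pull G (SimplexCategory.δ 0)
          (mooreFill G (topFaces G c) (mooreList 0) (wtop G x)))⁻¹ * wtop G (c 1))
          (wface G 0 (c 1))))
      (fun k' => wcons G (mooreFill G (topFaces G c) (mooreList k') (wtop G x)) (c 0)) k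

theorem comp_wfill {S : C} (t : S ⟶ T) {n : ℕ} (k : Fin (n + 2))
    (c : Fin (n + 2) → (T ⟶ wbarObj G n)) (x : T ⟶ wbarObj G (n + 1)) :
    t ≫ wfill G k c x = wfill G k (fun i => t ≫ c i) (t ≫ x) := by
  cases n with
  | zero => rfl
  | succ n =>
    cases k using Fin.cases with
    | zero =>
      simp only [wfill, Fin.cases_zero, comp_wcons, comp_mooreFill, MonObj.comp_mul,
        GrpObj.comp_inv, comp_pull, comp_wtop, comp_wface, comp_topFaces]
    | succ k =>
      simp only [wfill, Fin.cases_succ, comp_wcons, comp_mooreFill, comp_wtop, comp_topFaces]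

theorem wfill_self {n : ℕ} (k : Fin (n + 2)) (c : Fin (n + 2) → (T ⟶ wbarObj G n))
    (x : T ⟶ wbarObj G (n + 1)) (h : ∀ i, i ≠ k → c i = wface G i x) : wfill G k c x = x := by
  cases n with
  | zero => rfl
  | succ n =>
    cases k using Fin.cases with
    | zero =>
      have e : mooreFill G (topFaces G c) (mooreList 0) (wtop G x) = wtop G x := by
        refine mooreFill_mooreList_self G fun i hi => ?_
        rw [topFaces, if_neg hi, h _ (Fin.succ_ne_zero i), wtop_wface_succ G hi]
      simp only [wfill, Fin.cases_zero, e]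
      rw [h 1 (by simp)]
      refine wext G (wtop_wcons G _ _) ((wface_wcons G _ _).trans (wext G ?_ ?_))
      · rw [wtop_wcons, wtop_wface_one]; simp
      · rw [wface_wcons]
        exact wface_wface G (i := (0 : Fin (n + 2))) (j := 0) le_rfl x
    | succ k =>
      have h0 := h 0 (Fin.succ_ne_zero k).symm
      have e : mooreFill G (topFaces G c) (mooreList k) (wtop G x) = wtop G x := by
        refine mooreFill_mooreList_self G fun i hi => ?_
        rw [topFaces]
        split_ifs with hi0
        · subst hi0
          rw [h0, h 1 (fun h' => hi (Fin.succ_injective _ h')), wtop_wface_one]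
          simp
        · rw [h _ (fun h' => hi (Fin.succ_injective _ h')), wtop_wface_succ G hi0]
      simp only [wfill, Fin.cases_succ, e, h0]
      exact wcons_wface G x

theorem wface_wfill_zero (k : Fin 2) (c : Fin 2 → (T ⟶ wbarObj G 0)) (x : T ⟶ wbarObj G 1)
    (i : Fin 2) : wface G i (wfill G k c x) = c i := wext_zero G _ _

theorem wface_wfill {n : ℕ} {k : Fin (n + 3)} {c : Fin (n + 3) → (T ⟶ wbarObj G (n + 1))}
    (hc : WCompat G k c) (x : T ⟶ wbarObj G (n + 2)) {i : Fin (n + 3)} (hi : i ≠ k) :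
    wface G i (wfill G k c x) = c i := by
  cases k using Fin.cases with
  | zero =>
    obtain ⟨i, rfl⟩ := Fin.exists_succ_eq.2 hi
    have hy := faceCompat_topFaces_zero G hc
    simp only [wfill, Fin.cases_zero]
    set g := mooreFill G (topFaces G c) (mooreList 0) (wtop G x) with hg
    set z := wcons G g (wcons G ((pull G (SimplexCategory.δ 0) g)⁻¹ * wtop G (c 1))
      (wface G 0 (c 1))) with hz
    have h1 : wface G 1 z = c 1 := by
      refine wext G ?_ ?_
      · rw [wtop_wface_one, hz, wface_wcons, wtop_wcons, wtop_wcons]; simp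
      · refine (wface_wface G (i := (0 : Fin (n + 2))) (j := 0) le_rfl z).trans ?_
        change wface G 0 (wface G 0 z) = _
        rw [hz, wface_wcons, wface_wcons]
    by_cases hi0 : i = 0
    · subst hi0; exact h1
    have htop : wtop G (wface G i.succ z) = wtop G (c i.succ) := by
      rw [wtop_wface_succ G hi0, hz, wtop_wcons, hg, face_mooreFill_mooreList G hy _ hi0, topFaces,
        if_neg hi0]
    obtain ⟨j, rfl⟩ := Fin.exists_succ_eq.2 hi0
    cases n with
    | zero => exact wext G htop (wext_zero G _ _)
    | succ n =>
      refine wext_one G htop ?_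
      have h1j : (1 : Fin (n + 3)) ≤ j.succ := by simp [Fin.le_def]
      refine (wface_wface G h1j z).trans ?_
      have h2 := hc 1 j.succ h1j (by simp) hi
      rw [h2]
      exact congrArg _ h1
  | succ k =>
    have hy := faceCompat_topFaces G hc
    simp only [wfill, Fin.cases_succ]
    cases i using Fin.cases with
    | zero => exact wface_wcons G _ _
    | succ i =>
      have hik : i ≠ k := fun h => hi (congrArg Fin.succ h)
      have hf := face_mooreFill_mooreList G hy (wtop G x) hik
      refine wext G ?_ ?_
      · by_cases hi0 : i = 0
        · subst hi0
          refine (wtop_wface_one G _).trans ?_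
          rw [wtop_wcons, wface_wcons, hf, topFaces, if_pos rfl]
          simp
        · rw [wtop_wface_succ G hi0, wtop_wcons, hf, topFaces, if_neg hi0]
      · refine (wface_wface G (Fin.zero_le i) _).trans ?_
        refine Eq.trans ?_ (hc 0 i (Fin.zero_le i) (Fin.succ_ne_zero k).symm hi).symm
        exact congrArg _ (wface_wcons G _ _)

/-- The `i`-th face as an element of the horn `Λ_k`. -/
def hornFace {n : ℕ} {k i : Fin (n + 2)} (h : i ≠ k) : (SSet.horn.{0} (n + 1) k : SSet.{0}).Elements :=
  ⟨op (.mk n), ⟨SSet.stdSimplex.objEquiv.symm (SimplexCategory.δ i),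
    (SSet.objEquiv_symm_δ_mem_horn_iff i k).2 h⟩⟩

theorem hornElement_hornFace {n : ℕ} {k i : Fin (n + 2)} (h : i ≠ k) :
    hornElement (hornFace h) = (SimplexCategory.δ i).op := by
  unfold hornElement hornFace
  simp

theorem horn_hom_ext {n : ℕ} {k : Fin (n + 1)} {e e' : (SSet.horn.{0} n k : SSet.{0}).Elements}
    (f : e.1 ⟶ e'.1) (h : hornElement e' = hornElement e ≫ f) :
    (SSet.horn.{0} n k : SSet.{0}).map f e.2 = e'.2 := by
  refine Subtype.ext (SSet.stdSimplex.objEquiv.injective ?_)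
  exact (Quiver.Hom.op_inj h).symm

theorem exists_hornFace {n : ℕ} {k : Fin (n + 2)} (e : (SSet.horn.{0} (n + 1) k : SSet.{0}).Elements) :
    ∃ (i : Fin (n + 2)) (h : i ≠ k), Nonempty (hornFace h ⟶ e) := by
  obtain ⟨⟨⟨p⟩⟩, ⟨s, hs⟩⟩ := e
  obtain ⟨i, hi, h⟩ := (SSet.mem_horn_iff_notMem_range s k).1 hs
  obtain ⟨β, hβ⟩ := SimplexCategory.eq_comp_δ_of_not_surjective' (SSet.stdSimplex.objEquiv s) i
    fun x hx => h ⟨x, hx⟩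
  exact ⟨i, hi, ⟨β.op, horn_hom_ext _ (by rw [hornElement_hornFace]; exact congrArg Quiver.Hom.op hβ)⟩⟩

/-- The faces of a horn, where the missing face is replaced by that of `x`. -/
def coneFaces {n : ℕ} {k : Fin (n + 2)}
    (c : (Functor.const _).obj T ⟶ hornDiagram (Wbar.obj G) (n + 1) k)
    (x : T ⟶ wbarObj G (n + 1)) (i : Fin (n + 2)) : T ⟶ wbarObj G n :=
  if h : i ≠ k then c.app (hornFace h) else wface G i x

theorem coneFaces_of_ne {n : ℕ} {k : Fin (n + 2)}
    (c : (Functor.const _).obj T ⟶ hornDiagram (Wbar.obj G) (n + 1) k)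
    (x : T ⟶ wbarObj G (n + 1)) {i : Fin (n + 2)} (h : i ≠ k) :
    coneFaces G c x i = c.app (hornFace h) := dif_pos h

theorem coneFaces_of_eq {n : ℕ} {k : Fin (n + 2)}
    (c : (Functor.const _).obj T ⟶ hornDiagram (Wbar.obj G) (n + 1) k)
    (x : T ⟶ wbarObj G (n + 1)) {i : Fin (n + 2)} (h : ¬ i ≠ k) :
    coneFaces G c x i = wface G i x := dif_neg h

theorem wcompat_coneFaces {n : ℕ} {k : Fin (n + 3)}
    (c : (Functor.const _).obj T ⟶ hornDiagram (Wbar.obj G) (n + 2) k)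
    (x : T ⟶ wbarObj G (n + 2)) : WCompat G k (coneFaces G c x) := by
  intro i j hij hi hj
  rw [coneFaces_of_ne G c x hi, coneFaces_of_ne G c x hj]
  have hδ := SimplexCategory.δ_comp_δ hij
  let E : (SSet.horn.{0} (n + 2) k : SSet.{0}).Elements :=
    ⟨op (.mk n), (SSet.horn.{0} (n + 2) k : SSet.{0}).map (SimplexCategory.δ i).op (hornFace hj).2⟩
  let f : hornFace hj ⟶ E := ⟨(SimplexCategory.δ i).op, rfl⟩
  have hE : hornElement E = hornElement (hornFace hj) ≫ (SimplexCategory.δ i).op := rfl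
  let g : hornFace hi ⟶ E := ⟨(SimplexCategory.δ j).op, horn_hom_ext _ (by
    rw [hE, hornElement_hornFace, hornElement_hornFace]; exact congrArg Quiver.Hom.op hδ)⟩
  have h1 := c.naturality f
  have h2 := c.naturality g
  exact h1.symm.trans h2

/-- The horns of `W̄ G` can be filled by natural formulas. -/
def wbarHornFiller (n : ℕ) (hn : 1 ≤ n) (k : Fin (n + 1)) : HornFiller (Wbar.obj G) n k :=
  match n, hn, k with
  | n + 1, _, k =>
    { fill := fun c x => wfill G k (coneFaces G c x) x
      fill_app := fun {T} c x e => by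
        have key : ∀ (i) (h : i ≠ k),
            wface G i (wfill G k (coneFaces G c x) x) = c.app (hornFace h) := by
          intro i h
          rw [← coneFaces_of_ne G c x h]
          cases n with
          | zero => exact wface_wfill_zero G _ _ _ _
          | succ n => exact wface_wfill G (wcompat_coneFaces G c x) x h
        obtain ⟨i, h, ⟨f⟩⟩ := exists_hornFace e
        have h1 := c.naturality f
        have h2 : hornElement e = hornElement (hornFace h) ≫ f.1 :=
          congrArg (fun x : (SSet.horn.{0} (n + 1) k : SSet.{0}).obj e.1 =>
            (SSet.stdSimplex.objEquiv x.1).op) f.2.symm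
        rw [h2, hornElement_hornFace]
        refine (congrArg (wfill G k (coneFaces G c x) x ≫ ·)
          ((Wbar.obj G).map_comp (SimplexCategory.δ i).op f.1)).trans ?_
        refine (Category.assoc _ _ _).symm.trans ?_
        refine (congrArg (· ≫ (Wbar.obj G).map f.1) (key i h)).trans ?_
        exact h1.symm.trans (Category.id_comp _)
      fill_res := fun {T} x => by
        refine wfill_self G k _ x fun i h => ?_
        refine (dif_pos h).trans ?_
        change x ≫ (Wbar.obj G).map (hornElement (hornFace h)) = _
        rw [hornElement_hornFace]
        rfl
      fill_nat := fun {S T} t c x => by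
        refine (comp_wfill G t k _ x).trans ?_
        congr 1
        funext i
        by_cases h : i ≠ k
        · exact (congrArg (t ≫ ·) (coneFaces_of_ne G c x h)).trans
            (coneFaces_of_ne G ((Functor.const _).map t ≫ c) (t ≫ x) h).symm
        · exact (congrArg (t ≫ ·) (coneFaces_of_eq G c x h)).trans
            ((comp_wface G t i x).trans (coneFaces_of_eq G _ _ h).symm) }

end WbarFiller

end

end FormalLie

end

noncomputable section

namespace FormalLie

section

open scoped TensorProduct
open Filter Asymptotics

theorem LinTopAlg.evalR_of {A : Type u} [CommRing A] [Algebra ℝ A] (m : Ideal A) (n : ℕ) (a : A) :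
    evalR m n (AdicCompletion.of m A a) = Ideal.Quotient.mk (m ^ n) a :=
  AdicCompletion.evalₐ_of m n a

namespace PtdMfd

variable (X : PtdMfd.{u})

/-- The evaluation of point distributions on a germ. -/
def distEval (a : X.germs) : X.dist.carrier →ₗ[ℝ] ℝ :=
  LinTopAlg.ev (A := LinTopAlg.completion X.maxIdeal X.finite_germs)
    (algebraMap X.germs (AdicCompletion X.maxIdeal X.germs) a)

theorem distEval_apply (a : X.germs) (φ : X.dist.carrier) : X.distEval a φ =
    (show LinTopAlg.contDual (LinTopAlg.completion X.maxIdeal X.finite_germs) from φ).1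
      (AdicCompletion.of X.maxIdeal X.germs a) := rfl

/-- A point distribution as a linear functional on germs. -/
def distFun (φ : X.dist.carrier) : X.germs →ₗ[ℝ] ℝ :=
  (show LinTopAlg.contDual (LinTopAlg.completion X.maxIdeal X.finite_germs) from φ).1 ∘ₗ
    ((Algebra.ofId X.germs (AdicCompletion X.maxIdeal X.germs)).restrictScalars ℝ).toLinearMap

theorem distFun_apply (φ : X.dist.carrier) (a : X.germs) : X.distFun φ a = X.distEval a φ := rfl

theorem exists_distFun_vanish (φ : X.dist.carrier) :
    ∃ n, ∀ a ∈ X.maxIdeal ^ n, X.distEval a φ = 0 := by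
  obtain ⟨φ, n, hn⟩ := φ
  refine ⟨n, fun a ha => hn _ ?_⟩
  change LinTopAlg.evalR X.maxIdeal n (AdicCompletion.of X.maxIdeal X.germs a) = 0
  rw [LinTopAlg.evalR_of]
  exact Ideal.Quotient.eq_zero_iff_mem.2 ha

theorem dist_eq_zero {φ : X.dist.carrier} (h : ∀ a, X.distEval a φ = 0) : φ = 0 := by
  obtain ⟨φ, n, hn⟩ := φ
  refine Subtype.ext (LinearMap.ext fun x => ?_)
  obtain ⟨a, ha⟩ := Ideal.Quotient.mk_surjective (LinTopAlg.evalR X.maxIdeal n x)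
  let A : AdicCompletion X.maxIdeal X.germs := AdicCompletion.of X.maxIdeal X.germs a
  let y : AdicCompletion X.maxIdeal X.germs := x
  have h1 : φ (y - A) = 0 := by
    refine hn _ ?_
    change LinTopAlg.evalR X.maxIdeal n (y - A) = 0
    rw [map_sub, LinTopAlg.evalR_of, ha, sub_self]
  have h2 : φ A = 0 := h a
  have h3 : φ y - φ A = 0 :=
    (map_sub φ (y : (LinTopAlg.completion X.maxIdeal X.finite_germs).carrier) A).symm.trans h1
  exact (sub_eq_zero.1 h3).trans h2

theorem dist_ext {φ ψ : X.dist.carrier} (h : ∀ a, X.distEval a φ = X.distEval a ψ) : φ = ψ := by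
  rw [← sub_eq_zero]
  exact X.dist_eq_zero fun a => by rw [map_sub, h, sub_self]

/-- The point distribution defined by a continuous functional on germs. -/
def mkDist (p : X.germs →ₗ[ℝ] ℝ) (n : ℕ) (h : ∀ a ∈ X.maxIdeal ^ n, p a = 0) : X.dist.carrier :=
  (⟨((X.maxIdeal ^ n).restrictScalars ℝ).liftQ p (fun a ha => h a ha) ∘ₗ
      (LinTopAlg.evalR X.maxIdeal n).toLinearMap, n, fun a ha => by
    have : LinTopAlg.evalR X.maxIdeal n a = 0 := ha
    exact (congrArg (((X.maxIdeal ^ n).restrictScalars ℝ).liftQ p (fun a ha => h a ha)) this).trans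
      (map_zero _)⟩ : LinTopAlg.contDual (LinTopAlg.completion X.maxIdeal X.finite_germs))

theorem distEval_mkDist (p : X.germs →ₗ[ℝ] ℝ) (n : ℕ) (h) (a : X.germs) :
    X.distEval a (X.mkDist p n h) = p a := by
  change ((X.maxIdeal ^ n).restrictScalars ℝ).liftQ p (fun a ha => h a ha)
    (LinTopAlg.evalR X.maxIdeal n (AdicCompletion.of X.maxIdeal X.germs a)) = p a
  rw [LinTopAlg.evalR_of]
  rfl

theorem counit_dist (φ : X.dist.carrier) : Coalgebra.counit (R := ℝ) φ = X.distEval 1 φ := by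
  change (LinTopAlg.ev (A := LinTopAlg.completion X.maxIdeal X.finite_germs) 1) φ = _
  rw [distEval, map_one]
  rfl

theorem distEval_comul (φ : X.dist.carrier) (a b : X.germs) :
    tensorFunctional (X.distEval a) (X.distEval b) (Coalgebra.comul (R := ℝ) φ) =
      X.distEval (a * b) φ := by
  refine (LinTopAlg.ev₂_comul
    (show LinTopAlg.contDual (LinTopAlg.completion X.maxIdeal X.finite_germs) from φ) _ _).trans ?_
  exact congrArg (show LinTopAlg.contDual (LinTopAlg.completion X.maxIdeal X.finite_germs) from φ).1
    (map_mul (algebraMap X.germs (AdicCompletion X.maxIdeal X.germs)) a b).symm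

theorem distEval_distMap {Y : PtdMfd.{u}} (f : X ⟶ Y) (φ : X.dist.carrier) (a : Y.germs) :
    Y.distEval a ((Dist.map f).toCoalgHom φ) = X.distEval (germMap f a) φ := by
  change (show LinTopAlg.contDual (LinTopAlg.completion X.maxIdeal X.finite_germs) from φ).1
    (LinTopAlg.completionMap (germMap f) (germMap_maxIdeal f)
      (AdicCompletion.of Y.maxIdeal Y.germs a)) = _
  rw [distEval_apply]
  refine congrArg _ (AdicCompletion.ext_evalₐ fun n => ?_)
  rw [LinTopAlg.eval_completionMap, LinTopAlg.evalR_of, AdicCompletion.evalₐ_of]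
  rfl

/-- The chart at the base point, centered at zero. -/
def chart : X.carrier → X.E := fun y => extChartAt X.I X.pt y - extChartAt X.I X.pt X.pt

theorem chart_pt : X.chart X.pt = 0 := sub_self _

theorem contMDiffAt_chart : ∀ᶠ y in 𝓝 X.pt, ContMDiffAt X.I 𝓘(ℝ, X.E) ∞ X.chart y := by
  filter_upwards [extChartAt_source_mem_nhds (I := X.I) X.pt] with y hy
  have : ContMDiffAt X.I 𝓘(ℝ, X.E) ∞ (extChartAt X.I X.pt) y :=
    contMDiffAt_extChartAt' (by rwa [← extChartAt_source X.I])
  exact this.sub contMDiffAt_const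

theorem contMDiffAt_comp_chart {g : X.E → ℝ} (hg : ContDiff ℝ ∞ g) :
    ∀ᶠ y in 𝓝 X.pt, ContMDiffAt X.I 𝓘(ℝ) ∞ (fun y => g (X.chart y)) y := by
  filter_upwards [X.contMDiffAt_chart] with y hy
  exact hg.contMDiff.contMDiffAt.comp y hy

/-- The germ of a smooth function of the coordinates. -/
def chartGerm (g : X.E → ℝ) (hg : ContDiff ℝ ∞ g) : X.germs :=
  mkGerm X.I X.pt (fun y => g (X.chart y)) (X.contMDiffAt_comp_chart hg)

theorem exists_chartGerm (a : X.germs) : ∃ h hh, a = X.chartGerm h hh := by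
  obtain ⟨f, hf, rfl⟩ := mkGerm_surj X.I a
  set x := X.pt
  set e := extChartAt X.I x with he
  have h₀ : ∀ᶠ v in 𝓝 (e x), ContDiffAt ℝ ∞ (f ∘ e.symm) v := by
    have h₁ := (continuousAt_extChartAt_symm (I := X.I) x).eventually
      (by rw [extChartAt_to_inv]; exact hf)
    filter_upwards [h₁, extChartAt_target_mem_nhds (I := X.I) x] with v hv hvt
    have s₁ : ContMDiffAt 𝓘(ℝ, X.E) X.I ∞ e.symm v :=
      (contMDiffOn_extChartAt_symm (I := X.I) x).contMDiffAt
        ((isOpen_extChartAt_target (I := X.I) x).mem_nhds hvt)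
    exact (ContMDiffAt.comp v hv s₁).contDiffAt
  obtain ⟨r, hr, hball⟩ := Metric.eventually_nhds_iff_ball.1 h₀
  let ρ : ContDiffBump (0 : X.E) := ⟨r / 4, r / 2, by positivity, by linarith⟩
  let h : X.E → ℝ := fun v => ρ v * f (e.symm (e x + v))
  have hh : ContDiff ℝ ∞ h := by
    rw [contDiff_iff_contDiffAt]
    intro v
    by_cases hv : v ∈ Metric.ball (0 : X.E) r
    · refine ρ.contDiff.contDiffAt.mul ?_
      have h₂ := hball (e x + v) (by simpa using hv)
      exact ContDiffAt.comp (f := fun w => e x + w) (g := f ∘ e.symm) v h₂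
        (contDiff_const.add contDiff_id).contDiffAt
    · have hv' : v ∉ Metric.closedBall (0 : X.E) (r / 2) := by
        simp only [Metric.mem_ball, Metric.mem_closedBall, dist_zero_right] at hv ⊢
        linarith
      have : h =ᶠ[𝓝 v] fun _ => 0 := by
        filter_upwards [Metric.isClosed_closedBall.isOpen_compl.mem_nhds hv'] with w hw
        have : ρ w = 0 := ρ.zero_of_le_dist (by
          simp only [Set.mem_compl_iff, Metric.mem_closedBall, not_le] at hw
          exact hw.le)
        simp [h, this]
      exact contDiffAt_const.congr_of_eventuallyEq this
  refine ⟨h, hh, (mkGerm_eq_iff X.I _ _).2 ?_⟩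
  have hclose : ∀ᶠ y in 𝓝 x, ρ (X.chart y) = 1 := by
    have : ContinuousAt X.chart x := (continuousAt_extChartAt x).sub continuousAt_const
    have h₃ := this.eventually (p := fun v => v ∈ Metric.closedBall (0 : X.E) (r / 4))
      (by rw [X.chart_pt]; exact Metric.closedBall_mem_nhds _ (by positivity))
    exact h₃.mono fun y hy => ρ.one_of_mem_closedBall hy
  filter_upwards [hclose, extChartAt_source_mem_nhds (I := X.I) x] with y hy hys
  simp only [h, hy, one_mul]
  rw [chart, add_sub_cancel, e.left_inv hys]

section Coordinates

variable {σ : Type*} [Fintype σ] (b : Module.Basis σ ℝ X.E)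

theorem contDiff_coord {E : Type*} [NormedAddCommGroup E] [NormedSpace ℝ E] [FiniteDimensional ℝ E]
    {σ : Type*} (b : Module.Basis σ ℝ E) (i : σ) : ContDiff ℝ ∞ (b.coord i) :=
  (LinearMap.toContinuousLinearMap (b.coord i)).contDiff

/-- The germs of the coordinate functions. -/
def coordGerm (i : σ) : X.germs := X.chartGerm (b.coord i) (contDiff_coord b i)

omit [Fintype σ] in
theorem coordGerm_mem (i : σ) : X.coordGerm b i ∈ X.maxIdeal := by
  change b.coord i (X.chart X.pt) = 0
  rw [X.chart_pt, map_zero]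

theorem exists_coordGerm_expansion (a : X.germs) :
    ∃ (r : ℝ) (g : σ → X.germs), a = algebraMap ℝ X.germs r + ∑ i, X.coordGerm b i * g i := by
  obtain ⟨h, hh, rfl⟩ := X.exists_chartGerm a
  let ε := Fintype.equivFin σ
  obtain ⟨g, hg, hsum⟩ := hadamard (b.reindex ε) (h := fun v => h v - h 0)
    (hh.sub contDiff_const) (sub_self _)
  refine ⟨h 0, fun i => X.chartGerm (g (ε i)) (hg _), Subtype.ext ?_⟩
  have hr : ((algebraMap ℝ X.germs (h 0) + ∑ i, X.coordGerm b i * X.chartGerm (g (ε i)) (hg _) :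
      X.germs) : Germ (𝓝 X.pt) ℝ) =
      (((fun _ => h 0) + ∑ i, fun y => b.coord i (X.chart y) * g (ε i) (X.chart y) :
        X.carrier → ℝ) : Germ (𝓝 X.pt) ℝ) := by
    change (algebraMap ℝ (Germ (𝓝 X.pt) ℝ) (h 0)) + _ = _
    rw [algebraMap_germ, AddSubmonoidClass.coe_finsetSum, Germ.coe_add]
    congr 1
    exact (map_sum (Germ.coeRingHom (𝓝 X.pt) (R := ℝ)) _ _).symm
  rw [hr]
  refine Germ.coe_eq.2 (Eventually.of_forall fun y => ?_)
  have := hsum (X.chart y)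
  rw [← Equiv.sum_comp ε] at this
  simp only [Module.Basis.coord_apply, Module.Basis.repr_reindex_apply, Equiv.symm_apply_apply]
    at this
  simp only [Pi.add_apply, Finset.sum_apply, Module.Basis.coord_apply]
  linarith

/-- Polynomials in the coordinates, as germs. -/
def polyGerm : MvPolynomial σ ℝ →ₐ[ℝ] X.germs := MvPolynomial.aeval (X.coordGerm b)

theorem exists_polyGerm_sub_mem (n : ℕ) (a : X.germs) :
    ∃ P, a - X.polyGerm b P ∈ X.maxIdeal ^ n := by
  induction n generalizing a with
  | zero => exact ⟨0, by simp⟩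
  | succ n ih =>
    obtain ⟨r, g, rfl⟩ := X.exists_coordGerm_expansion b a
    choose P hP using fun i => ih (g i)
    refine ⟨MvPolynomial.C r + ∑ i, MvPolynomial.X i * P i, ?_⟩
    have : X.polyGerm b (MvPolynomial.C r + ∑ i, MvPolynomial.X i * P i) =
        algebraMap ℝ X.germs r + ∑ i, X.coordGerm b i * X.polyGerm b (P i) := by
      simp only [polyGerm, map_add, map_sum, map_mul, MvPolynomial.aeval_X, MvPolynomial.aeval_C]
    rw [this, add_sub_add_left_eq_sub, ← Finset.sum_sub_distrib]
    refine Ideal.sum_mem _ fun i _ => ?_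
    rw [← mul_sub, pow_succ']
    exact Ideal.mul_mem_mul (X.coordGerm_mem b i) (hP i)

omit [Fintype σ] in
theorem polyGerm_monomial_mem (α : σ →₀ ℕ) {n : ℕ} (h : n ≤ α.degree) :
    X.polyGerm b (MvPolynomial.monomial α 1) ∈ X.maxIdeal ^ n := by
  refine Ideal.pow_le_pow_right h ?_
  rw [polyGerm, MvPolynomial.aeval_monomial, map_one, one_mul, Finsupp.prod,
    Finsupp.degree_apply, ← Finset.prod_pow_eq_pow_sum]
  exact Ideal.prod_mem_prod fun i _ => Ideal.pow_mem_pow (X.coordGerm_mem b i) _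

/-- The line in direction `v` through the base point, in the chart. -/
def chartLine (v : X.E) (t : ℝ) : X.carrier :=
  (extChartAt X.I X.pt).symm (extChartAt X.I X.pt X.pt + t • v)

theorem continuousAt_line (v : X.E) :
    Tendsto (fun t : ℝ => extChartAt X.I X.pt X.pt + t • v) (𝓝 0)
      (𝓝 (extChartAt X.I X.pt X.pt)) := by
  have : Continuous fun t : ℝ => extChartAt X.I X.pt X.pt + t • v := by fun_prop
  simpa using this.tendsto 0

theorem tendsto_chartLine (v : X.E) : Tendsto (X.chartLine v) (𝓝 0) (𝓝 X.pt) := by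
  have h := (continuousAt_extChartAt_symm (I := X.I) X.pt).tendsto
  rw [extChartAt_to_inv] at h
  exact h.comp (X.continuousAt_line v)

theorem chart_chartLine (v : X.E) : ∀ᶠ t in 𝓝 0, X.chart (X.chartLine v t) = t • v := by
  filter_upwards [(X.continuousAt_line v).eventually
    (extChartAt_target_mem_nhds (I := X.I) X.pt)] with t ht
  rw [chart, chartLine, PartialEquiv.right_inv _ ht, add_sub_cancel_left]

/-- The ideal of germs which vanish to order `n` along a line. -/
def lineIdeal (v : X.E) (n : ℕ) : Ideal X.germs where
  carrier := {a | ∀ f hf, mkGerm X.I X.pt f hf = a →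
    (fun t => f (X.chartLine v t)) =O[𝓝 0] fun t : ℝ => t ^ n}
  zero_mem' f hf h := by
    have h' : f =ᶠ[𝓝 X.pt] fun _ => 0 := Germ.coe_eq.1 (congrArg Subtype.val h)
    exact (h'.comp_tendsto (X.tendsto_chartLine v)).isBigO.trans (isBigO_zero _ _)
  add_mem' := by
    intro a a' ha ha' f hf h
    obtain ⟨g, hg, rfl⟩ := mkGerm_surj X.I a
    obtain ⟨g', hg', rfl⟩ := mkGerm_surj X.I a'
    have h' : f =ᶠ[𝓝 X.pt] g + g' := Germ.coe_eq.1 (congrArg Subtype.val h)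
    exact (h'.comp_tendsto (X.tendsto_chartLine v)).isBigO.trans ((ha g hg rfl).add (ha' g' hg' rfl))
  smul_mem' := by
    intro a a' ha' f hf h
    obtain ⟨g, hg, rfl⟩ := mkGerm_surj X.I a
    obtain ⟨g', hg', rfl⟩ := mkGerm_surj X.I a'
    have h' : f =ᶠ[𝓝 X.pt] g * g' := Germ.coe_eq.1 (congrArg Subtype.val h)
    have hc : (fun t => g (X.chartLine v t)) =O[𝓝 0] fun _ : ℝ => (1 : ℝ) :=
      (hg.self_of_nhds.continuousAt.tendsto.comp (X.tendsto_chartLine v)).isBigO_one ℝ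
    refine (h'.comp_tendsto (X.tendsto_chartLine v)).isBigO.trans ?_
    have := hc.mul (ha' g' hg' rfl)
    simp only [one_mul] at this
    exact this

theorem mul_mem_lineIdeal {v : X.E} {n : ℕ} {a a' : X.germs} (ha : a ∈ X.maxIdeal)
    (ha' : a' ∈ X.lineIdeal v n) : a * a' ∈ X.lineIdeal v (n + 1) := by
  intro f hf h
  obtain ⟨g, hg, rfl⟩ := X.exists_chartGerm a
  obtain ⟨g', hg', rfl⟩ := mkGerm_surj X.I a'
  have h' : f =ᶠ[𝓝 X.pt] fun y => g (X.chart y) * g' y :=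
    Germ.coe_eq.1 (congrArg Subtype.val h)
  have h0 : g 0 = 0 := by
    rw [← X.chart_pt]; exact ha
  have hc : (fun t => g (X.chart (X.chartLine v t))) =O[𝓝 0] fun t : ℝ => t := by
    have h1 : (fun t => g (X.chart (X.chartLine v t))) =ᶠ[𝓝 0] fun t => g (t • v) :=
      (X.chart_chartLine v).mono fun t ht => by simp only [ht]
    refine h1.isBigO.trans ?_
    have hd : DifferentiableAt ℝ (fun t : ℝ => g (t • v)) 0 :=
      ((hg.differentiable (by simp)).comp (differentiable_id.smul_const v)) 0
    have := hd.isBigO_sub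
    simpa [h0] using this
  refine (h'.comp_tendsto (X.tendsto_chartLine v)).isBigO.trans ?_
  have := hc.mul (ha' g' hg' rfl)
  simp only [← pow_succ'] at this
  exact this

theorem maxIdeal_pow_le_lineIdeal (v : X.E) (n : ℕ) : X.maxIdeal ^ n ≤ X.lineIdeal v n := by
  induction n with
  | zero =>
    intro a _ f hf _
    simpa using (hf.self_of_nhds.continuousAt.tendsto.comp (X.tendsto_chartLine v)).isBigO_one ℝ
  | succ n ih =>
    rw [pow_succ', Ideal.mul_le]
    exact fun a ha a' ha' => X.mul_mem_lineIdeal ha (ih ha')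

theorem _root_.Polynomial.coeff_eq_zero_of_isBigO (q : Polynomial ℝ) (n : ℕ)
    (h : (fun t => q.eval t) =O[𝓝 0] fun t : ℝ => t ^ n) : ∀ i < n, q.coeff i = 0 := by
  rw [← Polynomial.X_pow_dvd_iff]
  induction n with
  | zero => simp
  | succ n ih =>
    obtain ⟨r, rfl⟩ := ih (h.trans (by
      simp_rw [pow_succ]
      simpa using (isBigO_refl (fun t : ℝ => t ^ n) (𝓝 0)).mul
        ((continuous_id.tendsto (0 : ℝ)).isBigO_one ℝ)))
    rw [pow_succ]
    refine mul_dvd_mul_left _ (Polynomial.X_dvd_iff.2 ?_)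
    have h1 : (fun t => r.eval t) =O[𝓝[≠] 0] fun t : ℝ => t := by
      obtain ⟨c, hc⟩ := h.bound
      refine IsBigO.of_bound c ?_
      filter_upwards [nhdsWithin_le_nhds hc, self_mem_nhdsWithin] with t ht ht0
      have ht0' : (t : ℝ) ≠ 0 := ht0
      simp only [Polynomial.eval_mul, Polynomial.eval_pow, Polynomial.eval_X, norm_mul, norm_pow,
        pow_succ] at ht ⊢
      have : 0 < ‖t‖ ^ n := by positivity
      rw [mul_left_comm] at ht
      exact le_of_mul_le_mul_left ht this
    have h2 : Tendsto (fun t => r.eval t) (𝓝[≠] 0) (𝓝 0) :=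
      h1.trans_tendsto (tendsto_id.mono_left nhdsWithin_le_nhds)
    have h3 : Tendsto (fun t => r.eval t) (𝓝[≠] 0) (𝓝 (r.eval 0)) :=
      (r.continuous.tendsto 0).mono_left nhdsWithin_le_nhds
    rw [Polynomial.coeff_zero_eq_eval_zero]
    exact tendsto_nhds_unique h3 h2

omit [Fintype σ] in
theorem polyGerm_eq (P : MvPolynomial σ ℝ) : ∃ hf, X.polyGerm b P =
    mkGerm X.I X.pt (fun y => MvPolynomial.eval (fun i => b.coord i (X.chart y)) P) hf := by
  induction P using MvPolynomial.induction_on with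
  | C r =>
    refine ⟨by simp only [MvPolynomial.eval_C]; exact Eventually.of_forall fun _ => contMDiffAt_const, ?_⟩
    rw [polyGerm, MvPolynomial.aeval_C]
    refine Subtype.ext ((algebraMap_germ (𝓝 X.pt) r).trans ?_)
    simp only [MvPolynomial.eval_C]
    rfl
  | add P Q hP hQ =>
    obtain ⟨h1, e1⟩ := hP
    obtain ⟨h2, e2⟩ := hQ
    refine ⟨(h1.and h2).mono fun y h => by
      simp only [map_add]; exact h.1.add h.2, ?_⟩
    rw [map_add, e1, e2]
    refine Subtype.ext ?_
    simp only [map_add]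
    rfl
  | mul_X P i hP =>
    obtain ⟨h1, e1⟩ := hP
    refine ⟨(h1.and (X.contMDiffAt_comp_chart (contDiff_coord b i))).mono fun y h => by
      simp only [map_mul, MvPolynomial.eval_X]; exact h.1.mul h.2, ?_⟩
    rw [map_mul, e1]
    have : X.polyGerm b (MvPolynomial.X i) = X.coordGerm b i := MvPolynomial.aeval_X _ _
    rw [this]
    refine Subtype.ext ?_
    simp only [map_mul, MvPolynomial.eval_X]
    rfl

theorem coeff_eq_zero_of_polyGerm_mem {P : MvPolynomial σ ℝ} {n : ℕ}
    (h : X.polyGerm b P ∈ X.maxIdeal ^ n) {α : σ →₀ ℕ} (hα : α.degree < n) :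
    P.coeff α = 0 := by
  obtain ⟨hf, e⟩ := X.polyGerm_eq b P
  have key : MvPolynomial.homogeneousComponent α.degree P = 0 := by
    refine MvPolynomial.funext fun c => ?_
    let v : X.E := ∑ i, c i • b i
    have hv : ∀ i, b.coord i v = c i := fun i => by
      classical
      simp [v, Module.Basis.coord_apply, Finsupp.single_apply]
    let q : Polynomial ℝ := MvPolynomial.aeval (fun i => Polynomial.C (c i) * Polynomial.X) P
    have hq : ∀ t, q.eval t = MvPolynomial.eval (fun i => t * c i) P := by
      intro t
      have : (Polynomial.evalRingHom t).comp
          (MvPolynomial.aeval (fun i => Polynomial.C (c i) * Polynomial.X)).toRingHom =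
          MvPolynomial.eval (fun i => t * c i) := by
        refine MvPolynomial.ringHom_ext (fun r => by simp) fun i => ?_
        simp only [AlgHom.toRingHom_eq_coe, RingHom.coe_comp, RingHom.coe_coe, Function.comp_apply,
          MvPolynomial.aeval_X, Polynomial.coe_evalRingHom, Polynomial.eval_mul, Polynomial.eval_C,
          Polynomial.eval_X, MvPolynomial.eval_X]
        exact mul_comm _ _
      exact DFunLike.congr_fun this P
    have hO : (fun t => q.eval t) =O[𝓝 0] fun t : ℝ => t ^ n := by
      have h1 := X.maxIdeal_pow_le_lineIdeal v n h _ hf e.symm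
      refine EventuallyEq.trans_isBigO ?_ h1
      filter_upwards [X.chart_chartLine v] with t ht
      rw [hq, ht]
      simp only [map_smul, hv, smul_eq_mul]
    have hc := q.coeff_eq_zero_of_isBigO n hO _ hα
    have hcoeff : ∀ d, q.coeff d =
        MvPolynomial.eval c (MvPolynomial.homogeneousComponent d P) := by
      intro d
      simp only [q]
      rw [MvPolynomial.homogeneousComponent_apply, MvPolynomial.aeval_def, MvPolynomial.eval₂_eq,
        Polynomial.finsetSum_coeff, map_sum, Finset.sum_filter]
      refine Finset.sum_congr rfl fun β _ => ?_
      simp only [mul_pow, Finset.prod_mul_distrib, Finset.prod_pow_eq_pow_sum,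
        Polynomial.algebraMap_eq, ← Polynomial.C_pow, ← map_prod]
      rw [← mul_assoc, ← map_mul, Polynomial.coeff_C_mul_X_pow, MvPolynomial.eval_monomial]
      simp only [Finsupp.degree_apply, Finsupp.prod, eq_comm]
    rw [map_zero, ← hcoeff, hc]
  have := congrArg (MvPolynomial.coeff α) key
  rwa [MvPolynomial.coeff_homogeneousComponent, if_pos rfl, MvPolynomial.coeff_zero] at this

end Coordinates

end PtdMfd

end

end FormalLie

end

noncomputable section

namespace FormalLie

section

open scoped TensorProduct
open MonoidalCategory CartesianMonoidalCategory

theorem tensor_separating_ext {V W S T : Type*} [AddCommGroup V] [Module ℝ V] [AddCommGroup W]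
    [Module ℝ W] {p : S → Module.Dual ℝ V} (hp : ∀ v, (∀ s, p s v = 0) → v = 0)
    {q : T → Module.Dual ℝ W} (hq : ∀ w, (∀ t, q t w = 0) → w = 0) {z z' : V ⊗[ℝ] W}
    (h : ∀ s t, tensorFunctional (p s) (q t) z = tensorFunctional (p s) (q t) z') : z = z' :=
  sub_eq_zero.1 (tensor_separating p hp q hq _ fun s t => by rw [map_sub, h, sub_self])

/-- The linear map underlying a morphism of coalgebras. -/
abbrev CocommCoalg.lin {C D : CocommCoalg.{u}} (f : C ⟶ D) : C.carrier →ₗ[ℝ] D.carrier :=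
  f.toCoalgHom.toLinearMap

theorem CocommCoalg.isIso_of_bijective {C D : CocommCoalg.{u}} (f : C ⟶ D)
    (hf : Function.Bijective f.toCoalgHom) : IsIso f := by
  let e := LinearEquiv.ofBijective (f.toCoalgHom : C.carrier →ₗ[ℝ] D.carrier) hf
  have he : ∀ d, f.toCoalgHom (e.symm d) = d := fun d => e.apply_symm_apply d
  let g : D ⟶ C := Hom.mk (C := D) (D := C)
    { toLinearMap := e.symm.toLinearMap
      counit_comp := by
        ext d
        conv_rhs => rw [← he d]
        exact (CoalgHomClass.counit_comp_apply f.toCoalgHom (e.symm d)).symm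
      map_comp_comul := by
        have hinj : Function.Injective (TensorProduct.map (f.toCoalgHom : C.carrier →ₗ[ℝ] D.carrier)
            (f.toCoalgHom : C.carrier →ₗ[ℝ] D.carrier)) :=
          (TensorProduct.congr e e).injective
        ext d
        apply hinj
        change _ = TensorProduct.map (f.toCoalgHom : C.carrier →ₗ[ℝ] D.carrier)
            (f.toCoalgHom : C.carrier →ₗ[ℝ] D.carrier) (Coalgebra.comul (R := ℝ) (e.symm d))
        rw [CoalgHomClass.map_comp_comul_apply, he]
        exact (TensorProduct.congr e e).apply_symm_apply _ }
  exact ⟨g, hom_ext fun c => e.symm_apply_apply c, hom_ext fun d => he d⟩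

namespace PtdMfd

variable (X : PtdMfd.{u}) {σ : Type*} [Fintype σ] (b : Module.Basis σ ℝ X.E)

/-- The distribution which maps a polynomial in the coordinates to its `α`-th coefficient. -/
theorem exists_coeff_dist (α : σ →₀ ℕ) :
    ∃ φ : X.dist.carrier, ∀ P, X.distEval (X.polyGerm b P) φ = P.coeff α := by
  let n := α.degree + 1
  let s : MvPolynomial σ ℝ →ₗ[ℝ] X.germs ⧸ X.maxIdeal ^ n :=
    ((Ideal.Quotient.mkₐ ℝ (X.maxIdeal ^ n)).comp (X.polyGerm b)).toLinearMap
  have hs : Function.Surjective s := fun q => by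
    obtain ⟨a, rfl⟩ := Ideal.Quotient.mk_surjective q
    obtain ⟨P, hP⟩ := X.exists_polyGerm_sub_mem b n a
    exact ⟨P, ((Ideal.Quotient.mk_eq_mk_iff_sub_mem _ _).2 hP).symm⟩
  have hker : LinearMap.ker s ≤ LinearMap.ker (MvPolynomial.lcoeff ℝ α) := fun P hP =>
    X.coeff_eq_zero_of_polyGerm_mem b (n := n) (Ideal.Quotient.eq_zero_iff_mem.1 hP)
      (Nat.lt_succ_self _)
  let p : X.germs ⧸ X.maxIdeal ^ n →ₗ[ℝ] ℝ :=
    (LinearMap.ker s).liftQ (MvPolynomial.lcoeff ℝ α) hker ∘ₗ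
      (s.quotKerEquivOfSurjective hs).symm.toLinearMap
  refine ⟨X.mkDist (p ∘ₗ (Ideal.Quotient.mkₐ ℝ (X.maxIdeal ^ n)).toLinearMap) n fun a ha => ?_,
    fun P => ?_⟩
  · have : Ideal.Quotient.mk (X.maxIdeal ^ n) a = 0 := Ideal.Quotient.eq_zero_iff_mem.2 ha
    exact (congrArg p this).trans (map_zero p)
  · refine (X.distEval_mkDist _ _ _ _).trans ?_
    have : (s.quotKerEquivOfSurjective hs).symm (s P) = (LinearMap.ker s).mkQ P := by
      rw [LinearEquiv.symm_apply_eq]; rfl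
    exact (congrArg ((LinearMap.ker s).liftQ (MvPolynomial.lcoeff ℝ α) hker) this).trans rfl

theorem dist_eq_zero_of_polyGerm {φ : X.dist.carrier}
    (h : ∀ α, X.distEval (X.polyGerm b (MvPolynomial.monomial α 1)) φ = 0) : φ = 0 := by
  have h' : ∀ P, X.distEval (X.polyGerm b P) φ = 0 := fun P => by
    induction P using MvPolynomial.induction_on' with
    | monomial α r =>
      have : MvPolynomial.monomial α r = r • MvPolynomial.monomial α (1 : ℝ) := by
        rw [MvPolynomial.smul_monomial, smul_eq_mul, mul_one]
      rw [← X.distFun_apply, this, map_smul, map_smul, X.distFun_apply, h, smul_zero]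
    | add P Q hP hQ =>
      rw [← X.distFun_apply] at hP hQ ⊢
      rw [map_add, map_add, hP, hQ, add_zero]
  obtain ⟨n, hn⟩ := X.exists_distFun_vanish φ
  refine X.dist_eq_zero fun a => ?_
  obtain ⟨P, hP⟩ := X.exists_polyGerm_sub_mem b n a
  have := hn _ hP
  rw [← X.distFun_apply, map_sub, X.distFun_apply, X.distFun_apply, h', sub_zero] at this
  exact this

/-- The basis of the space of point distributions which is dual to the monomials in the
coordinates. -/
def distBasis : Module.Basis (σ →₀ ℕ) ℝ X.dist.carrier :=
  Module.Basis.mk (v := fun α => (X.exists_coeff_dist b α).choose)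
    (by
      classical
      rw [linearIndependent_iff']
      intro s g hg α hα
      have := congrArg (X.distEval (X.polyGerm b (MvPolynomial.monomial α 1))) hg
      rw [map_sum, map_zero] at this
      simpa only [map_smul, (X.exists_coeff_dist b _).choose_spec, MvPolynomial.coeff_monomial,
        smul_eq_mul, mul_ite, mul_one, mul_zero, Finset.sum_ite_eq, hα, if_true] using this)
    (by
      classical
      intro φ _
      obtain ⟨n, hn⟩ := X.exists_distFun_vanish φ
      let c : (σ →₀ ℕ) → ℝ := fun α => X.distEval (X.polyGerm b (MvPolynomial.monomial α 1)) φ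
      have hc : ∀ α, α ∉ DPBasis.box σ n → c α = 0 := fun α hα => by
        rw [DPBasis.mem_box] at hα
        push Not at hα
        obtain ⟨i, hi⟩ := hα
        exact hn _ (X.polyGerm_monomial_mem b α (hi.trans (Finsupp.le_degree i α)))
      have : φ = ∑ α ∈ DPBasis.box σ n, c α • (X.exists_coeff_dist b α).choose := by
        rw [← sub_eq_zero]
        refine X.dist_eq_zero_of_polyGerm b fun β => ?_
        rw [map_sub, map_sum]
        simp only [map_smul, (X.exists_coeff_dist b _).choose_spec, MvPolynomial.coeff_monomial,
          smul_eq_mul, mul_ite, mul_one, mul_zero, Finset.sum_ite_eq]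
        split_ifs with h
        · exact sub_self _
        · rw [sub_zero]; exact hc β h
      rw [this]
      exact Submodule.sum_mem _ fun α _ => Submodule.smul_mem _ _
        (Submodule.subset_span ⟨α, rfl⟩))

theorem distEval_distBasis (α : σ →₀ ℕ) (P : MvPolynomial σ ℝ) :
    X.distEval (X.polyGerm b P) (X.distBasis b α) = P.coeff α := by
  rw [distBasis, Module.Basis.mk_apply]
  exact (X.exists_coeff_dist b α).choose_spec P

/-- Point distributions on a manifold form a coalgebra of divided powers. -/
def dpBasis [DecidableEq σ] : DPBasis σ X.dist where
  e := X.distBasis b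
  counit_e α := by
    rw [counit_dist, ← map_one (X.polyGerm b), distEval_distBasis, MvPolynomial.coeff_one]
    simp only [eq_comm]
  comul_e α := by
    rw [← sub_eq_zero]
    refine tensor_separating (fun P => X.distEval (X.polyGerm b (MvPolynomial.monomial P 1)))
      (fun φ => X.dist_eq_zero_of_polyGerm b)
      (fun P => X.distEval (X.polyGerm b (MvPolynomial.monomial P 1)))
      (fun φ => X.dist_eq_zero_of_polyGerm b) _ fun β γ => ?_
    rw [map_sub, map_sum, distEval_comul, ← map_mul, distEval_distBasis, MvPolynomial.coeff_mul,
      sub_eq_zero]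
    refine Finset.sum_congr rfl fun p _ => ?_
    rw [tensorFunctional_tmul, distEval_distBasis, distEval_distBasis]

theorem isNice_dist : X.dist.IsNice :=
  CocommCoalg.IsNice.of_dpBasis (X.dpBasis (Module.finBasis ℝ X.E))

variable (Y : PtdMfd.{u}) {τ : Type*} [Fintype τ] (b' : Module.Basis τ ℝ Y.E)

theorem chart_prod (y : X.carrier × Y.carrier) :
    (X.prod Y).chart y = (X.chart y.1, Y.chart y.2) := by
  have : ∀ y : X.carrier × Y.carrier, extChartAt (X.prod Y).I (X.prod Y).pt y =
      (extChartAt X.I X.pt y.1, extChartAt Y.I Y.pt y.2) := fun y => by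
    change extChartAt (X.I.prod Y.I) (X.pt, Y.pt) y = _
    rw [extChartAt_prod]
    rfl
  exact congrArg₂ (fun p q : X.E × Y.E => p - q) (this y) (this (X.pt, Y.pt))

/-- The coordinates of a product. -/
abbrev prodBasis : Module.Basis (σ ⊕ τ) ℝ (X.prod Y).E := b.prod b'

theorem germMap_fst_coordGerm (i : σ) : germMap (fst X Y) (X.coordGerm b i) =
    (X.prod Y).coordGerm (prodBasis X b Y b') (Sum.inl i) := by
  refine Subtype.ext (Filter.Germ.coe_eq.2 (Filter.Eventually.of_forall fun y => ?_))
  change b.coord i (X.chart y.1) = (b.prod b').coord (Sum.inl i) ((X.prod Y).chart y)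
  exact (b.prod_repr_inl b' _ i).symm.trans (congrArg ((b.prod b').coord (Sum.inl i))
    (chart_prod X Y y).symm)

theorem germMap_snd_coordGerm (i : τ) : germMap (snd X Y) (Y.coordGerm b' i) =
    (X.prod Y).coordGerm (prodBasis X b Y b') (Sum.inr i) := by
  refine Subtype.ext (Filter.Germ.coe_eq.2 (Filter.Eventually.of_forall fun y => ?_))
  change b'.coord i (Y.chart y.2) = (b.prod b').coord (Sum.inr i) ((X.prod Y).chart y)
  exact (b.prod_repr_inr b' _ i).symm.trans (congrArg ((b.prod b').coord (Sum.inr i))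
    (chart_prod X Y y).symm)

theorem germMap_fst_polyGerm (P : MvPolynomial σ ℝ) : germMap (fst X Y) (X.polyGerm b P) =
    (X.prod Y).polyGerm (prodBasis X b Y b') (MvPolynomial.rename Sum.inl P) := by
  have : (germMap (fst X Y)).comp (X.polyGerm b) =
      ((X.prod Y).polyGerm (prodBasis X b Y b')).comp (MvPolynomial.rename Sum.inl) := by
    refine MvPolynomial.algHom_ext fun i => ?_
    rw [AlgHom.comp_apply, AlgHom.comp_apply, MvPolynomial.rename_X, polyGerm, polyGerm,
      MvPolynomial.aeval_X, MvPolynomial.aeval_X, germMap_fst_coordGerm X b Y b']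
  exact DFunLike.congr_fun this P

theorem germMap_snd_polyGerm (P : MvPolynomial τ ℝ) : germMap (snd X Y) (Y.polyGerm b' P) =
    (X.prod Y).polyGerm (prodBasis X b Y b') (MvPolynomial.rename Sum.inr P) := by
  have : (germMap (snd X Y)).comp (Y.polyGerm b') =
      ((X.prod Y).polyGerm (prodBasis X b Y b')).comp (MvPolynomial.rename Sum.inr) := by
    refine MvPolynomial.algHom_ext fun i => ?_
    rw [AlgHom.comp_apply, AlgHom.comp_apply, MvPolynomial.rename_X, polyGerm, polyGerm,
      MvPolynomial.aeval_X, MvPolynomial.aeval_X, germMap_snd_coordGerm X b Y b']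
  exact DFunLike.congr_fun this P

variable {X Y}

/-- The evaluation of the distribution on `X × Y` with components `φ` and `ψ`. -/
theorem distEval_pair {C : CocommCoalg.{u}} (f : C ⟶ X.dist) (g : C ⟶ Y.dist) (c : C.carrier)
    (a : X.germs) (a' : Y.germs) :
    tensorFunctional (X.distEval a) (Y.distEval a') ((CocommCoalg.pair f g).toCoalgHom c) =
      tensorFunctional (X.distEval a ∘ₗ (f.toCoalgHom : C.carrier →ₗ[ℝ] X.dist.carrier))
        (Y.distEval a' ∘ₗ (g.toCoalgHom : C.carrier →ₗ[ℝ] Y.dist.carrier))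
        (Coalgebra.comul (R := ℝ) c) := by
  change tensorFunctional _ _ (TensorProduct.map (f.toCoalgHom : C.carrier →ₗ[ℝ] X.dist.carrier)
    (g.toCoalgHom : C.carrier →ₗ[ℝ] Y.dist.carrier) (Coalgebra.comul (R := ℝ) c)) = _
  induction Coalgebra.comul (R := ℝ) c with
  | zero => simp
  | add x y hx hy => rw [map_add, map_add, map_add, hx, hy]
  | tmul x y => simp

variable (X Y)

/-- The comparison `Dist(X × Y) → Dist(X) ⊗ Dist(Y)`. -/
def distProd : (X.prod Y).dist ⟶ X.dist.prod Y.dist :=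
  CocommCoalg.pair (Dist.map (fst X Y)) (Dist.map (snd X Y))

theorem tensorFunctional_distProd (φ : (X.prod Y).dist.carrier) (a : X.germs) (a' : Y.germs) :
    tensorFunctional (X.distEval a) (Y.distEval a') ((distProd X Y).toCoalgHom φ) =
      (X.prod Y).distEval (germMap (fst X Y) a * germMap (snd X Y) a') φ := by
  refine (distEval_pair (X := X) (Y := Y) (C := (X.prod Y).dist) _ _ φ a a').trans ?_
  rw [← distEval_comul]
  have h1 : X.distEval a ∘ₗ CocommCoalg.lin (Dist.map (fst X Y)) =
      (X.prod Y).distEval (germMap (fst X Y) a) :=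
    LinearMap.ext fun φ => distEval_distMap _ (fst X Y) φ a
  have h2 : Y.distEval a' ∘ₗ CocommCoalg.lin (Dist.map (snd X Y)) =
      (X.prod Y).distEval (germMap (snd X Y) a') :=
    LinearMap.ext fun φ => distEval_distMap _ (snd X Y) φ a'
  exact congrArg₂ (fun p q => tensorFunctional p q (Coalgebra.comul (R := ℝ) φ)) h1 h2

theorem distProd_distBasis (γ : σ ⊕ τ →₀ ℕ) :
    (distProd X Y).toCoalgHom ((X.prod Y).distBasis (prodBasis X b Y b') γ) =
      (X.distBasis b (Finsupp.sumFinsuppEquivProdFinsupp γ).1 ⊗ₜ[ℝ]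
        Y.distBasis b' (Finsupp.sumFinsuppEquivProdFinsupp γ).2 :
          X.dist.carrier ⊗[ℝ] Y.dist.carrier) := by
  classical
  refine tensor_separating_ext (V := X.dist.carrier) (W := Y.dist.carrier)
    (p := fun P => X.distEval (X.polyGerm b (MvPolynomial.monomial P 1)))
    (fun φ => X.dist_eq_zero_of_polyGerm b)
    (q := fun P => Y.distEval (Y.polyGerm b' (MvPolynomial.monomial P 1)))
    (fun φ => Y.dist_eq_zero_of_polyGerm b') fun α β => ?_
  refine (tensorFunctional_distProd X Y _ _ _).trans ?_
  rw [germMap_fst_polyGerm X b Y b', germMap_snd_polyGerm X b Y b', ← map_mul,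
    distEval_distBasis, tensorFunctional_tmul, distEval_distBasis, distEval_distBasis,
    MvPolynomial.rename_monomial, MvPolynomial.rename_monomial, MvPolynomial.monomial_mul,
    MvPolynomial.coeff_monomial, MvPolynomial.coeff_monomial, MvPolynomial.coeff_monomial]
  have : Finsupp.mapDomain Sum.inl α + Finsupp.mapDomain Sum.inr β = γ ↔
      α = (Finsupp.sumFinsuppEquivProdFinsupp γ).1 ∧
        β = (Finsupp.sumFinsuppEquivProdFinsupp γ).2 := by
    constructor
    · rintro rfl
      constructor <;> ext i
      · rw [Finsupp.fst_sumFinsuppEquivProdFinsupp, Finsupp.add_apply,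
          Finsupp.mapDomain_apply Sum.inl_injective, Finsupp.mapDomain_of_notMem_range _ _ (by simp),
          add_zero]
      · rw [Finsupp.snd_sumFinsuppEquivProdFinsupp, Finsupp.add_apply,
          Finsupp.mapDomain_apply Sum.inr_injective, Finsupp.mapDomain_of_notMem_range _ _ (by simp),
          zero_add]
    · rintro ⟨rfl, rfl⟩
      ext i
      rcases i with i | i
      · rw [Finsupp.add_apply, Finsupp.mapDomain_apply Sum.inl_injective,
          Finsupp.mapDomain_of_notMem_range _ _ (by simp), add_zero]
        rfl
      · rw [Finsupp.add_apply, Finsupp.mapDomain_apply Sum.inr_injective,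
          Finsupp.mapDomain_of_notMem_range _ _ (by simp), zero_add]
        rfl
  simp only [this, one_mul]
  split_ifs <;> simp_all

theorem isIso_distProd : IsIso (distProd X Y) := by
  refine CocommCoalg.isIso_of_bijective _ ?_
  let b := Module.finBasis ℝ X.E
  let b' := Module.finBasis ℝ Y.E
  let e : (X.prod Y).dist.carrier ≃ₗ[ℝ] X.dist.carrier ⊗[ℝ] Y.dist.carrier :=
    ((X.prod Y).distBasis (prodBasis X b Y b')).equiv
      ((X.distBasis b).tensorProduct (Y.distBasis b')) Finsupp.sumFinsuppEquivProdFinsupp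
  have he : (CocommCoalg.lin (distProd X Y) :
      (X.prod Y).dist.carrier →ₗ[ℝ] X.dist.carrier ⊗[ℝ] Y.dist.carrier) = e.toLinearMap := by
    refine Module.Basis.ext ((X.prod Y).distBasis (prodBasis X b Y b')) fun γ => ?_
    refine (distProd_distBasis X b Y b' γ).trans ?_
    refine ((Module.Basis.tensorProduct_apply (X.distBasis b) (Y.distBasis b') _ _).symm.trans ?_)
    exact (Module.Basis.equiv_apply ((X.prod Y).distBasis (prodBasis X b Y b')) γ
      ((X.distBasis b).tensorProduct (Y.distBasis b')) Finsupp.sumFinsuppEquivProdFinsupp).symm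
  have : ((distProd X Y).toCoalgHom : (X.prod Y).dist.carrier → X.dist.carrier ⊗[ℝ] Y.dist.carrier)
      = e := funext fun φ => DFunLike.congr_fun he φ
  change Function.Bijective ((distProd X Y).toCoalgHom :
    (X.prod Y).dist.carrier → X.dist.carrier ⊗[ℝ] Y.dist.carrier)
  rw [this]
  exact e.bijective

theorem bijective_counit_dist_point :
    Function.Bijective (Coalgebra.counit (R := ℝ) (A := point.{u}.dist.carrier)) := by
  let b : Module.Basis (Fin 0) ℝ point.{u}.E := Module.Basis.empty PUnit.{u + 1}
  let B := point.{u}.dpBasis b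
  have hr : ∀ φ : point.{u}.dist.carrier, φ = B.e.repr φ 0 • B.e 0 := fun φ => by
    conv_lhs => rw [← B.e.sum_repr φ]
    rw [Fintype.sum_unique]
    rfl
  have h0 : Coalgebra.counit (R := ℝ) (B.e 0) = 1 := by rw [B.counit_e, if_pos rfl]
  refine ⟨fun φ ψ h => ?_, fun r => ⟨r • B.e 0, by rw [map_smul, h0, smul_eq_mul, mul_one]⟩⟩
  rw [hr φ, hr ψ] at h ⊢
  rw [map_smul, map_smul, h0, smul_eq_mul, smul_eq_mul, mul_one, mul_one] at h
  rw [h]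

theorem isIso_toUnit_dist_point : IsIso point.{u}.dist.toUnit :=
  CocommCoalg.isIso_of_bijective _
    ((ULift.moduleEquiv.{0, 0, u} (R := ℝ) (M := ℝ)).symm.bijective.comp
      bijective_counit_dist_point)

/-- `Dist` preserves finite products. -/
theorem preservesFiniteProducts_dist : Limits.PreservesFiniteProducts Dist.{u} := by
  have h1 : IsIso (terminalComparison Dist.{u}) := isIso_toUnit_dist_point
  have h2 : ∀ X Y : PtdMfd.{u}, IsIso (prodComparison Dist.{u} X Y) := fun X Y =>
    isIso_distProd X Y
  have := preservesLimit_empty_of_isIso_terminalComparison Dist.{u}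
  have := Limits.preservesLimitsOfShape_pempty_of_preservesTerminal Dist.{u}
  have := preservesLimitsOfShape_discrete_walkingPair_of_isIso_prodComparison Dist.{u}
  exact Limits.PreservesFiniteProducts.of_preserves_binary_and_terminal Dist.{u}

end PtdMfd

end

end FormalLie

end

noncomputable section

namespace FormalLie

section

open scoped TensorProduct

section OrderedMonomials

variable {L : Type*} [LieRing L] [LieAlgebra ℝ L] {σ : Type*} (b : Module.Basis σ ℝ L)

/-- The product of the elements of a basis of `L` in `U(L)` which is given by a list of indices. -/
def envWord (l : List σ) : Env L := (l.map fun i => envι (b i)).prod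

theorem envWord_cons (i : σ) (l : List σ) : envWord b (i :: l) = envι (b i) * envWord b l := by
  simp [envWord]

/-- The span of the products of at most `n` basis elements. -/
def envFiltration (n : ℕ) : Submodule ℝ (Env L) :=
  Submodule.span ℝ {x | ∃ l : List σ, l.length ≤ n ∧ envWord b l = x}

theorem envWord_mem {l : List σ} {n : ℕ} (h : l.length ≤ n) : envWord b l ∈ envFiltration b n :=
  Submodule.subset_span ⟨l, h, rfl⟩

theorem mul_mem_envFiltration (x : L) {n : ℕ} {u : Env L} (hu : u ∈ envFiltration b n) :
    envι x * u ∈ envFiltration b (n + 1) := by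
  have hx : x ∈ Submodule.span ℝ (Set.range b) := by rw [b.span_eq]; trivial
  induction hx using Submodule.span_induction with
  | zero => rw [map_zero, zero_mul]; exact Submodule.zero_mem _
  | add x y _ _ hx hy => rw [map_add, add_mul]; exact Submodule.add_mem _ hx hy
  | smul r x _ hx => rw [map_smul, smul_mul_assoc]; exact Submodule.smul_mem _ r hx
  | mem x hx =>
    obtain ⟨i, rfl⟩ := hx
    induction hu using Submodule.span_induction with
    | zero => rw [mul_zero]; exact Submodule.zero_mem _
    | add x y _ _ hx hy => rw [mul_add]; exact Submodule.add_mem _ hx hy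
    | smul r x _ hx => rw [mul_smul_comm]; exact Submodule.smul_mem _ r hx
    | mem u hu =>
      obtain ⟨l, hl, rfl⟩ := hu
      rw [← envWord_cons]
      exact envWord_mem b (by simpa using hl)

theorem envWord_sub_mem_of_perm {l l' : List σ} (h : l.Perm l') :
    ∀ n, l.length ≤ n + 1 → envWord b l - envWord b l' ∈ envFiltration b n := by
  induction h with
  | nil => intro n _; rw [sub_self]; exact Submodule.zero_mem _
  | @cons i l₁ l₂ hp ih =>
    intro n hn
    rw [envWord_cons, envWord_cons, ← mul_sub]
    cases n with
    | zero =>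
      have h₁ : l₁ = [] := List.eq_nil_of_length_eq_zero (by simp only [List.length_cons] at hn; omega)
      subst h₁
      have h₂ : l₂ = [] := hp.nil_eq.symm
      subst h₂
      rw [sub_self, mul_zero]; exact Submodule.zero_mem _
    | succ n =>
      exact mul_mem_envFiltration b _ (ih n (by simp only [List.length_cons] at hn; omega))
  | swap i j l =>
    intro n hn
    simp only [List.length_cons] at hn
    have : envWord b (j :: i :: l) - envWord b (i :: j :: l) =
        envι ⁅b j, b i⁆ * envWord b l := by
      rw [envι_lie]
      simp only [envWord_cons, sub_mul, mul_assoc]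
    rw [this]
    obtain ⟨m, rfl⟩ : ∃ m, n = m + 1 := ⟨n - 1, by omega⟩
    exact mul_mem_envFiltration b _ (envWord_mem b (by omega))
  | @trans l₁ l₂ l₃ h₁ _ ih₁ ih₂ =>
    intro n hn
    rw [← sub_add_sub_cancel _ (envWord b l₂)]
    exact Submodule.add_mem _ (ih₁ n hn) (ih₂ n (h₁.length_eq ▸ hn))

variable [LinearOrder σ]

/-- The sorted list of indices with multiplicities `α`. -/
def sortedWord (α : σ →₀ ℕ) : List σ := (Finsupp.toMultiset α).sort (· ≤ ·)

theorem coe_sortedWord (α : σ →₀ ℕ) : (sortedWord α : Multiset σ) = Finsupp.toMultiset α :=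
  Multiset.sort_eq _ _

theorem length_sortedWord (α : σ →₀ ℕ) : (sortedWord α).length = α.degree := by
  rw [← Multiset.coe_card, coe_sortedWord, Finsupp.card_toMultiset]
  rfl

theorem sortedWord_perm (l : List σ) :
    l.Perm (sortedWord (Multiset.toFinsupp (l : Multiset σ))) := by
  rw [← Multiset.coe_eq_coe, coe_sortedWord, Multiset.toFinsupp_toMultiset]

/-- The ordered monomials in the elements of a basis of `L` span `U(L)`. -/
theorem span_envWord_sortedWord :
    Submodule.span ℝ (Set.range fun α : σ →₀ ℕ => envWord b (sortedWord α)) = ⊤ := by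
  set S := Submodule.span ℝ (Set.range fun α : σ →₀ ℕ => envWord b (sortedWord α)) with hS
  have hle : ∀ n, envFiltration b n ≤ S := by
    intro n
    induction n with
    | zero =>
      refine Submodule.span_le.2 ?_
      rintro _ ⟨l, hl, rfl⟩
      have : l = [] := List.eq_nil_of_length_eq_zero (by omega)
      subst this
      refine Submodule.subset_span ⟨0, ?_⟩
      simp [sortedWord]
    | succ n ih =>
      refine Submodule.span_le.2 ?_
      rintro _ ⟨l, hl, rfl⟩
      have h := ih (envWord_sub_mem_of_perm b (sortedWord_perm l) n hl)
      have h' : envWord b (sortedWord (Multiset.toFinsupp (l : Multiset σ))) ∈ S :=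
        Submodule.subset_span ⟨_, rfl⟩
      have := Submodule.add_mem _ h h'
      rwa [sub_add_cancel] at this
  rw [eq_top_iff]
  intro x _
  have hx : x ∈ Algebra.adjoin ℝ (Set.range fun i => envι (b i)) := by
    refine env_induction _ (fun y => ?_) x
    have hy : y ∈ Submodule.span ℝ (Set.range b) := by rw [b.span_eq]; trivial
    induction hy using Submodule.span_induction with
    | zero => rw [map_zero]; exact Subalgebra.zero_mem _
    | add x y _ _ hx hy => rw [map_add]; exact Subalgebra.add_mem _ hx hy
    | smul r x _ hx => rw [map_smul]; exact Subalgebra.smul_mem _ hx r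
    | mem x hx =>
      obtain ⟨i, rfl⟩ := hx
      exact Algebra.subset_adjoin ⟨i, rfl⟩
  rw [← Subalgebra.mem_toSubmodule, Algebra.adjoin_eq_span] at hx
  refine Submodule.span_le.2 (fun y hy => ?_) hx
  have : ∃ l : List σ, envWord b l = y := by
    induction hy using Submonoid.closure_induction with
    | mem y hy =>
      obtain ⟨i, rfl⟩ := hy
      exact ⟨[i], by simp [envWord]⟩
    | one => exact ⟨[], rfl⟩
    | mul x y _ _ hx hy =>
      obtain ⟨l, rfl⟩ := hx
      obtain ⟨l', rfl⟩ := hy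
      exact ⟨l ++ l', by simp [envWord]⟩
  obtain ⟨l, rfl⟩ := this
  exact hle _ (envWord_mem b le_rfl)

end OrderedMonomials

section Derivations

variable {B : Type*} [Ring B] [Bialgebra ℝ B] [Coalgebra.IsCocomm ℝ B]

/-- The operator on functionals which is dual to the right multiplication by `w`. -/
def rightDual (w : B) (p : WithConv (B →ₗ[ℝ] ℝ)) : WithConv (B →ₗ[ℝ] ℝ) :=
  WithConv.toConv (p.ofConv ∘ₗ LinearMap.mulRight ℝ w)

omit [Coalgebra.IsCocomm ℝ B] in
theorem rightDual_apply (w : B) (p : WithConv (B →ₗ[ℝ] ℝ)) (x : B) :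
    rightDual w p x = p (x * w) := rfl

omit [Coalgebra.IsCocomm ℝ B] in
theorem rightDual_mul {w : B} (hw : Coalgebra.comul (R := ℝ) w = w ⊗ₜ[ℝ] 1 + 1 ⊗ₜ[ℝ] w)
    (p q : WithConv (B →ₗ[ℝ] ℝ)) :
    rightDual w (p * q) = rightDual w p * q + p * rightDual w q := by
  refine WithConv.ext (LinearMap.ext fun x => ?_)
  change (p * q) (x * w) = (rightDual w p * q) x + (p * rightDual w q) x
  rw [LinearMap.convMul_apply, LinearMap.convMul_apply, LinearMap.convMul_apply,
    Bialgebra.comul_mul, hw, mul_add, map_add, map_add]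
  have key : ∀ z : B ⊗[ℝ] B, TensorProduct.map p.ofConv q.ofConv (z * w ⊗ₜ[ℝ] 1) =
      TensorProduct.map (rightDual w p).ofConv q.ofConv z ∧
      TensorProduct.map p.ofConv q.ofConv (z * 1 ⊗ₜ[ℝ] w) =
        TensorProduct.map p.ofConv (rightDual w q).ofConv z := by
    intro z
    induction z with
    | zero => simp
    | add x y hx hy =>
      rw [add_mul, add_mul, map_add, map_add, map_add, map_add, hx.1, hx.2, hy.1, hy.2]
      exact ⟨rfl, rfl⟩
    | tmul x y => simp [rightDual]
  rw [(key _).1, (key _).2]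

variable (B) in
/-- The ideal of functionals vanishing at `1`. -/
def oneIdeal : @Ideal (WithConv (B →ₗ[ℝ] ℝ)) CommSemiring.toSemiring where
  carrier := {p | p 1 = 0}
  zero_mem' := rfl
  add_mem' {p q} hp hq := by
    change p 1 + q 1 = 0
    rw [show p 1 = 0 from hp, show q 1 = 0 from hq, add_zero]
  smul_mem' p q hq := by
    change (p * q) 1 = 0
    rw [LinearMap.convMul_apply, Bialgebra.comul_one, Algebra.TensorProduct.one_def]
    have : q 1 = 0 := hq
    simp [this]

theorem rightDual_mem {w : B} (hw : Coalgebra.comul (R := ℝ) w = w ⊗ₜ[ℝ] 1 + 1 ⊗ₜ[ℝ] w) (n : ℕ)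
    {p : WithConv (B →ₗ[ℝ] ℝ)} (hp : p ∈ oneIdeal B ^ (n + 1)) :
    rightDual w p ∈ oneIdeal B ^ n := by
  induction n generalizing p with
  | zero => simp
  | succ n ih =>
    rw [pow_succ'] at hp
    induction hp using Submodule.mul_induction_on' with
    | mem_mul_mem p hp q hq =>
      rw [rightDual_mul hw]
      refine Ideal.add_mem _ (Ideal.mul_mem_left _ _ hq) ?_
      rw [pow_succ']
      exact Ideal.mul_mem_mul hp (ih hq)
    | add p _ q _ hp hq =>
      have : rightDual w (p + q) = rightDual w p + rightDual w q := rfl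
      rw [this]
      exact Ideal.add_mem _ hp hq

theorem apply_prod_eq_zero {l : List B}
    (hl : ∀ w ∈ l, Coalgebra.comul (R := ℝ) w = w ⊗ₜ[ℝ] 1 + 1 ⊗ₜ[ℝ] w) {n : ℕ}
    (hn : l.length < n) {p : WithConv (B →ₗ[ℝ] ℝ)} (hp : p ∈ oneIdeal B ^ n) : p l.prod = 0 := by
  induction l using List.reverseRecOn generalizing n p with
  | nil =>
    rw [List.prod_nil]
    exact Ideal.pow_le_self (by simp at hn; omega) hp
  | append_singleton l w ih =>
    rw [List.prod_append, List.prod_singleton, ← rightDual_apply]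
    rw [List.length_append, List.length_singleton] at hn
    obtain ⟨m, rfl⟩ : ∃ m, n = m + 1 := ⟨n - 1, by omega⟩
    exact ih (fun w hw => hl w (List.mem_append_left _ hw)) (by omega)
      (rightDual_mem (hl w (by simp)) m hp)

variable {σ : Type*} [DecidableEq σ] {x : σ → B}
  (hx : ∀ i, Coalgebra.comul (R := ℝ) (x i) = x i ⊗ₜ[ℝ] 1 + 1 ⊗ₜ[ℝ] x i)
  {ξ : σ → WithConv (B →ₗ[ℝ] ℝ)} (hξ : ∀ i, ξ i 1 = 0) (hξx : ∀ i j, ξ i (x j) = if i = j then 1 else 0)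

omit [DecidableEq σ] in
theorem prod_X_eq [DecidableEq σ] (k : List σ) : (k.map (MvPolynomial.X (R := ℝ))).prod =
    MvPolynomial.monomial (Multiset.toFinsupp (k : Multiset σ)) 1 := by
  induction k with
  | nil => simp
  | cons i k ih =>
    rw [List.map_cons, List.prod_cons, ih, ← Multiset.cons_coe, ← Multiset.singleton_add,
      Multiset.toFinsupp_add, Multiset.toFinsupp_singleton, MvPolynomial.X,
      MvPolynomial.monomial_mul, one_mul]

include hξ in
omit [DecidableEq σ] in
theorem aeval_monomial_mem (β : σ →₀ ℕ) :
    MvPolynomial.aeval ξ (MvPolynomial.monomial β (1 : ℝ)) ∈ oneIdeal B ^ β.degree := by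
  rw [MvPolynomial.aeval_monomial, map_one, one_mul, Finsupp.prod, Finsupp.degree_apply,
    ← Finset.prod_pow_eq_pow_sum]
  exact Ideal.prod_mem_prod fun i _ => Ideal.pow_mem_pow (hξ i) _

include hx hξ hξx in
theorem rightDual_aeval_sub_mem (i : σ) (β : σ →₀ ℕ) :
    rightDual (x i) (MvPolynomial.aeval ξ (MvPolynomial.monomial β (1 : ℝ))) -
      MvPolynomial.aeval ξ (MvPolynomial.pderiv i (MvPolynomial.monomial β (1 : ℝ))) ∈
        oneIdeal B ^ β.degree := by
  have key : ∀ k : List σ, rightDual (x i) (MvPolynomial.aeval ξ (k.map (MvPolynomial.X (R := ℝ))).prod) -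
      MvPolynomial.aeval ξ (MvPolynomial.pderiv i (k.map (MvPolynomial.X (R := ℝ))).prod) ∈
        oneIdeal B ^ k.length := by
    intro k
    induction k with
    | nil => simp
    | cons j k ih =>
      rw [List.map_cons, List.prod_cons, map_mul, MvPolynomial.aeval_X, rightDual_mul (hx i),
        Derivation.leibniz, MvPolynomial.pderiv_X, smul_eq_mul, smul_eq_mul, map_add, map_mul,
        map_mul, MvPolynomial.aeval_X, List.length_cons]
      set A := MvPolynomial.aeval ξ (k.map (MvPolynomial.X (R := ℝ))).prod with hA
      set A' := MvPolynomial.aeval ξ (MvPolynomial.pderiv i (k.map (MvPolynomial.X (R := ℝ))).prod)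
      set d := MvPolynomial.aeval ξ (Pi.single (M := fun _ => MvPolynomial σ ℝ) i 1 j) with hd
      have e : rightDual (x i) (ξ j) * A + ξ j * rightDual (x i) A - (ξ j * A' + A * d) =
          (rightDual (x i) (ξ j) - d) * A + ξ j * (rightDual (x i) A - A') := by ring
      rw [e, pow_succ']
      refine Ideal.add_mem _ (Ideal.mul_mem_mul ?_ ?_) (Ideal.mul_mem_mul (hξ j) ih)
      · change rightDual (x i) (ξ j) 1 - d 1 = 0
        rw [rightDual_apply, one_mul, hξx, hd]
        by_cases h : j = i
        · subst h
          rw [if_pos rfl, Pi.single_eq_same, map_one (MvPolynomial.aeval ξ),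
            LinearMap.convOne_apply, Bialgebra.counit_one, map_one, sub_self]
        · rw [if_neg h, Pi.single_eq_of_ne h, map_zero]
          exact sub_zero _
      · rw [hA, prod_X_eq]
        have := aeval_monomial_mem hξ (Multiset.toFinsupp (k : Multiset σ))
        have hk : (Multiset.toFinsupp (k : Multiset σ)).degree = k.length := by
          have h := Finsupp.card_toMultiset (Multiset.toFinsupp (k : Multiset σ))
          rw [Multiset.toFinsupp_toMultiset, Multiset.coe_card] at h
          exact h.symm
        rwa [hk] at this
  have := key (Finsupp.toMultiset β).toList
  rw [prod_X_eq, Multiset.coe_toList, Finsupp.toMultiset_toFinsupp, Multiset.length_toList,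
    Finsupp.card_toMultiset] at this
  exact this

include hx hξ hξx in
/-- The values of monomials of degree `n` on products of `n` primitive elements. -/
theorem aeval_monomial_prod (l : List σ) (β : σ →₀ ℕ) (hβ : β.degree = l.length) :
    (β = Multiset.toFinsupp (l : Multiset σ) →
      MvPolynomial.aeval ξ (MvPolynomial.monomial β (1 : ℝ)) (l.map x).prod ≠ 0) ∧
    (β ≠ Multiset.toFinsupp (l : Multiset σ) →
      MvPolynomial.aeval ξ (MvPolynomial.monomial β (1 : ℝ)) (l.map x).prod = 0) := by
  induction l using List.reverseRecOn generalizing β with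
  | nil =>
    have : β = 0 := by rwa [List.length_nil, Finsupp.degree_eq_zero_iff] at hβ
    subst this
    simp [LinearMap.convOne_apply]
  | append_singleton l i ih =>
    rw [List.length_append, List.length_singleton] at hβ
    rw [List.map_append, List.prod_append, List.map_singleton, List.prod_singleton,
      ← rightDual_apply]
    have h0 : rightDual (x i) (MvPolynomial.aeval ξ (MvPolynomial.monomial β (1 : ℝ)))
        (l.map x).prod =
        MvPolynomial.aeval ξ (MvPolynomial.pderiv i (MvPolynomial.monomial β (1 : ℝ)))
          (l.map x).prod := by
      rw [← sub_eq_zero]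
      exact apply_prod_eq_zero (n := β.degree) (l := l.map x) (fun w hw => by
        obtain ⟨j, _, rfl⟩ := List.mem_map.1 hw
        exact hx j) (by rw [List.length_map]; omega) (rightDual_aeval_sub_mem hx hξ hξx i β)
    have hcount : Multiset.toFinsupp ((l ++ [i] : List σ) : Multiset σ) =
        Multiset.toFinsupp (l : Multiset σ) + Finsupp.single i 1 := by
      rw [← Multiset.coe_add, Multiset.toFinsupp_add, Multiset.coe_singleton,
        Multiset.toFinsupp_singleton]
    have h1 : MvPolynomial.aeval ξ (MvPolynomial.pderiv i (MvPolynomial.monomial β (1 : ℝ)))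
        (l.map x).prod = (β i : ℝ) * MvPolynomial.aeval ξ
          (MvPolynomial.monomial (β - Finsupp.single i 1) (1 : ℝ)) (l.map x).prod := by
      have : MvPolynomial.monomial (β - Finsupp.single i 1) (1 * (β i : ℝ)) =
          (β i : ℝ) • MvPolynomial.monomial (β - Finsupp.single i 1) (1 : ℝ) := by
        rw [MvPolynomial.smul_monomial, smul_eq_mul, one_mul, mul_one]
      rw [MvPolynomial.pderiv_monomial, this, map_smul]
      rfl
    rw [h0, h1, hcount]
    by_cases hi : β i = 0
    · refine ⟨fun h => ?_, fun _ => by rw [hi, Nat.cast_zero, zero_mul]⟩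
      rw [h] at hi
      simp at hi
    · have hle : Finsupp.single i 1 ≤ β := by
        rw [Finsupp.single_le_iff]; omega
      have hadd : β - Finsupp.single i 1 + Finsupp.single i 1 = β := tsub_add_cancel_of_le hle
      have hdeg : (β - Finsupp.single i 1).degree = l.length := by
        have := congrArg Finsupp.degree hadd
        rw [map_add, Finsupp.degree_single] at this
        omega
      have hi' : (β i : ℝ) ≠ 0 := Nat.cast_ne_zero.2 hi
      obtain ⟨h2, h3⟩ := ih _ hdeg
      refine ⟨fun h => mul_ne_zero hi' (h2 ?_), fun h => ?_⟩
      · rw [h, add_tsub_cancel_right]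
      · rw [h3 fun h' => h (by rw [← h', hadd]), mul_zero]

end Derivations

section Bijectivity

variable {B : Type*} [Ring B] [Bialgebra ℝ B] [Coalgebra.IsCocomm ℝ B]
  {L : Type*} [LieRing L] [LieAlgebra ℝ L] {σ : Type*} [LinearOrder σ]

/-- A homomorphism from `U(L)` to a cocommutative bialgebra which is dual to a power series algebra
is bijective if it maps a basis of `L` to the primitive elements which are dual to the variables. -/
theorem bijective_of_dual_monomials (b : Module.Basis σ ℝ L) (ψ : Env L →ₐ[ℝ] B)
    (hψ : ∀ i, Coalgebra.comul (R := ℝ) (ψ (envι (b i))) =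
      ψ (envι (b i)) ⊗ₜ[ℝ] 1 + 1 ⊗ₜ[ℝ] ψ (envι (b i)))
    (ξ : σ → WithConv (B →ₗ[ℝ] ℝ)) (hξ : ∀ i, ξ i 1 = 0)
    (hξψ : ∀ i j, ξ i (ψ (envι (b j))) = if i = j then 1 else 0)
    (e : Module.Basis (σ →₀ ℕ) ℝ B)
    (he : ∀ α β, MvPolynomial.aeval ξ (MvPolynomial.monomial β (1 : ℝ)) (e α) =
      if β = α then 1 else 0) :
    Function.Bijective ψ := by
  let f : (σ →₀ ℕ) → B := fun α => ψ (envWord b (sortedWord α))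
  let m : (σ →₀ ℕ) → B →ₗ[ℝ] ℝ := fun β =>
    (MvPolynomial.aeval ξ (MvPolynomial.monomial β (1 : ℝ))).ofConv
  have hf : ∀ α, f α = ((sortedWord α).map fun i => ψ (envι (b i))).prod := fun α => by
    simp only [f, envWord, map_list_prod, List.map_map]
    rfl
  have hm : ∀ (y : B) β, m β y = e.repr y β := by
    intro y β
    have : m β = (Finsupp.lapply β) ∘ₗ e.repr.toLinearMap := by
      refine e.ext fun α => ?_
      refine (he α β).trans ?_
      simp [Finsupp.single_apply, eq_comm]
    exact DFunLike.congr_fun this y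
  have h1 : ∀ α β, α.degree < β.degree → m β (f α) = 0 := fun α β h => by
    rw [hf]
    refine apply_prod_eq_zero (fun w hw => ?_) (by rwa [List.length_map, length_sortedWord])
      (aeval_monomial_mem hξ β)
    obtain ⟨j, _, rfl⟩ := List.mem_map.1 hw
    exact hψ j
  have hcount : ∀ α : σ →₀ ℕ, Multiset.toFinsupp (sortedWord α : Multiset σ) = α := fun α => by
    rw [coe_sortedWord, Finsupp.toMultiset_toFinsupp]
  have h2 : ∀ α β, β.degree = α.degree → β ≠ α → m β (f α) = 0 := fun α β h hne => by
    rw [hf]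
    exact (aeval_monomial_prod (x := fun i => ψ (envι (b i))) hψ hξ hξψ (sortedWord α) β
      (by rw [length_sortedWord, h])).2 (by rwa [hcount])
  have h3 : ∀ α, m α (f α) ≠ 0 := fun α => by
    rw [hf]
    exact (aeval_monomial_prod (x := fun i => ψ (envι (b i))) hψ hξ hξψ (sortedWord α) α
      (by rw [length_sortedWord])).1 (by rw [hcount])
  constructor
  · rw [injective_iff_map_eq_zero]
    intro z hz
    have hzs : z ∈ Submodule.span ℝ (Set.range fun α : σ →₀ ℕ => envWord b (sortedWord α)) := by
      rw [span_envWord_sortedWord]; trivial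
    obtain ⟨c, rfl⟩ := (Finsupp.mem_span_range_iff_exists_finsupp).1 hzs
    by_contra hne
    have hc : c.support.Nonempty := by
      rw [Finsupp.support_nonempty_iff]
      rintro rfl
      simp at hne
    obtain ⟨α, hα, hmax⟩ := Finset.exists_max_image c.support (fun α => α.degree) hc
    have h4 := congrArg (m α) hz
    rw [Finsupp.sum, map_sum, map_sum, map_zero, Finset.sum_eq_single α] at h4
    · rw [map_smul, map_smul, smul_eq_mul] at h4
      exact (mul_ne_zero (Finsupp.mem_support_iff.1 hα) (h3 α)) h4
    · intro γ hγ hγα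
      rw [map_smul, map_smul]
      have : m α (f γ) = 0 := by
        rcases (hmax γ hγ).lt_or_eq with h | h
        · exact h1 γ α h
        · exact h2 γ α h.symm hγα.symm
      exact (congrArg (c γ • ·) this).trans (smul_zero _)
    · exact fun h => absurd hα h
  · have key : ∀ n, ∀ α : σ →₀ ℕ, α.degree = n → e α ∈ ψ.toLinearMap.range := by
      intro n
      induction n using Nat.strong_induction_on with
      | _ n ih =>
        intro α hα
        have hsum := e.linearCombination_repr (f α)
        rw [Finsupp.linearCombination_apply, Finsupp.sum] at hsum
        have hαs : α ∈ (e.repr (f α)).support := by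
          rw [Finsupp.mem_support_iff, ← hm]; exact h3 α
        rw [← Finset.add_sum_erase _ _ hαs] at hsum
        have hr : ∑ β ∈ (e.repr (f α)).support.erase α, e.repr (f α) β • e β ∈
            ψ.toLinearMap.range := by
          refine Submodule.sum_mem _ fun β hβ => Submodule.smul_mem _ _ ?_
          obtain ⟨hβα, hβ⟩ := Finset.mem_erase.1 hβ
          rw [Finsupp.mem_support_iff, ← hm] at hβ
          refine ih β.degree ?_ β rfl
          by_contra hlt
          rcases (not_lt.1 hlt).lt_or_eq with h | h
          · exact hβ (h1 α β (hα ▸ h))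
          · exact hβ (h2 α β (hα ▸ h.symm) hβα)
        have hfα : f α ∈ ψ.toLinearMap.range := ⟨_, rfl⟩
        have h5 : e.repr (f α) α • e α ∈ ψ.toLinearMap.range := by
          have e5 := eq_sub_of_add_eq hsum
          rw [e5]
          exact Submodule.sub_mem _ hfα hr
        have h6 : e.repr (f α) α ≠ 0 := by rw [← hm]; exact h3 α
        have := Submodule.smul_mem _ (e.repr (f α) α)⁻¹ h5
        rwa [smul_smul, inv_mul_cancel₀ h6, one_smul] at this
    intro y
    have : (⊤ : Submodule ℝ B) ≤ ψ.toLinearMap.range := by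
      rw [← e.span_eq]
      refine Submodule.span_le.2 ?_
      rintro _ ⟨α, rfl⟩
      exact key _ α rfl
    obtain ⟨z, hz⟩ := this (x := y) trivial
    exact ⟨z, hz⟩

end Bijectivity

end

end FormalLie

end

noncomputable section

namespace FormalLie

section

open MonoidalCategory CartesianMonoidalCategory
open scoped TensorProduct MonObj

namespace CocommCoalg

section MonoidObjects

variable (B : CocommCoalg.{u}) [MonObj B]

/-- The multiplication of a monoid object in cocommutative coalgebras. -/
def monMulHom : B.carrier ⊗[ℝ] B.carrier →ₗc[ℝ] B.carrier := μ[B].toCoalgHom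

/-- The unit of a monoid object in cocommutative coalgebras. -/
def monOneHom : ULift.{u} ℝ →ₗc[ℝ] B.carrier := η[B].toCoalgHom

/-- The multiplication of a monoid object, as a linear map. -/
def monMul : B.carrier ⊗[ℝ] B.carrier →ₗ[ℝ] B.carrier := B.monMulHom.toLinearMap

/-- The unit element of a monoid object in cocommutative coalgebras. -/
def monOne : B.carrier := η[B].toCoalgHom (ULift.up 1 : ULift.{u} ℝ)

theorem one_apply (r : ULift.{u} ℝ) : η[B].toCoalgHom r = r.down • B.monOne := by
  refine Eq.trans ?_ (map_smul η[B].toCoalgHom r.down (ULift.up 1 : ULift.{u} ℝ))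
  refine congrArg η[B].toCoalgHom (?_ : r = r.down • (ULift.up 1 : ULift.{u} ℝ))
  ext
  simp

theorem monMul_one_left (a : B.carrier) : B.monMul (B.monOne ⊗ₜ[ℝ] a) = a := by
  have h := congrArg (fun f : 𝟙_ CocommCoalg.{u} ⊗ B ⟶ B => f.toCoalgHom
    ((ULift.up 1 : ULift.{u} ℝ) ⊗ₜ[ℝ] a : ULift.{u} ℝ ⊗[ℝ] B.carrier)) (MonObj.one_mul B)
  rw [← tensorHom_id, leftUnitor_hom] at h
  refine (congrArg B.monMul (tensorHom_apply η[B] (𝟙 B) (ULift.up 1) a)).symm.trans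
    (h.trans ?_)
  exact one_smul ℝ a

theorem monMul_one_right (a : B.carrier) : B.monMul (a ⊗ₜ[ℝ] B.monOne) = a := by
  have h := congrArg (fun f : B ⊗ 𝟙_ CocommCoalg.{u} ⟶ B => f.toCoalgHom
    (a ⊗ₜ[ℝ] (ULift.up 1 : ULift.{u} ℝ) : B.carrier ⊗[ℝ] ULift.{u} ℝ)) (MonObj.mul_one B)
  rw [← id_tensorHom, rightUnitor_hom] at h
  refine (congrArg B.monMul (tensorHom_apply (𝟙 B) η[B] a (ULift.up 1))).symm.trans
    (h.trans ?_)
  exact one_smul ℝ a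

theorem monMul_assoc (a b c : B.carrier) :
    B.monMul (B.monMul (a ⊗ₜ[ℝ] b) ⊗ₜ[ℝ] c) = B.monMul (a ⊗ₜ[ℝ] B.monMul (b ⊗ₜ[ℝ] c)) := by
  have h := congrArg (fun f : (B ⊗ B) ⊗ B ⟶ B => f.toCoalgHom
    ((a ⊗ₜ[ℝ] b) ⊗ₜ[ℝ] c : (B.carrier ⊗[ℝ] B.carrier) ⊗[ℝ] B.carrier)) (MonObj.mul_assoc B)
  rw [← tensorHom_id, ← id_tensorHom] at h
  have l := tensorHom_apply μ[B] (𝟙 B) (a ⊗ₜ[ℝ] b : B.carrier ⊗[ℝ] B.carrier) c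
  have r := (congrArg (𝟙 B ⊗ₘ μ[B] : B ⊗ (B ⊗ B) ⟶ _).toCoalgHom
    (associator_apply B B B a b c)).trans
    (tensorHom_apply (𝟙 B) μ[B] a (b ⊗ₜ[ℝ] c : B.carrier ⊗[ℝ] B.carrier))
  exact (congrArg B.monMul l).symm.trans (h.trans (congrArg B.monMul r))

theorem counit_monOne : Coalgebra.counit (R := ℝ) B.monOne = 1 :=
  CoalgHomClass.counit_comp_apply B.monOneHom (ULift.up 1 : ULift.{u} ℝ)

theorem counit_monMul (a b : B.carrier) : Coalgebra.counit (R := ℝ) (B.monMul (a ⊗ₜ[ℝ] b)) =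
    Coalgebra.counit (R := ℝ) a * Coalgebra.counit (R := ℝ) b := by
  refine (CoalgHomClass.counit_comp_apply B.monMulHom
    (a ⊗ₜ[ℝ] b : B.carrier ⊗[ℝ] B.carrier)).trans ?_
  exact mul_comm _ _

theorem comul_monOne : Coalgebra.comul (R := ℝ) B.monOne = B.monOne ⊗ₜ[ℝ] B.monOne := by
  refine (CoalgHomClass.map_comp_comul_apply B.monOneHom
    (ULift.up 1 : ULift.{u} ℝ)).symm.trans ?_
  change TensorProduct.map _ _ ((1 : ℝ) • ((ULift.up 1 : ULift.{u} ℝ) ⊗ₜ[ℝ]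
    (ULift.up 1 : ULift.{u} ℝ))) = _
  rw [one_smul]
  rfl

theorem comul_monMul (a b : B.carrier) : Coalgebra.comul (R := ℝ) (B.monMul (a ⊗ₜ[ℝ] b)) =
    TensorProduct.map B.monMul B.monMul
      (TensorProduct.tensorTensorTensorComm ℝ B.carrier B.carrier B.carrier B.carrier
        (Coalgebra.comul (R := ℝ) a ⊗ₜ[ℝ] Coalgebra.comul (R := ℝ) b)) :=
  (CoalgHomClass.map_comp_comul_apply B.monMulHom
    (a ⊗ₜ[ℝ] b : B.carrier ⊗[ℝ] B.carrier)).symm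

/-- The ring underlying a monoid object in cocommutative coalgebras. -/
@[reducible]
def monRing : Ring B.carrier :=
  { (inferInstance : AddCommGroup B.carrier) with
    mul := fun a b => B.monMul (a ⊗ₜ[ℝ] b)
    one := B.monOne
    zero_mul := fun a => by
      change B.monMul (0 ⊗ₜ[ℝ] a) = 0
      rw [TensorProduct.zero_tmul, map_zero]
    mul_zero := fun a => by
      change B.monMul (a ⊗ₜ[ℝ] 0) = 0
      rw [TensorProduct.tmul_zero, map_zero]
    left_distrib := fun a b c => by
      change B.monMul (a ⊗ₜ[ℝ] (b + c)) = B.monMul (a ⊗ₜ[ℝ] b) + B.monMul (a ⊗ₜ[ℝ] c)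
      rw [TensorProduct.tmul_add, map_add]
    right_distrib := fun a b c => by
      change B.monMul ((a + b) ⊗ₜ[ℝ] c) = B.monMul (a ⊗ₜ[ℝ] c) + B.monMul (b ⊗ₜ[ℝ] c)
      rw [TensorProduct.add_tmul, map_add]
    one_mul := B.monMul_one_left
    mul_one := B.monMul_one_right
    mul_assoc := B.monMul_assoc }

attribute [local instance] monRing

/-- The algebra underlying a monoid object in cocommutative coalgebras. -/
@[reducible]
def monAlgebra : Algebra ℝ B.carrier :=
  Algebra.ofModule
    (fun r a b => by
      change B.monMul ((r • a) ⊗ₜ[ℝ] b) = r • B.monMul (a ⊗ₜ[ℝ] b)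
      rw [← TensorProduct.smul_tmul', map_smul])
    (fun r a b => by
      change B.monMul (a ⊗ₜ[ℝ] (r • b)) = r • B.monMul (a ⊗ₜ[ℝ] b)
      rw [TensorProduct.tmul_smul, map_smul])

attribute [local instance] monAlgebra

theorem map_monMul (x y : B.carrier ⊗[ℝ] B.carrier) :
    TensorProduct.map B.monMul B.monMul
      (TensorProduct.tensorTensorTensorComm ℝ B.carrier B.carrier B.carrier B.carrier
        (x ⊗ₜ[ℝ] y)) = x * y := by
  induction x with
  | zero => rw [TensorProduct.zero_tmul, LinearEquiv.map_zero, LinearMap.map_zero, zero_mul]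
  | add x x' hx hx' => rw [TensorProduct.add_tmul, LinearEquiv.map_add, LinearMap.map_add, hx, hx', add_mul]
  | tmul a a' =>
    induction y with
    | zero => rw [TensorProduct.tmul_zero, LinearEquiv.map_zero, LinearMap.map_zero, mul_zero]
    | add y y' hy hy' => rw [TensorProduct.tmul_add, LinearEquiv.map_add, LinearMap.map_add, hy, hy', mul_add]
    | tmul b b' =>
      rw [TensorProduct.tensorTensorTensorComm_tmul, TensorProduct.map_tmul,
        Algebra.TensorProduct.tmul_mul_tmul]
      rfl

/-- The bialgebra underlying a monoid object in cocommutative coalgebras. -/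
@[reducible]
def monBialgebra : Bialgebra ℝ B.carrier :=
  Bialgebra.mk' ℝ B.carrier
    B.counit_monOne (fun {a b} => B.counit_monMul a b) B.comul_monOne
    (fun {a b} => (B.comul_monMul a b).trans (B.map_monMul _ _))

end MonoidObjects

end CocommCoalg

end

end FormalLie

end

noncomputable section

namespace FormalLie

section

open MonoidalCategory CartesianMonoidalCategory
open scoped TensorProduct MonObj

attribute [local instance] CocommCoalg.monRing CocommCoalg.monAlgebra CocommCoalg.monBialgebra

namespace CocommCoalg

/-- A homomorphism of monoid objects in cocommutative coalgebras, as an algebra homomorphism. -/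
def monAlgHom {B D : CocommCoalg.{u}} [MonObj B] [MonObj D] (f : B ⟶ D) [IsMonHom f] :
    B.carrier →ₐ[ℝ] D.carrier :=
  AlgHom.ofLinearMap (f.toCoalgHom : B.carrier →ₗ[ℝ] D.carrier)
    (congrArg (fun g : 𝟙_ CocommCoalg.{u} ⟶ D => g.toCoalgHom (ULift.up 1 : ULift.{u} ℝ))
      (IsMonHom.one_hom f))
    (fun a b => (congrArg (fun g : B ⊗ B ⟶ D => g.toCoalgHom
      (a ⊗ₜ[ℝ] b : B.carrier ⊗[ℝ] B.carrier)) (IsMonHom.mul_hom f)).trans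
        (congrArg D.monMul (tensorHom_apply f f a b)))

end CocommCoalg

namespace LieGrp

variable (G : LieGrp.{u}) (B : CocommCoalg.{u}) [MonObj B] (ψ : Env G.lieAlg →ₐ[ℝ] B.carrier)
  (hc : ∀ v, Coalgebra.counit (R := ℝ) (ψ (envι v)) = 0)
  (h : ∀ v, Coalgebra.comul (R := ℝ) (ψ (envι v)) =
    ψ (envι v) ⊗ₜ[ℝ] B.monOne + B.monOne ⊗ₜ[ℝ] ψ (envι v))

include hc in
theorem counit_envAlgHom (x : Env G.lieAlg) :
    Coalgebra.counit (R := ℝ) (ψ x) = Coalgebra.counit (R := ℝ) x := by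
  have : (Bialgebra.counitAlgHom ℝ B.carrier).comp ψ = Bialgebra.counitAlgHom ℝ (Env G.lieAlg) :=
    env_hom_ext fun v => (hc v).trans (envCounit_envι v).symm
  exact DFunLike.congr_fun this x

include h in
theorem comul_envAlgHom (x : Env G.lieAlg) :
    TensorProduct.map ψ.toLinearMap ψ.toLinearMap (Coalgebra.comul (R := ℝ) x) =
      Coalgebra.comul (R := ℝ) (ψ x) := by
  have : (Algebra.TensorProduct.map ψ ψ).comp (Bialgebra.comulAlgHom ℝ (Env G.lieAlg)) =
      (Bialgebra.comulAlgHom ℝ B.carrier).comp ψ := by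
    refine env_hom_ext fun v => Eq.trans ?_ (h v).symm
    refine (congrArg (Algebra.TensorProduct.map ψ ψ) (envComul_envι v)).trans ?_
    rw [map_add, Algebra.TensorProduct.map_tmul, Algebra.TensorProduct.map_tmul, map_one]
    rfl
  exact DFunLike.congr_fun this x

/-- A homomorphism from `U(𝔤)` to a Hopf algebra which maps `𝔤` to primitive elements, as a
morphism of coalgebras. -/
def envAlgHom : G.env ⟶ B :=
  CocommCoalg.Hom.mk (C := G.env) (D := B)
    { toLinearMap := ψ.toLinearMap
      counit_comp := LinearMap.ext (G.counit_envAlgHom B ψ hc)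
      map_comp_comul := LinearMap.ext (G.comul_envAlgHom B ψ h) }

theorem isMonHom_envAlgHom : IsMonHom (G.envAlgHom B ψ hc h) where
  one_hom := CocommCoalg.hom_ext fun r => by
    change ψ (r.down • (1 : Env G.lieAlg)) = η[B].toCoalgHom r
    rw [map_smul, map_one]
    exact (CocommCoalg.one_apply B r).symm
  mul_hom := by
    refine CocommCoalg.prod_hom_ext fun (a b : Env G.lieAlg) => ?_
    have l := congrArg (G.envAlgHom B ψ hc h).toCoalgHom (envMul_apply G a b)
    have r := congrArg B.monMul
      (CocommCoalg.tensorHom_apply (G.envAlgHom B ψ hc h) (G.envAlgHom B ψ hc h) a b)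
    exact (l.trans (map_mul ψ a b)).trans r.symm

end LieGrp

attribute [instance] PtdMfd.preservesFiniteProducts_dist

namespace LieGrp

open PtdMfd

variable (G : LieGrp.{u})

/-- The Hopf algebra of point distributions on a Lie group. -/
abbrev distHopf : Grp CocommCoalg.{u} := distGrp.obj (toGrp.obj G)

theorem distEval_monOne (a : G.toPtdMfd.germs) :
    G.toPtdMfd.distEval a G.distHopf.X.monOne = germEval G.I (1 : G.carrier) a := by
  let _ : PtdMfd.Dist.{u}.Monoidal := Functor.Monoidal.ofChosenFiniteProducts _
  let χ : point.{u}.dist.carrier :=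
    (Functor.LaxMonoidal.ε PtdMfd.Dist.{u}).toCoalgHom (ULift.up 1 : ULift.{u} ℝ)
  have hχ : Coalgebra.counit (R := ℝ) χ = 1 :=
    CoalgHomClass.counit_comp_apply
      (show ULift.{u} ℝ →ₗc[ℝ] point.{u}.dist.carrier from
        (Functor.LaxMonoidal.ε PtdMfd.Dist.{u}).toCoalgHom) (ULift.up 1 : ULift.{u} ℝ)
  refine (distEval_distMap point.{u} η[G.toPtdMfd] χ a).trans ?_
  have : germMap (X := point.{u}) η[G.toPtdMfd] a =
      germEval G.I (1 : G.carrier) a • (1 : point.{u}.germs) := by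
    rw [← Algebra.algebraMap_eq_smul_one]
    obtain ⟨f, hf, rfl⟩ := mkGerm_surj G.toPtdMfd.I a
    refine Subtype.ext ?_
    change _ = algebraMap ℝ (Filter.Germ (𝓝 point.{u}.pt) ℝ) (f (1 : G.carrier))
    rw [algebraMap_germ]
    rfl
  rw [this]
  refine (congrArg (fun p : point.{u}.dist.carrier →ₗ[ℝ] ℝ => p χ)
    (?_ : _ = germEval G.I (1 : G.carrier) a • point.{u}.distEval 1)).trans ?_
  · refine LinearMap.ext fun χ => ?_
    exact (point.{u}.distFun χ).map_smul (germEval G.I (1 : G.carrier) a) 1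
  · rw [LinearMap.smul_apply, ← counit_dist, hχ, smul_eq_mul, mul_one]

theorem distEval_monMul (φ φ' : G.toPtdMfd.dist.carrier)
    (χ : (G.toPtdMfd.prod G.toPtdMfd).dist.carrier)
    (hχ : (distProd G.toPtdMfd G.toPtdMfd).toCoalgHom χ =
      (φ ⊗ₜ[ℝ] φ' : G.toPtdMfd.dist.carrier ⊗[ℝ] G.toPtdMfd.dist.carrier))
    (a : G.toPtdMfd.germs) :
    G.toPtdMfd.distEval a (G.distHopf.X.monMul (φ ⊗ₜ[ℝ] φ')) =
      (G.toPtdMfd.prod G.toPtdMfd).distEval (germMap G.mulHom a) χ := by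
  let _ : PtdMfd.Dist.{u}.Monoidal := Functor.Monoidal.ofChosenFiniteProducts _
  rw [← distEval_distMap]
  refine congrArg (G.toPtdMfd.distEval a) ?_
  have h1 : G.distHopf.X.monMul (φ ⊗ₜ[ℝ] φ') =
      (Functor.LaxMonoidal.μ PtdMfd.Dist G.toPtdMfd G.toPtdMfd ≫
        PtdMfd.Dist.map μ[G.toPtdMfd]).toCoalgHom
        ((distProd G.toPtdMfd G.toPtdMfd).toCoalgHom χ) := by
    rw [hχ]
    rfl
  have h2 : distProd G.toPtdMfd G.toPtdMfd ≫
      Functor.LaxMonoidal.μ PtdMfd.Dist G.toPtdMfd G.toPtdMfd = 𝟙 _ := by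
    rw [Functor.Monoidal.μ_of_cartesianMonoidalCategory]
    exact (prodComparisonIso PtdMfd.Dist G.toPtdMfd G.toPtdMfd).hom_inv_id
  exact h1.trans (congrArg (fun f : (G.toPtdMfd.prod G.toPtdMfd).dist ⟶
    (G.toPtdMfd.prod G.toPtdMfd).dist => (f ≫ PtdMfd.Dist.map G.mulHom).toCoalgHom χ) h2)

end LieGrp

end

end FormalLie

end

noncomputable section

namespace FormalLie

section

open scoped TensorProduct
open Filter

section ProductDerivatives

variable {E F : Type*} [NormedAddCommGroup E] [NormedSpace ℝ E] [NormedAddCommGroup F]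
  [NormedSpace ℝ F]

theorem fderiv_comp_fst_apply {k : E → ℝ} {v : E × F} (hk : DifferentiableAt ℝ k v.1)
    (w : E × F) : fderiv ℝ (fun v : E × F => k v.1) v w = fderiv ℝ k v.1 w.1 := by
  have h := hk.hasFDerivAt.comp v (hasFDerivAt_fst (𝕜 := ℝ) (p := v))
  exact DFunLike.congr_fun h.fderiv w

theorem fderiv_comp_snd_apply {k : F → ℝ} {v : E × F} (hk : DifferentiableAt ℝ k v.2)
    (w : E × F) : fderiv ℝ (fun v : E × F => k v.2) v w = fderiv ℝ k v.2 w.2 := by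
  have h := hk.hasFDerivAt.comp v (hasFDerivAt_snd (𝕜 := ℝ) (p := v))
  exact DFunLike.congr_fun h.fderiv w

theorem fderiv_slice_fst {k : E × F → ℝ} {v : E} {w : F} (hk : DifferentiableAt ℝ k (v, w))
    (p : E) : fderiv ℝ (fun y => k (y, w)) v p = fderiv ℝ k (v, w) (p, 0) := by
  have h := HasFDerivAt.comp (g := k) (f := fun y => (y, w)) v hk.hasFDerivAt
    ((hasFDerivAt_id v).prodMk (hasFDerivAt_const w v))
  exact DFunLike.congr_fun h.fderiv p

theorem fderiv_slice_snd {k : E × F → ℝ} {v : E} {w : F} (hk : DifferentiableAt ℝ k (v, w))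
    (q : F) : fderiv ℝ (fun z => k (v, z)) w q = fderiv ℝ k (v, w) (0, q) := by
  have h := HasFDerivAt.comp (g := k) (f := fun z => (v, z)) w hk.hasFDerivAt
    ((hasFDerivAt_const v w).prodMk (hasFDerivAt_id w))
  exact DFunLike.congr_fun h.fderiv q

end ProductDerivatives

namespace PtdMfd

variable (X : PtdMfd.{u})

/-- The base point in the preferred chart. -/
def chartPt : X.E := extChartAt X.I X.pt X.pt

/-- A function on a pointed manifold, read in the preferred chart at the base point. -/
def read (f : X.carrier → ℝ) : X.E → ℝ := f ∘ (extChartAt X.I X.pt).symm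

theorem tendsto_chart_symm :
    Tendsto (extChartAt X.I X.pt).symm (𝓝 X.chartPt) (𝓝 X.pt) := by
  have h := (continuousAt_extChartAt_symm (I := X.I) X.pt).tendsto
  rwa [extChartAt_to_inv] at h

theorem read_chartPt (f : X.carrier → ℝ) : X.read f X.chartPt = f X.pt := by
  simp [read, chartPt]

variable {X}

theorem read_eventuallyEq {f g : X.carrier → ℝ} (h : f =ᶠ[𝓝 X.pt] g) :
    X.read f =ᶠ[𝓝 X.chartPt] X.read g :=
  h.comp_tendsto X.tendsto_chart_symm

theorem contDiffAt_read {f : X.carrier → ℝ}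
    (hf : ∀ᶠ y in 𝓝 X.pt, ContMDiffAt X.I 𝓘(ℝ) ∞ f y) :
    ∀ᶠ v in 𝓝 X.chartPt, ContDiffAt ℝ ∞ (X.read f) v := by
  filter_upwards [X.tendsto_chart_symm.eventually hf,
    extChartAt_target_mem_nhds (I := X.I) X.pt] with v hv hvt
  have s₁ : ContMDiffAt 𝓘(ℝ, X.E) X.I ∞ (extChartAt X.I X.pt).symm v :=
    (contMDiffOn_extChartAt_symm (I := X.I) X.pt).contMDiffAt
      ((isOpen_extChartAt_target (I := X.I) X.pt).mem_nhds hvt)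
  exact (ContMDiffAt.comp v hv s₁).contDiffAt

/-- The derivative of a germ, read in the chart, in direction `p`. -/
def fstDeriv (p : X.E) (a : X.germs) : ℝ := fderiv ℝ (X.read a.2.choose) X.chartPt p

/-- The second derivative of a germ, read in the chart, in directions `p` and `q`. -/
def sndDeriv (p q : X.E) (a : X.germs) : ℝ :=
  fderiv ℝ (fun y => fderiv ℝ (X.read a.2.choose) y q) X.chartPt p

theorem choose_eventuallyEq {f : X.carrier → ℝ} (hf) :
    (mkGerm X.I X.pt f hf).2.choose =ᶠ[𝓝 X.pt] f :=
  Germ.coe_eq.1 (mkGerm X.I X.pt f hf).2.choose_spec.2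

theorem fstDeriv_mkGerm (p : X.E) {f : X.carrier → ℝ} (hf) :
    fstDeriv p (mkGerm X.I X.pt f hf) = fderiv ℝ (X.read f) X.chartPt p := by
  rw [fstDeriv, (read_eventuallyEq (choose_eventuallyEq hf)).fderiv_eq]

theorem sndDeriv_mkGerm (p q : X.E) {f : X.carrier → ℝ} (hf) :
    sndDeriv p q (mkGerm X.I X.pt f hf) =
      fderiv ℝ (fun y => fderiv ℝ (X.read f) y q) X.chartPt p := by
  have h := (read_eventuallyEq (choose_eventuallyEq hf)).fderiv (𝕜 := ℝ)
  have h' : (fun y => fderiv ℝ (X.read (mkGerm X.I X.pt f hf).2.choose) y q) =ᶠ[𝓝 X.chartPt]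
      fun y => fderiv ℝ (X.read f) y q := h.mono fun y hy => by simp only [hy]
  rw [sndDeriv, h'.fderiv_eq]

theorem differentiableAt_read {f : X.carrier → ℝ}
    (hf : ∀ᶠ y in 𝓝 X.pt, ContMDiffAt X.I 𝓘(ℝ) ∞ f y) :
    ∀ᶠ v in 𝓝 X.chartPt, DifferentiableAt ℝ (X.read f) v :=
  (contDiffAt_read hf).mono fun _ h => h.differentiableAt (by simp)

theorem differentiableAt_fderiv_read {f : X.carrier → ℝ}
    (hf : ∀ᶠ y in 𝓝 X.pt, ContMDiffAt X.I 𝓘(ℝ) ∞ f y) (q : X.E) :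
    DifferentiableAt ℝ (fun y => fderiv ℝ (X.read f) y q) X.chartPt := by
  have h := ((contDiffAt_read hf).self_of_nhds.of_le (m := 2)
    (WithTop.coe_le_coe.2 le_top)).fderiv_right (m := 1) one_add_one_eq_two.le
  exact (h.differentiableAt (by simp)).clm_apply (differentiableAt_const q)

theorem fstDeriv_add (p : X.E) (a b : X.germs) :
    fstDeriv p (a + b) = fstDeriv p a + fstDeriv p b := by
  obtain ⟨f, hf, rfl⟩ := mkGerm_surj X.I a
  obtain ⟨g, hg, rfl⟩ := mkGerm_surj X.I b
  refine (fstDeriv_mkGerm (f := f + g) p ((hf.and hg).mono fun y h => h.1.add h.2)).trans ?_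
  rw [fstDeriv_mkGerm, fstDeriv_mkGerm, ← _root_.add_apply, ← fderiv_add
    (differentiableAt_read hf).self_of_nhds (differentiableAt_read hg).self_of_nhds]
  rfl

theorem fstDeriv_mul (p : X.E) (a b : X.germs) :
    fstDeriv p (a * b) =
      germEval X.I X.pt a * fstDeriv p b + fstDeriv p a * germEval X.I X.pt b := by
  obtain ⟨f, hf, rfl⟩ := mkGerm_surj X.I a
  obtain ⟨g, hg, rfl⟩ := mkGerm_surj X.I b
  refine (fstDeriv_mkGerm (f := f * g) p ((hf.and hg).mono fun y h => h.1.mul h.2)).trans ?_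
  rw [fstDeriv_mkGerm, fstDeriv_mkGerm]
  have h := fderiv_mul (differentiableAt_read hf).self_of_nhds
    (differentiableAt_read hg).self_of_nhds
  refine (DFunLike.congr_fun h p).trans ?_
  rw [read_chartPt, read_chartPt]
  change f X.pt * fderiv ℝ (X.read g) X.chartPt p + g X.pt * fderiv ℝ (X.read f) X.chartPt p =
    f X.pt * _ + _ * g X.pt
  ring

theorem fstDeriv_algebraMap (p : X.E) (r : ℝ) : fstDeriv p (algebraMap ℝ X.germs r) = 0 := by
  have h : algebraMap ℝ X.germs r = mkGerm X.I X.pt (fun _ => r)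
      (Eventually.of_forall fun _ => contMDiffAt_const) := Subtype.ext (algebraMap_germ _ r)
  rw [h, fstDeriv_mkGerm]
  exact DFunLike.congr_fun (fderiv_const_apply (𝕜 := ℝ) (x := X.chartPt) r) p

theorem sndDeriv_add (p q : X.E) (a b : X.germs) :
    sndDeriv p q (a + b) = sndDeriv p q a + sndDeriv p q b := by
  obtain ⟨f, hf, rfl⟩ := mkGerm_surj X.I a
  obtain ⟨g, hg, rfl⟩ := mkGerm_surj X.I b
  refine (sndDeriv_mkGerm (f := f + g) p q ((hf.and hg).mono fun y h => h.1.add h.2)).trans ?_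
  rw [sndDeriv_mkGerm, sndDeriv_mkGerm, ← _root_.add_apply, ← fderiv_add
    (differentiableAt_fderiv_read hf q) (differentiableAt_fderiv_read hg q)]
  refine congrArg (fun L : X.E →L[ℝ] ℝ => L p) (EventuallyEq.fderiv_eq ?_)
  filter_upwards [differentiableAt_read hf, differentiableAt_read hg] with y hy hy'
  exact DFunLike.congr_fun (fderiv_add hy hy') q

theorem sndDeriv_mul (p q : X.E) (a b : X.germs) :
    sndDeriv p q (a * b) = germEval X.I X.pt a * sndDeriv p q b + fstDeriv p a * fstDeriv q b +
      fstDeriv q a * fstDeriv p b + sndDeriv p q a * germEval X.I X.pt b := by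
  obtain ⟨f, hf, rfl⟩ := mkGerm_surj X.I a
  obtain ⟨g, hg, rfl⟩ := mkGerm_surj X.I b
  refine (sndDeriv_mkGerm (f := f * g) p q ((hf.and hg).mono fun y h => h.1.mul h.2)).trans ?_
  rw [sndDeriv_mkGerm, sndDeriv_mkGerm, fstDeriv_mkGerm, fstDeriv_mkGerm, fstDeriv_mkGerm,
    fstDeriv_mkGerm]
  have h1 : (fun y => fderiv ℝ (X.read (f * g)) y q) =ᶠ[𝓝 X.chartPt]
      fun y => X.read f y * fderiv ℝ (X.read g) y q + X.read g y * fderiv ℝ (X.read f) y q := by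
    filter_upwards [differentiableAt_read hf, differentiableAt_read hg] with y hy hy'
    exact DFunLike.congr_fun (fderiv_mul hy hy') q
  have df := (differentiableAt_read hf).self_of_nhds
  have dg := (differentiableAt_read hg).self_of_nhds
  have df' := differentiableAt_fderiv_read hf q
  have dg' := differentiableAt_fderiv_read hg q
  rw [h1.fderiv_eq, fderiv_fun_add (f := fun y => X.read f y * fderiv ℝ (X.read g) y q)
    (g := fun y => X.read g y * fderiv ℝ (X.read f) y q) (df.mul dg') (dg.mul df'), fderiv_fun_mul df dg',
    fderiv_fun_mul dg df']
  simp only [_root_.add_apply, _root_.smul_apply, smul_eq_mul,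
    read_chartPt]
  change _ = f X.pt * _ + _ + _ + _ * g X.pt
  ring

theorem sndDeriv_algebraMap (p q : X.E) (r : ℝ) :
    sndDeriv p q (algebraMap ℝ X.germs r) = 0 := by
  have h : algebraMap ℝ X.germs r = mkGerm X.I X.pt (fun _ => r)
      (Eventually.of_forall fun _ => contMDiffAt_const) := Subtype.ext (algebraMap_germ _ r)
  have h' : (fun y => fderiv ℝ (X.read fun _ => r) y q) = fun _ => 0 := funext fun y =>
    DFunLike.congr_fun (fderiv_const_apply (𝕜 := ℝ) (x := y) r) q
  rw [h, sndDeriv_mkGerm, h']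
  exact DFunLike.congr_fun (fderiv_const_apply (𝕜 := ℝ) (x := X.chartPt) (0 : ℝ)) p

theorem fstDeriv_smul (p : X.E) (r : ℝ) (a : X.germs) :
    fstDeriv p (r • a) = r * fstDeriv p a := by
  rw [Algebra.smul_def, fstDeriv_mul, fstDeriv_algebraMap, zero_mul, add_zero, AlgHom.commutes]
  rfl

theorem sndDeriv_smul (p q : X.E) (r : ℝ) (a : X.germs) :
    sndDeriv p q (r • a) = r * sndDeriv p q a := by
  rw [Algebra.smul_def, sndDeriv_mul, fstDeriv_algebraMap, fstDeriv_algebraMap,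
    sndDeriv_algebraMap, zero_mul, zero_mul, zero_mul, add_zero, add_zero, add_zero,
    AlgHom.commutes]
  rfl

theorem fstDeriv_eq_zero (p : X.E) : ∀ a ∈ X.maxIdeal ^ 2, fstDeriv p a = 0 := by
  intro a ha
  rw [pow_two] at ha
  induction ha using Submodule.mul_induction_on' with
  | mem_mul_mem a ha b hb =>
    have ha' : germEval X.I X.pt a = 0 := ha
    have hb' : germEval X.I X.pt b = 0 := hb
    rw [fstDeriv_mul, ha', hb', zero_mul, mul_zero, add_zero]
  | add a _ b _ ha hb => rw [fstDeriv_add, ha, hb, add_zero]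

theorem sndDeriv_eq_zero (p q : X.E) : ∀ a ∈ X.maxIdeal ^ 3, sndDeriv p q a = 0 := by
  intro a ha
  rw [pow_succ'] at ha
  induction ha using Submodule.mul_induction_on' with
  | mem_mul_mem a ha b hb =>
    have ha' : germEval X.I X.pt a = 0 := ha
    have hb' : germEval X.I X.pt b = 0 := Ideal.pow_le_self two_ne_zero hb
    rw [sndDeriv_mul, ha', hb', fstDeriv_eq_zero p b hb, fstDeriv_eq_zero q b hb]
    simp
  | add a _ b _ ha hb => rw [sndDeriv_add, ha, hb, add_zero]

variable (X)

/-- The point distribution of order one defined by a tangent vector, read in the chart. -/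
def fstDist (p : X.E) : X.dist.carrier :=
  X.mkDist { toFun := fstDeriv p, map_add' := fstDeriv_add p, map_smul' := fstDeriv_smul p } 2
    (fstDeriv_eq_zero p)

/-- The point distribution of order two defined by two tangent vectors, read in the chart. -/
def sndDist (p q : X.E) : X.dist.carrier :=
  X.mkDist { toFun := sndDeriv p q, map_add' := sndDeriv_add p q,
             map_smul' := sndDeriv_smul p q } 3 (sndDeriv_eq_zero p q)

theorem distEval_fstDist (p : X.E) (a : X.germs) : X.distEval a (X.fstDist p) = fstDeriv p a :=
  X.distEval_mkDist _ _ _ a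

theorem distEval_sndDist (p q : X.E) (a : X.germs) :
    X.distEval a (X.sndDist p q) = sndDeriv p q a :=
  X.distEval_mkDist _ _ _ a

theorem fstDist_add (p q : X.E) : X.fstDist (p + q) = X.fstDist p + X.fstDist q :=
  X.dist_ext fun a => by
    rw [map_add, distEval_fstDist, distEval_fstDist, distEval_fstDist]
    exact map_add _ _ _

theorem fstDist_smul (r : ℝ) (p : X.E) : X.fstDist (r • p) = r • X.fstDist p :=
  X.dist_ext fun a => by
    rw [map_smul, distEval_fstDist, distEval_fstDist]
    exact map_smul _ _ _

theorem counit_fstDist (p : X.E) : Coalgebra.counit (R := ℝ) (X.fstDist p) = 0 := by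
  rw [counit_dist, distEval_fstDist, ← map_one (algebraMap ℝ X.germs), fstDeriv_algebraMap]

section Product

variable (Y : PtdMfd.{u})

theorem chartPt_prod : (X.prod Y).chartPt = (X.chartPt, Y.chartPt) :=
  congrArg (fun e : PartialEquiv (X.carrier × Y.carrier) (X.E × Y.E) => e (X.pt, Y.pt)) (extChartAt_prod (I := X.I) (I' := Y.I) (X.pt, Y.pt))

theorem read_prod (f : X.carrier × Y.carrier → ℝ) (y : X.E) (z : Y.E) :
    (X.prod Y).read f (y, z) =
      f ((extChartAt X.I X.pt).symm y, (extChartAt Y.I Y.pt).symm z) :=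
  congrArg (fun e : PartialEquiv (X.carrier × Y.carrier) (X.E × Y.E) => f (e.symm (y, z))) (extChartAt_prod (I := X.I) (I' := Y.I) (X.pt, Y.pt))

theorem contMDiffAt_comp_fst {f : X.carrier → ℝ}
    (hf : ∀ᶠ y in 𝓝 X.pt, ContMDiffAt X.I 𝓘(ℝ) ∞ f y) :
    ∀ᶠ y in 𝓝 (X.prod Y).pt, ContMDiffAt (X.prod Y).I 𝓘(ℝ) ∞ (f ∘ (fst X Y).toFun) y :=
  ((tendsto_pt (fst X Y)).eventually hf).mono fun y hy =>
    ContMDiffAt.comp y hy (fst X Y).contMDiff.contMDiffAt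

theorem contMDiffAt_comp_snd {f : Y.carrier → ℝ}
    (hf : ∀ᶠ y in 𝓝 Y.pt, ContMDiffAt Y.I 𝓘(ℝ) ∞ f y) :
    ∀ᶠ y in 𝓝 (X.prod Y).pt, ContMDiffAt (X.prod Y).I 𝓘(ℝ) ∞ (f ∘ (snd X Y).toFun) y :=
  ((tendsto_pt (snd X Y)).eventually hf).mono fun y hy =>
    ContMDiffAt.comp y hy (snd X Y).contMDiff.contMDiffAt

theorem read_comp_fst (f : X.carrier → ℝ) :
    (X.prod Y).read (f ∘ (fst X Y).toFun) = fun v : X.E × Y.E => X.read f v.1 :=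
  funext fun v => read_prod X Y _ (v : X.E × Y.E).1 (v : X.E × Y.E).2

theorem read_comp_snd (f : Y.carrier → ℝ) :
    (X.prod Y).read (f ∘ (snd X Y).toFun) = fun v : X.E × Y.E => Y.read f v.2 :=
  funext fun v => read_prod X Y _ (v : X.E × Y.E).1 (v : X.E × Y.E).2

theorem fstDeriv_germMap_fst (w : X.E × Y.E) (a : X.germs) :
    fstDeriv (X := X.prod Y) w (germMap (fst X Y) a) = fstDeriv w.1 a := by
  obtain ⟨f, hf, rfl⟩ := mkGerm_surj X.I a
  refine (fstDeriv_mkGerm (X := X.prod Y) w (contMDiffAt_comp_fst X Y hf)).trans ?_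
  rw [read_comp_fst, fstDeriv_mkGerm, chartPt_prod]
  exact fderiv_comp_fst_apply (v := (X.chartPt, Y.chartPt)) (differentiableAt_read hf).self_of_nhds w

theorem fstDeriv_germMap_snd (w : X.E × Y.E) (a : Y.germs) :
    fstDeriv (X := X.prod Y) w (germMap (snd X Y) a) = fstDeriv w.2 a := by
  obtain ⟨f, hf, rfl⟩ := mkGerm_surj Y.I a
  refine (fstDeriv_mkGerm (X := X.prod Y) w (contMDiffAt_comp_snd X Y hf)).trans ?_
  rw [read_comp_snd, fstDeriv_mkGerm, chartPt_prod]
  exact fderiv_comp_snd_apply (v := (X.chartPt, Y.chartPt)) (differentiableAt_read hf).self_of_nhds w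

theorem sndDeriv_germMap_fst (p : X.E) (q : Y.E) (a : X.germs) :
    sndDeriv (X := X.prod Y) (p, 0) (0, q) (germMap (fst X Y) a) = 0 := by
  obtain ⟨f, hf, rfl⟩ := mkGerm_surj X.I a
  refine (sndDeriv_mkGerm (X := X.prod Y) (p, 0) (0, q) (contMDiffAt_comp_fst X Y hf)).trans ?_
  rw [read_comp_fst, chartPt_prod]
  have h : (fun y : X.E × Y.E => fderiv ℝ (fun v : X.E × Y.E => X.read f v.1) y (0, q))
      =ᶠ[𝓝 (X.chartPt, Y.chartPt)] fun _ => 0 := by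
    filter_upwards [(continuousAt_fst (p := (X.chartPt, Y.chartPt))).eventually
      (differentiableAt_read hf)] with y hy
    rw [fderiv_comp_fst_apply hy, map_zero]
  exact (DFunLike.congr_fun h.fderiv_eq (p, 0)).trans
    (DFunLike.congr_fun (fderiv_const_apply (𝕜 := ℝ) (x := (X.chartPt, Y.chartPt)) (0 : ℝ)) _)

theorem sndDeriv_germMap_snd (p : X.E) (q : Y.E) (a : Y.germs) :
    sndDeriv (X := X.prod Y) (p, 0) (0, q) (germMap (snd X Y) a) = 0 := by
  obtain ⟨f, hf, rfl⟩ := mkGerm_surj Y.I a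
  refine (sndDeriv_mkGerm (X := X.prod Y) (p, 0) (0, q) (contMDiffAt_comp_snd X Y hf)).trans ?_
  rw [read_comp_snd, chartPt_prod]
  have h : (fun y : X.E × Y.E => fderiv ℝ (fun v : X.E × Y.E => Y.read f v.2) y (0, q))
      =ᶠ[𝓝 (X.chartPt, Y.chartPt)] fun y => fderiv ℝ (Y.read f) y.2 q := by
    filter_upwards [(continuousAt_snd (p := (X.chartPt, Y.chartPt))).eventually
      (differentiableAt_read hf)] with y hy
    rw [fderiv_comp_snd_apply hy]
  refine (DFunLike.congr_fun h.fderiv_eq (p, 0)).trans ?_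
  exact (fderiv_comp_snd_apply (k := fun y => fderiv ℝ (Y.read f) y q)
    (v := (X.chartPt, Y.chartPt)) (differentiableAt_fderiv_read hf q) (p, 0)).trans (map_zero _)

theorem distProd_sndDist (p : X.E) (q : Y.E) :
    (distProd X Y).toCoalgHom ((X.prod Y).sndDist (p, 0) (0, q)) =
      (X.fstDist p ⊗ₜ[ℝ] Y.fstDist q : X.dist.carrier ⊗[ℝ] Y.dist.carrier) := by
  refine tensor_separating_ext (V := X.dist.carrier) (W := Y.dist.carrier)
    (p := X.distEval) (fun φ => X.dist_eq_zero) (q := Y.distEval) (fun φ => Y.dist_eq_zero)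
    fun a a' => ?_
  refine (tensorFunctional_distProd X Y _ _ _).trans ?_
  refine (distEval_sndDist (X.prod Y) (p, 0) (0, q) _).trans ?_
  refine (sndDeriv_mul (X := X.prod Y) (p, 0) (0, q) _ _).trans ?_
  rw [sndDeriv_germMap_fst X Y p q a, sndDeriv_germMap_snd X Y p q a',
    fstDeriv_germMap_fst X Y (p, 0) a, fstDeriv_germMap_fst X Y (0, q) a,
    fstDeriv_germMap_snd X Y (p, 0) a', fstDeriv_germMap_snd X Y (0, q) a',
    tensorFunctional_tmul, distEval_fstDist, distEval_fstDist]
  have h0 : fstDeriv (0 : X.E) a = 0 := by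
    rw [← X.distEval_fstDist, ← zero_smul ℝ (0 : X.E), fstDist_smul, zero_smul, map_zero]
  dsimp only
  rw [h0, zero_mul, zero_mul, mul_zero, add_zero, add_zero, zero_add]


end Product

end PtdMfd

end

end FormalLie

end

noncomputable section

namespace FormalLie

section

open scoped TensorProduct
open Filter VectorField

theorem PtdMfd.fderiv_read (X : PtdMfd.{u}) {f : X.carrier → ℝ} {y : X.carrier}
    (hy : y ∈ (extChartAt X.I X.pt).source) (hf : MDifferentiableAt X.I 𝓘(ℝ) f y)
    (w : TangentSpace X.I y) :
    fderiv ℝ (X.read f) (extChartAt X.I X.pt y)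
      (mfderiv X.I 𝓘(ℝ, X.E) (extChartAt X.I X.pt) y w : X.E) = (mfderiv X.I 𝓘(ℝ) f y w : ℝ) := by
  set e := extChartAt X.I X.pt with he
  have h1 : X.read f ∘ e =ᶠ[𝓝 y] f := by
    filter_upwards [(isOpen_extChartAt_source (I := X.I) X.pt).mem_nhds hy] with z hz
    simp only [PtdMfd.read, Function.comp_apply]
    rw [e.left_inv hz]
  have hs : MDifferentiableAt 𝓘(ℝ, X.E) X.I e.symm (e y) := by
    have := (contMDiffOn_extChartAt_symm (I := X.I) (n := ∞) X.pt).contMDiffAt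
      ((isOpen_extChartAt_target (I := X.I) X.pt).mem_nhds (e.map_source hy))
    exact this.mdifferentiableAt (by simp)
  have hread : MDifferentiableAt 𝓘(ℝ, X.E) 𝓘(ℝ) (X.read f) (e y) := by
    refine MDifferentiableAt.comp (e y) (g := f) (f := e.symm) ?_ hs
    rwa [e.left_inv hy]
  have hee : MDifferentiableAt X.I 𝓘(ℝ, X.E) e y :=
    mdifferentiableAt_extChartAt (by rwa [← extChartAt_source X.I])
  have h2 := mfderiv_comp y hread hee
  have h3 : mfderiv X.I 𝓘(ℝ) (X.read f ∘ e) y = mfderiv X.I 𝓘(ℝ) f y := h1.mfderiv_eq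
  have h4 := DFunLike.congr_fun (h2.symm.trans h3) w
  refine Eq.trans ?_ h4
  exact DFunLike.congr_fun (mfderiv_eq_fderiv (𝕜 := ℝ) (f := X.read f) (x := e y)).symm _

namespace LieGrp

open PtdMfd

variable (G : LieGrp.{u})

/-- The unit, in the preferred chart. -/
def chartPt : G.E := extChartAt G.I (1 : G.carrier) 1

/-- A function on a Lie group, read in the preferred chart at the unit. -/
def read (f : G.carrier → ℝ) : G.E → ℝ := f ∘ (extChartAt G.I (1 : G.carrier)).symm

/-- The tangent space at the unit, read in the preferred chart. -/
def chartVec : G.lieAlg →ₗ[ℝ] G.E where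
  toFun v := (mfderiv G.I 𝓘(ℝ, G.E) (extChartAt G.I (1 : G.carrier)) 1 v : G.E)
  map_add' := (mfderiv G.I 𝓘(ℝ, G.E) (extChartAt G.I (1 : G.carrier)) 1).map_add
  map_smul' := (mfderiv G.I 𝓘(ℝ, G.E) (extChartAt G.I (1 : G.carrier)) 1).map_smul

theorem bijective_chartVec : Function.Bijective G.chartVec := by
  obtain ⟨A, hA⟩ := isInvertible_mfderiv_extChartAt (I := G.I)
    (mem_extChartAt_source (I := G.I) (1 : G.carrier))
  have : (G.chartVec : G.lieAlg → G.E) = A := funext fun v => (DFunLike.congr_fun hA v).symm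
  rw [this]
  exact A.bijective

theorem fderiv_read_chartVec {f : G.carrier → ℝ}
    (hf : MDifferentiableAt G.I 𝓘(ℝ) f 1) (v : G.lieAlg) :
    fderiv ℝ (G.read f) G.chartPt (G.chartVec v) =
      (mfderiv G.I 𝓘(ℝ) f 1 v : ℝ) :=
  G.toPtdMfd.fderiv_read (f := f) (mem_extChartAt_source (I := G.I) (1 : G.carrier)) hf v

/-- The point distribution `f ↦ df(v)` defined by an element of the Lie algebra. -/
def tangentDist : G.lieAlg →ₗ[ℝ] G.distHopf.X.carrier where
  toFun v := G.toPtdMfd.fstDist (G.chartVec v)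
  map_add' v w := by rw [map_add]; exact fstDist_add _ _ _
  map_smul' r v := by rw [map_smul]; exact fstDist_smul _ _ _

theorem distEval_tangentDist (v : G.lieAlg) (a : G.toPtdMfd.germs) :
    G.toPtdMfd.distEval a (G.tangentDist v) = fstDeriv (X := G.toPtdMfd) (G.chartVec v) a :=
  distEval_fstDist _ _ _

theorem distEval_tangentDist_mkGerm (v : G.lieAlg) {f : G.carrier → ℝ} (hf) :
    G.toPtdMfd.distEval (mkGerm G.I (1 : G.carrier) f hf) (G.tangentDist v) =
      (mfderiv G.I 𝓘(ℝ) f 1 v : ℝ) := by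
  refine (G.distEval_tangentDist v _).trans ?_
  refine (fstDeriv_mkGerm (X := G.toPtdMfd) (G.chartVec v) hf).trans ?_
  exact G.fderiv_read_chartVec (hf.self_of_nhds.mdifferentiableAt (by simp)) v

theorem counit_tangentDist (v : G.lieAlg) :
    Coalgebra.counit (R := ℝ) (G.tangentDist v) = 0 := counit_fstDist _ _

theorem comul_tangentDist (v : G.lieAlg) : Coalgebra.comul (R := ℝ) (G.tangentDist v) =
    G.tangentDist v ⊗ₜ[ℝ] G.distHopf.X.monOne + G.distHopf.X.monOne ⊗ₜ[ℝ] G.tangentDist v := by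
  refine tensor_separating_ext (V := G.toPtdMfd.dist.carrier) (W := G.toPtdMfd.dist.carrier)
    (p := G.toPtdMfd.distEval) (fun φ => G.toPtdMfd.dist_eq_zero) (q := G.toPtdMfd.distEval)
    (fun φ => G.toPtdMfd.dist_eq_zero) fun a a' => ?_
  refine (distEval_comul _ _ _ _).trans ?_
  refine Eq.trans ?_ (map_add _ _ _).symm
  refine Eq.trans ?_ (congrArg₂ (· + ·) (tensorFunctional_tmul _ _ _ _)
    (tensorFunctional_tmul _ _ _ _)).symm
  rw [distEval_monOne, distEval_monOne, distEval_tangentDist, distEval_tangentDist,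
    distEval_tangentDist, add_comm]
  exact fstDeriv_mul (X := G.toPtdMfd) (G.chartVec v) a a'

theorem fderiv_read_mul (w : G.lieAlg) {f : G.carrier → ℝ}
    (hf : ∀ᶠ y in 𝓝 (1 : G.carrier), ContMDiffAt G.I 𝓘(ℝ) ∞ f y) :
    ∀ᶠ y in 𝓝 G.chartPt,
      fderiv ℝ (fun z => f ((extChartAt G.I (1 : G.carrier)).symm y *
        (extChartAt G.I (1 : G.carrier)).symm z)) G.chartPt (G.chartVec w) =
      fderiv ℝ (G.read f) y
        (chartField (1 : G.carrier) (mulInvariantVectorField (I := G.I) w) y) := by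
  set e := extChartAt G.I (1 : G.carrier) with he
  filter_upwards [G.toPtdMfd.tendsto_chart_symm.eventually hf,
    extChartAt_target_mem_nhds (I := G.I) (1 : G.carrier)] with y hy hyt
  set g : G.carrier := e.symm y with hg
  have hgs : g ∈ e.source := e.map_target hyt
  have hey : e g = y := e.right_inv hyt
  have hfg : MDifferentiableAt G.I 𝓘(ℝ) f g :=
    ContMDiffAt.mdifferentiableAt (M := G.carrier) hy (by simp)
  have hfg' : MDifferentiableAt G.I 𝓘(ℝ) f (g * 1) := by rwa [mul_one]
  have hmul : MDifferentiableAt G.I G.I (g * ·) (1 : G.carrier) :=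
    (contMDiff_mul_left (n := ∞)).mdifferentiableAt (by simp)
  have h1 := G.fderiv_read_chartVec (f := f ∘ (g * ·)) (hfg'.comp (1 : G.carrier) hmul) w
  refine h1.trans ?_
  have h2 := DFunLike.congr_fun (mfderiv_comp_of_eq (x := (1 : G.carrier)) hfg hmul (mul_one g)) w
  refine h2.trans ?_
  have e₁ : (mfderiv G.I 𝓘(ℝ) f (g * 1) : G.E →L[ℝ] ℝ) = mfderiv G.I 𝓘(ℝ) f g :=
    congrArg (β := G.E →L[ℝ] ℝ) (fun x => mfderiv G.I 𝓘(ℝ) f x) (mul_one g)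
  refine (DFunLike.congr_fun e₁ (mulInvariantVectorField w g : G.E)).trans ?_
  refine (G.toPtdMfd.fderiv_read (f := f) hgs hfg (mulInvariantVectorField w g)).symm.trans ?_
  have h3 := chartField_apply (1 : G.carrier) (mulInvariantVectorField (I := G.I) w) hgs
  rw [hey] at h3
  rw [h3]
  exact congrArg (fun z => fderiv ℝ (G.read f) z _) hey

theorem distEval_tangentDist_mul (v w : G.lieAlg) {f : G.carrier → ℝ} (hf) :
    G.toPtdMfd.distEval (mkGerm G.I (1 : G.carrier) f hf)
      (G.distHopf.X.monMul (G.tangentDist v ⊗ₜ[ℝ] G.tangentDist w)) =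
      fderiv ℝ (fun y => fderiv ℝ (G.read f) y
        (chartField (1 : G.carrier) (mulInvariantVectorField (I := G.I) w) y))
        G.chartPt (G.chartVec v) := by
  refine (G.distEval_monMul _ _ _ (distProd_sndDist G.toPtdMfd G.toPtdMfd (G.chartVec v)
    (G.chartVec w)) _).trans ?_
  refine (distEval_sndDist (G.toPtdMfd.prod G.toPtdMfd) (G.chartVec v, 0) (0, G.chartVec w)
    _).trans ?_
  have hm : ∀ᶠ y in 𝓝 (G.toPtdMfd.prod G.toPtdMfd).pt,
      ContMDiffAt (G.toPtdMfd.prod G.toPtdMfd).I 𝓘(ℝ) ∞ (f ∘ G.mulHom.toFun) y :=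
    ((tendsto_pt G.mulHom).eventually hf).mono fun y hy =>
      ContMDiffAt.comp y hy G.mulHom.contMDiff.contMDiffAt
  refine (sndDeriv_mkGerm (X := G.toPtdMfd.prod G.toPtdMfd) (G.chartVec v, 0) (0, G.chartVec w)
    hm).trans ?_
  have hd : ∀ᶠ x : G.E × G.E in 𝓝 (G.chartPt, G.chartPt),
      DifferentiableAt ℝ ((G.toPtdMfd.prod G.toPtdMfd).read (f ∘ G.mulHom.toFun) : G.E × G.E → ℝ) x
      := by
    have := differentiableAt_read hm
    rw [chartPt_prod] at this
    exact this
  have hd' : DifferentiableAt ℝ (fun x : G.E × G.E => fderiv ℝ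
      ((G.toPtdMfd.prod G.toPtdMfd).read (f ∘ G.mulHom.toFun) : G.E × G.E → ℝ) x
      (0, G.chartVec w)) (G.chartPt, G.chartPt) := by
    have := differentiableAt_fderiv_read hm (0, G.chartVec w)
    rw [chartPt_prod] at this
    exact this
  rw [chartPt_prod]
  refine (fderiv_slice_fst hd' (G.chartVec v)).symm.trans ?_
  refine congrArg (fun L : G.E →L[ℝ] ℝ => L (G.chartVec v)) (EventuallyEq.fderiv_eq ?_)
  have ht : Tendsto (fun y : G.E => (y, G.chartPt)) (𝓝 G.chartPt)
      (𝓝 (G.chartPt, G.chartPt)) :=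
    (Continuous.prodMk_left _).tendsto _
  filter_upwards [ht.eventually hd, G.fderiv_read_mul w hf] with y hy hy'
  refine (fderiv_slice_snd hy (G.chartVec w)).symm.trans (Eq.trans ?_ hy')
  refine congrArg (fun k : G.E → ℝ => fderiv ℝ k G.chartPt (G.chartVec w)) (funext fun z => ?_)
  exact read_prod G.toPtdMfd G.toPtdMfd _ y z

theorem chartVec_eq (v : G.lieAlg) :
    chartField (1 : G.carrier) (mulInvariantVectorField (I := G.I) v) G.chartPt =
      G.chartVec v := by
  refine (chartField_apply (1 : G.carrier) (mulInvariantVectorField (I := G.I) v)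
    (mem_extChartAt_source (1 : G.carrier))).trans ?_
  refine congrArg (mfderiv G.I 𝓘(ℝ, G.E) (extChartAt G.I (1 : G.carrier)) 1) ?_
  have h : ((1 : G.carrier) * ·) = id := funext one_mul
  change mfderiv G.I G.I ((1 : G.carrier) * ·) 1 v = v
  rw [h, mfderiv_id]
  rfl

/-- The commutator of the point distributions defined by tangent vectors. -/
theorem tangentDist_lie (v w : G.lieAlg) : G.tangentDist ⁅v, w⁆ =
    G.distHopf.X.monMul (G.tangentDist v ⊗ₜ[ℝ] G.tangentDist w) -
      G.distHopf.X.monMul (G.tangentDist w ⊗ₜ[ℝ] G.tangentDist v) := by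
  refine G.toPtdMfd.dist_ext fun a => ?_
  obtain ⟨f, hf, rfl⟩ := mkGerm_surj G.toPtdMfd.I a
  refine Eq.trans ?_ (map_sub _ _ _).symm
  refine Eq.trans ?_ (congrArg₂ (· - ·) (G.distEval_tangentDist_mul v w hf)
    (G.distEval_tangentDist_mul w v hf)).symm
  refine (G.distEval_tangentDist ⁅v, w⁆ _).trans ?_
  refine (fstDeriv_mkGerm (X := G.toPtdMfd) (G.chartVec ⁅v, w⁆) hf).trans ?_
  have hV := fun v : G.lieAlg => differentiableAt_chartField (I := G.I) (1 : G.carrier)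
    (mulInvariantVectorField v) (mdifferentiableAt_mulInvariantVectorField v)
  have hc : G.chartVec ⁅v, w⁆ = lieBracket ℝ
      (chartField (1 : G.carrier) (mulInvariantVectorField (I := G.I) v))
      (chartField (1 : G.carrier) (mulInvariantVectorField (I := G.I) w)) G.chartPt :=
    mfderiv_chart_mlieBracket (I := G.I) (1 : G.carrier) (mulInvariantVectorField v)
      (mulInvariantVectorField w)
  rw [hc]
  have h := fderiv_apply_lieBracket (𝕜 := ℝ) (n := 2)
    (f := G.read f) (x := G.chartPt)
    (((contDiffAt_read hf).self_of_nhds).of_le (WithTop.coe_le_coe.2 le_top)) (by simp) (hV w)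
    (hV v)
  rw [G.chartVec_eq, G.chartVec_eq] at h
  exact h

end LieGrp

end

end FormalLie

end

noncomputable section

namespace FormalLie

section

open MonoidalCategory CartesianMonoidalCategory
open scoped TensorProduct MonObj

attribute [local instance] CocommCoalg.monRing CocommCoalg.monAlgebra CocommCoalg.monBialgebra

theorem PtdMfd.fstDeriv_coordGerm (X : PtdMfd.{u}) {σ : Type*} (b : Module.Basis σ ℝ X.E) (i : σ)
    (p : X.E) : fstDeriv p (X.coordGerm b i) = b.coord i p := by
  refine (fstDeriv_mkGerm p (X.contMDiffAt_comp_chart (contDiff_coord b i))).trans ?_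
  have h : X.read (fun y => b.coord i (X.chart y)) =ᶠ[𝓝 X.chartPt]
      fun v => LinearMap.toContinuousLinearMap (b.coord i) (v - X.chartPt) := by
    filter_upwards [extChartAt_target_mem_nhds (I := X.I) X.pt] with v hv
    refine congrArg (b.coord i) ?_
    rw [chart, PartialEquiv.right_inv _ hv]
    rfl
  rw [h.fderiv_eq, fderiv_comp_sub, ContinuousLinearMap.fderiv]
  rfl

/-- The evaluation of point distributions, as a homomorphism to the dual algebra of `Dist(X)`. -/
def PtdMfd.dualEval (X : PtdMfd.{u}) :
    X.germs →ₐ[ℝ] WithConv (X.dist.carrier →ₗ[ℝ] ℝ) :=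
  AlgHom.ofLinearMap
    { toFun := fun a => WithConv.toConv (X.distEval a)
      map_add' := fun a b => WithConv.ext (LinearMap.ext fun φ => (X.distFun φ).map_add a b)
      map_smul' := fun r a => WithConv.ext (LinearMap.ext fun φ => (X.distFun φ).map_smul r a) }
    (WithConv.ext (LinearMap.ext fun φ => by
      refine (X.counit_dist φ).symm.trans ?_
      exact (LinearMap.convOne_apply (R := ℝ) (A := ℝ) φ).symm))
    (fun a b => WithConv.ext (LinearMap.ext fun φ => by
      refine (X.distEval_comul φ a b).symm.trans ?_
      refine Eq.trans ?_ (LinearMap.convMul_apply _ _ φ).symm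
      generalize Coalgebra.comul (R := ℝ) φ = z
      induction z with
      | zero => rw [map_zero, map_zero, map_zero]
      | add x y hx hy => rw [map_add, map_add, map_add, hx, hy]
      | tmul x y => rw [tensorFunctional_tmul]; rfl))

namespace LieGrp

open PtdMfd

variable (G : LieGrp.{u})

/-- The algebra homomorphism `U(𝔤) → Dist(G)`. -/
def envToDistAlg : Env G.lieAlg →ₐ[ℝ] G.distHopf.X.carrier :=
  envLift G.tangentDist G.tangentDist_lie

theorem envToDistAlg_envι (v : G.lieAlg) : G.envToDistAlg (envι v) = G.tangentDist v :=
  envLift_envι _ _ v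

/-- The morphism `ψ_G : U(𝔤) → Dist(G)`. -/
def envToDist : G.env ⟶ G.distHopf.X :=
  G.envAlgHom G.distHopf.X G.envToDistAlg
    (fun v => by rw [envToDistAlg_envι]; exact G.counit_tangentDist v)
    (fun v => by rw [envToDistAlg_envι]; exact G.comul_tangentDist v)

instance : IsMonHom G.envToDist := G.isMonHom_envAlgHom _ _ _ _

theorem envToDist_envι (v : G.lieAlg) : G.envToDist.toCoalgHom (envι v) = G.tangentDist v :=
  G.envToDistAlg_envι v

theorem bijective_envToDist : Function.Bijective G.envToDist.toCoalgHom := by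
  let b₀ := Module.finBasis ℝ G.E
  let E := LinearEquiv.ofBijective G.chartVec G.bijective_chartVec
  let b := b₀.map E.symm
  let X := G.toPtdMfd
  let ξ : Fin (Module.finrank ℝ G.E) → WithConv (G.distHopf.X.carrier →ₗ[ℝ] ℝ) := fun i =>
    WithConv.toConv (X.distEval (X.coordGerm b₀ i))
  refine bijective_of_dual_monomials b G.envToDistAlg ?_ ξ ?_ ?_ (X.distBasis b₀) ?_
  · intro i
    rw [envToDistAlg_envι]
    exact G.comul_tangentDist _
  · intro i
    exact (G.distEval_monOne _).trans (X.coordGerm_mem b₀ i)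
  · intro i j
    rw [envToDistAlg_envι]
    refine (G.distEval_tangentDist (b j) _).trans ?_
    refine (X.fstDeriv_coordGerm b₀ i _).trans ?_
    have hb : G.chartVec (b j) = b₀ j := by
      rw [Module.Basis.map_apply]
      exact E.apply_symm_apply (b₀ j)
    refine (congrArg (b₀.coord i) hb).trans ?_
    rw [Module.Basis.coord_apply, Module.Basis.repr_self, Finsupp.single_apply]
    exact if_congr eq_comm rfl rfl
  · intro α β
    have h1 : MvPolynomial.aeval ξ (MvPolynomial.monomial β (1 : ℝ)) =
        X.dualEval (X.polyGerm b₀ (MvPolynomial.monomial β 1)) :=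
      (MvPolynomial.comp_aeval_apply (f := X.coordGerm b₀) X.dualEval _).symm
    rw [h1]
    refine (X.distEval_distBasis b₀ α _).trans ?_
    rw [MvPolynomial.coeff_monomial]

end LieGrp

end

end FormalLie

end

noncomputable section

namespace FormalLie

section

open MonoidalCategory CartesianMonoidalCategory
open scoped TensorProduct MonObj

attribute [local instance] CocommCoalg.monRing CocommCoalg.monAlgebra CocommCoalg.monBialgebra

namespace LieGrp

open PtdMfd

variable (G : LieGrp.{u})

theorem mfderiv_lieMap {G K : LieGrp.{u}} (f : G ⟶ K) (v : G.lieAlg) {g : K.carrier → ℝ}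
    (hg : MDifferentiableAt K.I 𝓘(ℝ) g (1 : K.carrier)) :
    (mfderiv G.I 𝓘(ℝ) (g ∘ f.toMonoidHom) 1 v : ℝ) = mfderiv K.I 𝓘(ℝ) g 1 (lieMap f v) := by
  have c := mfderiv_comp_of_eq (x := (1 : G.carrier)) (I := G.I) (I' := K.I) (I'' := 𝓘(ℝ))
    (g := g) (f := f.toMonoidHom) (y := 1) hg
    (f.contMDiff.mdifferentiableAt (by simp)) (map_one f.toMonoidHom)
  have e : (mfderiv K.I 𝓘(ℝ) g (f.toMonoidHom 1) : K.E →L[ℝ] ℝ) =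
      mfderiv K.I 𝓘(ℝ) g (1 : K.carrier) :=
    congrArg (β := K.E →L[ℝ] ℝ) (fun x => mfderiv K.I 𝓘(ℝ) g x) (map_one f.toMonoidHom)
  exact (DFunLike.congr_fun c v).trans (DFunLike.congr_fun e (Hom.differential f v : K.E))

theorem contMDiffAt_comp_hom {G K : LieGrp.{u}} (f : G ⟶ K) {g : K.carrier → ℝ}
    (hg : ∀ᶠ y in 𝓝 (1 : K.carrier), ContMDiffAt K.I 𝓘(ℝ) ∞ g y) :
    ∀ᶠ y in 𝓝 (1 : G.carrier), ContMDiffAt G.I 𝓘(ℝ) ∞ (g ∘ f.toMonoidHom) y :=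
  ((tendsto_pt (Hom.toPtdMfdHom f)).eventually hg).mono fun y hy =>
    ContMDiffAt.comp (M := G.carrier) y hy f.contMDiff.contMDiffAt

theorem distMap_tangentDist {G K : LieGrp.{u}} (f : G ⟶ K) (v : G.lieAlg) :
    (Dist.map (Hom.toPtdMfdHom f)).toCoalgHom (G.tangentDist v) =
      K.tangentDist (lieMap f v) := by
  refine K.toPtdMfd.dist_ext fun a => ?_
  obtain ⟨g, hg, rfl⟩ := mkGerm_surj K.toPtdMfd.I a
  refine (distEval_distMap _ _ _ _).trans ?_
  refine Eq.trans ?_ (K.distEval_tangentDist_mkGerm (lieMap f v) hg).symm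
  refine (G.distEval_tangentDist_mkGerm v (contMDiffAt_comp_hom f hg)).trans ?_
  exact mfderiv_lieMap f v (ContMDiffAt.mdifferentiableAt (M := K.carrier) hg.self_of_nhds
    (by simp))

theorem envHom_envToDist {G K : LieGrp.{u}} (f : G ⟶ K) :
    envHom f ≫ K.envToDist = G.envToDist ≫ (distGrp.map (toGrp.map f)).hom.hom := by
  have h : K.envToDistAlg.comp (envMap (lieMap f)) =
      (CocommCoalg.monAlgHom (distGrp.map (toGrp.map f)).hom.hom).comp G.envToDistAlg := by
    refine env_hom_ext fun v => ?_
    rw [AlgHom.comp_apply, AlgHom.comp_apply, envMap_envι, envToDistAlg_envι, envToDistAlg_envι]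
    exact (distMap_tangentDist f v).symm
  exact CocommCoalg.hom_ext fun x => DFunLike.congr_fun h x

/-- The natural isomorphism `ψ : U(𝔤) ≅ Dist(G)`. -/
def envIsoDist : envGrp.{u} ≅ toGrp ⋙ distGrp :=
  NatIso.ofComponents
    (fun G =>
      have := CocommCoalg.isIso_of_bijective G.envToDist G.bijective_envToDist
      Grp.mkIso' (asIso G.envToDist))
    (fun f => by
      ext : 2
      exact envHom_envToDist f)

theorem distValue_envIsoDist (G : LieGrp.{u}) (v : G.lieAlg) (f : G.carrier → ℝ)
    (hf : ∀ᶠ y in 𝓝 (1 : G.carrier), ContMDiffAt G.I 𝓘(ℝ) ∞ f y) :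
    distValue (X := G.toPtdMfd) ((envIsoDist.hom.app G).hom.hom.toCoalgHom (envι v)) f hf =
      mfderiv G.I 𝓘(ℝ) f 1 v := by
  refine Eq.trans ?_ (G.distEval_tangentDist_mkGerm v hf)
  exact congrArg (G.toPtdMfd.distEval (mkGerm G.I (1 : G.carrier) f hf)) (G.envToDist_envι v)

end LieGrp

end

end FormalLie

end

noncomputable section

namespace FormalLie

section

open MonoidalCategory CartesianMonoidalCategory
open scoped MonObj Obj

section WbarComparison

universe u₁ v₁ u₂ v₂

attribute [local instance] Functor.Monoidal.ofChosenFiniteProducts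

variable {C : Type u₁} [Category.{v₁} C] [CartesianMonoidalCategory C]
  {D : Type u₂} [Category.{v₂} D] [CartesianMonoidalCategory D]
  (F : C ⥤ D) [Limits.PreservesFiniteProducts F] (G : SimplicialObject (Grp C))

/-- The simplicial group object obtained by applying a product-preserving functor. -/
abbrev mapSimplicialGrp : SimplicialObject (Grp D) :=
  ((SimplicialObject.whiskering _ _).obj F.mapGrp).obj G

/-- The comparison `F(W̄_n G) → W̄_n F(G)`. -/
def wbarComparison (n : ℕ) : F.obj (wbarObj G n) ⟶ wbarObj (mapSimplicialGrp F G) n :=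
  wbarLift (mapSimplicialGrp F G) (fun k => F.map (wbarProj G n k)) n

theorem wbarComparison_proj {n k : ℕ} (hk : k < n) :
    wbarComparison F G n ≫ wbarProj (mapSimplicialGrp F G) n k = F.map (wbarProj G n k) :=
  wbarLift_proj _ _ hk

theorem map_hom_orderedProd {X Y : C} [GrpObj Y] (f : ℕ → (X ⟶ Y)) (a b : ℕ) :
    F.map (orderedProd f a b) = orderedProd (fun p => F.map (f p)) a b :=
  map_orderedProd (F.homMonoidHom (X := X) (M := Y)) f a b

theorem wbarComparison_naturality {x y : SimplexCategory} (α : x ⟶ y) :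
    F.map (wbarMap G α) ≫ wbarComparison F G x.len =
      wbarComparison F G y.len ≫ wbarMap (mapSimplicialGrp F G) α := by
  refine wbar_hom_ext _ fun k hk => ?_
  rw [Category.assoc, Category.assoc, wbarComparison_proj F G hk,
    wbarMap_proj (mapSimplicialGrp F G) α hk]
  refine (F.map_comp _ _).symm.trans ((congrArg F.map (wbarMap_proj G α hk)).trans ?_)
  refine (map_hom_orderedProd F _ _ _).trans (Eq.trans ?_ (comp_orderedProd _ _ _ _).symm)
  refine orderedProd_congr fun p _ hp => ?_
  have hy := simplexVal_le α (x.len - k)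
  refine (F.map_comp _ _).trans ?_
  refine (congrArg (· ≫ act (mapSimplicialGrp F G) (shiftMap α k p))
    (wbarComparison_proj F G (n := y.len) (k := y.len - 1 - p) (by omega)).symm).trans ?_
  exact Category.assoc _ _ _

theorem isIso_wbarComparison (n : ℕ) : IsIso (wbarComparison F G n) := by
  induction n with
  | zero =>
    have h : wbarComparison F G 0 = (terminalComparison F) := toUnit_unique _ _
    rw [h]
    exact terminalComparison_isIso_of_preservesLimits F
  | succ n ih =>
    have h1 : (prodComparison F (level G n) (wbarObj G n) ≫
        F.obj (level G n) ◁ wbarComparison F G n) ≫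
          fst (F.obj (level G n)) (wbarObj (mapSimplicialGrp F G) n) =
        F.map (fst (level G n) (wbarObj G n)) := by
      rw [Category.assoc, whiskerLeft_fst, prodComparison_fst]
    have h2 : (prodComparison F (level G n) (wbarObj G n) ≫
        F.obj (level G n) ◁ wbarComparison F G n) ≫
          snd (F.obj (level G n)) (wbarObj (mapSimplicialGrp F G) n) =
        F.map (snd (level G n) (wbarObj G n)) ≫ wbarComparison F G n := by
      rw [Category.assoc, whiskerLeft_snd, prodComparison_snd_assoc]
    have h3 : wbarLift (mapSimplicialGrp F G) (fun k => F.map (wbarProj G (n + 1) k)) n =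
        F.map (snd (level G n) (wbarObj G n)) ≫ wbarComparison F G n :=
      wbar_hom_ext _ fun k hk => (wbarLift_proj _ _ hk).trans
        (((congrArg F.map (wbarProj_succ G hk)).trans (F.map_comp _ _)).trans
          ((congrArg (F.map (snd (level G n) (wbarObj G n)) ≫ ·)
            (wbarComparison_proj F G hk).symm).trans (Category.assoc _ _ _).symm))
    have h : wbarComparison F G (n + 1) =
        prodComparison F (level G n) (wbarObj G n) ≫
          (F.obj (level G n) ◁ wbarComparison F G n) :=
      CartesianMonoidalCategory.hom_ext (X := F.obj (level G n))
        (Y := wbarObj (mapSimplicialGrp F G) n) _ _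
        (((lift_fst _ _).trans (congrArg F.map (wbarProj_top G n))).trans h1.symm)
        ((lift_snd _ _).trans (h3.trans h2.symm))
    have h4 : IsIso (prodComparison F (level G n) (wbarObj G n)) := inferInstance
    have h5 : IsIso (F.obj (level G n) ◁ wbarComparison F G n) := inferInstance
    rw [h]
    exact IsIso.comp_isIso' h4 h5

/-- `F(W̄ G) ≅ W̄ F(G)` for a product-preserving functor `F`. -/
def wbarComparisonIso : Wbar ⋙ (SimplicialObject.whiskering C D).obj F ≅
    (SimplicialObject.whiskering (Grp C) (Grp D)).obj F.mapGrp ⋙ Wbar :=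
  NatIso.ofComponents
    (fun G => NatIso.ofComponents
      (fun x => @asIso _ _ _ _ (wbarComparison F G x.unop.len)
        (isIso_wbarComparison F G x.unop.len))
      (fun {x y} α => wbarComparison_naturality F G α.unop))
    (fun {G H} φ => by
      ext x : 2
      refine wbar_hom_ext (mapSimplicialGrp F H) fun k hk => ?_
      have h1 := congrArg F.map (wbarLift_proj H
        (fun k => wbarProj G x.unop.len k ≫ (φ.app (op (.mk k))).hom.hom) hk)
      have h2 := wbarLift_proj (mapSimplicialGrp F H)
        (fun k => wbarProj (mapSimplicialGrp F G) x.unop.len k ≫ F.map (φ.app (op (.mk k))).hom.hom)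
        hk
      have h3 := congrArg (· ≫ F.map (φ.app (op (.mk k))).hom.hom) (wbarComparison_proj F G hk)
      refine (Category.assoc _ _ _).trans ?_
      refine (congrArg (F.map ((Wbar.map φ).app x) ≫ ·) (wbarComparison_proj F H hk)).trans ?_
      refine ((F.map_comp _ _).symm.trans h1).trans ?_
      refine ((F.map_comp _ _).trans h3.symm).trans ?_
      refine (Category.assoc _ _ _).trans ?_
      exact (congrArg (wbarComparison F G x.unop.len ≫ ·) h2.symm).trans
        (Category.assoc _ _ _).symm)

end WbarComparison

end

end FormalLie

end

noncomputable section

namespace FormalLie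

section

open MonoidalCategory CartesianMonoidalCategory
open scoped MonObj

/-- The isomorphism `Dist(W̄ G) ≅ W̄ U(𝔤)` of simplicial coalgebras. -/
def distWbarIso : distWbar.{u} ≅ wbarEnv.{u} :=
  Functor.isoWhiskerLeft simplicialGrp (wbarComparisonIso PtdMfd.Dist.{u}) ≪≫
    Functor.isoWhiskerRight ((SimplicialObject.whiskering _ _).mapIso LieGrp.envIsoDist.symm) Wbar

theorem distWbarIso_proj (G : SimplicialObject LieGrp.{u}) {n k : ℕ} (hk : k < n) :
    (distWbarIso.hom.app G).app (op (.mk n)) ≫ wbarProj (simplicialEnv.obj G) n k =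
      PtdMfd.Dist.map (wbarProj (simplicialGrp.obj G) n k) ≫
        (LieGrp.envIsoDist.inv.app (G.obj (op (.mk k)))).hom.hom := by
  have h1 := wbarComparison_proj PtdMfd.Dist.{u} (simplicialGrp.obj G) hk
  have h2 := wbarLift_proj (simplicialEnv.obj G)
    (fun k => wbarProj (mapSimplicialGrp PtdMfd.Dist.{u} (simplicialGrp.obj G)) n k ≫
      (LieGrp.envIsoDist.inv.app (G.obj (op (.mk k)))).hom.hom) hk
  refine (Category.assoc _ _ _).trans ?_
  refine (congrArg (wbarComparison PtdMfd.Dist.{u} (simplicialGrp.obj G) n ≫ ·) h2).trans ?_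
  refine (Category.assoc _ _ _).symm.trans ?_
  exact congrArg (· ≫ (LieGrp.envIsoDist.inv.app (G.obj (op (.mk k)))).hom.hom) h1

theorem isNice_wbarEnv (G : SimplicialObject LieGrp.{u}) (p : SimplexCategoryᵒᵖ) :
    ((wbarEnv.obj G).obj p).IsNice :=
  CocommCoalg.IsNice.of_retract ((distWbarIso.inv.app G).app p) ((distWbarIso.hom.app G).app p)
    (congrArg (fun f => NatTrans.app f p) (distWbarIso.inv_hom_id_app G))
    (PtdMfd.isNice_dist _)

theorem isFormalInftyGroup_wbarEnv (G : SimplicialObject LieGrp.{u}) :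
    CocommCoalg.IsFormalInftyGroup (wbarEnv.obj G) :=
  ⟨⟨fun p => (isNice_wbarEnv G p).isFormalManifold,
    CocommCoalg.isKan_of_hornFiller (wbarEnv.obj G) (isNice_wbarEnv G)
    (fun n hn k => wbarHornFiller (simplicialEnv.obj G) n hn k)
    (fun n => wbarLift (simplicialEnv.obj G) (fun _ => toUnit (𝟙_ CocommCoalg.{u}) ≫ η) n)⟩,
    (ULift.moduleEquiv.{0, 0, u} (R := ℝ) (M := ℝ)).bijective⟩

theorem isFormalInftyGroup_distWbar (G : SimplicialObject LieGrp.{u}) :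
    CocommCoalg.IsFormalInftyGroup (distWbar.obj G) :=
  CocommCoalg.IsFormalInftyGroup.of_iso (distWbarIso.symm.app G) (isFormalInftyGroup_wbarEnv G)

/-- The isomorphism `Dist(W̄ G) ≅ W̄ U(𝔤)` of formal `∞`-groups. -/
def formalDistWbarIso :
    CocommCoalg.IsFormalInftyGroup.lift distWbar.{u} isFormalInftyGroup_distWbar ≅
      CocommCoalg.IsFormalInftyGroup.lift wbarEnv.{u} isFormalInftyGroup_wbarEnv :=
  NatIso.ofComponents (fun G => CocommCoalg.IsFormalInftyGroup.isoMk (distWbarIso.app G))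
    (fun f => by
      ext : 1
      exact distWbarIso.hom.naturality f)

end

end FormalLie

end

theorem mainTheorem12 :
    ∃ (_ : Limits.PreservesFiniteProducts FormalLie.PtdMfd.Dist.{u})
      (ψ : FormalLie.LieGrp.envGrp.{u} ≅ FormalLie.LieGrp.toGrp ⋙ FormalLie.distGrp),
      (∀ (G : FormalLie.LieGrp.{u}) (v : G.lieAlg) (f : G.carrier → ℝ)
        (hf : ∀ᶠ y in 𝓝 (1 : G.carrier), ContMDiffAt G.I 𝓘(ℝ) ∞ f y),
        FormalLie.PtdMfd.distValue (X := G.toPtdMfd)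
          ((ψ.hom.app G).hom.hom.toCoalgHom (FormalLie.envι v)) f hf =
            mfderiv G.I 𝓘(ℝ) f 1 v) ∧
      ∃ (hD : ∀ G, FormalLie.CocommCoalg.IsFormalInftyGroup (FormalLie.distWbar.{u}.obj G))
        (hU : ∀ G, FormalLie.CocommCoalg.IsFormalInftyGroup (FormalLie.wbarEnv.{u}.obj G))
        (θ : FormalLie.CocommCoalg.IsFormalInftyGroup.lift FormalLie.distWbar hD ≅
          FormalLie.CocommCoalg.IsFormalInftyGroup.lift FormalLie.wbarEnv hU),
        ∀ (G : SimplicialObject FormalLie.LieGrp.{u}) (n k : ℕ), k < n →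
          (θ.hom.app G).hom.app (op (.mk n)) ≫
              FormalLie.wbarProj (FormalLie.simplicialEnv.obj G) n k =
            FormalLie.PtdMfd.Dist.map (FormalLie.wbarProj (FormalLie.simplicialGrp.obj G) n k) ≫
              (ψ.inv.app (G.obj (op (.mk k)))).hom.hom :=
  ⟨FormalLie.PtdMfd.preservesFiniteProducts_dist, FormalLie.LieGrp.envIsoDist,
    FormalLie.LieGrp.distValue_envIsoDist, FormalLie.isFormalInftyGroup_distWbar,
    FormalLie.isFormalInftyGroup_wbarEnv, FormalLie.formalDistWbarIso,
    fun G _ _ hk => FormalLie.distWbarIso_proj G hk⟩
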